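/- **Setting.** Let $\Lambda$ be the Grassmann algebra over $\mathbb C$ on a (finite or infinite) set of odd generators; if this set is infinite, formal sums of monomials are allowed. Let $B$ be the supercommutative ring of formal power series in the even variables $x,t_2,t_4,\dots$ and the odd variables $\varphi,t_1,t_3,\dots$ with coefficients in $\Lambda$. Let $z$ be an even and $\theta$ an odd spectral parameter. All functions below are formal power series in $x,\varphi,t_1,t_2,\dots$ whose coefficients are Laurent series in $z^{-1}$, polynomial in $\theta$, over $\Lambda$. Odd derivatives act from the left, $\partial_n=\partial/\partial t_n$ has parity $n$, and $\delta=\partial_\varphi+\varphi\partial_x$. Let $V^-$ be the set of series containing only negative powers of $z$. **HSKP.** Let $\hat h=\nu+\theta a+\varphi h+\theta\varphi\psi$, where $\nu=\sum_{j>0}\nu_jz^{-j}$ and $\psi=\sum_{j>0}\psi_jz^{-j}$ are odd, $a=1+\sum_{j>0}a_jz^{-j}$ and $h=z+\sum_{j>0}h_jz^{-j}$ are even, and $\nu_j,a_j,h_j,\psi_j\in B$ do not depend on $\varphi$. For an odd $g$ put $g^{(k)}=(\delta+g)^k\cdot 1$, and let $W$ be the $B$-span of the $\hat h^{(k)}$,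 $k\ge0$. The currents $H^{(k)}$ are the elements of $W$ with $H^{(2j+p)}-z^j\theta^p\in V^-$ $(j\ge 0,\ p\in\{0,1\})$. HSKP is the system $\partial_k\hat h=(-1)^k\delta H^{(k)}$, $k>0$. Let $C_j=\oint H^{(j)}dz\,d\theta$ be the coefficient of $z^{-1}\theta$ in $H^{(j)}$, with $\theta$ written on the right. The enhanced currents are $K^{(j)}=H^{(j)}+(-1)^{j+1}\varphi\,C_j$. **JSKP.** A dressing operator is an even super pseudo-differential operator $$S=1+\sum_{j>0}\big((u_j+\varphi\xi_j)\partial_x^{-j}+(\eta_j+\varphi w_j)\delta^{-(2j-1)}\big),$$ where $u_j,w_j$ are even and $\xi_j,\eta_j$ odd elements of $B$ not depending on $\varphi$. Here $\delta^2=\partial_x$, and operators are multiplied by the super Leibniz rule. JSKP is the system $$\partial_{2j}S=-(S\partial_x^jS^{-1})_-S,\qquad \partial_{2j-1}S=-(S\partial_\varphi\partial_x^{j-1}S^{-1})_-S\qquad(j\ge1),$$ where $(\cdot)_-$ is the part of negative order in $\delta$. The vacuum wave function is $e=\exp\big(\varphi\theta+zx+\sum_{j>0}(t_{2j}z^j+t_{2j-1}\theta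 z^{j-1})\big)$. The operator $S$ acts on $e$ term by term, with $\delta^{2m}e=z^me$ and $\delta^{2m+1}e=z^m\,\delta e$ for all $m\in\mathbb Z$. **Coordinate change.** Let $\nu_0\in B$ be odd and independent of $\varphi$, and put $\mathfrak h=\hat h+\nu_0$ and $\tilde\nu=\nu_0+\nu$. The coordinates $(u,w,\xi,\eta)$ of $S$ and the components $(\nu_0,\nu,a,h,\psi)$ of $\mathfrak h$ are related by $$\begin{aligned} \tilde\nu\Big(1+\sum_{i\ge1}\frac{u_i}{z^i}\Big)&=-\eta_1+\sum_{i\ge1}\frac{\xi_i-\eta_{i+1}}{z^i},\\ a\Big(1+\sum_{i\ge1}\frac{u_i}{z^i}\Big)-\sum_{i\ge1}\frac{\eta_i}{z^i}\,\tilde\nu&=1+\sum_{i\ge1}\frac{u_i+w_i}{z^i},\\ h\Big(1+\sum_{i\ge1}\frac{u_i}{z^i}\Big)&=z+u_1+\eta_1\tilde\nu+\sum_{i\ge1}\frac{u_{i,x}+u_{i+1}}{z^i}+\tilde\nu\sum_{i\ge1}\frac{\xi_i-\eta_{i+1}}{z^i},\\ \psi\Big(1+\sum_{i\ge1}\frac{u_i}{z^i}\Big)&=a\Big(\eta_1+\sum_{i\ge1}\frac{\eta_{i+1}-\xi_i}{z^i}\Big)+\tilde\nu\sum_{i\ge1}\frac{w_i}{z^i}-h\sum_{i\ge1}\frac{\eta_i}{z^i}+\sum_{i\ge1}\frac{\eta_{i,x}+\xi_i}{z^i}.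 \end{aligned}\tag{$*$}$$ We say that $S$ corresponds to $\hat h$ if $(*)$ holds for some such $\nu_0$. **Theorem.** 1. (From HSKP to JSKP.) Let $\hat h$ be a solution of HSKP. Then $\partial_nK^{(j)}=(-1)^{jn}\partial_jK^{(n)}$ for all $j,n\ge1$. There is an odd $q\in B$, independent of $\varphi$, with $\partial_nq=C_n|_{\varphi=0}$ for all $n\ge1$ and $\partial_xq=C_2|_{\varphi=0}$. For each such $q$ the following hold. - $\partial_xq=\psi_1$. - There are an invertible even $\Phi$ with $\partial_n\Phi=H^{(n)}\Phi$ $(n\geq 1)$ and $\delta\Phi=\hat h\Phi$, and a dressing operator $S$, such that $\Psi=\Phi\exp(-\varphi q)$ is invertible and satisfies $\partial_n\Psi=K^{(n)}\Psi$ $(n\ge1)$, $\delta\Psi=(\hat h-q)\Psi$ and $\Psi=S\cdot e$. - Whenever $\Psi=S\cdot e$ for a dressing operator $S$, $\partial_n\Psi=K^{(n)}\Psi$ for all $n\ge1$ and $\delta\Psi=\mathfrak h\Psi$ with $\mathfrak h=\hat h-q$, each $K^{(n)}$ is a finite sum $\sum_l\Gamma^n_l\mathfrak h^{(l)}$ with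 $\Gamma^n_l\in B$ and $\partial_n\Psi=\sum_l\Gamma^n_l\delta^l\Psi$. Moreover $S$ satisfies JSKP, and $(*)$ holds with $\nu_0=-q$. 2. (From JSKP to HSKP.) For every dressing operator $S$ there is exactly one $(\hat h,\nu_0)$ satisfying $(*)$. For it, $\Psi=S\cdot e$ is even and invertible, $\delta\Psi/\Psi=\hat h+\nu_0$, and $\partial_x\nu_0+\psi_1=0$. If $S$ satisfies JSKP, then $\hat h$ satisfies HSKP, $q=-\nu_0$ is as in 1, and $\partial_n\Psi=K^{(n)}\Psi$ for all $n\ge1$. 3. (Isomorphism.) $\hat h$ is a solution of HSKP if and only if some solution $S$ of JSKP corresponds to it. For a dressing operator $S$ let $\Phi_S=(S\cdot e)\exp(\varphi\eta_1)$. Let $S$ be a solution of JSKP corresponding to $\hat h$. Then a dressing operator $S'$ is a solution of JSKP corresponding to the same $\hat h$ if and only if $\Phi_{S'}=\Phi_S\,\kappa$ for an even constant $\kappa=1+\sum_{j>0}(c_j+\gamma_j\theta)z^{-j}$ with $c_j,\gamma_j\in\Lambda$. Every such $\kappa$ occurs for exactly one $S'$. Thus $(*)$ identifies the solutions of HSKP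 with the solutions of JSKP modulo these constants. -/

import Mathlib

/-! ## Formal Grassmann series

`GrassmannSeries O K` is the (completed) Grassmann algebra over the commutative ring `K` on
anticommuting generators `ϑ_o`, `o : O`.  An element is a formal sum `∑ f S • ϑ_S` over the finite
subsets `S` of `O`, where `ϑ_S` is the product of the generators `ϑ_o`, `o ∈ S`, in increasing order.
The linear order on `O` only fixes the sign of the basis elements. -/

/-- Formal sums `∑ f S • ϑ_S` over finite sets `S` of anticommuting generators. -/
def GrassmannSeries (O K : Type*) := Finset O → K

namespace GrassmannSeries

variable {O K : Type*}

instance [AddCommGroup K] : AddCommGroup (GrassmannSeries O K) :=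
  inferInstanceAs (AddCommGroup (Finset O → K))

instance {A : Type*} [Semiring A] [AddCommGroup K] [Module A K] :
    Module A (GrassmannSeries O K) :=
  inferInstanceAs (Module A (Finset O → K))

@[ext] theorem ext {f g : GrassmannSeries O K} (h : ∀ S, f S = g S) : f = g := funext h

/-- The number of transpositions needed to sort the concatenation of `S` and `T`:
`ϑ_S ϑ_T = (-1) ^ inversions S T • ϑ_{S ∪ T}` for disjoint `S`, `T`. -/
def inversions [LinearOrder O] (S T : Finset O) : ℕ :=
  ((S ×ˢ T).filter fun p => p.2 < p.1).card

theorem inversions_union_left [LinearOrder O] {S T : Finset O} (h : Disjoint S T) (U : Finset O) :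
    inversions (S ∪ T) U = inversions S U + inversions T U := by
  unfold inversions
  rw [Finset.union_product, Finset.filter_union, Finset.card_union_of_disjoint]
  apply Finset.disjoint_filter_filter
  rw [Finset.disjoint_left] at h ⊢
  intro p hp hq
  exact h (Finset.mem_product.1 hp).1 (Finset.mem_product.1 hq).1

theorem inversions_union_right [LinearOrder O] {S T : Finset O} (h : Disjoint S T) (U : Finset O) :
    inversions U (S ∪ T) = inversions U S + inversions U T := by
  unfold inversions
  rw [Finset.product_union, Finset.filter_union, Finset.card_union_of_disjoint]
  apply Finset.disjoint_filter_filter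
  rw [Finset.disjoint_left] at h ⊢
  intro p hp hq
  exact h (Finset.mem_product.1 hp).2 (Finset.mem_product.1 hq).2

@[simp] theorem inversions_empty_left [LinearOrder O] (S : Finset O) : inversions ∅ S = 0 := by
  simp [inversions]

@[simp] theorem inversions_empty_right [LinearOrder O] (S : Finset O) : inversions S ∅ = 0 := by
  simp [inversions]

instance [LinearOrder O] [CommRing K] : One (GrassmannSeries O K) :=
  ⟨fun S => if S = ∅ then 1 else 0⟩

instance [LinearOrder O] [CommRing K] : Mul (GrassmannSeries O K) :=
  ⟨fun f g S => ∑ T ∈ S.powerset, (-1) ^ inversions T (S \ T) * (f T * g (S \ T))⟩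

theorem one_apply [LinearOrder O] [CommRing K] (S : Finset O) :
    (1 : GrassmannSeries O K) S = if S = ∅ then 1 else 0 := rfl

theorem mul_apply [LinearOrder O] [CommRing K] (f g : GrassmannSeries O K) (S : Finset O) :
    (f * g) S = ∑ T ∈ S.powerset, (-1) ^ inversions T (S \ T) * (f T * g (S \ T)) := rfl

theorem add_apply [AddCommGroup K] (f g : GrassmannSeries O K) (S : Finset O) :
    (f + g) S = f S + g S := rfl

theorem zero_apply [AddCommGroup K] (S : Finset O) : (0 : GrassmannSeries O K) S = 0 := rfl

protected theorem mul_assoc [LinearOrder O] [CommRing K] (f g h : GrassmannSeries O K) :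
    f * g * h = f * (g * h) := by
  ext S
  simp only [mul_apply, Finset.sum_mul, Finset.mul_sum]
  rw [Finset.sum_sigma', Finset.sum_sigma']
  refine Finset.sum_nbij' (fun p => ⟨p.2, p.1 \ p.2⟩) (fun p => ⟨p.1 ∪ p.2, p.1⟩) ?_ ?_ ?_ ?_ ?_
  · rintro ⟨T, U⟩ hp
    simp only [Finset.mem_sigma, Finset.mem_powerset] at hp ⊢
    exact ⟨hp.2.trans hp.1, Finset.sdiff_subset_sdiff hp.1 le_rfl⟩
  · rintro ⟨U, V⟩ hp
    simp only [Finset.mem_sigma, Finset.mem_powerset] at hp ⊢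
    exact ⟨Finset.union_subset hp.1 (hp.2.trans Finset.sdiff_subset), Finset.subset_union_left⟩
  · rintro ⟨T, U⟩ hp
    simp only [Finset.mem_sigma, Finset.mem_powerset] at hp
    simp [Finset.union_sdiff_of_subset hp.2]
  · rintro ⟨U, V⟩ hp
    simp only [Finset.mem_sigma, Finset.mem_powerset] at hp
    have hd : Disjoint U V := (Finset.disjoint_of_subset_left hp.2 Finset.sdiff_disjoint).symm
    simp [Finset.union_sdiff_cancel_left hd]
  · rintro ⟨T, U⟩ hp
    simp only [Finset.mem_sigma, Finset.mem_powerset] at hp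
    obtain ⟨hT, hU⟩ := hp
    have e1 : (S \ U) \ (T \ U) = S \ T := by
      rw [Finset.sdiff_sdiff_left']
      ext a
      simp only [Finset.mem_inter, Finset.mem_sdiff]
      grind
    have e2 : S \ U = (T \ U) ∪ (S \ T) := by grind
    have d1 : Disjoint (T \ U) (S \ T) :=
      Finset.disjoint_of_subset_left Finset.sdiff_subset Finset.disjoint_sdiff
    have e3 : inversions T (S \ T) = inversions U (S \ T) + inversions (T \ U) (S \ T) := by
      rw [← inversions_union_left Finset.disjoint_sdiff, Finset.union_sdiff_of_subset hU]
    have e4 : inversions U (S \ U) = inversions U (T \ U) + inversions U (S \ T) := by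
      rw [e2, inversions_union_right d1]
    rw [e1, e3, e4]
    ring

instance [LinearOrder O] [CommRing K] : Ring (GrassmannSeries O K) :=
  { (inferInstance : AddCommGroup (GrassmannSeries O K)) with
    mul_assoc := GrassmannSeries.mul_assoc
    one_mul := fun f => by
      ext S
      rw [mul_apply, Finset.sum_eq_single ∅]
      · simp [one_apply]
      · intro T _ hT
        simp [one_apply, hT]
      · simp
    mul_one := fun f => by
      ext S
      rw [mul_apply, Finset.sum_eq_single S]
      · simp [one_apply]
      · intro T hT hne
        have : S \ T ≠ ∅ := by
          intro h
          exact hne (Finset.Subset.antisymm (Finset.mem_powerset.1 hT)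
            (Finset.sdiff_eq_empty_iff_subset.1 h))
        simp [one_apply, this]
      · simp
    left_distrib := fun f g h => by
      ext S
      simp only [mul_apply, add_apply, mul_add, Finset.sum_add_distrib]
    right_distrib := fun f g h => by
      ext S
      simp only [mul_apply, add_apply, add_mul, mul_add, Finset.sum_add_distrib]
    zero_mul := fun f => by
      ext S
      simp [mul_apply, zero_apply]
    mul_zero := fun f => by
      ext S
      simp [mul_apply, zero_apply] }

/-- The scalar `c`, i.e. `c • ϑ_∅`. -/
def const [LinearOrder O] [CommRing K] (c : K) : GrassmannSeries O K :=
  fun S => if S = ∅ then c else 0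

/-- The generator `ϑ_o`. -/
def gen [LinearOrder O] [CommRing K] (o : O) : GrassmannSeries O K :=
  fun S => if S = {o} then 1 else 0

/-- The left derivative with respect to `ϑ_o`: it sends `ϑ_o ϑ_S` to `ϑ_S` and `ϑ_S` to `0`
if `o ∉ S`. -/
def deriv [LinearOrder O] [CommRing K] (o : O) (f : GrassmannSeries O K) :
    GrassmannSeries O K :=
  fun S => if o ∈ S then 0 else (-1) ^ inversions {o} S * f (insert o S)

end GrassmannSeries

/-! ## The ring of formal superfunctions

The even variables are `x` and the even times `t₂, t₄, …`.  The odd variables are `θ`, `φ`, the odd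
times `t₁, t₃, …` and the generators `ζ_i`, `i : I`, of the Grassmann algebra `Λ` over `ℂ`.
Coefficients are Laurent series in `z⁻¹` over `ℂ` (the variable of `LaurentSeries ℂ` is `z⁻¹`). -/

namespace SuperKP

/-- Labels of the odd variables: the generators of `Λ`, and then `θ`, `φ`, `t₁`, `t₃`, `t₅`, … -/
abbrev OddVar (I : Type*) := I ⊕ₗ ℕ

/-- Formal power series in `x, t₂, t₄, …` (labelled by `0, 1, 2, …`) and in all the odd variables,
with coefficients in the Laurent series in `z⁻¹`. -/
abbrev SuperFn (I : Type*) := MvPowerSeries ℕ (GrassmannSeries (OddVar I) (LaurentSeries ℂ))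

variable {I : Type*} [LinearOrder I]

noncomputable section

def thetaVar : OddVar I := toLex (Sum.inr 0)
def phiVar : OddVar I := toLex (Sum.inr 1)
/-- The label of `t_{2j+1}`. -/
def oddTimeVar (j : ℕ) : OddVar I := toLex (Sum.inr (j + 2))

/-- The complex coefficient of `z ^ m` times the even monomial with exponents `n` times the odd
monomial `ϑ_S`. -/
def coef (f : SuperFn I) (n : ℕ →₀ ℕ) (S : Finset (OddVar I)) (m : ℤ) : ℂ :=
  HahnSeries.coeff (f n S) (-m)

def zpow (m : ℤ) : SuperFn I :=
  MvPowerSeries.C (GrassmannSeries.const (HahnSeries.single (-m) (1 : ℂ)))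

def oddVar (o : OddVar I) : SuperFn I := MvPowerSeries.C (GrassmannSeries.gen o)

def theta : SuperFn I := oddVar thetaVar
def phi : SuperFn I := oddVar phiVar
def xvar : SuperFn I := MvPowerSeries.X 0

/-- The `n`-th time `t_n`, `n ≥ 1`: an even variable for even `n`, an odd one for odd `n`. -/
def time (n : ℕ) : SuperFn I :=
  if Even n then MvPowerSeries.X (n / 2) else oddVar (oddTimeVar (n / 2))

/-- The parity involution. -/
def parity (f : SuperFn I) : SuperFn I := fun n S => (-1) ^ S.card * f n S

/-- `f` is homogeneous of parity `p` modulo 2. -/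
def HasParity (p : ℕ) (f : SuperFn I) : Prop := parity f = (-1) ^ p * f

/-! ### Derivations (odd ones act from the left) -/

def dEven (i : ℕ) (f : SuperFn I) : SuperFn I :=
  fun n => (n i + 1) • (f (n + Finsupp.single i 1) : GrassmannSeries (OddVar I) (LaurentSeries ℂ))

def dOdd (o : OddVar I) (f : SuperFn I) : SuperFn I := fun n => GrassmannSeries.deriv o (f n)

def dx (f : SuperFn I) : SuperFn I := dEven 0 f
def dphi (f : SuperFn I) : SuperFn I := dOdd phiVar f

/-- `∂/∂t_n`, `n ≥ 1`. -/
def dt (n : ℕ) (f : SuperFn I) : SuperFn I :=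
  if Even n then dEven (n / 2) f else dOdd (oddTimeVar (n / 2)) f

/-- The odd derivation `δ = ∂_φ + φ ∂_x`. -/
def del (f : SuperFn I) : SuperFn I := dphi f + phi * dx f

/-! ### Superfields and Laurent series of superfields -/

/-- `f` is a superfield: it does not involve `z` and `θ`, so it is a formal function of
`x, φ, t₁, t₂, …` with values in `Λ`. -/
def IsField (f : SuperFn I) : Prop :=
  ∀ n S m, (m ≠ 0 ∨ thetaVar ∈ S) → coef f n S m = 0

/-- Only negative powers of `z` occur in `f`. -/
def IsNeg (f : SuperFn I) : Prop := ∀ n S m, 0 ≤ m → coef f n S m = 0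

/-- `f` does not depend on `φ`. -/
def PhiFree (f : SuperFn I) : Prop := dphi f = 0

/-- `f` does not depend on `θ`. -/
def ThetaFree (f : SuperFn I) : Prop := dOdd thetaVar f = 0

/-- The coefficient of `z ^ m`, as a function of the other variables. -/
def zCoef (m : ℤ) (f : SuperFn I) : SuperFn I :=
  fun n S => HahnSeries.single 0 (coef f n S m)

/-- The series `∑_{i ≥ 0} b i * z ^ (-(i + 1))` of superfields `b i`. -/
def negSeries (b : ℕ → SuperFn I) : SuperFn I :=
  fun n S => HahnSeries.single 1 1 *
    HahnSeries.ofPowerSeries ℤ ℂ (PowerSeries.mk fun i => coef (b i) n S 0)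

/-- The exponential of a series without constant term: a monomial of total degree `d` occurs in
the power `L ^ k` only for `k ≤ d`. -/
def fexp (L : SuperFn I) : SuperFn I :=
  fun n S => ∑ k ∈ Finset.range (n.degree + S.card + 1), ((k.factorial : ℂ)⁻¹) • (L ^ k) n S

/-! ## The Hamiltonian super KP hierarchy -/

/-- The components `ν, a, h, ψ` of a super Faà di Bruno generator. -/
structure Components (I : Type*) [LinearOrder I] where
  nu : SuperFn I
  a : SuperFn I
  h : SuperFn I
  psi : SuperFn I

/-- `ν = ∑_{j>0} ν_j z⁻ʲ` and `ψ = ∑_{j>0} ψ_j z⁻ʲ` are odd, `a = 1 + ∑_{j>0} a_j z⁻ʲ` and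
`h = z + ∑_{j>0} h_j z⁻ʲ` are even; the coefficients depend on `x` and the times only. -/
structure Components.Admissible (c : Components I) : Prop where
  nu_odd : HasParity 1 c.nu
  a_even : HasParity 0 c.a
  h_even : HasParity 0 c.h
  psi_odd : HasParity 1 c.psi
  phiFree : PhiFree c.nu ∧ PhiFree c.a ∧ PhiFree c.h ∧ PhiFree c.psi
  thetaFree : ThetaFree c.nu ∧ ThetaFree c.a ∧ ThetaFree c.h ∧ ThetaFree c.psi
  nu_neg : IsNeg c.nu
  a_neg : IsNeg (c.a - 1)
  h_neg : IsNeg (c.h - zpow 1)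
  psi_neg : IsNeg c.psi

/-- The generator `ĥ = ν + θ a + φ h + θ φ ψ`. -/
def Components.gen (c : Components I) : SuperFn I :=
  c.nu + theta * c.a + phi * c.h + theta * phi * c.psi

/-- The Faà di Bruno iterates `g⁽ᵏ⁾ = (δ + g)ᵏ · 1`. -/
def iterate (g : SuperFn I) : ℕ → SuperFn I
  | 0 => 1
  | k + 1 => del (iterate g k) + g * iterate g k

/-- `f` lies in the span `W` over the superfields of the Faà di Bruno iterates of `g`. -/
def InSpan (g f : SuperFn I) : Prop :=
  ∃ (N : ℕ) (b : ℕ → SuperFn I), (∀ l, IsField (b l)) ∧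
    f = ∑ l ∈ Finset.range N, b l * iterate g l

/-- The monomial `z ^ j * θ ^ p` with index `k = 2 j + p`, `p ∈ {0, 1}`. -/
def vacuum (k : ℕ) : SuperFn I := zpow (k / 2 : ℕ) * theta ^ (k % 2)

/-- `H` is the sequence of super currents of `g`: the elements `H⁽ᵏ⁾` of the span `W` of the
iterates with `H⁽²ʲ⁺ᵖ⁾ = z ^ j θ ^ p +` (negative powers of `z`). -/
def IsCurrents (g : SuperFn I) (H : ℕ → SuperFn I) : Prop :=
  ∀ k, InSpan g (H k) ∧ IsNeg (H k - vacuum k)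

/-- `c`, with super currents `H`, is a solution of HSKP: `∂_k ĥ = (-1)ᵏ δ H⁽ᵏ⁾` for `k > 0`. -/
structure SolvesHSKP (c : Components I) (H : ℕ → SuperFn I) : Prop where
  admissible : c.Admissible
  currents : IsCurrents c.gen H
  flow : ∀ k, 0 < k → dt k c.gen = (-1) ^ k * del (H k)

/-- The Berezin residue `∮ f dz dθ`: the coefficient of `z⁻¹ θ` in `f`, with `θ` written on the
right (`f₀ + f₁ θ` has left `θ`-derivative `parity f₁`). -/
def residue (f : SuperFn I) : SuperFn I := parity (dOdd thetaVar (zCoef (-1) f))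

/-- The enhanced currents `K⁽ʲ⁾ = H⁽ʲ⁾ + (-1)ʲ⁺¹ φ ∮ H⁽ʲ⁾ dz dθ`. -/
def enhanced (H : ℕ → SuperFn I) (j : ℕ) : SuperFn I :=
  H j + (-1) ^ (j + 1) * (phi * residue (H j))

/-- `q` is a potential of the residues at `φ = 0`, with `x` identified with `t₂`: an odd superfield
independent of `φ` with `∂_n q = C_n` at `φ = 0` for all `n ≥ 1`, and `∂_x q = C_2` at `φ = 0`, where
`C_n = ∮ H⁽ⁿ⁾ dz dθ`. -/
structure IsPotential (H : ℕ → SuperFn I) (q : SuperFn I) : Prop where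
  field : IsField q
  odd : HasParity 1 q
  phiFree : PhiFree q
  dt_eq : ∀ n, 0 < n → phi * dt n q = phi * residue (H n)
  dx_eq : phi * dx q = phi * residue (H 2)

/-! ## Super pseudo-differential operators -/

/-- The formal expression `∑ A k * δ ^ k`. -/
abbrev PsiDO (I : Type*) := ℤ → SuperFn I

namespace PsiDO

/-- Coefficients are superfields, and the order is bounded above. -/
def IsPsiDO (A : PsiDO I) : Prop := (∀ k, IsField (A k)) ∧ ∃ N : ℤ, ∀ k, N < k → A k = 0

/-- The super binomial coefficients, for `k : ℤ` and `i : ℕ`. -/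
def superBinom (k : ℤ) (i : ℕ) : ℤ :=
  if Even k ∧ Odd i then 0 else Ring.choose (k / 2) (i / 2)

/-- The term of order `k - i` in the super Leibniz rule
`δ ^ k ∘ b = ∑_{i ≥ 0} superBinom k i * (-1) ^ (|b| * (k - i)) * (δ ^ i b) * δ ^ (k - i)`. -/
def leibniz (k : ℤ) (i : ℕ) (b : SuperFn I) : SuperFn I :=
  superBinom k i • del^[i] (if Even (k - i) then b else parity b)

/-- The product of super pseudo-differential operators; for `IsPsiDO` operators the sum is finite.
The term of `A k * (δ ^ k ∘ B l) * δ ^ l` of order `n` has `i = k + l - n`. -/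
def comp (A B : PsiDO I) : PsiDO I := fun n =>
  ∑ᶠ p : ℤ × ℤ,
    if n ≤ p.1 + p.2 then A p.1 * leibniz p.1 (p.1 + p.2 - n).toNat (B p.2) else 0

/-- The operator `b * δ ^ k`. -/
def mono (k : ℤ) (b : SuperFn I) : PsiDO I := fun l => if l = k then b else 0

def one : PsiDO I := mono 0 1

/-- `∂_x ^ j = δ ^ (2 j)`. -/
def dxPow (j : ℕ) : PsiDO I := mono (2 * j) 1

/-- `∂_φ ∂_x ^ i = δ ^ (2 i + 1) - φ δ ^ (2 i + 2)`. -/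
def dphiDxPow (i : ℕ) : PsiDO I := mono (2 * i + 1) 1 - mono (2 * i + 2) phi

/-- The purely pseudo-differential part: the terms of negative order. -/
def negPart (A : PsiDO I) : PsiDO I := fun k => if k < 0 then A k else 0

/-- The derivative of the coefficients with respect to `t_n`. -/
def dtCoef (n : ℕ) (A : PsiDO I) : PsiDO I := fun k => dt n (A k)

/-- The equations of the Jacobian super KP hierarchy:
`∂_{2j} S = -(S ∂_x^j S⁻¹)₋ S` and `∂_{2j-1} S = -(S ∂_φ ∂_x^{j-1} S⁻¹)₋ S` for `j ≥ 1`
(here `j = i + 1`). -/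
def SolvesJSKP (S : PsiDO I) : Prop :=
  ∃ T : PsiDO I, IsPsiDO T ∧ comp S T = one ∧ comp T S = one ∧
    ∀ i : ℕ,
      dtCoef (2 * i + 2) S = -comp (negPart (comp (comp S (dxPow (i + 1))) T)) S ∧
      dtCoef (2 * i + 1) S = -comp (negPart (comp (comp S (dphiDxPow i)) T)) S

end PsiDO

/-- The coordinates of a dressing operator: `u i`, `xi i`, `eta i`, `w i` stand for
`u_{i+1}`, `ξ_{i+1}`, `η_{i+1}`, `w_{i+1}`. -/
structure Dressing (I : Type*) [LinearOrder I] where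
  u : ℕ → SuperFn I
  xi : ℕ → SuperFn I
  eta : ℕ → SuperFn I
  w : ℕ → SuperFn I

/-- The coordinates are functions of `x` and the times; `u_j, w_j` are even and `ξ_j, η_j` odd. -/
structure Dressing.Admissible (d : Dressing I) : Prop where
  u_even : ∀ i, IsField (d.u i) ∧ PhiFree (d.u i) ∧ HasParity 0 (d.u i)
  xi_odd : ∀ i, IsField (d.xi i) ∧ PhiFree (d.xi i) ∧ HasParity 1 (d.xi i)
  eta_odd : ∀ i, IsField (d.eta i) ∧ PhiFree (d.eta i) ∧ HasParity 1 (d.eta i)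
  w_even : ∀ i, IsField (d.w i) ∧ PhiFree (d.w i) ∧ HasParity 0 (d.w i)

/-- `S = 1 + ∑_{j>0} ((u_j + φ ξ_j) ∂_x⁻ʲ + (η_j + φ w_j) δ^{-(2j-1)})`. -/
def Dressing.op (d : Dressing I) : PsiDO I
  | Int.ofNat 0 => 1
  | Int.ofNat (_ + 1) => 0
  | Int.negSucc m =>
      if Even m then d.eta (m / 2) + phi * d.w (m / 2) else d.u (m / 2) + phi * d.xi (m / 2)

/-! ## Wave functions -/

/-- The sum of a family in which every monomial in the variables other than `z` occurs only finitely
often. -/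
def formalSum (f : ℕ → SuperFn I) : SuperFn I := fun n S => ∑ᶠ i, f i n S

/-- The phase `φ θ + z x + ∑_{j>0} (t_{2j} z ^ j + t_{2j-1} θ z ^ (j-1))`. -/
def phase : SuperFn I :=
  phi * theta + zpow 1 * xvar +
    formalSum fun i => time (2 * i + 2) * zpow (i + 1) + time (2 * i + 1) * theta * zpow i

/-- The vacuum wave function `e`. -/
def vacuumWave : SuperFn I := fexp phase

/-- `δ ^ k e` for `k : ℤ`, where `δ ^ (2 m) e = ∂_x ^ m e = z ^ m e`. -/
def delPowWave (k : ℤ) : SuperFn I :=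
  zpow (k / 2) * if Even k then vacuumWave else del vacuumWave

/-- `Ψ = S · e = ∑_k S_k δ ^ k e`; for operators of bounded order every coefficient of this series
is a finite sum. -/
def IsDressed (S : PsiDO I) (Psi : SuperFn I) : Prop :=
  ∀ n T m, coef Psi n T m = ∑ᶠ k : ℤ, coef (S k * delPowWave k) n T m

/-! ## The change of coordinates -/

/-- The components of `𝔥 = ĥ + ν₀`: here `ν₀` is an odd superfield independent of `φ`. -/
structure IsEnhanced (c : Components I) (nu0 : SuperFn I) : Prop where
  admissible : c.Admissible
  field : IsField nu0
  odd : HasParity 1 nu0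
  phiFree : PhiFree nu0

/-- The change of coordinates between `(u_i, w_i, ξ_i, η_i)` and the components of `𝔥`, with
`ν(z) = ν₀ + ∑_{j>0} ν_j z⁻ʲ`. -/
structure CoordChange (d : Dressing I) (c : Components I) (nu0 : SuperFn I) : Prop where
  nu_eq : (nu0 + c.nu) * (1 + negSeries d.u) =
    -d.eta 0 + negSeries fun i => d.xi i - d.eta (i + 1)
  a_eq : c.a * (1 + negSeries d.u) - negSeries d.eta * (nu0 + c.nu) =
    1 + negSeries fun i => d.u i + d.w i
  h_eq : c.h * (1 + negSeries d.u) =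
    zpow 1 + d.u 0 + d.eta 0 * (nu0 + c.nu) + (negSeries fun i => dx (d.u i) + d.u (i + 1)) +
      (nu0 + c.nu) * negSeries fun i => d.xi i - d.eta (i + 1)
  psi_eq : c.psi * (1 + negSeries d.u) =
    c.a * (d.eta 0 + negSeries fun i => d.eta (i + 1) - d.xi i) + (nu0 + c.nu) * negSeries d.w -
      c.h * negSeries d.eta + negSeries fun i => dx (d.eta i) + d.xi i

/-- The HSKP generator with components `c` belongs to the dressing operator with coordinates `d`:
`c` is obtained by the change of coordinates, forgetting `ν₀`. -/
def Corresponds (d : Dressing I) (c : Components I) : Prop :=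
  ∃ nu0, IsEnhanced c nu0 ∧ CoordChange d c nu0

/-- The first wave function `Φ = Ψ exp(φ η_1)` belonging to `Ψ = S · e`. -/
def IsFirstWave (d : Dressing I) (Phi : SuperFn I) : Prop :=
  ∃ Psi, IsDressed d.op Psi ∧ Phi = Psi * fexp (phi * d.eta 0)

/-- The even constants `κ = 1 + ∑_{j>0} (c_j + γ_j θ) z⁻ʲ`, with `c_j, γ_j ∈ Λ`. -/
structure IsConstant (kappa : SuperFn I) : Prop where
  even : HasParity 0 kappa
  neg : IsNeg (kappa - 1)
  dx_eq : dx kappa = 0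
  dphi_eq : dphi kappa = 0
  dt_eq : ∀ n, 0 < n → dt n kappa = 0

end

end SuperKP

/-! Both hierarchies are statements about one object, an even invertible wave function Φ = g · e
with g ∈ 1 + V⁻, and the proof consists in translating each of them into conditions on Φ.

Dressing operators. An operator acts on the vacuum wave by its symbol, S · e = `sym S` · e, where
δ^(2m) becomes z^m and δ^(2m+1) becomes z^m(θ + φz). For a dressing operator the only deviation of
the symbol from 1 outside V⁻ is -φη_1. Multiplication by 1 + φη_1 = exp(φη_1) removes it, and
`firstSymbol` becomes a bijection from dressing operators onto the even elements of 1 + V⁻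
(`firstSymbol_isNeg`, `firstSymbol_injective`, `exists_dressing`). The change of coordinates (*) is
nothing but δΨ = (ĥ + ν_0)Ψ for Ψ = S · e, written in the components 1, θ, φ, φθ
(`coordChange_iff`); its coefficient of z^0 forces ν_0 = -η_1, so on Φ it reads δΦ = ĥΦ.

HSKP. If δΦ = ĥΦ, multiplication by Φ intertwines δ + ĥ with δ, hence maps W onto the span of the
δ^l Φ (`mem_fieldSpan_wave_iff`). The leading terms of the iterates are independent over the
superfields, so W ∩ V⁻ = 0 (`eq_zero_of_mem_fieldSpan_of_isNeg`). The flow equation makes ∂_n +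
H^(n) supercommute with δ + ĥ, so it preserves W; comparison of leading terms gives ∂_n H^(j) =
(-1)^(jn) ∂_j H^(n) (`zero_curvature`). The currents minus their vacuum parts are then the
components of a closed form with values in V⁻. A Poincaré lemma in even and odd variables gives its
primitive L, and Φ = exp(L) · e (`exists_log_wave`, `exists_wave`). Conversely the logarithmic
derivatives of a wave function with ∂_nΦ in the span of the δ^l Φ lie in W and have the right
leading terms, so they are the currents, and the flow equations express that δ and ∂_n supercommute
(`exists_currents`, `IsWave.flow`).

JSKP. By Sato's argument the flow in t_n holds if and only if ∂_nΨ is a differential operator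
applied to Ψ, that is, ∂_nΨ lies in the span of the δ^l Ψ (`flow_iff`). Since Ψ and Φ differ by an
invertible superfield, the two spans coincide and the condition on Ψ is the condition on Φ.

Residues. Taking the coefficient of z⁻¹θ at φ = 0 in ∂_n g = (H^(n) - vacuum) g kills all products
of two elements of V⁻. So that coefficient of g, which is η_1, is a potential q of the residues
(`isPotential_of_wave`), and the enhanced currents are the logarithmic derivatives of Φ exp(-φq)
(`enhanced_eq`). Any other potential differs by an odd constant γ and is reached by multiplying Φ by
1 + γθz⁻¹.

Fibres. Two wave functions with the same generator and currents have a quotient killed by δ and all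
∂_n. This quotient is the constant κ of the third part, and the bijection of dressing operators with
1 + V⁻ turns κ into a unique S'. -/

set_option linter.unusedSectionVars false

/-! ### Grassmann algebra: reordering signs, parity involution, left derivatives -/

namespace GrassmannSeries

variable {O K : Type*} [LinearOrder O] [CommRing K]

/-- The parity involution of the Grassmann algebra. -/
def invol (f : GrassmannSeries O K) : GrassmannSeries O K := fun S => (-1) ^ S.card * f S

/-- Disjointness excludes equal entries, so each pair of S × T is an inversion in exactly one of the
two orders. -/
theorem inversions_add_comm {S T : Finset O} (h : Disjoint S T) :
    inversions S T + inversions T S = S.card * T.card := by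
  unfold inversions
  rw [← Finset.card_product, ← Finset.card_filter_add_card_filter_not (s := S ×ˢ T)
    (fun p : O × O => p.2 < p.1)]
  congr 1
  refine Finset.card_bij' (fun p _ => (p.2, p.1)) (fun p _ => (p.2, p.1)) ?_ ?_ ?_ ?_
  · rintro ⟨a, b⟩ hp
    simp only [Finset.mem_filter, Finset.mem_product] at hp ⊢
    exact ⟨⟨hp.1.2, hp.1.1⟩, not_lt.2 hp.2.le⟩
  · rintro ⟨a, b⟩ hp
    simp only [Finset.mem_filter, Finset.mem_product] at hp ⊢
    refine ⟨⟨hp.1.2, hp.1.1⟩, lt_of_le_of_ne (not_lt.1 hp.2) ?_⟩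
    rintro rfl
    exact Finset.disjoint_left.1 h hp.1.1 hp.1.2
  · intro p _
    rfl
  · intro p _
    rfl

theorem neg_one_pow_congr {a b : ℕ} (h : (a + b) % 2 = 0) : (-1 : K) ^ a = (-1) ^ b := by
  have h1 : (-1 : K) ^ (a + b) = 1 := (Nat.even_iff.2 h).neg_one_pow
  have h2 : (-1 : K) ^ b * (-1) ^ b = 1 := by rw [← mul_pow]; simp
  calc (-1 : K) ^ a = (-1) ^ a * ((-1) ^ b * (-1) ^ b) := by rw [h2, mul_one]
    _ = (-1) ^ (a + b) * (-1) ^ b := by rw [pow_add, mul_assoc]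
    _ = _ := by rw [h1, one_mul]

theorem neg_one_pow_congr_neg {a b : ℕ} (h : (a + b) % 2 = 1) : (-1 : K) ^ a = -(-1) ^ b := by
  rw [← neg_one_pow_congr (K := K) (a := b + 1) (b := a) (by omega), pow_succ]
  ring

@[simp] theorem invol_apply (f : GrassmannSeries O K) (S : Finset O) :
    invol f S = (-1) ^ S.card * f S := rfl

theorem invol_mul (f g : GrassmannSeries O K) : invol (f * g) = invol f * invol g := by
  ext S
  simp only [invol_apply, mul_apply, Finset.mul_sum]
  refine Finset.sum_congr rfl fun T hT => ?_
  rw [← Finset.card_sdiff_add_card_eq_card (Finset.mem_powerset.1 hT), pow_add]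
  ring

/-- Complementation exchanges the two products, and the signs differ by (-1)^(|T||S \ T|), which is
1 when |T| is even. -/
theorem mul_eq_of_even {f : GrassmannSeries O K} (hf : ∀ S, Odd S.card → f S = 0)
    (g : GrassmannSeries O K) : f * g = g * f := by
  ext S
  simp only [mul_apply]
  refine Finset.sum_nbij' (fun T => S \ T) (fun T => S \ T) ?_ ?_ ?_ ?_ ?_
  · simp
  · simp
  · intro T hT; simpa using Finset.mem_powerset.1 hT
  · intro T hT; simpa using Finset.mem_powerset.1 hT
  · intro T hT
    rw [Finset.sdiff_sdiff_eq_self (Finset.mem_powerset.1 hT)]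
    rcases Nat.even_or_odd T.card with h | h
    · rw [neg_one_pow_congr (K := K) (a := inversions T (S \ T)) (b := inversions (S \ T) T)]
      · ring
      · rw [inversions_add_comm Finset.disjoint_sdiff]
        exact Nat.even_iff.1 (h.mul_right _)
    · simp [hf T h]

/-- As in the even case, but for |T| odd the sign (-1)^(|T||S \ T|) is (-1)^|S \ T|, which is what
the involution puts on the other factor. -/
theorem mul_eq_of_odd {f : GrassmannSeries O K} (hf : ∀ S, Even S.card → f S = 0)
    (g : GrassmannSeries O K) : f * g = invol g * f := by
  ext S
  simp only [mul_apply]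
  refine Finset.sum_nbij' (fun T => S \ T) (fun T => S \ T) ?_ ?_ ?_ ?_ ?_
  · simp
  · simp
  · intro T hT; simpa using Finset.mem_powerset.1 hT
  · intro T hT; simpa using Finset.mem_powerset.1 hT
  · intro T hT
    rw [Finset.sdiff_sdiff_eq_self (Finset.mem_powerset.1 hT)]
    rcases Nat.even_or_odd T.card with h | h
    · simp [hf T h]
    · rw [invol_apply, neg_one_pow_congr (K := K) (a := inversions T (S \ T))
        (b := inversions (S \ T) T + (S \ T).card)]
      · ring
      · rw [← add_assoc, inversions_add_comm Finset.disjoint_sdiff]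
        exact Nat.even_iff.1 (by
          have := h.add_odd odd_one
          rw [← Nat.succ_mul]
          exact this.mul_right _)

theorem inversions_insert_left {o : O} {S : Finset O} (h : o ∉ S) (T : Finset O) :
    inversions (insert o S) T = inversions {o} T + inversions S T := by
  rw [Finset.insert_eq, inversions_union_left (Finset.disjoint_singleton_left.2 h)]

theorem inversions_insert_right {o : O} {S : Finset O} (h : o ∉ S) (T : Finset O) :
    inversions T (insert o S) = inversions T {o} + inversions T S := by
  rw [Finset.insert_eq, inversions_union_right (Finset.disjoint_singleton_left.2 h)]

theorem inversions_singleton_add {o : O} {S : Finset O} (h : o ∉ S) :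
    inversions {o} S + inversions S {o} = S.card := by
  rw [inversions_add_comm (Finset.disjoint_singleton_left.2 h)]; simp

theorem deriv_apply (o : O) (f : GrassmannSeries O K) (S : Finset O) :
    deriv o f S = if o ∈ S then 0 else (-1) ^ inversions {o} S * f (insert o S) := rfl

/-- If o ∉ S, the subsets of S ∪ {o} that contain o give the first term and the others the second.
If o ∈ S the left side vanishes; on the right the subsets T and T ∪ {o} contribute opposite terms.
-/
theorem deriv_mul (o : O) (f g : GrassmannSeries O K) :
    deriv o (f * g) = deriv o f * g + invol f * deriv o g := by
  ext S
  rw [add_apply, deriv_apply]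
  split_ifs with ho
  · rw [mul_apply, mul_apply, ← Finset.insert_erase ho, Finset.sum_powerset_insert (by simp),
      Finset.sum_powerset_insert (by simp)]
    set U := S.erase o
    have hU : o ∉ U := by simp [U]
    have e1 : ∀ T ∈ U.powerset, o ∉ T := fun T hT h => hU (Finset.mem_powerset.1 hT h)
    rw [Finset.sum_eq_zero (s := U.powerset) (f := fun T => (-1) ^ inversions (insert o T)
        (insert o U \ insert o T) * (deriv o f (insert o T) * g (insert o U \ insert o T))),
      Finset.sum_eq_zero (s := U.powerset) (f := fun T => (-1) ^ inversions T
        (insert o U \ T) * (invol f T * deriv o g (insert o U \ T))), add_zero, zero_add,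
      ← Finset.sum_add_distrib]
    · refine (Finset.sum_eq_zero fun T hT => ?_).symm
      have hoT := e1 T hT
      have hoV : o ∉ U \ T := by simp [hU]
      have e2 : insert o U \ T = insert o (U \ T) := by grind
      have e3 : insert o U \ insert o T = U \ T := by grind
      rw [e2, e3, invol_apply, deriv_apply, deriv_apply, if_neg hoT, if_neg hoV,
        Finset.card_insert_of_notMem hoT, inversions_insert_left hoT,
        inversions_insert_right hoV]
      have := inversions_singleton_add hoT
      rw [← this]
      simp only [pow_add, pow_one]
      have h2 : ∀ a : ℕ, (-1 : K) ^ a * (-1) ^ a = 1 := fun a => by rw [← mul_pow]; simp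
      linear_combination (-((-1) ^ inversions T {o} * (-1) ^ inversions T (U \ T) *
        (-1) ^ inversions {o} T * f (insert o T) * g (insert o (U \ T)))) * h2 (inversions {o} (U \ T))
    · intro T hT
      have hoT := e1 T hT
      have : o ∈ insert o U \ T := by grind
      simp [deriv_apply, hoT]
    · intro T hT
      simp [deriv_apply]
  · rw [mul_apply, mul_apply, mul_apply, Finset.sum_powerset_insert ho,
      mul_add, add_comm, Finset.mul_sum, Finset.mul_sum]
    congr 1
    · refine Finset.sum_congr rfl fun T hT => ?_
      have hTS := Finset.mem_powerset.1 hT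
      have hoT : o ∉ T := fun h => ho (hTS h)
      have e3 : insert o S \ insert o T = S \ T := by grind
      have e4 : inversions {o} S = inversions {o} T + inversions {o} (S \ T) := by
        rw [← inversions_union_right Finset.disjoint_sdiff, Finset.union_sdiff_of_subset hTS]
      rw [e3, deriv_apply, if_neg hoT, inversions_insert_left hoT, e4]
      have h2 : ∀ a : ℕ, (-1 : K) ^ a * (-1) ^ a = 1 := fun a => by rw [← mul_pow]; simp
      simp only [pow_add]
      linear_combination ((-1) ^ inversions {o} T * (-1) ^ inversions T (S \ T) *
        f (insert o T) * g (S \ T)) * h2 (inversions {o} (S \ T))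
    · refine Finset.sum_congr rfl fun T hT => ?_
      have hTS := Finset.mem_powerset.1 hT
      have hoT : o ∉ T := fun h => ho (hTS h)
      have hoV : o ∉ S \ T := fun h => ho (Finset.mem_sdiff.1 h).1
      have e3 : insert o S \ T = insert o (S \ T) := by grind
      have e4 : inversions {o} S = inversions {o} T + inversions {o} (S \ T) := by
        rw [← inversions_union_right Finset.disjoint_sdiff, Finset.union_sdiff_of_subset hTS]
      rw [e3, deriv_apply, if_neg hoV, invol_apply, inversions_insert_right hoV, e4,
        ← inversions_singleton_add hoT]
      simp only [pow_add]
      ring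

theorem deriv_deriv (o p : O) (f : GrassmannSeries O K) :
    deriv o (deriv p f) = -deriv p (deriv o f) := by
  ext S
  change deriv o (deriv p f) S = -(deriv p (deriv o f) S)
  simp only [deriv_apply]
  by_cases hop : o = p
  · subst hop
    simp
  by_cases ho : o ∈ S
  · simp [ho]
  by_cases hp : p ∈ S
  · simp [hp]
  have h1 : p ∉ insert o S := by simp [hp, Ne.symm hop]
  have h2 : o ∉ insert p S := by simp [ho, hop]
  rw [if_neg ho, if_neg hp, if_neg h1, if_neg h2, inversions_insert_right ho,
    inversions_insert_right hp, Finset.insert_comm]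
  -- Exactly one of the two orders of o and p is an inversion; this is the source of the minus sign.
  have h3 : inversions {p} {o} + inversions {o} {p} = 1 := by
    rw [inversions_singleton_add (by simpa using Ne.symm hop)]; simp
  have h4 : (-1 : K) ^ inversions {p} {o} = -(-1) ^ inversions {o} {p} :=
    neg_one_pow_congr_neg (by omega)
  rw [pow_add, pow_add, h4]
  ring

theorem deriv_invol (o : O) (f : GrassmannSeries O K) :
    deriv o (invol f) = -invol (deriv o f) := by
  ext S
  change deriv o (invol f) S = -(invol (deriv o f) S)
  simp only [deriv_apply, invol_apply]
  split_ifs with h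
  · simp
  · rw [Finset.card_insert_of_notMem h, pow_succ]
    ring

theorem deriv_gen (o p : O) : deriv o (gen p : GrassmannSeries O K) = if o = p then 1 else 0 := by
  ext S
  rw [deriv_apply]
  by_cases hop : o = p
  · subst hop
    rw [if_pos rfl, one_apply]
    by_cases hS : S = ∅
    · subst hS
      simp [gen]
    · rw [if_neg hS]
      split_ifs with h
      · rfl
      · have : insert o S ≠ {o} := by
          intro e
          apply hS
          rw [← Finset.erase_insert h, e]
          simp
        simp [gen, this]
  · rw [if_neg hop, zero_apply]
    split_ifs with h
    · rfl
    · have : insert o S ≠ {p} := by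
        intro e
        have := Finset.mem_insert_self o S
        rw [e, Finset.mem_singleton] at this
        exact hop this
      simp [gen, this]

theorem const_mul (c : K) (f : GrassmannSeries O K) (S : Finset O) :
    ((const c : GrassmannSeries O K) * f) S = c * f S := by
  rw [mul_apply, Finset.sum_eq_single ∅]
  · simp [const]
  · intro T _ hT
    simp [const, hT]
  · simp

end GrassmannSeries

namespace GrassmannSeries

variable {O K : Type*} [LinearOrder O] [CommRing K]

theorem invol_add (f g : GrassmannSeries O K) : invol (f + g) = invol f + invol g := by
  ext S
  simp only [invol_apply, add_apply]
  ring

theorem deriv_add (o : O) (f g : GrassmannSeries O K) :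
    deriv o (f + g) = deriv o f + deriv o g := by
  ext S
  simp only [deriv_apply, add_apply]
  split_ifs
  · simp
  · ring

theorem invol_sum {ι : Type*} (s : Finset ι) (f : ι → GrassmannSeries O K) :
    invol (∑ i ∈ s, f i) = ∑ i ∈ s, invol (f i) :=
  map_sum (AddMonoidHom.mk' invol invol_add) f s

theorem deriv_sum (o : O) {ι : Type*} (s : Finset ι) (f : ι → GrassmannSeries O K) :
    deriv o (∑ i ∈ s, f i) = ∑ i ∈ s, deriv o (f i) :=
  map_sum (AddMonoidHom.mk' (deriv o) (deriv_add o)) f s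

theorem sum_apply {ι : Type*} (s : Finset ι) (f : ι → GrassmannSeries O K) (S : Finset O) :
    (∑ i ∈ s, f i) S = ∑ i ∈ s, f i S :=
  Finset.sum_apply S s f

theorem invol_invol (f : GrassmannSeries O K) : invol (invol f) = f := by
  ext S
  rw [invol_apply, invol_apply, ← mul_assoc, ← mul_pow]
  simp

end GrassmannSeries


/-! ### Power series with Grassmann coefficients -/

namespace GrassmannPowerSeries

open GrassmannSeries

variable {O K : Type*} [LinearOrder O] [CommRing K]

/-- Formal power series in countably many even variables over a Grassmann algebra. -/
abbrev Ser (O K : Type*) := MvPowerSeries ℕ (GrassmannSeries O K)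

/-- Parity involution. -/
def par (f : Ser O K) : Ser O K := fun n => invol (f n)
/-- Left derivative with respect to an odd variable. -/
def dOdd (o : O) (f : Ser O K) : Ser O K := fun n => GrassmannSeries.deriv o (f n)
/-- Derivative with respect to an even variable. -/
noncomputable def dEven (i : ℕ) (f : Ser O K) : Ser O K :=
  fun n => (n i + 1) • (f (n + Finsupp.single i 1) : GrassmannSeries O K)

theorem fn_mul (f g : Ser O K) (n : ℕ →₀ ℕ) :
    (f * g) n = ∑ p ∈ Finset.HasAntidiagonal.antidiagonal n, f p.1 * g p.2 := MvPowerSeries.coeff_mul n f g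

theorem fn_add (f g : Ser O K) (n : ℕ →₀ ℕ) : (f + g) n = f n + g n := rfl

theorem sum_swap_antidiagonal {M : Type*} [AddCommMonoid M] (n : ℕ →₀ ℕ)
    (F : (ℕ →₀ ℕ) × (ℕ →₀ ℕ) → M) :
    ∑ p ∈ Finset.HasAntidiagonal.antidiagonal n, F p =
      ∑ p ∈ Finset.HasAntidiagonal.antidiagonal n, F p.swap := by
  refine Finset.sum_nbij' Prod.swap Prod.swap ?_ ?_ ?_ ?_ ?_ <;>
    simp +contextual [add_comm]

theorem par_add (f g : Ser O K) : par (f + g) = par f + par g :=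
  funext fun n => invol_add (f n) (g n)

theorem par_mul (f g : Ser O K) : par (f * g) = par f * par g := by
  funext n
  change invol ((f * g) n) = _
  rw [fn_mul, fn_mul, invol_sum]
  exact Finset.sum_congr rfl fun p _ => invol_mul _ _

theorem par_par (f : Ser O K) : par (par f) = f := funext fun n => invol_invol (f n)

theorem mul_comm_of_even {f : Ser O K} (hf : ∀ n S, Odd S.card → f n S = 0) (g : Ser O K) :
    f * g = g * f := by
  funext n
  rw [fn_mul, fn_mul, sum_swap_antidiagonal]
  exact Finset.sum_congr rfl fun x _ => mul_eq_of_even (hf _) _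

theorem mul_comm_of_odd {f : Ser O K} (hf : ∀ n S, Even S.card → f n S = 0) (g : Ser O K) :
    f * g = par g * f := by
  funext n
  rw [fn_mul, fn_mul, sum_swap_antidiagonal]
  exact Finset.sum_congr rfl fun x _ => mul_eq_of_odd (hf _) _

/-- The hypothesis `h2` excludes 2-torsion: an odd-degree coefficient of an even element equals its
own negative. -/
theorem apply_eq_zero_of_par_eq (h2 : ∀ a : K, a + a = 0 → a = 0) {f : Ser O K} (h : par f = f)
    (n : ℕ →₀ ℕ) (S : Finset O) (hS : Odd S.card) : f n S = 0 := by
  have h := congrFun (congrFun h n) S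
  change (-1) ^ S.card * f n S = f n S at h
  rw [hS.neg_one_pow] at h
  exact h2 _ (by linear_combination -h)

theorem apply_eq_zero_of_par_eq_neg (h2 : ∀ a : K, a + a = 0 → a = 0) {f : Ser O K}
    (h : par f = -f) (n : ℕ →₀ ℕ) (S : Finset O) (hS : Even S.card) : f n S = 0 := by
  have h := congrFun (congrFun h n) S
  change (-1) ^ S.card * f n S = -(f n S) at h
  rw [hS.neg_one_pow] at h
  exact h2 _ (by linear_combination h)

theorem eq_zero_of_eq_neg (h2 : ∀ a : K, a + a = 0 → a = 0) {f : Ser O K} (h : f = -f) :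
    f = 0 := by
  funext n
  funext S
  have h3 : f n S = -(f n S) := congrFun (congrFun h n) S
  exact h2 _ (by linear_combination h3)

theorem dOdd_add (o : O) (f g : Ser O K) : dOdd o (f + g) = dOdd o f + dOdd o g :=
  funext fun n => deriv_add o (f n) (g n)

theorem dOdd_mul (o : O) (f g : Ser O K) : dOdd o (f * g) = dOdd o f * g + par f * dOdd o g := by
  funext n
  change GrassmannSeries.deriv o ((f * g) n) = _
  rw [fn_add, fn_mul, fn_mul, fn_mul, GrassmannSeries.deriv_sum, ← Finset.sum_add_distrib]
  exact Finset.sum_congr rfl fun p _ => deriv_mul o _ _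

theorem dOdd_par (o : O) (f : Ser O K) : dOdd o (par f) = -par (dOdd o f) :=
  funext fun n => deriv_invol o (f n)

theorem dOdd_dOdd (o p : O) (f : Ser O K) : dOdd o (dOdd p f) = -dOdd p (dOdd o f) :=
  funext fun n => deriv_deriv o p (f n)

theorem dEven_apply (i : ℕ) (f : Ser O K) (n : ℕ →₀ ℕ) :
    dEven i f n = (n i + 1) • f (n + Finsupp.single i 1) := rfl

theorem dEven_add (i : ℕ) (f g : Ser O K) : dEven i (f + g) = dEven i f + dEven i g := by
  funext n
  simp only [dEven_apply, fn_add, smul_add]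

theorem dEven_dEven (i j : ℕ) (f : Ser O K) : dEven i (dEven j f) = dEven j (dEven i f) := by
  by_cases hij : i = j
  · rw [hij]
  funext n
  simp only [dEven_apply]
  rw [smul_smul, smul_smul, add_right_comm n]
  simp [hij, Ne.symm hij, mul_comm]

theorem dEven_dOdd (i : ℕ) (o : O) (f : Ser O K) :
    dEven i (dOdd o f) = dOdd o (dEven i f) := by
  funext n
  change (n i + 1) • GrassmannSeries.deriv o (f (n + Finsupp.single i 1)) =
    GrassmannSeries.deriv o ((n i + 1) • f (n + Finsupp.single i 1))
  exact (map_nsmul (AddMonoidHom.mk' (GrassmannSeries.deriv o) (deriv_add o)) _ _).symm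

theorem dEven_par (i : ℕ) (f : Ser O K) : dEven i (par f) = par (dEven i f) := by
  funext n
  exact (map_nsmul (AddMonoidHom.mk' (invol (O := O) (K := K)) invol_add) _ _).symm

/-- The index shift in the Leibniz rule: the weight kills the pairs whose first entry has exponent 0
at i, and the others arise by raising that exponent by one. -/
theorem antidiagonal_succ_sum {M : Type*} [AddCommMonoid M] (i : ℕ) (n : ℕ →₀ ℕ)
    (F : (ℕ →₀ ℕ) → (ℕ →₀ ℕ) → M) :
    ∑ p ∈ (Finset.HasAntidiagonal.antidiagonal (n + Finsupp.single i 1) :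
        Finset ((ℕ →₀ ℕ) × (ℕ →₀ ℕ))), p.1 i • F p.1 p.2 =
      ∑ p ∈ Finset.HasAntidiagonal.antidiagonal n, (p.1 i + 1) • F (p.1 + Finsupp.single i 1) p.2 := by
  symm
  rw [← Finset.sum_filter_of_ne (s := Finset.HasAntidiagonal.antidiagonal (n + Finsupp.single i 1))
    (p := fun p : (ℕ →₀ ℕ) × (ℕ →₀ ℕ) => p.1 i ≠ 0) (by
      intro p _ h h0
      exact h (by rw [h0, zero_smul]))]
  refine Finset.sum_bij' (fun p _ => (p.1 + Finsupp.single i 1, p.2))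
    (fun p _ => (p.1 - Finsupp.single i 1, p.2)) ?_ ?_ ?_ ?_ ?_
  · rintro ⟨a, b⟩ h
    simp only [Finset.HasAntidiagonal.mem_antidiagonal, Finset.mem_filter] at h ⊢
    exact ⟨by rw [← h, add_right_comm], by simp⟩
  · rintro ⟨a, b⟩ h
    simp only [Finset.HasAntidiagonal.mem_antidiagonal, Finset.mem_filter] at h ⊢
    have hle : Finsupp.single i 1 ≤ a := by
      rw [Finsupp.single_le_iff]; omega
    apply add_right_cancel (b := Finsupp.single i 1)
    rw [← h.1, add_right_comm, tsub_add_cancel_of_le hle]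
  · rintro ⟨a, b⟩ h
    simp
  · rintro ⟨a, b⟩ h
    simp only [Finset.HasAntidiagonal.mem_antidiagonal, Finset.mem_filter] at h ⊢
    have hle : Finsupp.single i 1 ≤ a := by
      rw [Finsupp.single_le_iff]; omega
    rw [tsub_add_cancel_of_le hle]
  · rintro ⟨a, b⟩ h
    simp

/-- On the antidiagonal of n + e_i the two exponents at i add up to n_i + 1, so the factor n_i + 1
splits into the weights of the two terms. -/
theorem dEven_mul (i : ℕ) (f g : Ser O K) : dEven i (f * g) = dEven i f * g + f * dEven i g := by
  funext n
  rw [dEven_apply, fn_add, fn_mul, fn_mul, fn_mul, Finset.smul_sum]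
  have h1 := antidiagonal_succ_sum i n fun a b => f a * g b
  have h2 := antidiagonal_succ_sum i n fun a b => f b * g a
  rw [sum_swap_antidiagonal, sum_swap_antidiagonal n] at h2
  simp only [Prod.fst_swap, Prod.snd_swap] at h2
  simp only [dEven_apply, smul_mul_assoc, mul_smul_comm]
  rw [← h1, ← h2, ← Finset.sum_add_distrib]
  refine Finset.sum_congr rfl fun p hp => ?_
  rw [← add_smul]
  congr 1
  have := DFunLike.congr_fun (Finset.HasAntidiagonal.mem_antidiagonal.1 hp) i
  simp at this
  omega

theorem C_mul_apply (a : GrassmannSeries O K) (f : Ser O K) (n : ℕ →₀ ℕ) :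
    ((MvPowerSeries.C a : Ser O K) * f) n = a * f n := MvPowerSeries.coeff_C_mul n f a

end GrassmannPowerSeries

/-! ### The ring of superfunctions -/

namespace SuperKP

noncomputable section

variable {I : Type*} [LinearOrder I]

/-- The ring structure of the superfunctions, sealed so that unification does not unfold it. -/
def superRing : Ring (SuperFn I) := inferInstance

namespace Sealed

scoped instance : Ring (SuperFn I) := superRing
scoped instance : AddCommGroup (SuperFn I) := superRing.toAddCommGroup
scoped instance : AddCommMonoid (SuperFn I) :=
  @NonUnitalNonAssocSemiring.toAddCommMonoid _
    (@NonAssocSemiring.toNonUnitalNonAssocSemiring _ superRing.toSemiring.toNonAssocSemiring)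
scoped instance : AddGroup (SuperFn I) := superRing.toAddCommGroup.toAddGroup
scoped instance : AddMonoid (SuperFn I) := superRing.toAddCommGroup.toAddGroup.toAddMonoid
scoped instance : Semiring (SuperFn I) := superRing.toSemiring
scoped instance : Monoid (SuperFn I) := superRing.toSemiring.toMonoid
scoped instance : Add (SuperFn I) := superRing.toAdd
scoped instance : Mul (SuperFn I) := superRing.toMul
scoped instance : Neg (SuperFn I) := superRing.toNeg
scoped instance : Sub (SuperFn I) := superRing.toSub
scoped instance : Zero (SuperFn I) := superRing.toZero
scoped instance : One (SuperFn I) := superRing.toOne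
scoped instance : NatCast (SuperFn I) := superRing.toNatCast
scoped instance : IntCast (SuperFn I) := superRing.toIntCast
scoped instance : AddGroupWithOne (SuperFn I) := @Ring.toAddGroupWithOne _ superRing
scoped instance : AddMonoidWithOne (SuperFn I) :=
  (@Ring.toAddGroupWithOne _ superRing).toAddMonoidWithOne
scoped instance : Module ℤ (SuperFn I) := @AddCommGroup.toIntModule _ superRing.toAddCommGroup
scoped instance : Module ℕ (SuperFn I) := @AddCommMonoid.toNatModule _
  (@NonUnitalNonAssocSemiring.toAddCommMonoid _
    (@NonAssocSemiring.toNonUnitalNonAssocSemiring _ superRing.toSemiring.toNonAssocSemiring))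

end Sealed

open scoped Sealed
open GrassmannPowerSeries (par_add par_mul par_par)

theorem fn_ext {f g : SuperFn I} (h : ∀ n S, f n S = g n S) : f = g :=
  funext fun n => funext fun S => h n S

/-! ### Parity -/

theorem parity_add (f g : SuperFn I) : parity (f + g) = parity f + parity g := par_add f g

theorem parity_mul (f g : SuperFn I) : parity (f * g) = parity f * parity g := par_mul f g

theorem parity_parity (f : SuperFn I) : parity (parity f) = f := par_par f

theorem laurent_add_self (a : LaurentSeries ℂ) (h : a + a = 0) : a = 0 := by
  ext m
  have h1 : a.coeff m + a.coeff m = 0 := congrArg (fun b : LaurentSeries ℂ => b.coeff m) h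
  exact self_eq_neg.1 (eq_neg_of_add_eq_zero_left h1)

theorem additive_neg {A : Type*} [AddCommGroup A] {P : A → A}
    (hP : ∀ f g, P (f + g) = P f + P g) (f : A) : P (-f) = -P f :=
  map_neg (AddMonoidHom.mk' P hP) f

theorem additive_sub {A : Type*} [AddCommGroup A] {P : A → A}
    (hP : ∀ f g, P (f + g) = P f + P g) (f g : A) : P (f - g) = P f - P g :=
  map_sub (AddMonoidHom.mk' P hP) f g

theorem additive_zero {A : Type*} [AddCommGroup A] {P : A → A}
    (hP : ∀ f g, P (f + g) = P f + P g) : P 0 = 0 := map_zero (AddMonoidHom.mk' P hP)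

theorem additive_sum {A : Type*} [AddCommGroup A] {P : A → A}
    (hP : ∀ f g, P (f + g) = P f + P g) {ι : Type*} (s : Finset ι) (f : ι → A) :
    P (∑ i ∈ s, f i) = ∑ i ∈ s, P (f i) := map_sum (AddMonoidHom.mk' P hP) f s

theorem additive_zsmul {A : Type*} [AddCommGroup A] {P : A → A}
    (hP : ∀ f g, P (f + g) = P f + P g) (m : ℤ) (f : A) : P (m • f) = m • P f :=
  map_zsmul (AddMonoidHom.mk' P hP) m f

theorem parity_neg (f : SuperFn I) : parity (-f) = -parity f :=
  additive_neg parity_add f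

theorem parity_zero : parity (0 : SuperFn I) = 0 :=
  additive_zero parity_add

theorem parity_sub (f g : SuperFn I) : parity (f - g) = parity f - parity g :=
  additive_sub parity_add f g

theorem parity_sum {ι : Type*} (s : Finset ι) (f : ι → SuperFn I) :
    parity (∑ i ∈ s, f i) = ∑ i ∈ s, parity (f i) :=
  additive_sum parity_add s f

theorem parity_one : parity (1 : SuperFn I) = 1 := by
  have h : parity (1 : SuperFn I) * 1 = 1 := by
    calc parity (1 : SuperFn I) * 1 = parity (1 : SuperFn I) * parity (parity 1) := by
          rw [parity_parity]
      _ = 1 := by rw [← parity_mul, one_mul, parity_parity]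
  simpa using h

theorem hasParity_iff {p : ℕ} {f : SuperFn I} : HasParity p f ↔ parity f = (-1) ^ p * f := Iff.rfl


/-- The map `parity^[p]` supplies the Koszul sign (-1)^(p|f|) also for inhomogeneous f; only p
modulo 2 matters. -/
theorem iterate_parity_even {p : ℕ} (h : Even p) (f : SuperFn I) : parity^[p] f = f := by
  obtain ⟨k, rfl⟩ := h
  rw [← two_mul, Function.iterate_mul]
  have : (parity^[2] : SuperFn I → SuperFn I) = id := funext parity_parity
  rw [this, Function.iterate_id, id]

theorem iterate_parity_odd {p : ℕ} (h : Odd p) (f : SuperFn I) : parity^[p] f = parity f := by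
  obtain ⟨k, rfl⟩ := h
  rw [Function.iterate_add_apply, iterate_parity_even (even_two_mul k), Function.iterate_one]

theorem hasParity_zero_iff {f : SuperFn I} : HasParity 0 f ↔ parity f = f := by simp [hasParity_iff]
theorem hasParity_one_iff {f : SuperFn I} : HasParity 1 f ↔ parity f = -f := by simp [hasParity_iff]

theorem hasParity_even_iff {p : ℕ} (h : Even p) {f : SuperFn I} :
    HasParity p f ↔ HasParity 0 f := by simp [hasParity_iff, h.neg_one_pow]
theorem hasParity_odd_iff {p : ℕ} (h : Odd p) {f : SuperFn I} :
    HasParity p f ↔ HasParity 1 f := by simp [hasParity_iff, h.neg_one_pow]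

theorem neg_one_pow_comm (p : ℕ) (f : SuperFn I) : f * (-1) ^ p = (-1) ^ p * f :=
  ((Commute.neg_one_left f).pow_left p).eq.symm

theorem neg_one_pow_mul_self (p : ℕ) (f : SuperFn I) : (-1) ^ p * ((-1) ^ p * f) = f := by
  rcases Nat.even_or_odd p with h | h <;> simp [h.neg_one_pow]

namespace HasParity

variable {p q : ℕ} {f g : SuperFn I}

theorem mul (hf : HasParity p f) (hg : HasParity q g) : HasParity (p + q) (f * g) := by
  simp only [hasParity_iff] at *
  rw [parity_mul, hf, hg, pow_add, mul_assoc, ← mul_assoc f, neg_one_pow_comm]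
  simp only [mul_assoc]

theorem add (hf : HasParity p f) (hg : HasParity p g) : HasParity p (f + g) := by
  simp only [hasParity_iff] at *
  rw [parity_add, hf, hg, mul_add]

theorem neg (hf : HasParity p f) : HasParity p (-f) := by
  simp only [hasParity_iff] at *
  rw [parity_neg, hf, mul_neg]

theorem sub (hf : HasParity p f) (hg : HasParity p g) : HasParity p (f - g) := by
  rw [sub_eq_add_neg]; exact hf.add hg.neg

theorem one : HasParity 0 (1 : SuperFn I) := hasParity_zero_iff.2 parity_one

theorem congr (h : p % 2 = q % 2) (hf : HasParity p f) : HasParity q f := by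
  rcases Nat.even_or_odd p with hp | hp
  · exact (hasParity_even_iff (by grind)).2 ((hasParity_even_iff hp).1 hf)
  · exact (hasParity_odd_iff (by grind)).2 ((hasParity_odd_iff hp).1 hf)

theorem sum {ι : Type*} {s : Finset ι} {f : ι → SuperFn I} (h : ∀ i ∈ s, HasParity p (f i)) :
    HasParity p (∑ i ∈ s, f i) := by
  simp only [hasParity_iff] at *
  rw [parity_sum, Finset.mul_sum]
  exact Finset.sum_congr rfl h

theorem apply_eq_zero_of_even (hf : HasParity 0 f) (n : ℕ →₀ ℕ) (S : Finset (OddVar I))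
    (hS : Odd S.card) : f n S = 0 :=
  GrassmannPowerSeries.apply_eq_zero_of_par_eq laurent_add_self (f := f) (hasParity_zero_iff.1 hf) n S hS

theorem apply_eq_zero_of_odd (hf : HasParity 1 f) (n : ℕ →₀ ℕ) (S : Finset (OddVar I))
    (hS : Even S.card) : f n S = 0 :=
  GrassmannPowerSeries.apply_eq_zero_of_par_eq_neg laurent_add_self (f := f) (hasParity_one_iff.1 hf) n S hS

theorem comm (hf : HasParity 0 f) (g : SuperFn I) : f * g = g * f :=
  GrassmannPowerSeries.mul_comm_of_even (apply_eq_zero_of_even hf) g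

theorem odd_comm (hf : HasParity 1 f) (g : SuperFn I) : f * g = parity g * f :=
  GrassmannPowerSeries.mul_comm_of_odd (apply_eq_zero_of_odd hf) g

theorem super_comm (hf : HasParity p f) (g : SuperFn I) : f * g = parity^[p] g * f := by
  rcases Nat.even_or_odd p with h | h
  · rw [iterate_parity_even h, ((hasParity_even_iff h).1 hf).comm]
  · rw [iterate_parity_odd h, ((hasParity_odd_iff h).1 hf).odd_comm]

theorem iterate_parity (hf : HasParity p f) (q : ℕ) : parity^[q] f = (-1) ^ (p * q) * f := by
  rcases Nat.even_or_odd q with h | h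
  · rw [iterate_parity_even h, (h.mul_left p).neg_one_pow, one_mul]
  · rw [iterate_parity_odd h, hasParity_iff.1 hf]
    congr 1
    rcases Nat.even_or_odd p with h' | h'
    · rw [h'.neg_one_pow, (h'.mul_right q).neg_one_pow]
    · rw [h'.neg_one_pow, (h'.mul h).neg_one_pow]

theorem comm_mul (hf : HasParity p f) (hg : HasParity q g) : f * g = (-1) ^ (p * q) * (g * f) := by
  rw [hf.super_comm, hg.iterate_parity, mul_assoc, mul_comm q p]

theorem anticomm (hf : HasParity 1 f) (hg : HasParity 1 g) : f * g = -(g * f) := by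
  simpa using hf.comm_mul hg

theorem sq_eq_zero (hf : HasParity 1 f) : f * f = 0 :=
  GrassmannPowerSeries.eq_zero_of_eq_neg laurent_add_self (hf.anticomm hf)

theorem mul_even (hf : HasParity 0 f) (hg : HasParity 0 g) : HasParity 0 (f * g) := by
  simpa using hf.mul hg

theorem odd_mul_odd (hf : HasParity 1 f) (hg : HasParity 1 g) : HasParity 0 (f * g) := by
  rw [hasParity_zero_iff, parity_mul, hasParity_one_iff.1 hf, hasParity_one_iff.1 hg, neg_mul_neg]

theorem even_mul_odd (hf : HasParity 0 f) (hg : HasParity 1 g) : HasParity 1 (f * g) := by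
  rw [hasParity_one_iff, parity_mul, hasParity_zero_iff.1 hf, hasParity_one_iff.1 hg, mul_neg]

theorem odd_mul_even (hf : HasParity 1 f) (hg : HasParity 0 g) : HasParity 1 (f * g) := by
  rw [hasParity_one_iff, parity_mul, hasParity_one_iff.1 hf, hasParity_zero_iff.1 hg, neg_mul]

theorem pow_even (hf : HasParity 0 f) (k : ℕ) : HasParity 0 (f ^ k) := by
  induction k with
  | zero => rw [pow_zero]; exact one
  | succ k ih => rw [pow_succ]; exact ih.mul_even hf

end HasParity

/-! ### Super derivations -/

/-- `D` is a super derivation of parity `p` acting from the left. -/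
structure IsSuperDer (p : ℕ) (D : SuperFn I → SuperFn I) : Prop where
  add : ∀ f g, D (f + g) = D f + D g
  mul : ∀ f g, D (f * g) = D f * g + parity^[p] f * D g
  parity : ∀ f, D (parity f) = (-1) ^ p * SuperKP.parity (D f)

namespace IsSuperDer

variable {p q : ℕ} {D E : SuperFn I → SuperFn I}

theorem neg (h : IsSuperDer p D) (f : SuperFn I) : D (-f) = -D f :=
  map_neg (AddMonoidHom.mk' D h.add) f

theorem zero (h : IsSuperDer p D) : D 0 = 0 := map_zero (AddMonoidHom.mk' D h.add)

theorem sub (h : IsSuperDer p D) (f g : SuperFn I) : D (f - g) = D f - D g :=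
  map_sub (AddMonoidHom.mk' D h.add) f g

theorem sum (h : IsSuperDer p D) {ι : Type*} (s : Finset ι) (f : ι → SuperFn I) :
    D (∑ i ∈ s, f i) = ∑ i ∈ s, D (f i) :=
  map_sum (AddMonoidHom.mk' D h.add) f s

theorem neg_one_pow_mul (h : IsSuperDer p D) (k : ℕ) (f : SuperFn I) :
    D ((-1) ^ k * f) = (-1) ^ k * D f := by
  rcases Nat.even_or_odd k with hk | hk <;> simp [hk.neg_one_pow, h.neg]

theorem one (h : IsSuperDer p D) : D 1 = 0 := by
  have h1 := h.mul 1 1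
  have h2 : SuperKP.parity^[p] (1 : SuperFn I) = 1 := by
    rcases Nat.even_or_odd p with h | h
    · simp [iterate_parity_even h]
    · simp [iterate_parity_odd h, parity_one]
  rw [h2, mul_one, mul_one, one_mul] at h1
  simpa using h1

theorem mul_of_hasParity (h : IsSuperDer p D) {f : SuperFn I} (hf : HasParity q f)
    (g : SuperFn I) : D (f * g) = D f * g + (-1) ^ (q * p) * (f * D g) := by
  rw [h.mul, hf.iterate_parity, mul_assoc]

theorem mul_of_even (h : IsSuperDer p D) {f : SuperFn I} (hf : HasParity 0 f)
    (g : SuperFn I) : D (f * g) = D f * g + f * D g := by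
  simpa using h.mul_of_hasParity hf g

theorem hasParity (h : IsSuperDer p D) {f : SuperFn I} (hf : HasParity q f) :
    HasParity (p + q) (D f) := by
  have h1 := h.parity f
  rw [hasParity_iff.1 hf, h.neg_one_pow_mul] at h1
  rw [hasParity_iff]
  rw [pow_add, mul_assoc, h1, neg_one_pow_mul_self]

theorem pow_of_even (h : IsSuperDer p D) {f : SuperFn I} (hf : HasParity 0 f) (k : ℕ) :
    D (f ^ (k + 1)) = (k + 1 : ℕ) • (D f * f ^ k) := by
  induction k with
  | zero => simp
  | succ k ih =>
    rw [pow_succ' f (k + 1), h.mul_of_even hf, ih, add_smul (k + 1), one_smul, add_comm,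
      mul_smul_comm, ← mul_assoc f, hf.comm, mul_assoc, ← pow_succ']

end IsSuperDer

/-! ### The coordinate derivations -/

theorem dOdd_isSuperDer (o : OddVar I) : IsSuperDer 1 (dOdd o) where
  add f g := GrassmannPowerSeries.dOdd_add o f g
  mul f g := GrassmannPowerSeries.dOdd_mul o f g
  parity f := by
    rw [pow_one, neg_one_mul]
    exact GrassmannPowerSeries.dOdd_par o f

theorem dOdd_dOdd (o p : OddVar I) (f : SuperFn I) : dOdd o (dOdd p f) = -dOdd p (dOdd o f) :=
  GrassmannPowerSeries.dOdd_dOdd o p f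

theorem dEven_dEven (i j : ℕ) (f : SuperFn I) : dEven i (dEven j f) = dEven j (dEven i f) :=
  GrassmannPowerSeries.dEven_dEven i j f

theorem dEven_dOdd (i : ℕ) (o : OddVar I) (f : SuperFn I) :
    dEven i (dOdd o f) = dOdd o (dEven i f) := GrassmannPowerSeries.dEven_dOdd i o f

theorem dEven_isSuperDer (i : ℕ) : IsSuperDer 0 (dEven (I := I) i) where
  add f g := GrassmannPowerSeries.dEven_add i f g
  mul f g := GrassmannPowerSeries.dEven_mul i f g
  parity f := by
    rw [pow_zero, one_mul]
    exact GrassmannPowerSeries.dEven_par i f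

theorem dx_isSuperDer : IsSuperDer 0 (dx (I := I)) := dEven_isSuperDer 0

theorem dphi_isSuperDer : IsSuperDer 1 (dphi (I := I)) := dOdd_isSuperDer phiVar

/-- This lets ∂_n carry the parity n itself instead of 0 or 1. -/
theorem IsSuperDer.congr {p q : ℕ} {D : SuperFn I → SuperFn I} (h : IsSuperDer p D)
    (hpq : p % 2 = q % 2) : IsSuperDer q D := by
  have h1 : (-1 : SuperFn I) ^ p = (-1) ^ q := by
    rw [neg_one_pow_eq_pow_mod_two p, hpq, ← neg_one_pow_eq_pow_mod_two]
  have h2 : ∀ f : SuperFn I, SuperKP.parity^[p] f = SuperKP.parity^[q] f := by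
    intro f
    rcases Nat.even_or_odd p with h' | h'
    · rw [iterate_parity_even h', iterate_parity_even (by grind)]
    · rw [iterate_parity_odd h', iterate_parity_odd (by grind)]
  exact ⟨h.add, fun f g => by rw [h.mul, h2], fun f => by rw [h.parity, h1]⟩

theorem dt_of_even {n : ℕ} (h : Even n) : dt (I := I) n = dEven (n / 2) :=
  funext fun _ => if_pos h

theorem dt_of_odd {n : ℕ} (h : Odd n) : dt (I := I) n = dOdd (oddTimeVar (n / 2)) :=
  funext fun _ => if_neg (Nat.not_even_iff_odd.2 h)

theorem dt_isSuperDer (n : ℕ) : IsSuperDer n (dt (I := I) n) := by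
  rcases Nat.even_or_odd n with h | h
  · rw [dt_of_even h]
    exact (dEven_isSuperDer _).congr (by grind)
  · rw [dt_of_odd h]
    exact (dOdd_isSuperDer _).congr (by grind)

theorem dt_dt (n m : ℕ) (f : SuperFn I) : dt n (dt m f) = (-1) ^ (n * m) * dt m (dt n f) := by
  rcases Nat.even_or_odd n with h | h
  · rw [(h.mul_right m).neg_one_pow, one_mul, dt_of_even h]
    rcases Nat.even_or_odd m with h' | h'
    · rw [dt_of_even h', dEven_dEven]
    · rw [dt_of_odd h', dEven_dOdd]
  · rw [dt_of_odd h]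
    rcases Nat.even_or_odd m with h' | h'
    · rw [dt_of_even h', dEven_dOdd, (h'.mul_left n).neg_one_pow, one_mul]
    · rw [dt_of_odd h', dOdd_dOdd, (h.mul h').neg_one_pow, neg_one_mul]

theorem dt_dx (n : ℕ) (f : SuperFn I) : dt n (dx f) = dx (dt n f) := by
  rcases Nat.even_or_odd n with h | h
  · rw [dt_of_even h]; exact dEven_dEven _ _ _
  · rw [dt_of_odd h]; exact (dEven_dOdd _ _ _).symm

theorem dt_dphi (n : ℕ) (f : SuperFn I) : dt n (dphi f) = (-1) ^ n * dphi (dt n f) := by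
  rcases Nat.even_or_odd n with h | h
  · rw [dt_of_even h, h.neg_one_pow, one_mul]; exact dEven_dOdd _ _ _
  · rw [dt_of_odd h, h.neg_one_pow, neg_one_mul]; exact dOdd_dOdd _ _ _

theorem dphi_dx (f : SuperFn I) : dphi (dx f) = dx (dphi f) := (dEven_dOdd _ _ _).symm

theorem dphi_dphi (f : SuperFn I) : dphi (dphi f) = 0 :=
  GrassmannPowerSeries.eq_zero_of_eq_neg laurent_add_self (dOdd_dOdd phiVar phiVar f)

end
end SuperKP

/-! ### Laurent coefficients -/

namespace GrassmannPowerSeries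

open GrassmannSeries

variable {O k : Type*} [LinearOrder O] [Field k]

theorem coeff_sum_apply {ι : Type*} (s : Finset ι) (f : ι → LaurentSeries k) (i : ℤ) :
    (∑ j ∈ s, f j).coeff i = ∑ j ∈ s, (f j).coeff i := by
  induction s using Finset.cons_induction with
  | empty => simp
  | cons a s ha ih => rw [Finset.sum_cons, Finset.sum_cons, HahnSeries.coeff_add, ih]

theorem coeff_neg_one_pow_mul (j : ℕ) (a : LaurentSeries k) (i : ℤ) :
    ((-1) ^ j * a).coeff i = (-1) ^ j * a.coeff i := by
  rcases Nat.even_or_odd j with h | h <;> simp [h.neg_one_pow]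

theorem coeff_mul_apply (f g : Ser O (LaurentSeries k)) (n : ℕ →₀ ℕ) (S : Finset O) (i : ℤ) :
    ((f * g) n S).coeff i = ∑ p ∈ Finset.HasAntidiagonal.antidiagonal n, ∑ T ∈ S.powerset,
      (-1) ^ inversions T (S \ T) * (f p.1 T * g p.2 (S \ T)).coeff i := by
  rw [fn_mul, GrassmannSeries.sum_apply, coeff_sum_apply]
  refine Finset.sum_congr rfl fun p _ => ?_
  rw [mul_apply, coeff_sum_apply]
  exact Finset.sum_congr rfl fun T _ => coeff_neg_one_pow_mul _ _ _

theorem coeff_mul_eq_zero {x y : LaurentSeries k} {a b c : ℤ} (hx : ∀ i < a, x.coeff i = 0)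
    (hy : ∀ i < b, y.coeff i = 0) (hc : c < a + b) : (x * y).coeff c = 0 := by
  rw [HahnSeries.coeff_mul]
  refine Finset.sum_eq_zero fun p hp => ?_
  have := (Finset.mem_antidiagonal.1 hp).2.2
  rcases lt_or_ge p.1 a with h | h
  · rw [hx _ h, zero_mul]
  · rw [hy _ (by omega), mul_zero]

theorem coeff_const_mul {x : LaurentSeries k} (hx : ∀ i, i ≠ 0 → x.coeff i = 0)
    (y : LaurentSeries k) (i : ℤ) : (x * y).coeff i = x.coeff 0 * y.coeff i := by
  have h : x = HahnSeries.single 0 (x.coeff 0) := by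
    ext j
    by_cases hj : j = 0
    · simp [hj]
    · rw [hx j hj, HahnSeries.coeff_single_of_ne hj]
  rw [h, HahnSeries.coeff_single_mul]
  simp

theorem coeff_mul_const {x : LaurentSeries k} (hx : ∀ i, i ≠ 0 → x.coeff i = 0)
    (y : LaurentSeries k) (i : ℤ) : (y * x).coeff i = y.coeff i * x.coeff 0 := by
  rw [mul_comm, coeff_const_mul hx, mul_comm]

theorem exists_coeff_eq_zero (x : LaurentSeries k) : ∃ a : ℤ, ∀ i < a, x.coeff i = 0 :=
  ⟨x.order, fun _ hi => HahnSeries.coeff_eq_zero_of_lt_order hi⟩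

theorem coeff_single_C_mul (j : ℤ) (f : Ser O (LaurentSeries k)) (n : ℕ →₀ ℕ) (S : Finset O)
    (i : ℤ) : (((MvPowerSeries.C (GrassmannSeries.const (HahnSeries.single j (1 : k))) :
      Ser O (LaurentSeries k)) * f) n S).coeff i = (f n S).coeff (i - j) := by
  rw [C_mul_apply, GrassmannSeries.const_mul, HahnSeries.coeff_single_mul, one_mul]

theorem dOdd_C (o : O) {K : Type*} [CommRing K] (a : GrassmannSeries O K) :
    dOdd o (MvPowerSeries.C a : Ser O K) = MvPowerSeries.C (GrassmannSeries.deriv o a) := by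
  funext n
  change GrassmannSeries.deriv o (MvPowerSeries.coeff n (MvPowerSeries.C a)) =
    MvPowerSeries.coeff n (MvPowerSeries.C (GrassmannSeries.deriv o a))
  rw [MvPowerSeries.coeff_C, MvPowerSeries.coeff_C]
  split_ifs
  · rfl
  · exact map_zero (AddMonoidHom.mk' (GrassmannSeries.deriv o) (deriv_add o))

theorem dEven_C (j : ℕ) {K : Type*} [CommRing K] (a : GrassmannSeries O K) :
    dEven j (MvPowerSeries.C a : Ser O K) = 0 := by
  funext n
  change (n j + 1) • (MvPowerSeries.coeff (n + Finsupp.single j 1) (MvPowerSeries.C a)) = 0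
  rw [MvPowerSeries.coeff_C, if_neg, smul_zero]
  intro h
  have := DFunLike.congr_fun h j
  simp at this

theorem deriv_const (o : O) {K : Type*} [CommRing K] (c : K) :
    GrassmannSeries.deriv o (GrassmannSeries.const c : GrassmannSeries O K) = 0 := by
  ext S
  rw [deriv_apply, GrassmannSeries.zero_apply]
  split_ifs
  · rfl
  · simp [GrassmannSeries.const]

theorem dOdd_C_const (o : O) {K : Type*} [CommRing K] (c : K) :
    dOdd o (MvPowerSeries.C (GrassmannSeries.const c) : Ser O K) = 0 := by
  rw [dOdd_C, deriv_const, map_zero]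

theorem dOdd_C_gen (o p : O) {K : Type*} [CommRing K] :
    dOdd o (MvPowerSeries.C (GrassmannSeries.gen p) : Ser O K) = if o = p then 1 else 0 := by
  rw [dOdd_C, deriv_gen]
  split_ifs
  · exact map_one _
  · exact map_zero _

theorem par_C {K : Type*} [CommRing K] (a : GrassmannSeries O K) :
    par (MvPowerSeries.C a : Ser O K) = MvPowerSeries.C (invol a) := by
  funext n
  change invol (MvPowerSeries.coeff n (MvPowerSeries.C a)) =
    MvPowerSeries.coeff n (MvPowerSeries.C (invol a))
  rw [MvPowerSeries.coeff_C, MvPowerSeries.coeff_C]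
  split_ifs
  · rfl
  · exact map_zero (AddMonoidHom.mk' (invol (O := O) (K := K)) invol_add)

theorem par_C_const {K : Type*} [CommRing K] (c : K) :
    par (MvPowerSeries.C (GrassmannSeries.const c) : Ser O K) =
      MvPowerSeries.C (GrassmannSeries.const c) := by
  rw [par_C]
  congr 1
  ext S
  by_cases h : S = ∅ <;> simp [GrassmannSeries.const, h]

theorem par_C_gen {K : Type*} [CommRing K] (o : O) :
    par (MvPowerSeries.C (GrassmannSeries.gen o) : Ser O K) =
      -MvPowerSeries.C (GrassmannSeries.gen o) := by
  rw [par_C, ← map_neg]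
  congr 1
  ext S
  change _ = -(GrassmannSeries.gen o S)
  by_cases h : S = {o} <;> simp [GrassmannSeries.gen, h]

theorem coeff_C_gen (o : O) (n : ℕ →₀ ℕ) (S : Finset O) (i : ℤ) (hi : i ≠ 0) :
    ((MvPowerSeries.C (GrassmannSeries.gen o) : Ser O (LaurentSeries k)) n S).coeff i = 0 := by
  have h : (MvPowerSeries.C (GrassmannSeries.gen o) : Ser O (LaurentSeries k)) n =
      if n = 0 then GrassmannSeries.gen o else 0 := MvPowerSeries.coeff_C n _
  rw [h]
  split_ifs
  · unfold GrassmannSeries.gen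
    split_ifs
    · exact HahnSeries.coeff_single_of_ne hi
    · rfl
  · rfl

theorem coeff_one (n : ℕ →₀ ℕ) (S : Finset O) (i : ℤ) (hi : i ≠ 0) :
    ((1 : Ser O (LaurentSeries k)) n S).coeff i = 0 := by
  have h : (1 : Ser O (LaurentSeries k)) n = if n = 0 then 1 else 0 := MvPowerSeries.coeff_one n
  rw [h]
  split_ifs
  · rw [GrassmannSeries.one_apply]
    split_ifs
    · exact HahnSeries.coeff_single_of_ne hi
    · rfl
  · rfl

end GrassmannPowerSeries

namespace SuperKP

noncomputable section

open scoped Sealed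
open GrassmannSeries (inversions)

variable {I : Type*} [LinearOrder I]

theorem coef_def (f : SuperFn I) (n : ℕ →₀ ℕ) (S : Finset (OddVar I)) (m : ℤ) :
    coef f n S m = HahnSeries.coeff (f n S) (-m) := rfl

theorem coef_add (f g : SuperFn I) (n : ℕ →₀ ℕ) (S : Finset (OddVar I)) (m : ℤ) :
    coef (f + g) n S m = coef f n S m + coef g n S m := rfl

theorem coef_zero (n : ℕ →₀ ℕ) (S : Finset (OddVar I)) (m : ℤ) :
    coef (0 : SuperFn I) n S m = 0 := rfl

theorem coef_neg (f : SuperFn I) (n : ℕ →₀ ℕ) (S : Finset (OddVar I)) (m : ℤ) :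
    coef (-f) n S m = -coef f n S m := rfl

theorem coef_sum {ι : Type*} (s : Finset ι) (f : ι → SuperFn I) (n : ℕ →₀ ℕ)
    (S : Finset (OddVar I)) (m : ℤ) :
    coef (∑ i ∈ s, f i) n S m = ∑ i ∈ s, coef (f i) n S m :=
  map_sum (AddMonoidHom.mk' (fun f : SuperFn I => coef f n S m) fun f g => coef_add f g n S m) f s

theorem coef_ext {f g : SuperFn I} (h : ∀ n S m, coef f n S m = coef g n S m) : f = g := by
  refine fn_ext fun n S => ?_
  ext i
  simpa [coef_def] using h n S (-i)

/-- `f` does not depend on `z`. -/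
def ZConst (f : SuperFn I) : Prop := ∀ n S m, m ≠ 0 → coef f n S m = 0

/-- `f` has degree at most `a` in `z`. -/
def DegLE (a : ℤ) (f : SuperFn I) : Prop := ∀ n S m, a < m → coef f n S m = 0

theorem coef_zconst_mul {b : SuperFn I} (hb : ZConst b) (f : SuperFn I) (n : ℕ →₀ ℕ)
    (S : Finset (OddVar I)) (m : ℤ) :
    coef (b * f) n S m = ∑ p ∈ Finset.HasAntidiagonal.antidiagonal n, ∑ T ∈ S.powerset,
      (-1) ^ inversions T (S \ T) * (coef b p.1 T 0 * coef f p.2 (S \ T) m) := by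
  refine (GrassmannPowerSeries.coeff_mul_apply b f n S (-m)).trans ?_
  refine Finset.sum_congr rfl fun p _ => Finset.sum_congr rfl fun T _ => ?_
  congr 1
  refine GrassmannPowerSeries.coeff_const_mul (x := b p.1 T) (fun i hi => ?_) (f p.2 (S \ T)) (-m)
  have := hb p.1 T (-i) (by simpa using hi)
  simpa [coef_def] using this

theorem coef_mul_zconst {b : SuperFn I} (hb : ZConst b) (f : SuperFn I) (n : ℕ →₀ ℕ)
    (S : Finset (OddVar I)) (m : ℤ) :
    coef (f * b) n S m = ∑ p ∈ Finset.HasAntidiagonal.antidiagonal n, ∑ T ∈ S.powerset,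
      (-1) ^ inversions T (S \ T) * (coef f p.1 T m * coef b p.2 (S \ T) 0) := by
  refine (GrassmannPowerSeries.coeff_mul_apply f b n S (-m)).trans ?_
  refine Finset.sum_congr rfl fun p _ => Finset.sum_congr rfl fun T _ => ?_
  congr 1
  refine GrassmannPowerSeries.coeff_mul_const (x := b p.2 (S \ T)) (fun i hi => ?_) (f p.1 T) (-m)
  have := hb p.2 (S \ T) (-i) (by simpa using hi)
  simpa [coef_def] using this

/-- The degree bounds are asked only at the coefficients that enter the coefficient (n, S) of the
product. Functions such as the vacuum wave have no global bound on the powers of z, only one for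
each monomial in the other variables. -/
theorem coef_mul_eq_zero {f g : SuperFn I} {n : ℕ →₀ ℕ} {S : Finset (OddVar I)} {m a b : ℤ}
    (hf : ∀ p ∈ (Finset.HasAntidiagonal.antidiagonal n : Finset ((ℕ →₀ ℕ) × (ℕ →₀ ℕ))),
      ∀ T ∈ S.powerset, ∀ k, a < k → coef f p.1 T k = 0)
    (hg : ∀ p ∈ (Finset.HasAntidiagonal.antidiagonal n : Finset ((ℕ →₀ ℕ) × (ℕ →₀ ℕ))),
      ∀ T ∈ S.powerset, ∀ k, b < k → coef g p.2 (S \ T) k = 0) (hm : a + b < m) :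
    coef (f * g) n S m = 0 := by
  refine (GrassmannPowerSeries.coeff_mul_apply f g n S (-m)).trans ?_
  refine Finset.sum_eq_zero fun p hp => Finset.sum_eq_zero fun T hT => ?_
  have h := GrassmannPowerSeries.coeff_mul_eq_zero (x := f p.1 T) (y := g p.2 (S \ T)) (a := -a)
    (b := -b) (c := -m) (fun i hi => ?_) (fun i hi => ?_) (by omega)
  · exact mul_eq_zero_of_right _ h
  · simpa [coef_def] using hf p hp T hT (-i) (by omega)
  · simpa [coef_def] using hg p hp T hT (-i) (by omega)

theorem DegLE.mul {a b : ℤ} {f g : SuperFn I} (hf : DegLE a f) (hg : DegLE b g) :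
    DegLE (a + b) (f * g) := fun _ _ _ hm =>
  coef_mul_eq_zero (fun _ _ _ _ _ hk => hf _ _ _ hk) (fun _ _ _ _ _ hk => hg _ _ _ hk) hm

theorem exists_coef_eq_zero (f : SuperFn I) (n : ℕ →₀ ℕ) (S : Finset (OddVar I)) :
    ∃ d : ℤ, ∀ k, d < k → coef f n S k = 0 := by
  obtain ⟨a, ha⟩ := GrassmannPowerSeries.exists_coeff_eq_zero (f n S)
  exact ⟨-a, fun k hk => ha (-k) (by omega)⟩

/-- Every coefficient of a product is insensitive to the part of very negative degree of the left
factor. -/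
theorem exists_degLE_coef_mul_eq_zero (F : SuperFn I) (n : ℕ →₀ ℕ) (S : Finset (OddVar I))
    (m : ℤ) : ∃ K : ℤ, ∀ y, DegLE K y → coef (y * F) n S m = 0 := by
  choose d hd using exists_coef_eq_zero F
  obtain ⟨D, hD⟩ := Finset.exists_le
    ((Finset.HasAntidiagonal.antidiagonal n ×ˢ S.powerset).image fun q => d q.1.2 (S \ q.2))
  refine ⟨m - D - 1, fun y hy => coef_mul_eq_zero (a := m - D - 1) (b := D)
    (fun _ _ _ _ _ hk => hy _ _ _ hk) (fun p hp T hT k hk => hd _ _ _ ?_) (by omega)⟩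
  refine lt_of_le_of_lt (hD _ ?_) hk
  exact Finset.mem_image.2 ⟨(p, T), Finset.mem_product.2 ⟨hp, hT⟩, rfl⟩

theorem coef_zpow_mul (k : ℤ) (f : SuperFn I) (n : ℕ →₀ ℕ) (S : Finset (OddVar I)) (m : ℤ) :
    coef (zpow k * f) n S m = coef f n S (m - k) := by
  refine (GrassmannPowerSeries.coeff_single_C_mul (-k) f n S (-m)).trans ?_
  rw [coef_def]
  congr 1
  ring

/-! ### Coefficients of powers of `z` as functions of the other variables -/

theorem coef_zCoef (k : ℤ) (f : SuperFn I) (n : ℕ →₀ ℕ) (S : Finset (OddVar I)) (m : ℤ) :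
    coef (zCoef k f) n S m = if m = 0 then coef f n S k else 0 := by
  rw [coef_def]
  change HahnSeries.coeff (HahnSeries.single 0 (coef f n S k)) (-m) = _
  by_cases h : m = 0
  · simp [h]
  · rw [if_neg h, HahnSeries.coeff_single_of_ne (by simpa using h)]

theorem zconst_zCoef (k : ℤ) (f : SuperFn I) : ZConst (zCoef k f) := fun n S m hm => by
  rw [coef_zCoef, if_neg hm]

theorem zCoef_add (k : ℤ) (f g : SuperFn I) : zCoef k (f + g) = zCoef k f + zCoef k g := by
  refine coef_ext fun n S m => ?_
  rw [coef_add, coef_zCoef, coef_zCoef, coef_zCoef, coef_add]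
  split_ifs <;> simp

theorem zCoef_neg (k : ℤ) (f : SuperFn I) : zCoef k (-f) = -zCoef k f :=
  additive_neg (zCoef_add k) f
theorem zCoef_zero (k : ℤ) : zCoef k (0 : SuperFn I) = 0 := additive_zero (zCoef_add k)
theorem zCoef_sub (k : ℤ) (f g : SuperFn I) : zCoef k (f - g) = zCoef k f - zCoef k g :=
  additive_sub (zCoef_add k) f g
theorem zCoef_sum (k : ℤ) {ι : Type*} (s : Finset ι) (f : ι → SuperFn I) :
    zCoef k (∑ i ∈ s, f i) = ∑ i ∈ s, zCoef k (f i) := additive_sum (zCoef_add k) s f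

theorem zCoef_ext {f g : SuperFn I} (h : ∀ m, zCoef m f = zCoef m g) : f = g := by
  refine coef_ext fun n S m => ?_
  have := congrArg (fun F : SuperFn I => coef F n S 0) (h m)
  simpa [coef_zCoef] using this

theorem zCoef_mul_left {b : SuperFn I} (hb : ZConst b) (k : ℤ) (f : SuperFn I) :
    zCoef k (b * f) = b * zCoef k f := by
  refine coef_ext fun n S m => ?_
  rw [coef_zCoef, coef_zconst_mul hb, coef_zconst_mul hb]
  simp only [coef_zCoef]
  split_ifs <;> simp

theorem zCoef_mul_right {b : SuperFn I} (hb : ZConst b) (k : ℤ) (f : SuperFn I) :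
    zCoef k (f * b) = zCoef k f * b := by
  refine coef_ext fun n S m => ?_
  rw [coef_zCoef, coef_mul_zconst hb, coef_mul_zconst hb]
  simp only [coef_zCoef]
  split_ifs <;> simp

theorem zCoef_zpow_mul (k j : ℤ) (f : SuperFn I) : zCoef k (zpow j * f) = zCoef (k - j) f := by
  refine coef_ext fun n S m => ?_
  rw [coef_zCoef, coef_zCoef, coef_zpow_mul]

theorem zCoef_zero_of_zconst {b : SuperFn I} (hb : ZConst b) : zCoef 0 b = b := by
  refine coef_ext fun n S m => ?_
  rw [coef_zCoef]
  split_ifs with h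
  · rw [h]
  · rw [hb _ _ _ h]

theorem zCoef_of_ne {b : SuperFn I} (hb : ZConst b) {k : ℤ} (hk : k ≠ 0) : zCoef k b = 0 := by
  refine coef_ext fun n S m => ?_
  rw [coef_zCoef, hb _ _ _ hk]
  split_ifs <;> rfl

theorem zCoef_parity (k : ℤ) (f : SuperFn I) : zCoef k (parity f) = parity (zCoef k f) := by
  have h : ∀ (g : SuperFn I) n S m, coef (parity g) n S m = (-1) ^ S.card * coef g n S m :=
    fun g n S m => GrassmannPowerSeries.coeff_neg_one_pow_mul _ (g n S) (-m)
  refine coef_ext fun n S m => ?_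
  rw [h, coef_zCoef, coef_zCoef, h]
  split_ifs <;> simp

theorem zCoef_dOdd (k : ℤ) (o : OddVar I) (f : SuperFn I) :
    zCoef k (dOdd o f) = dOdd o (zCoef k f) := by
  have h : ∀ (g : SuperFn I) n S m, coef (dOdd o g) n S m =
      if o ∈ S then 0 else (-1) ^ inversions {o} S * coef g n (insert o S) m := by
    intro g n S m
    change HahnSeries.coeff (if o ∈ S then 0 else (-1) ^ inversions {o} S * g n (insert o S)) (-m)
      = _
    split_ifs
    · rfl
    · exact GrassmannPowerSeries.coeff_neg_one_pow_mul _ (g n (insert o S)) (-m)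
  refine coef_ext fun n S m => ?_
  rw [h, coef_zCoef, coef_zCoef, h]
  split_ifs <;> simp

theorem coef_dEven (i : ℕ) (f : SuperFn I) (n : ℕ →₀ ℕ) (S : Finset (OddVar I)) (m : ℤ) :
    coef (dEven i f) n S m = (n i + 1) * coef f (n + Finsupp.single i 1) S m := by
  change HahnSeries.coeff ((n i + 1) • f (n + Finsupp.single i 1) S) (-m) = _
  rw [HahnSeries.coeff_smul, nsmul_eq_mul]
  push_cast
  rfl

theorem zCoef_dEven (k : ℤ) (i : ℕ) (f : SuperFn I) :
    zCoef k (dEven i f) = dEven i (zCoef k f) := by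
  refine coef_ext fun n S m => ?_
  rw [coef_dEven, coef_zCoef, coef_zCoef, coef_dEven]
  split_ifs <;> simp

theorem zCoef_dx (k : ℤ) (f : SuperFn I) : zCoef k (dx f) = dx (zCoef k f) := zCoef_dEven k 0 f
theorem zCoef_dphi (k : ℤ) (f : SuperFn I) : zCoef k (dphi f) = dphi (zCoef k f) :=
  zCoef_dOdd k _ f
theorem zCoef_dt (k : ℤ) (n : ℕ) (f : SuperFn I) : zCoef k (dt n f) = dt n (zCoef k f) := by
  rcases Nat.even_or_odd n with h | h
  · rw [dt_of_even h, zCoef_dEven]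
  · rw [dt_of_odd h, zCoef_dOdd]

theorem degLE_iff {a : ℤ} {f : SuperFn I} : DegLE a f ↔ ∀ m, a < m → zCoef m f = 0 := by
  refine ⟨fun h m hm => coef_ext fun n S k => ?_, fun h n S m hm => ?_⟩
  · rw [coef_zCoef, h _ _ _ hm, coef_zero, ite_self]
  · have := congrArg (fun F : SuperFn I => coef F n S 0) (h m hm)
    simpa [coef_zCoef, coef_zero] using this

theorem isNeg_iff {f : SuperFn I} : IsNeg f ↔ DegLE (-1) f :=
  ⟨fun h n S m hm => h n S m (by omega), fun h n S m hm => h n S m (by omega)⟩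

theorem isNeg_iff_zCoef {f : SuperFn I} : IsNeg f ↔ ∀ m, 0 ≤ m → zCoef m f = 0 := by
  rw [isNeg_iff, degLE_iff]
  exact ⟨fun h m hm => h m (by omega), fun h m hm => h m (by omega)⟩

theorem zconst_iff {f : SuperFn I} : ZConst f ↔ ∀ m, m ≠ 0 → zCoef m f = 0 := by
  refine ⟨fun h m hm => zCoef_of_ne h hm, fun h n S m hm => ?_⟩
  have := congrArg (fun F : SuperFn I => coef F n S 0) (h m hm)
  simpa [coef_zCoef, coef_zero] using this

end
end SuperKP

namespace SuperKP

noncomputable section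

open scoped Sealed
open GrassmannSeries (inversions)

variable {I : Type*} [LinearOrder I]

/-! ### Degree in `z` -/

theorem zconst_zero : ZConst (0 : SuperFn I) := fun _ _ _ _ => rfl

theorem zconst_one : ZConst (1 : SuperFn I) := fun n S m hm =>
  GrassmannPowerSeries.coeff_one n S (-m) (by simpa using hm)

theorem zconst_oddVar (o : OddVar I) : ZConst (oddVar o) := fun n S m hm =>
  GrassmannPowerSeries.coeff_C_gen o n S (-m) (by simpa using hm)

namespace ZConst

variable {f g : SuperFn I}

theorem add (hf : ZConst f) (hg : ZConst g) : ZConst (f + g) := fun n S m hm => by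
  rw [coef_add, hf n S m hm, hg n S m hm, add_zero]

theorem neg (hf : ZConst f) : ZConst (-f) := fun n S m hm => by
  rw [coef_neg, hf n S m hm, neg_zero]

theorem sub (hf : ZConst f) (hg : ZConst g) : ZConst (f - g) := by
  rw [sub_eq_add_neg]; exact hf.add hg.neg

theorem mul (hf : ZConst f) (hg : ZConst g) : ZConst (f * g) :=
  zconst_iff.2 fun m hm => by rw [zCoef_mul_left hf, zCoef_of_ne hg hm, mul_zero]

theorem parity (hf : ZConst f) : ZConst (SuperKP.parity f) :=
  zconst_iff.2 fun m hm => by rw [zCoef_parity, zCoef_of_ne hf hm, parity_zero]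

theorem dOdd (hf : ZConst f) (o : OddVar I) : ZConst (SuperKP.dOdd o f) :=
  zconst_iff.2 fun m hm => by rw [zCoef_dOdd, zCoef_of_ne hf hm, (dOdd_isSuperDer o).zero]

theorem dEven (hf : ZConst f) (i : ℕ) : ZConst (SuperKP.dEven i f) :=
  zconst_iff.2 fun m hm => by rw [zCoef_dEven, zCoef_of_ne hf hm, (dEven_isSuperDer i).zero]

theorem degLE (hf : ZConst f) : DegLE 0 f := fun n S m hm => hf n S m hm.ne'

end ZConst

namespace DegLE

variable {a b : ℤ} {f g : SuperFn I}

theorem mono (hf : DegLE a f) (h : a ≤ b) : DegLE b f := fun n S m hm =>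
  hf n S m (lt_of_le_of_lt h hm)

theorem add (hf : DegLE a f) (hg : DegLE a g) : DegLE a (f + g) := fun n S m hm => by
  rw [coef_add, hf n S m hm, hg n S m hm, add_zero]

theorem neg (hf : DegLE a f) : DegLE a (-f) := fun n S m hm => by
  rw [coef_neg, hf n S m hm, neg_zero]

theorem sub (hf : DegLE a f) (hg : DegLE a g) : DegLE a (f - g) := by
  rw [sub_eq_add_neg]; exact hf.add hg.neg

theorem zero : DegLE a (0 : SuperFn I) := fun _ _ _ _ => rfl

theorem sum {ι : Type*} {s : Finset ι} {f : ι → SuperFn I} (h : ∀ i ∈ s, DegLE a (f i)) :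
    DegLE a (∑ i ∈ s, f i) := fun n S m hm => by
  rw [coef_sum]
  exact Finset.sum_eq_zero fun i hi => h i hi n S m hm

theorem zCoef_eq_zero (hf : DegLE a f) {m : ℤ} (hm : a < m) : zCoef m f = 0 := degLE_iff.1 hf m hm

theorem parity (hf : DegLE a f) : DegLE a (SuperKP.parity f) :=
  degLE_iff.2 fun m hm => by rw [zCoef_parity, hf.zCoef_eq_zero hm, parity_zero]

theorem dOdd (hf : DegLE a f) (o : OddVar I) : DegLE a (SuperKP.dOdd o f) :=
  degLE_iff.2 fun m hm => by rw [zCoef_dOdd, hf.zCoef_eq_zero hm, (dOdd_isSuperDer o).zero]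

theorem dEven (hf : DegLE a f) (i : ℕ) : DegLE a (SuperKP.dEven i f) :=
  degLE_iff.2 fun m hm => by rw [zCoef_dEven, hf.zCoef_eq_zero hm, (dEven_isSuperDer i).zero]

theorem dt (hf : DegLE a f) (n : ℕ) : DegLE a (SuperKP.dt n f) := by
  rcases Nat.even_or_odd n with h | h
  · rw [dt_of_even h]; exact hf.dEven _
  · rw [dt_of_odd h]; exact hf.dOdd _

theorem dx (hf : DegLE a f) : DegLE a (SuperKP.dx f) := hf.dEven 0

end DegLE

theorem DegLE.zconst_mul {a : ℤ} {b f : SuperFn I} (hf : DegLE a f) (hb : ZConst b) :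
    DegLE a (b * f) := by simpa using hb.degLE.mul hf

theorem DegLE.mul_zconst {a : ℤ} {b f : SuperFn I} (hf : DegLE a f) (hb : ZConst b) :
    DegLE a (f * b) := by simpa using hf.mul hb.degLE

/-! ### The variables -/

theorem dOdd_zpow (o : OddVar I) (k : ℤ) : dOdd o (zpow k : SuperFn I) = 0 :=
  GrassmannPowerSeries.dOdd_C_const o _

theorem dEven_zpow (i : ℕ) (k : ℤ) : dEven i (zpow k : SuperFn I) = 0 :=
  GrassmannPowerSeries.dEven_C i _

theorem zpow_even (k : ℤ) : HasParity 0 (zpow k : SuperFn I) :=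
  hasParity_zero_iff.2 (GrassmannPowerSeries.par_C_const _)

theorem zpow_zero : (zpow 0 : SuperFn I) = 1 := by
  refine zCoef_ext fun m => ?_
  rw [← mul_one (zpow 0), zCoef_zpow_mul, sub_zero]

theorem zpow_mul_zpow (k l : ℤ) : (zpow k : SuperFn I) * zpow l = zpow (k + l) := by
  refine zCoef_ext fun m => ?_
  rw [← mul_one (zpow (k + l)), zCoef_zpow_mul, zCoef_zpow_mul, ← mul_one (zpow l),
    zCoef_zpow_mul, sub_sub]

theorem zCoef_mul_zpow (k j : ℤ) (f : SuperFn I) : zCoef k (f * zpow j) = zCoef (k - j) f := by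
  rw [← (zpow_even j).comm, zCoef_zpow_mul]

theorem zCoef_zpow (k j : ℤ) : zCoef k (zpow j : SuperFn I) = if k = j then 1 else 0 := by
  rw [← mul_one (zpow j), zCoef_zpow_mul]
  split_ifs with h
  · rw [h, sub_self, zCoef_zero_of_zconst zconst_one]
  · exact zCoef_of_ne zconst_one (by omega)

theorem degLE_zpow (k : ℤ) : DegLE k (zpow k : SuperFn I) := degLE_iff.2 fun m hm => by
  rw [zCoef_zpow, if_neg hm.ne']

theorem dEven_oddVar (i : ℕ) (o : OddVar I) : dEven i (oddVar o) = 0 :=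
  GrassmannPowerSeries.dEven_C i _

theorem dOdd_oddVar_self (o : OddVar I) : dOdd o (oddVar o) = 1 :=
  (GrassmannPowerSeries.dOdd_C_gen o o).trans (if_pos rfl)

theorem dOdd_oddVar_of_ne {o p : OddVar I} (h : o ≠ p) : dOdd o (oddVar p) = 0 :=
  (GrassmannPowerSeries.dOdd_C_gen o p).trans (if_neg h)

theorem oddVar_odd (o : OddVar I) : HasParity 1 (oddVar o) :=
  hasParity_one_iff.2 (GrassmannPowerSeries.par_C_gen o)

theorem theta_ne_phi : (thetaVar : OddVar I) ≠ phiVar := by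
  intro h
  have := toLex.injective h
  simp at this

theorem oddTimeVar_ne_theta (j : ℕ) : (oddTimeVar j : OddVar I) ≠ thetaVar := by
  intro h
  have := toLex.injective h
  simp at this

theorem oddTimeVar_ne_phi (j : ℕ) : (oddTimeVar j : OddVar I) ≠ phiVar := by
  intro h
  have := Sum.inr_injective (toLex.injective h)
  omega

theorem oddTimeVar_injective : Function.Injective (oddTimeVar : ℕ → OddVar I) := by
  intro i j h
  have := Sum.inr_injective (toLex.injective h)
  omega

theorem phi_odd : HasParity 1 (phi : SuperFn I) := oddVar_odd _
theorem theta_odd : HasParity 1 (theta : SuperFn I) := oddVar_odd _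
theorem zconst_phi : ZConst (phi : SuperFn I) := zconst_oddVar _
theorem zconst_theta : ZConst (theta : SuperFn I) := zconst_oddVar _
theorem phi_mul_phi : (phi : SuperFn I) * phi = 0 := phi_odd.sq_eq_zero
theorem theta_mul_theta : (theta : SuperFn I) * theta = 0 := theta_odd.sq_eq_zero
theorem theta_mul_phi : (theta : SuperFn I) * phi = -(phi * theta) := theta_odd.anticomm phi_odd

theorem dphi_phi : dphi (phi : SuperFn I) = 1 := dOdd_oddVar_self _
theorem dphi_theta : dphi (theta : SuperFn I) = 0 := dOdd_oddVar_of_ne theta_ne_phi.symm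
theorem dx_phi : dx (phi : SuperFn I) = 0 := dEven_oddVar _ _
theorem dx_theta : dx (theta : SuperFn I) = 0 := dEven_oddVar _ _

theorem dt_phi (n : ℕ) : dt n (phi : SuperFn I) = 0 := by
  rcases Nat.even_or_odd n with h | h
  · rw [dt_of_even h]; exact dEven_oddVar _ _
  · rw [dt_of_odd h]; exact dOdd_oddVar_of_ne (oddTimeVar_ne_phi _)

theorem dt_theta (n : ℕ) : dt n (theta : SuperFn I) = 0 := by
  rcases Nat.even_or_odd n with h | h
  · rw [dt_of_even h]; exact dEven_oddVar _ _
  · rw [dt_of_odd h]; exact dOdd_oddVar_of_ne (oddTimeVar_ne_theta _)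

theorem dx_zpow (k : ℤ) : dx (zpow k : SuperFn I) = 0 := dEven_zpow 0 k
theorem dphi_zpow (k : ℤ) : dphi (zpow k : SuperFn I) = 0 := dOdd_zpow _ k
theorem dt_zpow (n : ℕ) (k : ℤ) : dt n (zpow k : SuperFn I) = 0 := by
  rcases Nat.even_or_odd n with h | h
  · rw [dt_of_even h, dEven_zpow]
  · rw [dt_of_odd h, dOdd_zpow]

theorem IsSuperDer.const_mul {p : ℕ} {D : SuperFn I → SuperFn I} (h : IsSuperDer p D)
    {b : SuperFn I} (hb : HasParity 0 b) (h0 : D b = 0) (f : SuperFn I) : D (b * f) = b * D f := by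
  rw [h.mul_of_even hb, h0, zero_mul, zero_add]

theorem IsSuperDer.odd_const_mul {p : ℕ} {D : SuperFn I → SuperFn I} (h : IsSuperDer p D)
    {b : SuperFn I} (hb : HasParity 1 b) (h0 : D b = 0) (f : SuperFn I) :
    D (b * f) = (-1) ^ p * (b * D f) := by
  rw [h.mul_of_hasParity hb, h0, zero_mul, zero_add, one_mul]

/-! ### The derivation `δ` -/

theorem del_def (f : SuperFn I) : del f = dphi f + phi * dx f := rfl

theorem del_isSuperDer : IsSuperDer 1 (del (I := I)) where
  add f g := by
    rw [del_def, del_def, del_def, dphi_isSuperDer.add, dx_isSuperDer.add, mul_add]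
    abel
  mul f g := by
    rw [del_def, del_def, del_def, dphi_isSuperDer.mul, dx_isSuperDer.mul]
    simp only [Function.iterate_one, Function.iterate_zero, id]
    have h : phi * (f * dx g) = parity f * (phi * dx g) := by
      rw [← mul_assoc, phi_odd.odd_comm, mul_assoc]
    rw [mul_add, mul_add, add_mul, h, mul_assoc]
    abel
  parity f := by
    rw [del_def, del_def, dphi_isSuperDer.parity, dx_isSuperDer.parity, parity_add, parity_mul,
      hasParity_one_iff.1 phi_odd]
    simp only [pow_one, pow_zero, one_mul, neg_mul]
    abel

theorem del_del (f : SuperFn I) : del (del f) = dx f := by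
  rw [del_def f, del_isSuperDer.add, del_def (dphi f), dphi_dphi, zero_add,
    del_isSuperDer.mul_of_hasParity phi_odd, del_def phi, dphi_phi, dx_phi, del_def (dx f)]
  have : phi * (phi * dx (dx f)) = 0 := by rw [← mul_assoc, phi_mul_phi, zero_mul]
  rw [mul_zero, add_zero, one_mul, mul_add, this, add_zero, dphi_dx]
  simp

theorem dt_del (n : ℕ) (f : SuperFn I) : dt n (del f) = (-1) ^ n * del (dt n f) := by
  rw [del_def, del_def, (dt_isSuperDer n).add, dt_dphi,
    (dt_isSuperDer n).odd_const_mul phi_odd (dt_phi n), dt_dx, mul_add]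

theorem del_phi : del (phi : SuperFn I) = 1 := by rw [del_def, dphi_phi, dx_phi, mul_zero, add_zero]
theorem del_theta : del (theta : SuperFn I) = 0 := by
  rw [del_def, dphi_theta, dx_theta, mul_zero, add_zero]
theorem del_zpow (k : ℤ) : del (zpow k : SuperFn I) = 0 := by
  rw [del_def, dphi_zpow, dx_zpow, mul_zero, add_zero]

theorem zCoef_del (k : ℤ) (f : SuperFn I) : zCoef k (del f) = del (zCoef k f) := by
  rw [del_def, zCoef_add, zCoef_mul_left zconst_phi, zCoef_dphi, zCoef_dx, del_def]

theorem ZConst.del {f : SuperFn I} (hf : ZConst f) : ZConst (SuperKP.del f) :=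
  (hf.dOdd phiVar).add (zconst_phi.mul (hf.dEven 0))

theorem ZConst.dt {f : SuperFn I} (hf : ZConst f) (n : ℕ) : ZConst (SuperKP.dt n f) := by
  rcases Nat.even_or_odd n with h | h
  · rw [dt_of_even h]; exact hf.dEven _
  · rw [dt_of_odd h]; exact hf.dOdd _

theorem DegLE.del {a : ℤ} {f : SuperFn I} (hf : DegLE a f) : DegLE a (SuperKP.del f) :=
  (hf.dOdd phiVar).add (hf.dx.zconst_mul zconst_phi)

/-! ### Independence of an odd variable -/

/-- `f` does not depend on the odd variable `o`. -/
def OddFree (o : OddVar I) (f : SuperFn I) : Prop := dOdd o f = 0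

theorem phiFree_iff {f : SuperFn I} : PhiFree f ↔ OddFree phiVar f := Iff.rfl
theorem oddFree_oddVar {o p : OddVar I} (h : o ≠ p) : OddFree o (oddVar p) := dOdd_oddVar_of_ne h
theorem oddFree_zpow (o : OddVar I) (k : ℤ) : OddFree o (zpow k : SuperFn I) := dOdd_zpow o k
theorem oddFree_zero (o : OddVar I) : OddFree o (0 : SuperFn I) := (dOdd_isSuperDer o).zero
theorem oddFree_one (o : OddVar I) : OddFree o (1 : SuperFn I) := (dOdd_isSuperDer o).one

namespace OddFree

variable {o : OddVar I} {f g : SuperFn I}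

theorem add (hf : OddFree o f) (hg : OddFree o g) : OddFree o (f + g) := by
  unfold OddFree at *
  rw [(dOdd_isSuperDer o).add, hf, hg, add_zero]

theorem neg (hf : OddFree o f) : OddFree o (-f) := by
  unfold OddFree at *
  rw [(dOdd_isSuperDer o).neg, hf, neg_zero]

theorem sub (hf : OddFree o f) (hg : OddFree o g) : OddFree o (f - g) := by
  rw [sub_eq_add_neg]; exact hf.add hg.neg

theorem mul (hf : OddFree o f) (hg : OddFree o g) : OddFree o (f * g) := by
  unfold OddFree at *
  rw [(dOdd_isSuperDer o).mul, hf, hg, zero_mul, mul_zero, add_zero]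

theorem parity (hf : OddFree o f) : OddFree o (SuperKP.parity f) := by
  unfold OddFree at *
  rw [(dOdd_isSuperDer o).parity, hf, parity_zero, mul_zero]

theorem dOdd (hf : OddFree o f) (p : OddVar I) : OddFree o (SuperKP.dOdd p f) := by
  unfold OddFree at *
  rw [dOdd_dOdd, hf, (dOdd_isSuperDer p).zero, neg_zero]

theorem dEven (hf : OddFree o f) (i : ℕ) : OddFree o (SuperKP.dEven i f) := by
  unfold OddFree at *
  rw [← dEven_dOdd, hf, (dEven_isSuperDer i).zero]

theorem dx (hf : OddFree o f) : OddFree o (SuperKP.dx f) := hf.dEven 0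

theorem dt (hf : OddFree o f) (n : ℕ) : OddFree o (SuperKP.dt n f) := by
  rcases Nat.even_or_odd n with h | h
  · rw [dt_of_even h]; exact hf.dEven _
  · rw [dt_of_odd h]; exact hf.dOdd _

theorem zCoef (hf : OddFree o f) (k : ℤ) : OddFree o (SuperKP.zCoef k f) := by
  unfold OddFree at *
  rw [← zCoef_dOdd, hf, zCoef_zero]

end OddFree

theorem oddFree_of_zCoef {o : OddVar I} {f : SuperFn I} (h : ∀ k, OddFree o (zCoef k f)) :
    OddFree o f := zCoef_ext fun m => by rw [zCoef_dOdd, zCoef_zero]; exact h m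

theorem thetaFree_phi : OddFree thetaVar (phi : SuperFn I) := oddFree_oddVar theta_ne_phi

theorem OddFree.del {f : SuperFn I} (hf : OddFree thetaVar f) :
    OddFree thetaVar (SuperKP.del f) := (hf.dOdd phiVar).add (thetaFree_phi.mul hf.dx)

/-! ### Superfields -/

/-- A coefficient at a set containing θ is, up to sign, a coefficient of the θ-derivative. The two
resulting conditions are visibly stable under the algebraic operations. -/
theorem isField_iff {f : SuperFn I} : IsField f ↔ ZConst f ∧ OddFree thetaVar f := by
  constructor
  · intro h
    refine ⟨fun n S m hm => h n S m (Or.inl hm), fn_ext fun n S => ?_⟩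
    change (if thetaVar ∈ S then 0 else (-1) ^ inversions {thetaVar} S *
      f n (insert thetaVar S)) = 0
    split_ifs with hS
    · rfl
    · have h0 : f n (insert thetaVar S) = 0 := by
        ext i
        have := h n (insert thetaVar S) (-i) (Or.inr (Finset.mem_insert_self _ _))
        simpa [coef_def] using this
      exact mul_eq_zero_of_right _ h0
  · rintro ⟨h1, h2⟩ n S m hm
    rcases hm with hm | hm
    · exact h1 n S m hm
    · have h3 : (if thetaVar ∈ S.erase thetaVar then 0 else (-1) ^ inversions {thetaVar}
          (S.erase thetaVar) * f n (insert thetaVar (S.erase thetaVar))) = 0 :=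
        congrFun (congrFun h2 n) (S.erase thetaVar)
      rw [if_neg (by simp), Finset.insert_erase hm] at h3
      have h4 := GrassmannPowerSeries.coeff_neg_one_pow_mul (inversions {thetaVar}
        (S.erase thetaVar)) (f n S) (-m)
      have h5 : (-1) ^ (inversions {thetaVar} (S.erase thetaVar)) * coef f n S m = 0 := by
        refine h4.symm.trans ?_
        exact congrArg (fun x : LaurentSeries ℂ => x.coeff (-m)) h3
      exact (mul_eq_zero.1 h5).resolve_left (by simp)

theorem IsField.zconst {f : SuperFn I} (hf : IsField f) : ZConst f := (isField_iff.1 hf).1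
theorem IsField.thetaFree {f : SuperFn I} (hf : IsField f) : OddFree thetaVar f :=
  (isField_iff.1 hf).2

theorem isField_zero : IsField (0 : SuperFn I) := isField_iff.2 ⟨zconst_zero, oddFree_zero _⟩
theorem isField_one : IsField (1 : SuperFn I) := isField_iff.2 ⟨zconst_one, oddFree_one _⟩
theorem isField_phi : IsField (phi : SuperFn I) := isField_iff.2 ⟨zconst_phi, thetaFree_phi⟩

theorem isField_zCoef {f : SuperFn I} (hf : OddFree thetaVar f) (k : ℤ) : IsField (zCoef k f) :=
  isField_iff.2 ⟨zconst_zCoef k f, hf.zCoef k⟩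

namespace IsField

variable {f g : SuperFn I}

theorem add (hf : IsField f) (hg : IsField g) : IsField (f + g) :=
  isField_iff.2 ⟨hf.zconst.add hg.zconst, hf.thetaFree.add hg.thetaFree⟩
theorem neg (hf : IsField f) : IsField (-f) := isField_iff.2 ⟨hf.zconst.neg, hf.thetaFree.neg⟩
theorem sub (hf : IsField f) (hg : IsField g) : IsField (f - g) :=
  isField_iff.2 ⟨hf.zconst.sub hg.zconst, hf.thetaFree.sub hg.thetaFree⟩
theorem mul (hf : IsField f) (hg : IsField g) : IsField (f * g) :=
  isField_iff.2 ⟨hf.zconst.mul hg.zconst, hf.thetaFree.mul hg.thetaFree⟩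
theorem parity (hf : IsField f) : IsField (SuperKP.parity f) :=
  isField_iff.2 ⟨hf.zconst.parity, hf.thetaFree.parity⟩
theorem dx (hf : IsField f) : IsField (SuperKP.dx f) :=
  isField_iff.2 ⟨hf.zconst.dEven 0, hf.thetaFree.dx⟩
theorem dt (hf : IsField f) (n : ℕ) : IsField (SuperKP.dt n f) :=
  isField_iff.2 ⟨hf.zconst.dt n, hf.thetaFree.dt n⟩
theorem del (hf : IsField f) : IsField (SuperKP.del f) :=
  isField_iff.2 ⟨hf.zconst.del, hf.thetaFree.del⟩

theorem neg_one_pow_mul (hf : IsField f) (k : ℕ) : IsField ((-1) ^ k * f) := by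
  rcases Nat.even_or_odd k with h | h
  · simpa [h.neg_one_pow] using hf
  · simpa [h.neg_one_pow] using hf.neg

theorem iterate_parity (hf : IsField f) (k : ℕ) : IsField (SuperKP.parity^[k] f) := by
  rcases Nat.even_or_odd k with h | h
  · simpa [iterate_parity_even h] using hf
  · simpa [iterate_parity_odd h] using hf.parity

theorem iterate_del (hf : IsField f) (k : ℕ) : IsField (SuperKP.del^[k] f) := by
  induction k with
  | zero => simpa using hf
  | succ k ih => rw [Function.iterate_succ_apply']; exact ih.del

theorem zsmul (hf : IsField f) (m : ℤ) : IsField (m • f) := by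
  induction m with
  | zero => simpa using isField_zero
  | succ i hi => rw [add_zsmul, one_zsmul]; exact hi.add hf
  | pred i hi => rw [sub_zsmul, one_zsmul]; exact hi.sub hf

theorem sum {ι : Type*} {s : Finset ι} {f : ι → SuperFn I} (h : ∀ i ∈ s, IsField (f i)) :
    IsField (∑ i ∈ s, f i) := by
  induction s using Finset.cons_induction with
  | empty => simpa using isField_zero
  | cons a s ha ih =>
    rw [Finset.sum_cons]
    exact (h a (by simp)).add (ih fun i hi => h i (by simp [hi]))

end IsField

/-! ### The right `θ`-component -/

/-- The component `f₁` of `f = f₀ + f₁ θ`. -/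
def thetaCoef (f : SuperFn I) : SuperFn I := parity (dOdd thetaVar f)

theorem residue_eq (f : SuperFn I) : residue f = thetaCoef (zCoef (-1) f) := rfl

theorem thetaCoef_add (f g : SuperFn I) : thetaCoef (f + g) = thetaCoef f + thetaCoef g := by
  unfold thetaCoef
  rw [(dOdd_isSuperDer _).add, parity_add]

theorem thetaCoef_sub (f g : SuperFn I) : thetaCoef (f - g) = thetaCoef f - thetaCoef g :=
  additive_sub thetaCoef_add f g
theorem thetaCoef_zero : thetaCoef (0 : SuperFn I) = 0 := additive_zero thetaCoef_add
theorem thetaCoef_sum {ι : Type*} (s : Finset ι) (f : ι → SuperFn I) :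
    thetaCoef (∑ i ∈ s, f i) = ∑ i ∈ s, thetaCoef (f i) := additive_sum thetaCoef_add s f

theorem thetaCoef_of_free {f : SuperFn I} (h : OddFree thetaVar f) : thetaCoef f = 0 := by
  unfold thetaCoef
  rw [show dOdd thetaVar f = 0 from h, parity_zero]

theorem thetaCoef_mul_left {b : SuperFn I} (hb : OddFree thetaVar b) (f : SuperFn I) :
    thetaCoef (b * f) = b * thetaCoef f := by
  unfold thetaCoef
  rw [(dOdd_isSuperDer _).mul, show dOdd thetaVar b = 0 from hb, zero_mul, zero_add,
    Function.iterate_one, parity_mul, parity_parity]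

theorem thetaCoef_theta : thetaCoef (theta : SuperFn I) = 1 := by
  unfold thetaCoef theta
  rw [dOdd_oddVar_self, parity_one]

theorem thetaCoef_zCoef (k : ℤ) (f : SuperFn I) :
    thetaCoef (zCoef k f) = zCoef k (thetaCoef f) := by
  unfold thetaCoef
  rw [zCoef_parity, zCoef_dOdd]

/-- No sign appears: one minus comes from exchanging the two odd derivatives and one from moving the
derivative through the parity involution. -/
theorem thetaCoef_dOdd (o : OddVar I) (f : SuperFn I) :
    thetaCoef (dOdd o f) = dOdd o (thetaCoef f) := by
  unfold thetaCoef
  rw [dOdd_dOdd, (dOdd_isSuperDer o).parity, parity_neg, pow_one, neg_one_mul]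

theorem thetaCoef_dEven (i : ℕ) (f : SuperFn I) :
    thetaCoef (dEven i f) = dEven i (thetaCoef f) := by
  unfold thetaCoef
  rw [← dEven_dOdd, (dEven_isSuperDer i).parity, pow_zero, one_mul]

theorem thetaCoef_dx (f : SuperFn I) : thetaCoef (dx f) = dx (thetaCoef f) := thetaCoef_dEven 0 f

theorem thetaCoef_dt (n : ℕ) (f : SuperFn I) : thetaCoef (dt n f) = dt n (thetaCoef f) := by
  rcases Nat.even_or_odd n with h | h
  · rw [dt_of_even h, thetaCoef_dEven]
  · rw [dt_of_odd h, thetaCoef_dOdd]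

theorem dOdd_dOdd_self (o : OddVar I) (f : SuperFn I) : dOdd o (dOdd o f) = 0 :=
  GrassmannPowerSeries.eq_zero_of_eq_neg laurent_add_self (dOdd_dOdd o o f)

theorem thetaFree_thetaCoef (f : SuperFn I) : OddFree thetaVar (thetaCoef f) :=
  OddFree.parity (dOdd_dOdd_self _ _)

theorem phiFree_dphi (f : SuperFn I) : OddFree phiVar (dphi f) := dphi_dphi f

theorem thetaFree_sub_thetaCoef (f : SuperFn I) :
    OddFree thetaVar (f - thetaCoef f * theta) := by
  unfold OddFree
  rw [(dOdd_isSuperDer _).sub, (dOdd_isSuperDer _).mul,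
    show dOdd thetaVar (thetaCoef f) = 0 from thetaFree_thetaCoef f]
  unfold theta
  rw [dOdd_oddVar_self, Function.iterate_one, zero_mul, zero_add, mul_one]
  unfold thetaCoef
  rw [parity_parity, sub_self]

theorem phiFree_sub_dphi (f : SuperFn I) : OddFree phiVar (f - phi * dphi f) := by
  change dphi (f - phi * dphi f) = 0
  rw [dphi_isSuperDer.sub, dphi_isSuperDer.mul, dphi_dphi, dphi_phi, mul_zero, one_mul, add_zero,
    sub_self]

/-! ### Laurent series of superfields -/

/-- The series `∑ a m * z ^ m`, for `a` vanishing for large `m`. -/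
def zSeries (a : ℤ → SuperFn I) : SuperFn I := by
  classical
  exact fun n S =>
    -- The value 0 is a default for supports that are not those of a Laurent series; it is never
    -- taken when a vanishes for large m.
    if h : BddBelow (Function.support fun i : ℤ => coef (a (-i)) n S 0) then
      HahnSeries.ofSuppBddBelow _ h else 0

theorem coef_zSeries {a : ℤ → SuperFn I} {N : ℤ} (ha : ∀ m, N < m → a m = 0) (n : ℕ →₀ ℕ)
    (S : Finset (OddVar I)) (m : ℤ) : coef (zSeries a) n S m = coef (a m) n S 0 := by
  have h : BddBelow (Function.support fun i : ℤ => coef (a (-i)) n S 0) := by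
    refine ⟨-N, fun i hi => ?_⟩
    by_contra hlt
    apply hi
    simp only
    rw [ha (-i) (by omega), coef_zero]
  have h1 : zSeries a n S = HahnSeries.ofSuppBddBelow _ h := dif_pos h
  rw [coef_def, h1]
  change coef (a (- -m)) n S 0 = _
  rw [neg_neg]

theorem zCoef_zSeries {a : ℤ → SuperFn I} {N : ℤ} (ha : ∀ m, N < m → a m = 0)
    (hc : ∀ m, ZConst (a m)) (m : ℤ) : zCoef m (zSeries a) = a m := by
  refine coef_ext fun n S k => ?_
  rw [coef_zCoef, coef_zSeries ha]
  split_ifs with h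
  · rw [h]
  · rw [hc m n S k h]

theorem coef_negSeries (b : ℕ → SuperFn I) (n : ℕ →₀ ℕ) (S : Finset (OddVar I)) (m : ℤ) :
    coef (negSeries b) n S m = if m < 0 then coef (b (-m - 1).toNat) n S 0 else 0 := by
  have h : coef (negSeries b) n S m = (HahnSeries.ofPowerSeries ℤ ℂ
      (PowerSeries.mk fun i => coef (b i) n S 0)).coeff (-m - 1) :=
    (HahnSeries.coeff_single_mul).trans (one_mul _)
  rw [h]
  split_ifs with hm
  · obtain ⟨i, hi⟩ := Int.eq_ofNat_of_zero_le (show 0 ≤ -m - 1 by omega)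
    rw [hi]
    simp only [Int.toNat_natCast]
    rw [HahnSeries.ofPowerSeries_apply_coeff, PowerSeries.coeff_mk]
  · rw [HahnSeries.ofPowerSeries_apply, HahnSeries.embDomain_of_notMem_range]
    rintro ⟨i, hi⟩
    simp at hi
    omega

theorem zCoef_negSeries {b : ℕ → SuperFn I} (hb : ∀ i, ZConst (b i)) (m : ℤ) :
    zCoef m (negSeries b) = if m < 0 then b (-m - 1).toNat else 0 := by
  refine coef_ext fun n S k => ?_
  rw [coef_zCoef, coef_negSeries]
  split_ifs with h1 h2
  · rw [h1]
  · rfl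
  · rw [hb _ n S k h1]
  · rfl

theorem isNeg_negSeries (b : ℕ → SuperFn I) : IsNeg (negSeries b) := fun n S m hm => by
  rw [coef_negSeries, if_neg (by omega)]

end
end SuperKP

/-! ### Total degree, and derivatives of the variables -/

namespace GrassmannPowerSeries

open GrassmannSeries

variable {O K : Type*} [LinearOrder O] [CommRing K]

theorem mul_apply_eq_zero {f g : Ser O K} {a b : ℕ}
    (hf : ∀ n S, n.degree + S.card < a → f n S = 0)
    (hg : ∀ n S, n.degree + S.card < b → g n S = 0) (n : ℕ →₀ ℕ) (S : Finset O)
    (h : n.degree + S.card < a + b) : (f * g) n S = 0 := by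
  rw [fn_mul, GrassmannSeries.sum_apply]
  refine Finset.sum_eq_zero fun p hp => ?_
  rw [mul_apply]
  refine Finset.sum_eq_zero fun T hT => ?_
  have h1 : p.1.degree + p.2.degree = n.degree := by
    rw [← Finset.HasAntidiagonal.mem_antidiagonal.1 hp, map_add]
  have h2 := Finset.card_sdiff_add_card_eq_card (Finset.mem_powerset.1 hT)
  by_cases h3 : p.1.degree + T.card < a
  · rw [hf _ _ h3]; ring
  · rw [hg _ (S \ T) (by omega)]; ring

theorem X_apply (i : ℕ) (n : ℕ →₀ ℕ) :
    (MvPowerSeries.X i : Ser O K) n = if n = Finsupp.single i 1 then 1 else 0 :=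
  MvPowerSeries.coeff_X n i

theorem dEven_X_self (i : ℕ) : dEven i (MvPowerSeries.X i : Ser O K) = 1 := by
  funext n
  have h1 : (1 : Ser O K) n = if n = 0 then 1 else 0 := MvPowerSeries.coeff_one n
  rw [dEven_apply, X_apply, h1]
  by_cases h : n = 0
  · simp [h]
  · rw [if_neg h, if_neg (by simpa using h), smul_zero]

theorem dEven_X_of_ne {i j : ℕ} (hij : i ≠ j) : dEven i (MvPowerSeries.X j : Ser O K) = 0 := by
  funext n
  rw [dEven_apply, X_apply, if_neg, smul_zero]
  · rfl
  · intro h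
    have := DFunLike.congr_fun h i
    simp [hij] at this

theorem deriv_one (o : O) : GrassmannSeries.deriv o (1 : GrassmannSeries O K) = 0 := by
  ext S
  rw [deriv_apply, GrassmannSeries.zero_apply]
  split_ifs <;> simp [one_apply]

theorem dOdd_X (o : O) (j : ℕ) : dOdd o (MvPowerSeries.X j : Ser O K) = 0 := by
  funext n
  change GrassmannSeries.deriv o ((MvPowerSeries.X j : Ser O K) n) = 0
  rw [X_apply]
  split_ifs
  · exact deriv_one o
  · exact map_zero (AddMonoidHom.mk' (GrassmannSeries.deriv o) (deriv_add o))

theorem par_X (j : ℕ) : par (MvPowerSeries.X j : Ser O K) = MvPowerSeries.X j := by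
  funext n
  change invol ((MvPowerSeries.X j : Ser O K) n) = _
  rw [X_apply]
  split_ifs
  · ext S
    by_cases h : S = ∅ <;> simp [one_apply, h]
  · exact map_zero (AddMonoidHom.mk' (invol (O := O) (K := K)) invol_add)

theorem C_gen_apply_empty (o : O) (n : ℕ →₀ ℕ) (S : Finset O) (h : o ∉ S) :
    (MvPowerSeries.C (GrassmannSeries.gen o) : Ser O K) n S = 0 := by
  have h1 : (MvPowerSeries.C (GrassmannSeries.gen o) : Ser O K) n =
      if n = 0 then GrassmannSeries.gen o else 0 := MvPowerSeries.coeff_C n _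
  rw [h1]
  split_ifs
  · exact if_neg fun e => h (by simp [e])
  · rfl

theorem mul_apply_of_oddFactor {f : Ser O K} {o : O} (hf : ∀ n S, o ∉ S → f n S = 0) (g : Ser O K)
    (n : ℕ →₀ ℕ) (S : Finset O) (h : o ∉ S) : (f * g) n S = 0 := by
  rw [fn_mul, GrassmannSeries.sum_apply]
  refine Finset.sum_eq_zero fun p hp => ?_
  rw [mul_apply]
  refine Finset.sum_eq_zero fun T hT => ?_
  rw [hf _ T fun hT' => h (Finset.mem_powerset.1 hT hT')]
  ring

theorem X_mul_apply (i : ℕ) (g : Ser O K) (n : ℕ →₀ ℕ) (h : n i = 0) :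
    ((MvPowerSeries.X i : Ser O K) * g) n = 0 := by
  rw [fn_mul]
  refine Finset.sum_eq_zero fun p hp => ?_
  rw [X_apply, if_neg, zero_mul]
  intro hp1
  have := DFunLike.congr_fun (Finset.HasAntidiagonal.mem_antidiagonal.1 hp) i
  simp [hp1, h] at this

theorem dOdd_apply (o : O) (f : Ser O K) (n : ℕ →₀ ℕ) (S : Finset O) :
    dOdd o f n S = if o ∈ S then 0 else (-1) ^ inversions {o} S * f n (insert o S) := rfl

end GrassmannPowerSeries

namespace SuperKP

noncomputable section

open scoped Sealed
open GrassmannSeries (inversions)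

variable {I : Type*} [LinearOrder I]

/-! ### Order of vanishing -/

/-- All monomials of `f` in the variables other than `z` have degree at least `d`. -/
def OrdGE (d : ℕ) (f : SuperFn I) : Prop := ∀ n S, n.degree + S.card < d → f n S = 0

theorem eq_zero_of_ordGE {f : SuperFn I} (h : ∀ d, OrdGE d f) : f = 0 :=
  fn_ext fun n S => h (n.degree + S.card + 1) n S (by omega)

theorem fn_add (f g : SuperFn I) (n : ℕ →₀ ℕ) (S : Finset (OddVar I)) :
    (f + g) n S = f n S + g n S := rfl
theorem fn_sum {ι : Type*} (s : Finset ι) (f : ι → SuperFn I) (n : ℕ →₀ ℕ)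
    (S : Finset (OddVar I)) : (∑ i ∈ s, f i) n S = ∑ i ∈ s, f i n S := by
  induction s using Finset.cons_induction with
  | empty => rfl
  | cons a s ha ih => rw [Finset.sum_cons, Finset.sum_cons, fn_add, ih]
theorem fn_zero (n : ℕ →₀ ℕ) (S : Finset (OddVar I)) : (0 : SuperFn I) n S = 0 := rfl

namespace OrdGE

variable {a b : ℕ} {f g : SuperFn I}

theorem mono (hf : OrdGE a f) (h : b ≤ a) : OrdGE b f := fun n S hd => hf n S (by omega)

theorem add (hf : OrdGE a f) (hg : OrdGE a g) : OrdGE a (f + g) := fun n S hd => by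
  rw [fn_add, hf n S hd, hg n S hd, add_zero]

theorem neg (hf : OrdGE a f) : OrdGE a (-f) := fun n S hd => by
  change -(f n S) = 0
  rw [hf n S hd, neg_zero]

theorem sub (hf : OrdGE a f) (hg : OrdGE a g) : OrdGE a (f - g) := by
  rw [sub_eq_add_neg]; exact hf.add hg.neg

theorem mul (hf : OrdGE a f) (hg : OrdGE b g) : OrdGE (a + b) (f * g) :=
  GrassmannPowerSeries.mul_apply_eq_zero hf hg

theorem any (f : SuperFn I) : OrdGE 0 f := fun _ _ h => absurd h (by omega)

theorem pow (hf : OrdGE 1 f) (k : ℕ) : OrdGE k (f ^ k) := by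
  induction k with
  | zero => exact any _
  | succ k ih => rw [pow_succ]; exact ih.mul hf

theorem dEven (hf : OrdGE (a + 1) f) (i : ℕ) : OrdGE a (SuperKP.dEven i f) := fun n S hd => by
  change (n i + 1) • f (n + Finsupp.single i 1) S = 0
  rw [hf _ _ (by rw [map_add, Finsupp.degree_single]; omega), smul_zero]

theorem dOdd (hf : OrdGE (a + 1) f) (o : OddVar I) : OrdGE a (SuperKP.dOdd o f) := fun n S hd => by
  refine (GrassmannPowerSeries.dOdd_apply o f n S).trans ?_
  split_ifs with h
  · rfl
  · exact mul_eq_zero_of_right _ (hf n _ (by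
      have := Finset.card_insert_le o S
      change n.degree + (insert o S).card < a + 1
      omega))

theorem parity (hf : OrdGE a f) : OrdGE a (SuperKP.parity f) := fun n S hd =>
  mul_eq_zero_of_right _ (hf n S hd)

end OrdGE

theorem ordGE_one_iff {f : SuperFn I} : OrdGE 1 f ↔ f 0 ∅ = 0 := by
  refine ⟨fun h => h 0 ∅ (by simp), fun h n S hd => ?_⟩
  have h1 : n.degree = 0 := by omega
  have h2 : S.card = 0 := by omega
  rw [Finsupp.degree_eq_zero_iff] at h1
  rw [Finset.card_eq_zero] at h2
  rw [h1, h2, h]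

/-! ### Exponentials -/

/-- The complex constant `c`. -/
def cst (c : ℂ) : SuperFn I := MvPowerSeries.C (GrassmannSeries.const (HahnSeries.single 0 c))

theorem cst_mul_apply (c : ℂ) (f : SuperFn I) (n : ℕ →₀ ℕ) (S : Finset (OddVar I)) :
    (cst c * f : SuperFn I) n S = c • f n S := by
  have h1 : (cst c * f : SuperFn I) n S = HahnSeries.single 0 c * f n S := by
    have h2 : (cst c * f : SuperFn I) n = GrassmannSeries.const (HahnSeries.single 0 c) * f n :=
      GrassmannPowerSeries.C_mul_apply _ _ _
    exact (congrFun h2 S).trans (GrassmannSeries.const_mul _ _ _)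
  rw [h1]
  ext i
  refine (HahnSeries.coeff_single_mul).trans ?_
  simp

theorem coef_cst_mul (c : ℂ) (f : SuperFn I) (n : ℕ →₀ ℕ) (S : Finset (OddVar I)) (m : ℤ) :
    coef (cst c * f) n S m = c * coef f n S m := by
  rw [coef_def, cst_mul_apply]
  rfl

theorem cst_one : (cst 1 : SuperFn I) = 1 := coef_ext fun n S m => by
  rw [← mul_one (cst 1), coef_cst_mul, one_mul]

theorem cst_mul_cst (c d : ℂ) : (cst c : SuperFn I) * cst d = cst (c * d) :=
  coef_ext fun n S m => by
    rw [← mul_one (cst (c * d)), ← mul_one (cst d), coef_cst_mul, coef_cst_mul, coef_cst_mul,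
      mul_assoc]

theorem natCast_eq_cst (k : ℕ) : (k : SuperFn I) = cst k := by
  induction k with
  | zero =>
    refine coef_ext fun n S m => ?_
    rw [← mul_one (cst _), coef_cst_mul]
    simp [coef_zero]
  | succ k ih =>
    rw [Nat.cast_succ, ih]
    refine coef_ext fun n S m => ?_
    rw [← mul_one (cst (k + 1 : ℕ)), coef_cst_mul, coef_add, ← mul_one (cst (k : ℂ)), coef_cst_mul]
    push_cast
    ring

theorem cst_even (c : ℂ) : HasParity 0 (cst c : SuperFn I) :=
  hasParity_zero_iff.2 (GrassmannPowerSeries.par_C_const _)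
theorem dOdd_cst (o : OddVar I) (c : ℂ) : dOdd o (cst c : SuperFn I) = 0 :=
  GrassmannPowerSeries.dOdd_C_const o _
theorem dEven_cst (i : ℕ) (c : ℂ) : dEven i (cst c : SuperFn I) = 0 :=
  GrassmannPowerSeries.dEven_C i _
theorem zconst_cst (c : ℂ) : ZConst (cst c : SuperFn I) := zconst_iff.2 fun m hm =>
  coef_ext fun n S k => by
    rw [coef_zCoef, ← mul_one (cst c), coef_cst_mul, zconst_one n S m hm]
    simp [coef_zero]

/-- Partial sums of the exponential series. -/
def expSum (L : SuperFn I) (N : ℕ) : SuperFn I :=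
  ∑ k ∈ Finset.range N, cst ((k.factorial : ℂ)⁻¹) * L ^ k

/-- Powers L^k have order at least k, so a partial sum is exact below degree N. Identities for the
exponential are proved by comparing orders of vanishing with partial sums. -/
theorem fexp_sub_expSum {L : SuperFn I} (hL : OrdGE 1 L) (N : ℕ) :
    OrdGE N (fexp L - expSum L N) := by
  intro n S hd
  have h1 : expSum L N n S = ∑ k ∈ Finset.range N, ((k.factorial : ℂ)⁻¹) • (L ^ k) n S := by
    have h2 : expSum L N n S = ∑ k ∈ Finset.range N,
        (cst ((k.factorial : ℂ)⁻¹) * L ^ k : SuperFn I) n S :=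
      fn_sum _ _ n S
    rw [h2]
    exact Finset.sum_congr rfl fun k _ => cst_mul_apply _ _ _ _
  have h3 : fexp L n S = ∑ k ∈ Finset.range (n.degree + S.card + 1),
      ((k.factorial : ℂ)⁻¹) • (L ^ k) n S := rfl
  change fexp L n S - expSum L N n S = 0
  rw [h1, h3, sub_eq_zero]
  refine Finset.sum_subset (Finset.range_mono (by omega)) fun k _ hk => ?_
  rw [Finset.mem_range, not_lt] at hk
  rw [hL.pow k n S (by omega), smul_zero]

/-- The shift by 2 is for exponents with L² = 0, whose partial sums are constant from the second one
on. -/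
theorem eq_of_ordGE_expSum {L F : SuperFn I} (hL : OrdGE 1 L)
    (h : ∀ N, OrdGE N (F - expSum L (N + 2))) : fexp L = F := by
  rw [← sub_eq_zero]
  refine eq_zero_of_ordGE fun N => ?_
  have : fexp L - F = fexp L - expSum L (N + 2) - (F - expSum L (N + 2)) := by abel
  rw [this]
  exact ((fexp_sub_expSum hL (N + 2)).mono (by omega)).sub (h N)

theorem expSum_add_two_of_sq {L : SuperFn I} (h : L * L = 0) (N : ℕ) :
    expSum L (N + 2) = 1 + L := by
  induction N with
  | zero => simp [expSum, Finset.sum_range_succ, cst_one]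
  | succ N ih =>
    unfold expSum at *
    rw [Finset.sum_range_succ, ih]
    have : L ^ (N + 2) = 0 := by rw [pow_add, pow_two, h, mul_zero]
    rw [this, mul_zero, add_zero]

theorem fexp_of_sq {L : SuperFn I} (hL : OrdGE 1 L) (h : L * L = 0) : fexp L = 1 + L :=
  eq_of_ordGE_expSum hL fun N => by
    rw [expSum_add_two_of_sq h, sub_self]
    exact fun n S _ => rfl

/-- Because L is even, D L can be moved to the left in each D(L^k), also for odd D; the factor k
cancels against the factorial. -/
theorem IsSuperDer.expSum {p : ℕ} {D : SuperFn I → SuperFn I} (h : IsSuperDer p D)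
    (h0 : ∀ c, D (cst c) = 0) {L : SuperFn I} (hL : HasParity 0 L) (N : ℕ) :
    D (expSum L (N + 1)) = D L * SuperKP.expSum L N := by
  unfold SuperKP.expSum
  rw [Finset.sum_range_succ', h.add, h.sum, Finset.mul_sum]
  have h1 : D (cst (((Nat.factorial 0 : ℕ) : ℂ)⁻¹) * L ^ 0) = 0 := by
    rw [pow_zero, mul_one, h0]
  rw [h1, add_zero]
  refine Finset.sum_congr rfl fun k _ => ?_
  rw [h.const_mul (cst_even _) (h0 _), h.pow_of_even hL, nsmul_eq_mul, natCast_eq_cst, ← mul_assoc,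
    cst_mul_cst, ← mul_assoc (D L), ← (cst_even _).comm (D L), mul_assoc]
  congr 2
  rw [Nat.factorial_succ]
  have h2 : ((k + 1 : ℕ) : ℂ) ≠ 0 := by exact_mod_cast Nat.succ_ne_zero k
  have h3 : (k.factorial : ℂ) ≠ 0 := by exact_mod_cast Nat.factorial_ne_zero k
  push_cast at h2 ⊢
  field_simp

/-- `D` is a super derivation of the functions of the variables other than `z`. -/
structure IsFormalDer (p : ℕ) (D : SuperFn I → SuperFn I) : Prop extends IsSuperDer p D where
  cst : ∀ c, D (SuperKP.cst c) = 0
  ordGE : ∀ d f, OrdGE (d + 1) f → OrdGE d (D f)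

theorem dOdd_isFormalDer (o : OddVar I) : IsFormalDer 1 (dOdd o) :=
  ⟨dOdd_isSuperDer o, dOdd_cst o, fun _ _ h => h.dOdd o⟩

theorem dEven_isFormalDer (i : ℕ) : IsFormalDer 0 (dEven (I := I) i) :=
  ⟨dEven_isSuperDer i, dEven_cst i, fun _ _ h => h.dEven i⟩

theorem dx_isFormalDer : IsFormalDer 0 (dx (I := I)) := dEven_isFormalDer 0
theorem dphi_isFormalDer : IsFormalDer 1 (dphi (I := I)) := dOdd_isFormalDer phiVar

theorem dt_isFormalDer (n : ℕ) : IsFormalDer n (dt (I := I) n) := by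
  refine ⟨dt_isSuperDer n, fun c => ?_, fun d f h => ?_⟩ <;> rcases Nat.even_or_odd n with h' | h'
  · rw [dt_of_even h', dEven_cst]
  · rw [dt_of_odd h', dOdd_cst]
  · rw [dt_of_even h']; exact h.dEven _
  · rw [dt_of_odd h']; exact h.dOdd _

theorem del_isFormalDer : IsFormalDer 1 (del (I := I)) :=
  ⟨del_isSuperDer, fun c => by
    rw [del_def, dphi_isFormalDer.cst, dx_isFormalDer.cst, mul_zero, add_zero],
    fun d f h => by
      have h1 : OrdGE d (phi * dx f) :=
        OrdGE.mono (a := 0 + d) ((OrdGE.any phi).mul (h.dEven 0)) (by omega)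
      rw [del_def]
      exact (h.dOdd phiVar).add h1⟩

/-- D lowers the order by at most one, so the identity for partial sums shows that the difference of
both sides vanishes to every order. -/
theorem IsFormalDer.fexp {p : ℕ} {D : SuperFn I → SuperFn I} (h : IsFormalDer p D) {L : SuperFn I}
    (hL : HasParity 0 L) (h1 : OrdGE 1 L) : D (fexp L) = D L * SuperKP.fexp L := by
  rw [← sub_eq_zero]
  refine eq_zero_of_ordGE fun N => ?_
  have h2 : D (SuperKP.fexp L) - D L * SuperKP.fexp L =
      D (SuperKP.fexp L - SuperKP.expSum L (N + 1)) -
        D L * (SuperKP.fexp L - SuperKP.expSum L N) := by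
    rw [h.toIsSuperDer.sub, h.toIsSuperDer.expSum h.cst hL, mul_sub]
    abel
  rw [h2]
  exact (h.ordGE _ _ (fexp_sub_expSum h1 _)).sub
    (by simpa using (OrdGE.any (D L)).mul (fexp_sub_expSum h1 N))

theorem expSum_even {L : SuperFn I} (hL : HasParity 0 L) (N : ℕ) : HasParity 0 (expSum L N) := by
  unfold expSum
  refine HasParity.sum fun k _ => (cst_even _).mul_even (hL.pow_even k)

theorem fexp_even {L : SuperFn I} (hL : HasParity 0 L) (h1 : OrdGE 1 L) :
    HasParity 0 (fexp L) := by
  rw [hasParity_zero_iff, ← sub_eq_zero]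
  refine eq_zero_of_ordGE fun N => ?_
  have h2 : parity (fexp L) - fexp L = parity (fexp L - expSum L N) - (fexp L - expSum L N) := by
    rw [parity_sub, hasParity_zero_iff.1 (expSum_even hL N)]
    abel
  rw [h2]
  exact (fexp_sub_expSum h1 N).parity.sub (fexp_sub_expSum h1 N)

theorem fexp_constantCoeff {L : SuperFn I} (h1 : OrdGE 1 L) : OrdGE 1 (fexp L - 1) := by
  have h2 := fexp_sub_expSum h1 1
  have h3 : expSum L 1 = 1 := by simp [expSum, cst_one]
  rwa [h3] at h2

theorem fexp_isNeg {L : SuperFn I} (hL : IsNeg L) (h1 : OrdGE 1 L) : IsNeg (fexp L - 1) := by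
  intro n S m hm
  -- At a fixed monomial the exponential equals a finite partial sum, whose terms beyond 1 all lie
  -- in V⁻.
  have h2 := fexp_sub_expSum h1 (n.degree + S.card + 1) n S (by omega)
  have h3 : fexp L - 1 = fexp L - expSum L (n.degree + S.card + 1) +
      ∑ k ∈ Finset.range (n.degree + S.card), cst (((k + 1).factorial : ℂ)⁻¹) * L ^ (k + 1) := by
    unfold expSum
    rw [Finset.sum_range_succ']
    simp only [Nat.factorial_zero, Nat.cast_one, inv_one, cst_one, pow_zero, mul_one]
    abel
  have h4 : ∀ k, DegLE (-1) (L ^ (k + 1)) := by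
    intro k
    induction k with
    | zero => simpa using isNeg_iff.1 hL
    | succ k ih => rw [pow_succ]; exact (ih.mul (isNeg_iff.1 hL)).mono (by norm_num)
  have h5 : DegLE (-1) (∑ k ∈ Finset.range (n.degree + S.card),
      cst (((k + 1).factorial : ℂ)⁻¹) * L ^ (k + 1)) :=
    DegLE.sum fun k _ => (h4 k).zconst_mul (zconst_cst _)
  rw [h3, coef_add, h5 n S m (by omega), coef_def, h2]
  simp

/-- A function is determined by its derivatives and its constant term. -/
theorem eq_zero_of_derivs {f : SuperFn I} (he : ∀ i, dEven i f = 0) (ho : ∀ o, dOdd o f = 0)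
    (h1 : OrdGE 1 f) : f = 0 := by
  refine fn_ext fun n S => ?_
  by_cases hn : n = 0
  · by_cases hS : S = ∅
    · rw [hn, hS]; exact ordGE_one_iff.1 h1
    · obtain ⟨o, hoS⟩ := Finset.nonempty_iff_ne_empty.2 hS
      have h2 : (if o ∈ S.erase o then 0 else (-1) ^ inversions {o} (S.erase o) *
          f n (insert o (S.erase o))) = 0 := congrFun (congrFun (ho o) n) (S.erase o)
      rw [if_neg (by simp), Finset.insert_erase hoS] at h2
      exact (mul_eq_zero.1 h2).resolve_left (pow_ne_zero _ (neg_ne_zero.2 one_ne_zero))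
  · obtain ⟨i, hi⟩ := Finsupp.ne_iff.1 hn
    have hi' : n i ≠ 0 := hi
    have hle : Finsupp.single i 1 ≤ n := by rw [Finsupp.single_le_iff]; omega
    refine HahnSeries.ext (funext fun j => ?_)
    have h2 := congrArg (fun F : SuperFn I => coef F (n - Finsupp.single i 1) S (-j)) (he i)
    simp only [coef_dEven, tsub_add_cancel_of_le hle, coef_zero] at h2
    have h3 := (mul_eq_zero.1 h2).resolve_left (Nat.cast_add_one_ne_zero _)
    rw [coef_def, neg_neg] at h3
    exact h3

theorem OrdGE.mul_sub_one {f g : SuperFn I} (hf : OrdGE 1 (f - 1)) (hg : OrdGE 1 (g - 1)) :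
    OrdGE 1 (f * g - 1) := by
  have : f * g - 1 = (f - 1) * g + (g - 1) := by rw [sub_mul, one_mul]; abel
  rw [this]
  exact (hf.mul (OrdGE.any g)).add hg

/-- All coordinate derivatives of the product vanish and its constant term is 1. -/
theorem fexp_mul_fexp_neg {L : SuperFn I} (hL : HasParity 0 L) (h1 : OrdGE 1 L) :
    fexp L * fexp (-L) = 1 := by
  have key : ∀ (p : ℕ) (D : SuperFn I → SuperFn I), IsFormalDer p D →
      D (fexp L * fexp (-L) - 1) = 0 := by
    intro p D h
    rw [h.toIsSuperDer.sub, h.toIsSuperDer.one, h.toIsSuperDer.mul_of_even (fexp_even hL h1),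
      h.fexp hL h1, h.fexp hL.neg h1.neg, h.toIsSuperDer.neg, mul_assoc, ← mul_assoc (fexp L),
      (fexp_even hL h1).comm (-D L), neg_mul, neg_mul, mul_assoc]
    abel
  rw [← sub_eq_zero]
  exact eq_zero_of_derivs (fun i => key 0 _ (dEven_isFormalDer i))
    (fun o => key 1 _ (dOdd_isFormalDer o))
    ((fexp_constantCoeff h1).mul_sub_one (fexp_constantCoeff h1.neg))

end
end SuperKP

namespace SuperKP

noncomputable section

open scoped Sealed
open GrassmannSeries (inversions)

variable {I : Type*} [LinearOrder I]

/-! ### The vacuum wave function -/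

/-- Every monomial in the variables other than `z` occurs in finitely many members of `f`. -/
def LocallyFin (f : ℕ → SuperFn I) : Prop := ∀ n S, (Function.support fun i => f i n S).Finite

theorem formalSum_parity {f : ℕ → SuperFn I} (hf : LocallyFin f) :
    parity (formalSum f) = formalSum fun i => parity (f i) :=
  fn_ext fun n S => (AddMonoidHom.mulLeft ((-1 : LaurentSeries ℂ) ^ S.card)).map_finsum (hf n S)

theorem formalSum_dEven {f : ℕ → SuperFn I} (hf : LocallyFin f) (j : ℕ) :
    dEven j (formalSum f) = formalSum fun i => dEven j (f i) :=
  fn_ext fun n S => (nsmulAddMonoidHom (α := LaurentSeries ℂ) (n j + 1)).map_finsum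
    (hf (n + Finsupp.single j 1) S)

theorem formalSum_dOdd {f : ℕ → SuperFn I} (hf : LocallyFin f) (o : OddVar I) :
    dOdd o (formalSum f) = formalSum fun i => dOdd o (f i) := by
  refine fn_ext fun n S => ?_
  change (if o ∈ S then 0 else (-1) ^ inversions {o} S * formalSum f n (insert o S)) =
    ∑ᶠ i, if o ∈ S then 0 else (-1) ^ inversions {o} S * f i n (insert o S)
  split_ifs with h
  · simp
  · exact (AddMonoidHom.mulLeft ((-1 : LaurentSeries ℂ) ^ inversions {o} S)).map_finsum
      (hf n (insert o S))

theorem formalSum_single (f : ℕ → SuperFn I) (j : ℕ) (h : ∀ i, i ≠ j → f i = 0) :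
    formalSum f = f j :=
  fn_ext fun n S => finsum_eq_single _ j fun i hi => by rw [h i hi, fn_zero]

theorem formalSum_zero : formalSum (fun _ => (0 : SuperFn I)) = 0 :=
  fn_ext fun n S => by
    change ∑ᶠ _ : ℕ, (0 : LaurentSeries ℂ) = 0
    simp

theorem time_even (i : ℕ) : time (I := I) (2 * i + 2) = MvPowerSeries.X (i + 1) := by
  unfold time
  rw [if_pos (by grind)]
  congr 1
  omega

theorem time_odd (i : ℕ) : time (I := I) (2 * i + 1) = oddVar (oddTimeVar i) := by
  unfold time
  rw [if_neg (by grind)]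
  congr 2
  omega

/-- The terms of the phase containing `t_{2i+2}` and `t_{2i+1}`. -/
def phaseTerm (i : ℕ) : SuperFn I :=
  time (2 * i + 2) * zpow (i + 1) + time (2 * i + 1) * theta * zpow i

theorem phase_eq : (phase : SuperFn I) =
    phi * theta + zpow 1 * xvar + formalSum phaseTerm := rfl

theorem dEven_X_self (i : ℕ) : dEven i (MvPowerSeries.X i : SuperFn I) = 1 :=
  GrassmannPowerSeries.dEven_X_self i
theorem dEven_X_of_ne {i j : ℕ} (h : i ≠ j) : dEven i (MvPowerSeries.X j : SuperFn I) = 0 :=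
  GrassmannPowerSeries.dEven_X_of_ne h
theorem dOdd_X (o : OddVar I) (j : ℕ) : dOdd o (MvPowerSeries.X j : SuperFn I) = 0 :=
  GrassmannPowerSeries.dOdd_X o j
theorem X_even (j : ℕ) : HasParity 0 (MvPowerSeries.X j : SuperFn I) :=
  hasParity_zero_iff.2 (GrassmannPowerSeries.par_X j)

/-- The i-th term is a sum of multiples of t_{2i+2} and t_{2i+1}, and a monomial involves only
finitely many times. -/
theorem phaseTerm_locallyFin : LocallyFin (phaseTerm (I := I)) := by
  intro n S
  refine Set.Finite.subset (s := {i | n (i + 1) ≠ 0} ∪ {i | oddTimeVar i ∈ S}) ?_ ?_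
  · refine Set.Finite.union ?_ ?_
    · refine Set.Finite.preimage (f := fun i => i + 1) (s := {i | n i ≠ 0})
        (fun a _ b _ h => Nat.succ_injective h) ?_
      exact n.support.finite_toSet.subset fun i hi => by simpa using hi
    · exact Set.Finite.preimage (oddTimeVar_injective.injOn) S.finite_toSet
  · intro i hi
    by_contra h
    simp only [Set.mem_union, Set.mem_ofPred_eq, not_or, not_not] at h
    apply hi
    have h1 : (time (2 * i + 2) * zpow (i + 1) : SuperFn I) n S = 0 := by
      rw [time_even]
      exact congrFun (GrassmannPowerSeries.X_mul_apply (i + 1) _ n h.1) S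
    have h2 : (time (2 * i + 1) * theta * zpow i : SuperFn I) n S = 0 := by
      rw [time_odd, mul_assoc]
      exact GrassmannPowerSeries.mul_apply_of_oddFactor
        (fun n S hS => GrassmannPowerSeries.C_gen_apply_empty _ n S hS) _ n S h.2
    change (time (2 * i + 2) * zpow (i + 1) : SuperFn I) n S +
      (time (2 * i + 1) * theta * zpow i : SuperFn I) n S = 0
    rw [h1, h2, add_zero]

theorem phaseTerm_even (i : ℕ) : HasParity 0 (phaseTerm (I := I) i) := by
  unfold phaseTerm
  rw [time_even, time_odd]
  exact ((X_even _).mul_even (zpow_even _)).add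
    (((oddVar_odd _).odd_mul_odd theta_odd).mul_even (zpow_even _))

theorem xvar_even : HasParity 0 (xvar : SuperFn I) := X_even 0

theorem phase_even : HasParity 0 (phase : SuperFn I) := by
  rw [phase_eq]
  refine ((phi_odd.odd_mul_odd theta_odd).add ((zpow_even _).mul_even xvar_even)).add ?_
  rw [hasParity_zero_iff, formalSum_parity phaseTerm_locallyFin]
  congr 1
  exact funext fun i => hasParity_zero_iff.1 (phaseTerm_even i)

theorem ordGE_oddVar (o : OddVar I) : OrdGE 1 (oddVar o) :=
  ordGE_one_iff.2 (GrassmannPowerSeries.C_gen_apply_empty o 0 ∅ (by simp))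

theorem ordGE_X (i : ℕ) : OrdGE 1 (MvPowerSeries.X i : SuperFn I) := by
  refine ordGE_one_iff.2 ?_
  have h := GrassmannPowerSeries.X_apply (O := OddVar I) (K := LaurentSeries ℂ) i 0
  rw [if_neg (by
    intro h
    have := DFunLike.congr_fun h i
    simp at this)] at h
  exact congrFun h ∅

theorem phase_ordGE : OrdGE 1 (phase : SuperFn I) := by
  rw [phase_eq]
  refine OrdGE.add (OrdGE.add ?_ ?_) ?_
  · exact ((ordGE_oddVar _).mul (OrdGE.any _)).mono (by omega)
  · exact ((OrdGE.any _).mul (ordGE_X 0)).mono (by omega)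
  · refine ordGE_one_iff.2 ?_
    have h : ∀ i, phaseTerm (I := I) i 0 ∅ = 0 := by
      intro i
      refine ordGE_one_iff.1 ?_
      unfold phaseTerm
      rw [time_even, time_odd, mul_assoc]
      exact (((ordGE_X _).mul (OrdGE.any _)).mono (by omega)).add
        (((ordGE_oddVar _).mul (OrdGE.any _)).mono (by omega))
    change ∑ᶠ i, phaseTerm (I := I) i 0 ∅ = 0
    simp [h]

theorem dEven_phaseTerm (j i : ℕ) : dEven j (phaseTerm (I := I) i) =
    if j = i + 1 then zpow (i + 1) else 0 := by
  unfold phaseTerm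
  rw [(dEven_isSuperDer j).add, time_even, time_odd, mul_assoc,
    (dEven_isSuperDer j).mul_of_even (X_even _), (dEven_isSuperDer j).mul, dEven_zpow,
    (dEven_isSuperDer j).mul, dEven_zpow, dEven_oddVar, theta, dEven_oddVar]
  split_ifs with h
  · rw [h, dEven_X_self]
    simp
  · rw [dEven_X_of_ne h]
    simp

theorem dOdd_phaseTerm {o : OddVar I} (ho : o ≠ thetaVar) (i : ℕ) :
    dOdd o (phaseTerm i) = if o = oddTimeVar i then theta * zpow i else 0 := by
  unfold phaseTerm
  rw [(dOdd_isSuperDer o).add, time_even, time_odd, mul_assoc,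
    (dOdd_isSuperDer o).mul_of_even (X_even _), (dOdd_isSuperDer o).mul, dOdd_zpow,
    (dOdd_isSuperDer o).mul, dOdd_zpow, dOdd_X, theta, dOdd_oddVar_of_ne ho]
  split_ifs with h
  · rw [h, dOdd_oddVar_self]
    simp
  · rw [dOdd_oddVar_of_ne h]
    simp

theorem dx_phase : dx (phase : SuperFn I) = zpow 1 := by
  rw [phase_eq, dx_isSuperDer.add, dx_isSuperDer.add]
  have h1 : dx (formalSum phaseTerm : SuperFn I) = 0 := by
    refine (formalSum_dEven phaseTerm_locallyFin 0).trans ?_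
    rw [← formalSum_zero]
    congr 1
    funext i
    rw [dEven_phaseTerm, if_neg (by omega)]
  rw [h1, dx_isSuperDer.mul, dx_phi, dx_theta, dx_isSuperDer.const_mul (zpow_even 1) (dx_zpow 1)]
  have h2 : dx (xvar : SuperFn I) = 1 := dEven_X_self 0
  rw [h2]
  simp

theorem dphi_phase : dphi (phase : SuperFn I) = theta := by
  rw [phase_eq, dphi_isSuperDer.add, dphi_isSuperDer.add]
  have h1 : dphi (formalSum phaseTerm : SuperFn I) = 0 := by
    refine (formalSum_dOdd phaseTerm_locallyFin phiVar).trans ?_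
    rw [← formalSum_zero]
    congr 1
    funext i
    rw [dOdd_phaseTerm theta_ne_phi.symm, if_neg (oddTimeVar_ne_phi i).symm]
  have h2 : dphi (xvar : SuperFn I) = 0 := dOdd_X _ 0
  rw [h1, dphi_isSuperDer.mul, dphi_phi, dphi_theta,
    dphi_isSuperDer.const_mul (zpow_even 1) (dphi_zpow 1), h2]
  simp

theorem vacuum_eq (k : ℕ) : (vacuum k : SuperFn I) = zpow (k / 2 : ℕ) * theta ^ (k % 2) := rfl

theorem vacuum_two_mul (i : ℕ) : (vacuum (2 * i) : SuperFn I) = zpow i := by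
  rw [vacuum_eq, Nat.mul_mod_right, pow_zero, mul_one, Nat.mul_div_cancel_left _ (by omega)]

theorem vacuum_two_mul_add_one (i : ℕ) : (vacuum (2 * i + 1) : SuperFn I) = zpow i * theta := by
  have h1 : (2 * i + 1) % 2 = 1 := by omega
  have h2 : (2 * i + 1) / 2 = i := by omega
  rw [vacuum_eq, h1, h2, pow_one]

theorem vacuum_hasParity (k : ℕ) : HasParity k (vacuum k : SuperFn I) := by
  rcases Nat.even_or_odd' k with ⟨i, h | h⟩
  · rw [h, vacuum_two_mul]; exact (zpow_even _).congr (by omega)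
  · rw [h, vacuum_two_mul_add_one]; exact ((zpow_even _).mul theta_odd).congr (by omega)

/-- Only one term of the sum contains t_n. Positivity of n matters: `dt 0` is ∂_x, and ∂_x of the
phase is z, not `vacuum 0`. -/
theorem dt_phase {n : ℕ} (hn : 0 < n) : dt n (phase : SuperFn I) = vacuum n := by
  have h0 : dt n (phi * theta : SuperFn I) = 0 := by
    rw [(dt_isSuperDer n).odd_const_mul phi_odd (dt_phi n), dt_theta, mul_zero, mul_zero]
  rcases Nat.even_or_odd' n with ⟨i, h | h⟩
  · have he : Even n := ⟨i, by omega⟩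
    have h2 : n / 2 = i := by omega
    have h3 : dt n (xvar : SuperFn I) = 0 := by
      rw [dt_of_even he]; exact dEven_X_of_ne (by omega)
    rw [phase_eq, (dt_isSuperDer n).add, (dt_isSuperDer n).add, h0,
      (dt_isSuperDer n).const_mul (zpow_even 1) (dt_zpow n 1), h3, dt_of_even he,
      formalSum_dEven phaseTerm_locallyFin, formalSum_single _ (i - 1), dEven_phaseTerm, if_pos,
      h, vacuum_two_mul]
    · rw [mul_zero, zero_add, zero_add]
      congr 1
      omega
    · omega
    · intro j hj
      rw [dEven_phaseTerm, if_neg (by omega)]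
  · have ho : Odd n := ⟨i, h⟩
    have h2 : n / 2 = i := by omega
    have h3 : dt n (xvar : SuperFn I) = 0 := by
      rw [dt_of_odd ho]; exact dOdd_X _ 0
    rw [phase_eq, (dt_isSuperDer n).add, (dt_isSuperDer n).add, h0,
      (dt_isSuperDer n).const_mul (zpow_even 1) (dt_zpow n 1), h3, dt_of_odd ho,
      formalSum_dOdd phaseTerm_locallyFin, formalSum_single _ i,
      dOdd_phaseTerm (oddTimeVar_ne_theta _), if_pos (by rw [h2]), h, vacuum_two_mul_add_one,
      mul_zero, zero_add, zero_add, (zpow_even i).comm]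
    intro j hj
    rw [dOdd_phaseTerm (oddTimeVar_ne_theta _), if_neg]
    intro e
    exact hj (by rw [← oddTimeVar_injective e, h2])

theorem vacuumWave_even : HasParity 0 (vacuumWave : SuperFn I) := fexp_even phase_even phase_ordGE

theorem dx_vacuumWave : dx (vacuumWave : SuperFn I) = zpow 1 * vacuumWave := by
  unfold vacuumWave
  rw [dx_isFormalDer.fexp phase_even phase_ordGE, dx_phase]

theorem dphi_vacuumWave : dphi (vacuumWave : SuperFn I) = theta * vacuumWave := by
  unfold vacuumWave
  rw [dphi_isFormalDer.fexp phase_even phase_ordGE, dphi_phase]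

theorem dt_vacuumWave {n : ℕ} (hn : 0 < n) :
    dt n (vacuumWave : SuperFn I) = vacuum n * vacuumWave := by
  unfold vacuumWave
  rw [(dt_isFormalDer n).fexp phase_even phase_ordGE, dt_phase hn]

/-- The symbol `θ + φ z` of `δ`. -/
def tau : SuperFn I := theta + phi * zpow 1

theorem tau_odd : HasParity 1 (tau : SuperFn I) :=
  theta_odd.add (phi_odd.odd_mul_even (zpow_even 1))

theorem del_vacuumWave : del (vacuumWave : SuperFn I) = tau * vacuumWave := by
  rw [del_def, dphi_vacuumWave, dx_vacuumWave, tau, add_mul, mul_assoc]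

theorem del_tau : del (tau : SuperFn I) = zpow 1 := by
  rw [tau, del_isSuperDer.add, del_theta, del_isSuperDer.mul, del_phi, del_zpow]
  simp

theorem dx_tau : dx (tau : SuperFn I) = 0 := by rw [← del_del, del_tau, del_zpow]

theorem dt_tau (n : ℕ) : dt n (tau : SuperFn I) = 0 := by
  rw [tau, (dt_isSuperDer n).add, dt_theta, (dt_isSuperDer n).mul, dt_phi, dt_zpow]
  simp

theorem dt_vacuum (n k : ℕ) : dt n (vacuum k : SuperFn I) = 0 := by
  rcases Nat.even_or_odd' k with ⟨i, h | h⟩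
  · rw [h, vacuum_two_mul, dt_zpow]
  · rw [h, vacuum_two_mul_add_one, (dt_isSuperDer n).mul, dt_zpow, dt_theta]
    simp

theorem vacuumWave_isUnit : IsUnit (vacuumWave : SuperFn I) :=
  isUnit_iff_exists.2 ⟨fexp (-phase), fexp_mul_fexp_neg phase_even phase_ordGE, by
    have h := fexp_mul_fexp_neg phase_even.neg (phase_ordGE (I := I)).neg
    rwa [neg_neg] at h⟩

end
end SuperKP

namespace SuperKP

noncomputable section

open scoped Sealed

variable {I : Type*} [LinearOrder I]

/-! ### Spans over the superfields -/

/-- The span of the family `x` over the superfields. -/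
def fieldSpan (x : ℕ → SuperFn I) : AddSubgroup (SuperFn I) :=
  AddSubgroup.closure {y | ∃ b l, IsField b ∧ y = b * x l}

theorem mul_mem_fieldSpan {x : ℕ → SuperFn I} {b : SuperFn I} (hb : IsField b) (l : ℕ) :
    b * x l ∈ fieldSpan x := AddSubgroup.subset_closure ⟨b, l, hb, rfl⟩

theorem self_mem_fieldSpan (x : ℕ → SuperFn I) (l : ℕ) : x l ∈ fieldSpan x := by
  simpa using mul_mem_fieldSpan (x := x) isField_one l

/-- Only additivity of T is assumed, since the derivations and covariant derivatives to which this
is applied are not linear over the superfields. -/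
theorem fieldSpan_map {x y : ℕ → SuperFn I} {T : SuperFn I → SuperFn I}
    (hT : ∀ f g, T (f + g) = T f + T g)
    (h : ∀ b l, IsField b → T (b * x l) ∈ fieldSpan y) {f : SuperFn I} (hf : f ∈ fieldSpan x) :
    T f ∈ fieldSpan y := by
  induction hf using AddSubgroup.closure_induction with
  | mem f hf =>
    obtain ⟨b, l, hb, rfl⟩ := hf
    exact h b l hb
  | zero => rw [additive_zero hT]; exact zero_mem _
  | add f g _ _ hf hg => rw [hT]; exact add_mem hf hg
  | neg f _ hf => rw [additive_neg hT]; exact neg_mem hf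

theorem mem_fieldSpan_iff {x : ℕ → SuperFn I} {f : SuperFn I} :
    f ∈ fieldSpan x ↔ ∃ (N : ℕ) (b : ℕ → SuperFn I), (∀ l, IsField (b l)) ∧
      f = ∑ l ∈ Finset.range N, b l * x l := by
  constructor
  · intro hf
    induction hf using AddSubgroup.closure_induction with
    | mem f hf =>
      obtain ⟨b, l, hb, rfl⟩ := hf
      refine ⟨l + 1, fun i => if i = l then b else 0, fun i => ?_, ?_⟩
      · simp only
        split_ifs
        · exact hb
        · exact isField_zero
      · rw [Finset.sum_eq_single l]
        · simp
        · intro i _ hi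
          simp [hi]
        · simp
    | zero => exact ⟨0, fun _ => 0, fun _ => isField_zero, by simp⟩
    | add f g _ _ hf hg =>
      obtain ⟨N, b, hb, rfl⟩ := hf
      obtain ⟨M, c, hc, rfl⟩ := hg
      have key : ∀ (b : ℕ → SuperFn I) (N K : ℕ), N ≤ K →
          ∑ l ∈ Finset.range N, b l * x l =
            ∑ l ∈ Finset.range K, (if l < N then b l else 0) * x l := by
        intro b N K h
        rw [← Finset.sum_subset (Finset.range_mono h)]
        · refine Finset.sum_congr rfl fun l hl => ?_
          rw [if_pos (Finset.mem_range.1 hl)]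
        · intro l _ hl
          rw [if_neg (by simpa using hl), zero_mul]
      refine ⟨max N M, fun l => (if l < N then b l else 0) + (if l < M then c l else 0),
        fun l => IsField.add ?_ ?_, ?_⟩
      · split_ifs
        · exact hb l
        · exact isField_zero
      · split_ifs
        · exact hc l
        · exact isField_zero
      · rw [key b N _ (le_max_left _ _), key c M _ (le_max_right _ _), ← Finset.sum_add_distrib]
        exact Finset.sum_congr rfl fun l _ => (add_mul _ _ _).symm
    | neg f _ hf =>
      obtain ⟨N, b, hb, rfl⟩ := hf
      refine ⟨N, fun l => -b l, fun l => (hb l).neg, ?_⟩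
      rw [← Finset.sum_neg_distrib]
      exact Finset.sum_congr rfl fun l _ => (neg_mul _ _).symm
  · rintro ⟨N, b, hb, rfl⟩
    exact sum_mem fun l _ => mul_mem_fieldSpan (hb l) l

theorem inSpan_iff {g f : SuperFn I} : InSpan g f ↔ f ∈ fieldSpan (iterate g) :=
  mem_fieldSpan_iff.symm

theorem field_mul_mem_fieldSpan {x : ℕ → SuperFn I} {b f : SuperFn I} (hb : IsField b)
    (hf : f ∈ fieldSpan x) : b * f ∈ fieldSpan x :=
  fieldSpan_map (T := fun f => b * f) (fun f g => mul_add b f g)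
    (fun c l hc => by
      simp only [← mul_assoc]
      exact mul_mem_fieldSpan (hb.mul hc) l) hf

/-! ### Faà di Bruno iterates -/

theorem iterate_zero (g : SuperFn I) : iterate g 0 = 1 := rfl
theorem iterate_succ (g : SuperFn I) (k : ℕ) :
    iterate g (k + 1) = del (iterate g k) + g * iterate g k := rfl
theorem iterate_one (g : SuperFn I) : iterate g 1 = g := by
  rw [iterate_succ, iterate_zero, del_isSuperDer.one, zero_add, mul_one]

section OddGenerator

variable {g : SuperFn I} (hg : HasParity 1 g)

/-- As g is odd, g² = 0, and the cross terms cancel; so (δ + g)² = ∂_x + δg is a first-order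
operator in x without square terms. -/
theorem cov_cov (hg : HasParity 1 g) (f : SuperFn I) :
    del (del f + g * f) + g * (del f + g * f) = dx f + del g * f := by
  rw [del_isSuperDer.add, del_del, del_isSuperDer.mul_of_hasParity hg, mul_add, ← mul_assoc g g,
    hg.sq_eq_zero]
  simp only [mul_one, pow_one, neg_one_mul, zero_mul]
  abel

theorem iterate_add_two (hg : HasParity 1 g) (k : ℕ) :
    iterate g (k + 2) = dx (iterate g k) + del g * iterate g k := by
  rw [iterate_succ, iterate_succ, cov_cov hg]

theorem iterate_two (hg : HasParity 1 g) : iterate g 2 = del g := by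
  rw [iterate_add_two hg, iterate_zero, dx_isSuperDer.one, zero_add, mul_one]

/-- The super Leibniz rule for δ + g: a superfield b passes to its left as `parity b`, and the extra
term has coefficient δb. -/
theorem cov_mem_fieldSpan (hg : HasParity 1 g) {f : SuperFn I} (hf : f ∈ fieldSpan (iterate g)) :
    del f + g * f ∈ fieldSpan (iterate g) := by
  refine fieldSpan_map (T := fun f => del f + g * f) (fun f h => ?_) (fun b l hb => ?_) hf
  · simp only [del_isSuperDer.add, mul_add]
    abel
  · have h1 : del (b * iterate g l) + g * (b * iterate g l) =
        del b * iterate g l + parity b * iterate g (l + 1) := by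
      rw [del_isSuperDer.mul, ← mul_assoc g, hg.odd_comm, iterate_succ, mul_add,
        Function.iterate_one, mul_assoc, add_assoc]
    simp only [h1]
    exact add_mem (mul_mem_fieldSpan hb.del l) (mul_mem_fieldSpan hb.parity (l + 1))

theorem parity_iterate (hg : HasParity 1 g) (l : ℕ) : HasParity l (iterate g l) := by
  induction l with
  | zero => exact HasParity.one
  | succ l ih =>
    rw [iterate_succ]
    exact ((del_isSuperDer.hasParity ih).congr (by omega)).add ((hg.mul ih).congr (by omega))

theorem parity_mem_fieldSpan (hg : HasParity 1 g) {f : SuperFn I}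
    (hf : f ∈ fieldSpan (iterate g)) : parity f ∈ fieldSpan (iterate g) := by
  refine fieldSpan_map parity_add (fun b l hb => ?_) hf
  rw [parity_mul, hasParity_iff.1 (parity_iterate hg l), ← mul_assoc, neg_one_pow_comm]
  exact mul_mem_fieldSpan (hb.parity.neg_one_pow_mul l) l

/-- When δF = gF, multiplication by F intertwines δ + g with δ. -/
theorem iterate_mul_wave (hg : HasParity 1 g) {F : SuperFn I} (hF : del F = g * F) (l : ℕ) :
    iterate g l * F = del^[l] F := by
  induction l with
  | zero => rw [iterate_zero, one_mul, Function.iterate_zero, id]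
  | succ l ih =>
    rw [Function.iterate_succ_apply', ← ih, del_isSuperDer.mul, hF, Function.iterate_one,
      iterate_succ, add_mul, ← mul_assoc (parity _), ← hg.odd_comm]

/-- The bridge between the two hierarchies: the span W of the iterates corresponds to the functions
obtained from the wave function by differential operators. -/
theorem mem_fieldSpan_wave_iff (hg : HasParity 1 g) {F : SuperFn I} (hF : del F = g * F)
    (hu : IsUnit F) {f : SuperFn I} :
    f ∈ fieldSpan (iterate g) ↔ f * F ∈ fieldSpan fun l => del^[l] F := by
  obtain ⟨G, hFG, hGF⟩ := isUnit_iff_exists.1 hu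
  constructor
  · intro hf
    refine fieldSpan_map (T := fun f => f * F) (fun f h => add_mul f h F) (fun b l hb => ?_) hf
    simp only [mul_assoc, iterate_mul_wave hg hF]
    exact mul_mem_fieldSpan (x := fun l => del^[l] F) hb l
  · intro hf
    have h1 := fieldSpan_map (T := fun f => f * G) (y := iterate g) (fun f h => add_mul f h G)
      (fun b l hb => ?_) hf
    · simpa [mul_assoc, hFG] using h1
    · simp only [← iterate_mul_wave hg hF, mul_assoc, hFG, mul_one]
      exact mul_mem_fieldSpan hb l

end OddGenerator

theorem del_mem_fieldSpan {F f : SuperFn I} (hf : f ∈ fieldSpan fun l => del^[l] F) :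
    del f ∈ fieldSpan fun l => del^[l] F := by
  refine fieldSpan_map del_isSuperDer.add (fun b l hb => ?_) hf
  rw [del_isSuperDer.mul, Function.iterate_one, ← Function.iterate_succ_apply' del l F]
  exact add_mem (mul_mem_fieldSpan (x := fun l => del^[l] F) hb.del l)
    (mul_mem_fieldSpan (x := fun l => del^[l] F) hb.parity (l + 1))

/-- The span of the derivatives of F is stable under δ and under superfields, so it contains every
derivative of E · F. -/
theorem fieldSpan_gauge {E F : SuperFn I} (hE : IsField E) {f : SuperFn I}
    (hf : f ∈ fieldSpan fun l => del^[l] (E * F)) : f ∈ fieldSpan fun l => del^[l] F := by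
  have h : ∀ l, del^[l] (E * F) ∈ fieldSpan fun l => del^[l] F := by
    intro l
    induction l with
    | zero => exact mul_mem_fieldSpan (x := fun l => del^[l] F) hE 0
    | succ l ih => rw [Function.iterate_succ_apply']; exact del_mem_fieldSpan ih
  exact fieldSpan_map (T := id) (fun _ _ => rfl) (fun b l hb => field_mul_mem_fieldSpan hb (h l)) hf

/-! ### Independence of the iterates modulo negative powers of `z` -/

theorem zCoef_mul_tau (m k : ℤ) : zCoef m (zpow k * tau : SuperFn I) =
    (if m = k then theta else 0) + (if m = k + 1 then phi else 0) := by
  rw [zCoef_zpow_mul, tau, zCoef_add, zCoef_mul_zpow]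
  congr 1
  · split_ifs with h
    · rw [h, sub_self, zCoef_zero_of_zconst zconst_theta]
    · exact zCoef_of_ne zconst_theta (by omega)
  · split_ifs with h
    · rw [h, show k + 1 - k - 1 = 0 by ring, zCoef_zero_of_zconst zconst_phi]
    · exact zCoef_of_ne zconst_phi (by omega)

theorem degLE_tau : DegLE 1 (tau : SuperFn I) :=
  (zconst_theta.degLE.mono (by norm_num)).add ((degLE_zpow 1).zconst_mul zconst_phi)

section Leading

variable {g : SuperFn I}

theorem del_sub_zpow (hn : IsNeg (g - tau)) : DegLE (-1) (del g - zpow 1) := by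
  rw [← del_tau, ← del_isSuperDer.sub]
  exact (isNeg_iff.1 hn).del

/-- Two steps of the iteration act as ∂_x + δg with δg = z + V⁻. Multiplication by z raises the
error by one degree, and (δg - z)z^k has degree at most k - 1 = (k + 1) - 2, so the gap of two below
the leading term persists. -/
theorem iterate_even_leading (hg : HasParity 1 g) (hn : IsNeg (g - tau)) (k : ℕ) :
    DegLE (k - 2) (iterate g (2 * k) - zpow k) := by
  induction k with
  | zero =>
    rw [Nat.mul_zero, iterate_zero, Nat.cast_zero, zpow_zero, sub_self]
    exact DegLE.zero
  | succ k ih =>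
    have h1 : iterate g (2 * (k + 1)) - zpow (k + 1 : ℕ) =
        dx (iterate g (2 * k) - zpow k) + (del g - zpow 1) * (iterate g (2 * k) - zpow k) +
          (zpow 1 * (iterate g (2 * k) - zpow k) + (del g - zpow 1) * zpow k) := by
      rw [show 2 * (k + 1) = 2 * k + 2 by ring, iterate_add_two hg, dx_isSuperDer.sub, dx_zpow]
      have h2 : (zpow (k + 1 : ℕ) : SuperFn I) = zpow 1 * zpow k := by
        rw [zpow_mul_zpow]; push_cast; rw [add_comm]
      rw [h2]
      noncomm_ring
    have h3 := del_sub_zpow hn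
    rw [h1]
    refine DegLE.add (DegLE.add ?_ ?_) (DegLE.add ?_ ?_)
    · exact ih.dx.mono (by push_cast; omega)
    · exact (h3.mul ih).mono (by push_cast; omega)
    · exact ((degLE_zpow 1).mul ih).mono (by push_cast; omega)
    · exact (h3.mul (degLE_zpow k)).mono (by push_cast; omega)

/-- The same recursion, started at g = τ + V⁻. Since τ has degree 1 in z, the corrections reach one
degree higher than for the even iterates. -/
theorem iterate_odd_leading (hg : HasParity 1 g) (hn : IsNeg (g - tau)) (k : ℕ) :
    DegLE (k - 1) (iterate g (2 * k + 1) - zpow k * tau) := by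
  induction k with
  | zero =>
    rw [Nat.mul_zero, iterate_one, Nat.cast_zero, zpow_zero, one_mul]
    exact isNeg_iff.1 hn
  | succ k ih =>
    have h1 : iterate g (2 * (k + 1) + 1) - zpow (k + 1 : ℕ) * tau =
        dx (iterate g (2 * k + 1) - zpow k * tau) +
          (del g - zpow 1) * (iterate g (2 * k + 1) - zpow k * tau) +
          (zpow 1 * (iterate g (2 * k + 1) - zpow k * tau) + (del g - zpow 1) * (zpow k * tau)) := by
      rw [show 2 * (k + 1) + 1 = 2 * k + 1 + 2 by ring, iterate_add_two hg, dx_isSuperDer.sub,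
        dx_isSuperDer.mul, dx_zpow, dx_tau]
      have h2 : (zpow (k + 1 : ℕ) : SuperFn I) = zpow 1 * zpow k := by
        rw [zpow_mul_zpow]; push_cast; rw [add_comm]
      rw [h2]
      noncomm_ring
    have h3 := del_sub_zpow hn
    rw [h1]
    refine DegLE.add (DegLE.add ?_ ?_) (DegLE.add ?_ ?_)
    · exact ih.dx.mono (by push_cast; omega)
    · exact (h3.mul ih).mono (by push_cast; omega)
    · exact ((degLE_zpow 1).mul ih).mono (by push_cast; omega)
    · exact (h3.mul ((degLE_zpow k).mul degLE_tau)).mono (by push_cast; omega)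

theorem zCoef_iterate_even (hg : HasParity 1 g) (hn : IsNeg (g - tau)) (k : ℕ) {m : ℤ}
    (hm : k - 1 ≤ m) : zCoef m (iterate g (2 * k)) = if m = k then 1 else 0 := by
  have h := (iterate_even_leading hg hn k).zCoef_eq_zero (show (k : ℤ) - 2 < m by omega)
  rwa [zCoef_sub, sub_eq_zero, zCoef_zpow] at h

theorem zCoef_iterate_odd (hg : HasParity 1 g) (hn : IsNeg (g - tau)) (k : ℕ) {m : ℤ}
    (hm : k ≤ m) : zCoef m (iterate g (2 * k + 1)) =
      (if m = k then theta else 0) + (if m = k + 1 then phi else 0) := by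
  have h := (iterate_odd_leading hg hn k).zCoef_eq_zero (show (k : ℤ) - 1 < m by omega)
  rwa [zCoef_sub, sub_eq_zero, zCoef_mul_tau] at h

/-- The top two coefficients are removed together. The iterate 2M + 1 begins with φz^(M+1) + θz^M,
and the iterate 2M + 2 begins with z^(M+1) and has no z^M. The θ-part at z^M thus isolates b_{2M+1},
and then z^(M+1) isolates b_{2M+2}. The number of terms is odd so that the induction removes such
pairs. -/
theorem coeffs_eq_zero_of_isNeg (hg : HasParity 1 g) (hn : IsNeg (g - tau)) {b : ℕ → SuperFn I}
    (hb : ∀ l, IsField (b l)) (M : ℕ)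
    (h : IsNeg (∑ l ∈ Finset.range (2 * M + 1), b l * iterate g l)) :
    ∀ l < 2 * M + 1, b l = 0 := by
  induction M with
  | zero =>
    intro l hl
    have h1 : IsNeg (b 0) := by simpa [iterate_zero] using h
    have h2 := isNeg_iff_zCoef.1 h1 0 le_rfl
    rw [zCoef_zero_of_zconst (hb 0).zconst] at h2
    rwa [show l = 0 by omega]
  | succ M ih =>
    rw [show 2 * (M + 1) + 1 = 2 * M + 1 + 1 + 1 by ring, Finset.sum_range_succ,
      Finset.sum_range_succ] at h
    set S := ∑ l ∈ Finset.range (2 * M + 1), b l * iterate g l with hS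
    -- The lower iterates do not reach z^(M+1), and at z^M they have no θ-part.
    have z1 : zCoef (M + 1) S = 0 := by
      rw [hS, zCoef_sum]
      refine Finset.sum_eq_zero fun l hl => ?_
      have hl' := Finset.mem_range.1 hl
      rw [zCoef_mul_left (hb l).zconst]
      rcases Nat.even_or_odd' l with ⟨k, hk | hk⟩
      · rw [hk, zCoef_iterate_even hg hn k (by omega), if_neg (by omega), mul_zero]
      · rw [hk, zCoef_iterate_odd hg hn k (by omega), if_neg (by omega), if_neg (by omega),
          add_zero, mul_zero]
    have z2 : thetaCoef (zCoef M S) = 0 := by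
      rw [hS, zCoef_sum, thetaCoef_sum]
      refine Finset.sum_eq_zero fun l hl => ?_
      have hl' := Finset.mem_range.1 hl
      rw [zCoef_mul_left (hb l).zconst, thetaCoef_mul_left (hb l).thetaFree]
      have : thetaCoef (zCoef M (iterate g l)) = 0 := by
        refine thetaCoef_of_free ?_
        rcases Nat.even_or_odd' l with ⟨k, hk | hk⟩
        · rw [hk, zCoef_iterate_even hg hn k (by omega)]
          split_ifs
          · exact oddFree_one _
          · exact oddFree_zero _
        · rw [hk, zCoef_iterate_odd hg hn k (by omega), if_neg (by omega), zero_add]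
          split_ifs
          · exact thetaFree_phi
          · exact oddFree_zero _
      rw [this, mul_zero]
    have h1 := isNeg_iff_zCoef.1 h (M + 1) (by omega)
    have h2 := congrArg thetaCoef (isNeg_iff_zCoef.1 h M (by omega))
    rw [zCoef_add, zCoef_add, z1, zCoef_mul_left (hb _).zconst, zCoef_mul_left (hb _).zconst,
      zCoef_iterate_odd hg hn M (by omega), if_neg (by omega), if_pos rfl,
      show 2 * M + 1 + 1 = 2 * (M + 1) by ring, zCoef_iterate_even hg hn (M + 1) (by push_cast; omega),
      if_pos (by push_cast; rfl)] at h1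
    rw [zCoef_add, zCoef_add, thetaCoef_add, thetaCoef_add, z2, zCoef_mul_left (hb _).zconst,
      zCoef_mul_left (hb _).zconst, thetaCoef_mul_left (hb _).thetaFree,
      thetaCoef_mul_left (hb _).thetaFree,
      zCoef_iterate_odd hg hn M (by omega), if_pos rfl, if_neg (by omega),
      show 2 * M + 1 + 1 = 2 * (M + 1) by ring, zCoef_iterate_even hg hn (M + 1) (by push_cast; omega),
      if_neg (by push_cast; omega), thetaCoef_zero, add_zero, thetaCoef_theta, mul_one, mul_zero,
      zero_add, add_zero] at h2
    rw [h2, zero_mul, zero_add, zero_add, mul_one] at h1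
    rw [show 2 * M + 1 + 1 = 2 * (M + 1) by ring, h1, h2, zero_mul, zero_mul, add_zero,
      add_zero] at h
    intro l hl
    rcases Nat.lt_or_ge l (2 * M + 1) with h3 | h3
    · exact ih h l h3
    · rcases Nat.eq_or_lt_of_le h3 with h4 | h4
      · rw [← h4, h2]
      · rw [show l = 2 * (M + 1) by omega, h1]

/-- W ∩ V⁻ = 0. Uniqueness, parity and the zero-curvature equations of the currents all come from
this. -/
theorem eq_zero_of_mem_fieldSpan_of_isNeg (hg : HasParity 1 g) (hn : IsNeg (g - tau))
    {f : SuperFn I} (hf : f ∈ fieldSpan (iterate g)) (h : IsNeg f) : f = 0 := by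
  obtain ⟨N, b, hb, rfl⟩ := mem_fieldSpan_iff.1 hf
  -- The sum is padded with zero coefficients to the odd length required above.
  have h1 : ∑ l ∈ Finset.range N, b l * iterate g l =
      ∑ l ∈ Finset.range (2 * N + 1), (if l < N then b l else 0) * iterate g l := by
    rw [← Finset.sum_subset (Finset.range_mono (show N ≤ 2 * N + 1 by omega))]
    · refine Finset.sum_congr rfl fun l hl => ?_
      rw [if_pos (Finset.mem_range.1 hl)]
    · intro l _ hl
      rw [if_neg (by simpa using hl), zero_mul]
  rw [h1] at h
  have h2 := coeffs_eq_zero_of_isNeg hg hn (fun l => by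
    split_ifs
    · exact hb l
    · exact isField_zero) N h
  rw [h1]
  refine Finset.sum_eq_zero fun l hl => ?_
  rw [h2 l (Finset.mem_range.1 hl), zero_mul]

/-! ### The currents -/

variable {H : ℕ → SuperFn I}

theorem current_unique (hg : HasParity 1 g) (hn : IsNeg (g - tau)) {v x y : SuperFn I}
    (hx : x ∈ fieldSpan (iterate g)) (hy : y ∈ fieldSpan (iterate g)) (hxv : IsNeg (x - v))
    (hyv : IsNeg (y - v)) : x = y := by
  rw [← sub_eq_zero]
  refine eq_zero_of_mem_fieldSpan_of_isNeg hg hn (sub_mem hx hy) ?_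
  have : x - y = (x - v) - (y - v) := by abel
  rw [this, isNeg_iff]
  exact (isNeg_iff.1 hxv).sub (isNeg_iff.1 hyv)

theorem isCurrents_iff : IsCurrents g H ↔
    ∀ k, H k ∈ fieldSpan (iterate g) ∧ IsNeg (H k - vacuum k) :=
  ⟨fun h k => ⟨inSpan_iff.1 (h k).1, (h k).2⟩, fun h k => ⟨inSpan_iff.2 (h k).1, (h k).2⟩⟩

theorem isCurrents_unique (hg : HasParity 1 g) (hn : IsNeg (g - tau)) {H' : ℕ → SuperFn I}
    (h : IsCurrents g H) (h' : IsCurrents g H') : H = H' := by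
  rw [isCurrents_iff] at h h'
  exact funext fun k => current_unique hg hn (h k).1 (h' k).1 (h k).2 (h' k).2

theorem degLE_neg_one_pow_mul {a : ℤ} {f : SuperFn I} (hf : DegLE a f) (k : ℕ) :
    DegLE a ((-1) ^ k * f) := by
  rcases Nat.even_or_odd k with h | h
  · simpa [h.neg_one_pow] using hf
  · simpa [h.neg_one_pow] using hf.neg

/-- The element (-1)^k `parity (H k)` again lies in W and has the same leading term, so uniqueness
identifies it with the current. -/
theorem current_hasParity (hg : HasParity 1 g) (hn : IsNeg (g - tau)) (h : IsCurrents g H)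
    (k : ℕ) : HasParity k (H k) := by
  rw [isCurrents_iff] at h
  have h1 : (-1) ^ k * parity (H k) = H k := by
    refine current_unique hg hn (v := vacuum k) ?_ (h k).1 ?_ (h k).2
    · have h2 := parity_mem_fieldSpan hg (h k).1
      rcases Nat.even_or_odd k with h' | h'
      · simpa [h'.neg_one_pow] using h2
      · simpa [h'.neg_one_pow] using h2
    · have h3 : (-1) ^ k * parity (H k) - vacuum k = (-1) ^ k * parity (H k - vacuum k) := by
        rw [parity_sub, hasParity_iff.1 (vacuum_hasParity k), mul_sub, neg_one_pow_mul_self]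
      rw [h3, isNeg_iff]
      exact degLE_neg_one_pow_mul (isNeg_iff.1 (h k).2).parity k
  rw [hasParity_iff, ← neg_one_pow_mul_self k (parity (H k)), h1]

/-- Here δg = (δ + g)²·1 lies in W and equals z up to V⁻. This makes the second flow the translation
in x. -/
theorem current_two (hg : HasParity 1 g) (hn : IsNeg (g - tau)) (h : IsCurrents g H) :
    H 2 = del g := by
  rw [isCurrents_iff] at h
  refine current_unique hg hn (h 2).1 ?_ (h 2).2 ?_
  · rw [← iterate_two hg]
    exact self_mem_fieldSpan _ 2
  · rw [isNeg_iff, show (vacuum 2 : SuperFn I) = zpow 1 from vacuum_two_mul 1]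
    exact del_sub_zpow hn

end Leading

/-- The covariant `t_n`-derivative preserves the span of the iterates. -/
theorem nabla_mem_fieldSpan {g h : SuperFn I} {n : ℕ} (hg : HasParity 1 g) (hh : HasParity n h)
    (hmem : h ∈ fieldSpan (iterate g)) (flow : dt n g = (-1) ^ n * del h) {f : SuperFn I}
    (hf : f ∈ fieldSpan (iterate g)) : dt n f + h * f ∈ fieldSpan (iterate g) := by
  -- The flow equation is exactly the statement that ∂_n + h and δ + g supercommute.
  have comm : ∀ f, dt n (del f + g * f) + h * (del f + g * f) =
      (-1) ^ n * (del (dt n f + h * f) + g * (dt n f + h * f)) := by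
    intro f
    have h1 : h * (g * f) = (-1) ^ n * (g * (h * f)) := by
      rw [← mul_assoc, hh.comm_mul hg, mul_one]
      simp only [mul_assoc]
    rw [(dt_isSuperDer n).add, dt_del, (dt_isSuperDer n).mul_of_hasParity hg, flow, one_mul,
      mul_add h, h1, del_isSuperDer.add, del_isSuperDer.mul_of_hasParity hh, mul_one, mul_add g]
    simp only [mul_add, neg_one_pow_mul_self, mul_assoc]
    abel
  have hit : ∀ l, dt n (iterate g l) + h * iterate g l ∈ fieldSpan (iterate g) := by
    intro l
    induction l with
    | zero => rwa [iterate_zero, (dt_isSuperDer n).one, zero_add, mul_one]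
    | succ l ih =>
      rw [iterate_succ, comm]
      have := cov_mem_fieldSpan hg ih
      rcases Nat.even_or_odd n with h' | h'
      · simpa [h'.neg_one_pow] using this
      · rw [h'.neg_one_pow, neg_one_mul]
        exact neg_mem this
  refine fieldSpan_map (T := fun f => dt n f + h * f) (fun f k => ?_) (fun b l hb => ?_) hf
  · simp only [(dt_isSuperDer n).add, mul_add]
    abel
  · have h1 : dt n (b * iterate g l) + h * (b * iterate g l) =
        dt n b * iterate g l + parity^[n] b * (dt n (iterate g l) + h * iterate g l) := by
      rw [(dt_isSuperDer n).mul, ← mul_assoc h, hh.super_comm, mul_add, mul_assoc, add_assoc]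
    simp only [h1]
    exact add_mem (mul_mem_fieldSpan (hb.dt n) l)
      (field_mul_mem_fieldSpan (hb.iterate_parity n) (hit l))

/-- The elements (∂_n + H^(n))H^(j) and (∂_j + H^(j))H^(n) lie in W. In their signed difference the
products cancel because the currents have definite parity. What remains lies in V⁻, since the vacuum
parts do not depend on the times, so it is 0. -/
theorem zero_curvature {g : SuperFn I} {H : ℕ → SuperFn I} (hg : HasParity 1 g)
    (hn : IsNeg (g - tau)) (hH : IsCurrents g H)
    (flow : ∀ k, 0 < k → dt k g = (-1) ^ k * del (H k)) {j n : ℕ} (hj : 0 < j) (hn' : 0 < n) :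
    dt n (H j) = (-1) ^ (j * n) * dt j (H n) := by
  have hp := current_hasParity hg hn hH
  have hm := isCurrents_iff.1 hH
  have h1 := nabla_mem_fieldSpan hg (hp n) (hm n).1 (flow n hn') (hm j).1
  have h2 := nabla_mem_fieldSpan hg (hp j) (hm j).1 (flow j hj) (hm n).1
  have h3 : dt n (H j) - (-1) ^ (j * n) * dt j (H n) =
      (dt n (H j) + H n * H j) - (-1) ^ (j * n) * (dt j (H n) + H j * H n) := by
    have h6 : H n * H j = (-1) ^ (j * n) * (H j * H n) := by
      rw [mul_comm j n]
      exact (hp n).comm_mul (hp j)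
    rw [mul_add, ← h6]
    abel
  have h4 : (-1) ^ (j * n) * (dt j (H n) + H j * H n) ∈ fieldSpan (iterate g) := by
    rcases Nat.even_or_odd (j * n) with h' | h'
    · simpa [h'.neg_one_pow] using h2
    · rw [h'.neg_one_pow, neg_one_mul]
      exact neg_mem h2
  rw [← sub_eq_zero]
  refine eq_zero_of_mem_fieldSpan_of_isNeg hg hn (h3 ▸ sub_mem h1 h4) ?_
  have h5 : ∀ i k, DegLE (-1) (dt i (H k)) := by
    intro i k
    have := (isNeg_iff.1 (hm k).2).dt i
    rwa [(dt_isSuperDer i).sub, dt_vacuum, sub_zero] at this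
  rw [isNeg_iff]
  exact (h5 n j).sub (degLE_neg_one_pow_mul (h5 j n) _)

end
end SuperKP

/-! ### The Poincaré lemma -/

namespace GrassmannPowerSeries

open GrassmannSeries

variable {O K : Type*} [LinearOrder O] [CommRing K] [Algebra ℂ K]

/-- The possible values at `(n, S)` of a primitive of the closed form with components `b i` in the
even directions and `c o` in the odd directions satisfying `P`. -/
def primitiveValues (P : O → Prop) (b : ℕ → Ser O K) (c : O → Ser O K) (n : ℕ →₀ ℕ)
    (S : Finset O) : Set K :=
  {y | (∃ i, n i ≠ 0 ∧ y = ((n i : ℂ)⁻¹) • b i (n - Finsupp.single i 1) S) ∨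
    ∃ o ∈ S, P o ∧ y = (-1) ^ inversions {o} (S.erase o) * c o n (S.erase o)}

variable {P : O → Prop} {b : ℕ → Ser O K} {c : O → Ser O K}

/-- Two recipes for the same coefficient agree by closedness at the exponent n - e_i - e_j. Division
by n_i and n_j is why K is a ℂ-algebra. -/
theorem even_even_values (h : ∀ i j, dEven i (b j) = dEven j (b i)) {n : ℕ →₀ ℕ} {i j : ℕ}
    (hi : n i ≠ 0) (hj : n j ≠ 0) (S : Finset O) :
    ((n i : ℂ)⁻¹) • b i (n - Finsupp.single i 1) S =
      ((n j : ℂ)⁻¹) • b j (n - Finsupp.single j 1) S := by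
  rcases eq_or_ne i j with rfl | hij
  · rfl
  have e1 : n - Finsupp.single i 1 - Finsupp.single j 1 + Finsupp.single i 1 =
      n - Finsupp.single j 1 := by
    ext k
    simp only [Finsupp.coe_add, Finsupp.coe_tsub, Pi.add_apply, Pi.sub_apply, Finsupp.single_apply]
    split_ifs <;> subst_vars <;> omega
  have e2 : n - Finsupp.single i 1 - Finsupp.single j 1 + Finsupp.single j 1 =
      n - Finsupp.single i 1 := by
    ext k
    simp only [Finsupp.coe_add, Finsupp.coe_tsub, Pi.add_apply, Pi.sub_apply, Finsupp.single_apply]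
    split_ifs <;> subst_vars <;> omega
  have h1 := congrFun (congrFun (h i j) (n - Finsupp.single i 1 - Finsupp.single j 1)) S
  have h2 : (n i : ℕ) • b j (n - Finsupp.single j 1) S =
      (n j : ℕ) • b i (n - Finsupp.single i 1) S := by
    have e3 : (n - Finsupp.single i 1 - Finsupp.single j 1 : ℕ →₀ ℕ) i + 1 = n i := by
      simp [hij.symm]
      omega
    have e4 : (n - Finsupp.single i 1 - Finsupp.single j 1 : ℕ →₀ ℕ) j + 1 = n j := by
      simp [hij]
      omega
    rw [dEven_apply, dEven_apply, e1, e2, e3, e4] at h1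
    exact h1
  have hi' : (n i : ℂ) ≠ 0 := by exact_mod_cast hi
  have hj' : (n j : ℂ) ≠ 0 := by exact_mod_cast hj
  rw [← Nat.cast_smul_eq_nsmul ℂ, ← Nat.cast_smul_eq_nsmul ℂ] at h2
  have h3 : ((n i : ℂ)) • ((n j : ℂ)⁻¹) • b j (n - Finsupp.single j 1) S =
      b i (n - Finsupp.single i 1) S := by
    rw [smul_comm, h2, inv_smul_smul₀ hj']
  rw [inv_smul_eq_iff₀ hi', h3]

theorem even_odd_values {o : O} {i : ℕ} (h : dEven i (c o) = dOdd o (b i)) {n : ℕ →₀ ℕ}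
    (hi : n i ≠ 0) {S : Finset O} (ho : o ∈ S) :
    ((n i : ℂ)⁻¹) • b i (n - Finsupp.single i 1) S =
      (-1) ^ inversions {o} (S.erase o) * c o n (S.erase o) := by
  have e1 : n - Finsupp.single i 1 + Finsupp.single i 1 = n := by
    ext k
    simp only [Finsupp.coe_add, Finsupp.coe_tsub, Pi.add_apply, Pi.sub_apply, Finsupp.single_apply]
    split_ifs <;> subst_vars <;> omega
  have h1 := congrFun (congrFun h (n - Finsupp.single i 1)) (S.erase o)
  have e3 : (n - Finsupp.single i 1 : ℕ →₀ ℕ) i + 1 = n i := by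
    simp
    omega
  have h2 : (n i : ℕ) • c o n (S.erase o) =
      (-1) ^ inversions {o} (S.erase o) * b i (n - Finsupp.single i 1) S := by
    rw [dEven_apply, e1, e3] at h1
    rw [dOdd_apply, if_neg (Finset.notMem_erase o S), Finset.insert_erase ho] at h1
    exact h1
  have hi' : (n i : ℂ) ≠ 0 := by exact_mod_cast hi
  rw [← Nat.cast_smul_eq_nsmul ℂ] at h2
  rw [inv_smul_eq_iff₀ hi', ← mul_smul_comm, h2, ← mul_assoc, ← mul_pow]
  simp

/-- Closedness is used at S with both o and p removed; the two ways of taking them out of S differ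
by a transposition, matching the minus sign of the hypothesis. -/
theorem odd_odd_values {o p : O} (h : dOdd o (c p) = -dOdd p (c o)) {n : ℕ →₀ ℕ} {S : Finset O}
    (ho : o ∈ S) (hp : p ∈ S) :
    (-1) ^ inversions {o} (S.erase o) * c o n (S.erase o) =
      (-1) ^ inversions {p} (S.erase p) * c p n (S.erase p) := by
  rcases eq_or_ne o p with rfl | hop
  · rfl
  set T := (S.erase o).erase p with hT
  have hT' : T = (S.erase p).erase o := Finset.erase_right_comm
  have hpT : p ∉ T := Finset.notMem_erase _ _
  have hoT : o ∉ T := by rw [hT']; exact Finset.notMem_erase _ _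
  have e1 : S.erase o = insert p T :=
    (Finset.insert_erase (Finset.mem_erase.2 ⟨hop.symm, hp⟩)).symm
  have e2 : S.erase p = insert o T := by
    rw [hT']
    exact (Finset.insert_erase (Finset.mem_erase.2 ⟨hop, ho⟩)).symm
  have h1 := congrFun (congrFun h n) T
  have h2 : (-1) ^ inversions {o} T * c p n (insert o T) =
      -((-1) ^ inversions {p} T * c o n (insert p T)) := by
    have h3 : dOdd o (c p) n T = -(dOdd p (c o) n T) := h1
    rwa [dOdd_apply, dOdd_apply, if_neg hoT, if_neg hpT] at h3
  rw [e1, e2, inversions_insert_right hpT, inversions_insert_right hoT]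
  have h4 := inversions_singleton_add (o := o) (S := {p}) (by simpa using hop)
  rw [Finset.card_singleton] at h4
  have sq : ∀ k : ℕ, ((-1 : K) ^ k) * (-1) ^ k = 1 := fun k => by rw [← mul_pow]; simp
  have h5 : c p n (insert o T) =
      -((-1) ^ inversions {o} T * (-1) ^ inversions {p} T * c o n (insert p T)) := by
    linear_combination (-1) ^ inversions {o} T * h2 - c p n (insert o T) * sq (inversions {o} T)
  rw [h5, pow_add, pow_add]
  -- Either o < p or p < o; in each case one extra sign remains.
  rcases Nat.eq_zero_or_pos (inversions {o} {p}) with h6 | h6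
  · rw [h6, show inversions {p} {o} = 1 by omega]
    linear_combination (-((-1) ^ inversions {o} T * c o n (insert p T))) * sq (inversions {p} T)
  · rw [show inversions {o} {p} = 1 by omega, show inversions {p} {o} = 0 by omega]
    linear_combination ((-1) ^ inversions {o} T * c o n (insert p T)) * sq (inversions {p} T)

/-- A closed form has a primitive, and its coefficients are multiples of those of the form. -/
theorem exists_primitive (hee : ∀ i j, dEven i (b j) = dEven j (b i))
    (heo : ∀ i o, P o → dEven i (c o) = dOdd o (b i))
    (hoo : ∀ o p, P o → P p → dOdd o (c p) = -dOdd p (c o)) (hs : ∀ o, P o → dOdd o (c o) = 0) :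
    ∃ L : Ser O K, (∀ i, dEven i L = b i) ∧ (∀ o, P o → dOdd o L = c o) ∧ L 0 ∅ = 0 ∧
      ∀ n S, L n S = 0 ∨ L n S ∈ primitiveValues P b c n S := by
  classical
  have huniq : ∀ n S, (primitiveValues P b c n S).Subsingleton := by
    rintro n S y (⟨i, hi, rfl⟩ | ⟨o, ho, hP, rfl⟩) y' (⟨j, hj, rfl⟩ | ⟨p, hp, hP', rfl⟩)
    · exact even_even_values hee hi hj S
    · exact even_odd_values (heo i p hP') hi hp
    · exact (even_odd_values (heo j o hP) hj ho).symm
    · exact odd_odd_values (hoo o p hP hP') ho hp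
  -- Any candidate value is taken, `huniq` making the choice immaterial. Where there is none, namely
  -- at monomials built only from odd variables outside P, the value is 0.
  let L : Ser O K := fun n S =>
    if h : (primitiveValues P b c n S).Nonempty then h.choose else 0
  have hL : ∀ n S y, y ∈ primitiveValues P b c n S → L n S = y := by
    intro n S y hy
    have h : (primitiveValues P b c n S).Nonempty := ⟨y, hy⟩
    have h1 : L n S = h.choose := dif_pos h
    rw [h1]
    exact huniq n S h.choose_spec hy
  refine ⟨L, fun i => ?_, fun o ho => ?_, ?_, fun n S => ?_⟩
  · funext n
    refine GrassmannSeries.ext fun S => ?_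
    have h1 : (n + Finsupp.single i 1 : ℕ →₀ ℕ) i = n i + 1 := by simp
    have h2 := hL (n + Finsupp.single i 1) S _ (Or.inl ⟨i, by omega, rfl⟩)
    rw [h1, add_tsub_cancel_right] at h2
    rw [dEven_apply]
    change (n i + 1) • L (n + Finsupp.single i 1) S = b i n S
    have h3 : ((n i + 1 : ℕ) : ℂ) ≠ 0 := by exact_mod_cast Nat.succ_ne_zero (n i)
    rw [h2, ← Nat.cast_smul_eq_nsmul ℂ, smul_inv_smul₀ h3]
  · funext n
    refine GrassmannSeries.ext fun S => ?_
    rw [dOdd_apply]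
    split_ifs with h
    · have h1 := congrFun (congrFun (hs o ho) n) (S.erase o)
      rw [dOdd_apply, if_neg (Finset.notMem_erase o S), Finset.insert_erase h] at h1
      have h2 : (-1) ^ inversions {o} (S.erase o) * c o n S = 0 := h1
      have h3 := congrArg (fun y => (-1) ^ inversions {o} (S.erase o) * y) h2
      simp only [← mul_assoc, ← mul_pow] at h3
      simpa using h3.symm
    · have h2 := hL n (insert o S) _ (Or.inr ⟨o, Finset.mem_insert_self o S, ho, rfl⟩)
      rw [Finset.erase_insert h] at h2
      rw [h2, ← mul_assoc, ← mul_pow]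
      simp
  · refine dif_neg ?_
    rintro ⟨y, ⟨i, hi, -⟩ | ⟨o, ho, -⟩⟩
    · exact hi rfl
    · exact absurd ho (Finset.notMem_empty o)
  · by_cases h : (primitiveValues P b c n S).Nonempty
    · right
      have h1 : L n S = h.choose := dif_pos h
      rw [h1]
      exact h.choose_spec
    · exact Or.inl (dif_neg h)

end GrassmannPowerSeries

namespace SuperKP

noncomputable section

open scoped Sealed

variable {I : Type*} [LinearOrder I]

/-! ### Inverses -/

theorem eq_zero_of_degLE {f : SuperFn I} (h : ∀ k : ℕ, DegLE (-k) f) : f = 0 :=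
  coef_ext fun n S m => h (m.natAbs + 1) n S m (by omega)

theorem DegLE.pow {x : SuperFn I} (hx : DegLE (-1) x) (k : ℕ) : DegLE (-k) (x ^ k) := by
  induction k with
  | zero => simpa using zconst_one.degLE
  | succ k ih =>
    rw [pow_succ]
    exact (ih.mul hx).mono (by push_cast; omega)

/-- The sum of a sequence whose `k`-th term has degree at most `-k`. -/
theorem exists_adic_sum {x : ℕ → SuperFn I} (hx : ∀ k : ℕ, DegLE (-k) (x k)) :
    ∃ y : SuperFn I, ∀ K : ℕ, DegLE (-K) (y - ∑ k ∈ Finset.range K, x k) := by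
  have h0 : ∀ m : ℤ, 0 < m →
      zCoef m (∑ k ∈ Finset.range (m.natAbs + 1), x k) = 0 := by
    intro m hm
    rw [zCoef_sum]
    exact Finset.sum_eq_zero fun k _ => (hx k).zCoef_eq_zero (by omega)
  -- Terms with k > |m| have degree below m, so |m| + 1 terms already determine the coefficient of
  -- z^m.
  refine ⟨zSeries fun m => zCoef m (∑ k ∈ Finset.range (m.natAbs + 1), x k), fun K => ?_⟩
  rw [degLE_iff]
  intro m hm
  rw [zCoef_sub, zCoef_zSeries h0 (fun m => zconst_zCoef _ _), zCoef_sum, zCoef_sum, sub_eq_zero]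
  rcases le_or_gt K (m.natAbs + 1) with h | h
  · symm
    refine Finset.sum_subset (Finset.range_mono h) fun k _ hk => ?_
    rw [Finset.mem_range, not_lt] at hk
    exact (hx k).zCoef_eq_zero (by omega)
  · refine Finset.sum_subset (Finset.range_mono h.le) fun k _ hk => ?_
    rw [Finset.mem_range, not_lt] at hk
    exact (hx k).zCoef_eq_zero (by omega)

/-- The geometric series in 1 - g, which has degree at most -1, converges coefficientwise in z. -/
theorem exists_inverse {g : SuperFn I} (hg : IsNeg (g - 1)) :
    ∃ y : SuperFn I, g * y = 1 ∧ y * g = 1 ∧ IsNeg (y - 1) := by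
  obtain ⟨x, hx⟩ : ∃ x, x = 1 - g := ⟨_, rfl⟩
  have hx1 : DegLE (-1) x := by
    have : x = -(g - 1) := by rw [hx]; abel
    rw [this]
    exact (isNeg_iff.1 hg).neg
  have hgx : g = 1 - x := by rw [hx]; abel
  obtain ⟨y, hy⟩ := exists_adic_sum hx1.pow
  have hg0 : DegLE 0 g := by
    rw [hgx]
    exact zconst_one.degLE.sub (hx1.mono (by omega))
  refine ⟨y, ?_, ?_, ?_⟩
  · rw [← sub_eq_zero]
    refine eq_zero_of_degLE fun K => ?_
    have h : g * y - 1 = g * (y - ∑ k ∈ Finset.range K, x ^ k) - x ^ K := by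
      rw [mul_sub, hgx, mul_neg_geom_sum]
      abel
    rw [h]
    exact ((hg0.mul (hy K)).mono (by omega)).sub (hx1.pow K)
  · rw [← sub_eq_zero]
    refine eq_zero_of_degLE fun K => ?_
    have h : y * g - 1 = (y - ∑ k ∈ Finset.range K, x ^ k) * g - x ^ K := by
      rw [sub_mul, hgx, geom_sum_mul_neg]
      abel
    rw [h]
    exact (((hy K).mul hg0).mono (by omega)).sub (hx1.pow K)
  · rw [isNeg_iff]
    simpa using hy 1

theorem isUnit_of_isNeg {g : SuperFn I} (hg : IsNeg (g - 1)) : IsUnit g := by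
  obtain ⟨y, h1, h2, -⟩ := exists_inverse hg
  exact ⟨⟨g, y, h1, h2⟩, rfl⟩

theorem even_of_mul_eq_one {g y : SuperFn I} (hg : HasParity 0 g) (h : g * y = 1) :
    HasParity 0 y := by
  have h1 : g * parity y = 1 := by
    rw [← hasParity_zero_iff.1 hg, ← parity_mul, h, parity_one]
  have h2 : y * g = 1 := by rw [← hg.comm, h]
  rw [hasParity_zero_iff]
  calc parity y = y * g * parity y := by rw [h2, one_mul]
    _ = y := by rw [mul_assoc, h1, mul_one]

end
end SuperKP

namespace SuperKP

noncomputable section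

open scoped Sealed

variable {I : Type*} [LinearOrder I]

/-! ### The super Leibniz rule -/

namespace PsiDO

theorem superBinom_def (k : ℤ) (i : ℕ) :
    superBinom k i = if Even k ∧ Odd i then 0 else Ring.choose (k / 2) (i / 2) := rfl

theorem superBinom_zero (k : ℤ) : superBinom k 0 = 1 := by
  rw [superBinom_def, if_neg (by simp)]
  simp

theorem superBinom_zero_left (i : ℕ) : superBinom 0 (i + 1) = 0 := by
  rw [superBinom_def]
  split_ifs with h
  · rfl
  · have h1 : ¬ Odd (i + 1) := fun h' => h ⟨Even.zero, h'⟩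
    rw [Nat.not_odd_iff_even] at h1
    obtain ⟨j, hj⟩ := h1
    have h2 : (i + 1) / 2 = (j - 1) + 1 := by omega
    rw [h2]
    simp

/-- Pascal's rule for δ^(k+1) = δ ∘ δ^k. Only the case of k and i both odd uses the ordinary Pascal
rule, for binomials with an integer upper entry; in the others one term vanishes or two cancel. -/
theorem superBinom_succ (k : ℤ) (i : ℕ) :
    superBinom (k + 1) (i + 1) = superBinom k i + (-1) ^ (i + 1) * superBinom k (i + 1) := by
  simp only [superBinom_def]
  rcases Int.even_or_odd' k with ⟨a, rfl | rfl⟩ <;> rcases Nat.even_or_odd' i with ⟨b, rfl | rfl⟩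
  · have h1 : ¬ Even (2 * a + 1) := by simp
    have h2 : Odd (2 * b + 1) := by simp
    have h3 : ¬ Odd (2 * b) := by simp
    rw [if_neg (fun h => h1 h.1), if_neg (fun h => h3 h.2), if_pos ⟨by simp, h2⟩, mul_zero,
      add_zero]
    congr 1 <;> omega
  · have h1 : ¬ Even (2 * a + 1) := by simp
    have h2 : Odd (2 * b + 1) := by simp
    have h3 : ¬ Odd (2 * b + 1 + 1) := by simp [parity_simps]
    have h4 : Even (2 * b + 1 + 1) := by simp [parity_simps]
    rw [if_neg (fun h => h1 h.1), if_pos ⟨by simp, h2⟩, if_neg (fun h => h3 h.2), h4.neg_one_pow,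
      one_mul, zero_add]
    congr 1
    omega
  · have h1 : ¬ Even (2 * a + 1) := by simp
    have h2 : Odd (2 * b + 1) := by simp
    rw [if_pos ⟨by simp [parity_simps], h2⟩, if_neg (fun h => h1 h.1), if_neg (fun h => h1 h.1),
      h2.neg_one_pow, show (2 * b + 1) / 2 = 2 * b / 2 by omega]
    ring
  · have h1 : ¬ Even (2 * a + 1) := by simp
    have h3 : ¬ Odd (2 * b + 1 + 1) := by simp [parity_simps]
    have h4 : Even (2 * b + 1 + 1) := by simp [parity_simps]
    rw [if_neg (fun h => h3 h.2), if_neg (fun h => h1 h.1), if_neg (fun h => h1 h.1),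
      h4.neg_one_pow, one_mul, show (2 * a + 1 + 1) / 2 = (2 * a + 1) / 2 + 1 by omega,
      show (2 * b + 1 + 1) / 2 = (2 * b + 1) / 2 + 1 by omega, Ring.choose_succ_succ]

theorem leibniz_def (k : ℤ) (i : ℕ) (b : SuperFn I) :
    leibniz k i b = superBinom k i • del^[i] (if Even (k - i) then b else parity b) := rfl

theorem iterate_additive {A : Type*} [Add A] {P : A → A} (hP : ∀ f g, P (f + g) = P f + P g)
    (i : ℕ) (f g : A) : P^[i] (f + g) = P^[i] f + P^[i] g := by
  induction i with
  | zero => rfl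
  | succ i ih => rw [Function.iterate_succ_apply', Function.iterate_succ_apply',
      Function.iterate_succ_apply', ih, hP]

theorem leibniz_add (k : ℤ) (i : ℕ) (b c : SuperFn I) :
    leibniz k i (b + c) = leibniz k i b + leibniz k i c := by
  simp only [leibniz_def]
  rw [← smul_add, ← iterate_additive del_isSuperDer.add]
  split_ifs
  · rfl
  · rw [parity_add]

theorem leibniz_zero (k : ℤ) (i : ℕ) : leibniz k i (0 : SuperFn I) = 0 :=
  additive_zero (leibniz_add k i)

theorem isField_leibniz {b : SuperFn I} (hb : IsField b) (k : ℤ) (i : ℕ) :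
    IsField (leibniz k i b) := by
  rw [leibniz_def]
  refine IsField.zsmul (IsField.iterate_del ?_ i) _
  split_ifs
  · exact hb
  · exact hb.parity

theorem parity_del (f : SuperFn I) : parity (del f) = -del (parity f) := by
  rw [del_isSuperDer.parity, pow_one, neg_one_mul, neg_neg]

theorem parity_iterate_del (i : ℕ) (f : SuperFn I) :
    parity (del^[i] f) = (-1) ^ i * del^[i] (parity f) := by
  induction i with
  | zero => simp
  | succ i ih =>
    rw [Function.iterate_succ_apply', parity_del, ih, del_isSuperDer.neg_one_pow_mul,
      Function.iterate_succ_apply', pow_succ]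
    simp

theorem neg_one_pow_mul_eq_zsmul (i : ℕ) (f : SuperFn I) : (-1) ^ i * f = ((-1) ^ i : ℤ) • f := by
  rcases Nat.even_or_odd i with h | h <;> simp [h.neg_one_pow]

theorem leibniz_succ_zero (k : ℤ) (b : SuperFn I) :
    leibniz (k + 1) 0 b = parity (leibniz k 0 b) := by
  simp only [leibniz_def, superBinom_zero, one_smul, Function.iterate_zero, id_eq]
  simp only [Nat.cast_zero, sub_zero, Int.even_add_one]
  by_cases h : Even k
  · simp [h]
  · simp [h, parity_parity]

theorem del_zsmul (m : ℤ) (f : SuperFn I) : del (m • f) = m • del f :=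
  additive_zsmul del_isSuperDer.add m f

theorem parity_zsmul (m : ℤ) (f : SuperFn I) : parity (m • f) = m • parity f :=
  additive_zsmul parity_add m f

/-- The recursion expressing δ ∘ bδ^j = (δb)δ^j + `parity b` δ^(j+1). It determines the passage from
δ^k to δ^(k+1), and associativity rests on it rather than on the closed form of the coefficients. -/
theorem leibniz_succ_succ (k : ℤ) (i : ℕ) (b : SuperFn I) :
    leibniz (k + 1) (i + 1) b = del (leibniz k i b) + parity (leibniz k (i + 1) b) := by
  simp only [leibniz_def]
  have h1 : k + 1 - ((i + 1 : ℕ) : ℤ) = k - i := by push_cast; ring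
  have h2 : parity (if Even (k - ((i + 1 : ℕ) : ℤ)) then b else parity b) =
      if Even (k - i) then b else parity b := by
    have h3 : k - i = k - ((i + 1 : ℕ) : ℤ) + 1 := by push_cast; ring
    rw [h3]
    by_cases h : Even (k - ((i + 1 : ℕ) : ℤ))
    · rw [if_pos h, if_neg (by rwa [Int.even_add_one, not_not])]
    · rw [if_neg h, if_pos (by rwa [Int.even_add_one]), parity_parity]
  rw [del_zsmul, parity_zsmul, parity_iterate_del, h2, h1,
    superBinom_succ, add_smul, ← Function.iterate_succ_apply' del, neg_one_pow_mul_eq_zsmul, smul_smul,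
    mul_comm (superBinom k (i + 1))]

theorem leibniz_zero_left (i : ℕ) (b : SuperFn I) :
    leibniz 0 i b = if i = 0 then b else 0 := by
  cases i with
  | zero => simp [leibniz_def, superBinom_zero]
  | succ i => rw [leibniz_def, superBinom_zero_left, zero_smul, if_neg (Nat.succ_ne_zero i)]

/-! ### Operators of bounded order -/

/-- The order of `A` is at most `N`. -/
def OrderLE (N : ℤ) (A : PsiDO I) : Prop := ∀ k, N < k → A k = 0

theorem isPsiDO_iff {A : PsiDO I} : IsPsiDO A ↔ (∀ k, IsField (A k)) ∧ ∃ N, OrderLE N A := Iff.rfl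

variable {A B C : PsiDO I} {M N : ℤ}

theorem OrderLE.mono (h : OrderLE N A) (hNM : N ≤ M) : OrderLE M A := fun k hk => h k (by omega)

/-- The product `δ ^ k ∘ B`. -/
def delPow (k : ℤ) (B : PsiDO I) : PsiDO I := fun n =>
  ∑ᶠ i : ℕ, leibniz k i (B (n - k + i))

theorem delPow_eq_sum (hB : OrderLE M B) {k n : ℤ} {K : ℕ} (hK : M + k < n + K) :
    delPow k B n = ∑ i ∈ Finset.range K, leibniz k i (B (n - k + i)) := by
  refine finsum_eq_sum_of_support_subset _ fun i hi => ?_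
  by_contra h
  apply hi
  simp only [Finset.coe_range, Set.mem_Iio, not_lt] at h
  simp only
  rw [hB _ (by omega), leibniz_zero]

theorem OrderLE.delPow (hB : OrderLE M B) (k : ℤ) : OrderLE (M + k) (delPow k B) := fun n hn => by
  rw [delPow_eq_sum hB (K := 0) (by simpa using hn), Finset.sum_range_zero]

theorem isField_delPow (hB : OrderLE M B) (hf : ∀ k, IsField (B k)) (k n : ℤ) :
    IsField (delPow k B n) := by
  rw [delPow_eq_sum hB (K := (M + k - n + 1).toNat) (by omega)]
  exact IsField.sum fun i _ => isField_leibniz (hf _) k i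

/-- The product `δ ∘ A`. -/
def delComp (A : PsiDO I) : PsiDO I := fun n => del (A n) + parity (A (n - 1))

theorem delComp_apply (A : PsiDO I) (n : ℤ) : delComp A n = del (A n) + parity (A (n - 1)) := rfl

theorem delComp_delPow (hB : OrderLE M B) (k : ℤ) : delComp (delPow k B) = delPow (k + 1) B := by
  funext n
  set K := (M + k - n + 1).toNat with hK
  rw [delComp_apply, delPow_eq_sum hB (K := K) (by omega),
    delPow_eq_sum hB (K := K + 1) (by push_cast; omega),
    delPow_eq_sum hB (K := K + 1) (by push_cast; omega), Finset.sum_range_succ',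
    Finset.sum_range_succ', parity_add, del_isSuperDer.sum, parity_sum, ← add_assoc,
    ← Finset.sum_add_distrib]
  congr 1
  · refine Finset.sum_congr rfl fun i _ => ?_
    rw [show n - 1 - k + ((i + 1 : ℕ) : ℤ) = n - k + i by push_cast; ring,
      show n - (k + 1) + ((i + 1 : ℕ) : ℤ) = n - k + i by push_cast; ring, leibniz_succ_succ]
  · rw [leibniz_succ_zero]
    congr 3
    ring

theorem delPow_zero (hB : OrderLE M B) : delPow 0 B = B := by
  funext n
  rw [delPow_eq_sum hB (K := (M - n + 1).toNat + 1) (by push_cast; omega), Finset.sum_eq_single 0]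
  · rw [leibniz_zero_left, if_pos rfl]
    congr 1
    push_cast
    ring
  · intro i _ hi
    rw [leibniz_zero_left, if_neg hi]
  · simp

theorem parity_injective {f g : SuperFn I} (h : parity f = parity g) : f = g := by
  rw [← parity_parity f, h, parity_parity]

/-- The coefficient of order n of δ ∘ A determines A_{n-1} once A_n is known, so A is recovered
downwards from above its order. This extends identities from δ^k to negative k. -/
theorem delComp_injective (hA : OrderLE N A) (hB : OrderLE N B) (h : delComp A = delComp B) :
    A = B := by
  have key : ∀ j : ℕ, A (N + 1 - j) = B (N + 1 - j) := by
    intro j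
    induction j with
    | zero => rw [hA _ (by simp), hB _ (by simp)]
    | succ j ih =>
      have h1 := congrFun h (N + 1 - j)
      rw [delComp_apply, delComp_apply, ih, add_right_inj] at h1
      rw [show N + 1 - ((j + 1 : ℕ) : ℤ) = N + 1 - j - 1 by push_cast; ring]
      exact parity_injective h1
  funext n
  rcases lt_or_ge N n with h1 | h1
  · rw [hA n h1, hB n h1]
  · rw [show n = N + 1 - ((N + 1 - n).toNat : ℤ) by omega]
    exact key _

/-! ### Products -/

theorem comp_apply (A B : PsiDO I) (n : ℤ) : comp A B n = ∑ᶠ p : ℤ × ℤ,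
    if n ≤ p.1 + p.2 then A p.1 * leibniz p.1 (p.1 + p.2 - n).toNat (B p.2) else 0 := rfl

/-- Only orders k ≤ N of A occur, and δ^k ∘ B reaches order n only for k ≥ n - M. The interval may
be enlarged, which lets several products be summed over a common range. -/
theorem comp_eq_sum (hA : OrderLE N A) (hB : OrderLE M B) {a b n : ℤ} (ha : a ≤ n - M)
    (hb : N ≤ b) : comp A B n = ∑ k ∈ Finset.Icc a b, A k * delPow k B n := by
  set K := (M + b - n + 1).toNat with hK
  set s := Finset.Icc a b ×ˢ Finset.Icc (n - b) (n - a + K) with hs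
  rw [comp_apply, finsum_eq_sum_of_support_subset (s := s), Finset.sum_product]
  · refine Finset.sum_congr rfl fun k hk => ?_
    rw [Finset.mem_Icc] at hk
    rw [delPow_eq_sum hB (K := K) (by omega), Finset.mul_sum]
    symm
    refine Finset.sum_of_injOn (fun i : ℕ => n - k + i) ?_ ?_ ?_ ?_
    · intro i _ j _ hij
      simpa using hij
    · intro i hi
      have := Finset.mem_range.1 hi
      simp only [Finset.coe_Icc, Set.mem_Icc]
      omega
    · intro l _ hl'
      split_ifs with h
      · rw [hB l, leibniz_zero, mul_zero]
        by_contra hlt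
        refine hl' ⟨(k + l - n).toNat, Finset.mem_coe.2 (Finset.mem_range.2 (by omega)), ?_⟩
        simp only
        omega
      · rfl
    · intro i _
      rw [if_pos (by omega), show (k + (n - k + i) - n).toNat = i by omega]
  · intro p hp
    by_contra h
    apply hp
    simp only
    split_ifs with h1
    · rcases lt_or_ge N p.1 with h2 | h2
      · rw [hA _ h2, zero_mul]
      · rw [hB, leibniz_zero, mul_zero]
        by_contra h3
        apply h
        rw [hs, Finset.coe_product, Set.mem_prod, Finset.coe_Icc, Finset.coe_Icc, Set.mem_Icc,
          Set.mem_Icc]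
        omega
    · rfl

theorem OrderLE.comp (hA : OrderLE N A) (hB : OrderLE M B) : OrderLE (N + M) (comp A B) :=
  fun n hn => by
    rw [comp_eq_sum hA hB le_rfl le_rfl, Finset.Icc_eq_empty (by omega), Finset.sum_empty]

theorem isPsiDO_comp (hA : IsPsiDO A) (hB : IsPsiDO B) : IsPsiDO (comp A B) := by
  obtain ⟨hA, N, hN⟩ := isPsiDO_iff.1 hA
  obtain ⟨hB, M, hM⟩ := isPsiDO_iff.1 hB
  refine ⟨fun n => ?_, N + M, hN.comp hM⟩
  rw [comp_eq_sum hN hM le_rfl le_rfl]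
  exact IsField.sum fun k _ => (hA k).mul (isField_delPow hM hB k n)

theorem OrderLE.delComp (hA : OrderLE N A) : OrderLE (N + 1) (delComp A) := fun n hn => by
  rw [delComp_apply, hA n (by omega), hA (n - 1) (by omega), del_isSuperDer.zero, parity_zero,
    add_zero]

/-- The super Leibniz rule on each A_k · (δ^k ∘ B) gives the two kinds of terms of δ ∘ A; the second
kind is matched after a shift of the index by one. -/
theorem delComp_comp (hA : OrderLE N A) (hB : OrderLE M B) :
    delComp (comp A B) = comp (delComp A) B := by
  funext n
  rw [delComp_apply, comp_eq_sum hA hB (a := n - M - 2) (b := N + 1) (by omega) (by omega),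
    comp_eq_sum hA hB (n := n - 1) (a := n - M - 2) (b := N + 1) (by omega) (by omega),
    comp_eq_sum hA.delComp hB (a := n - M - 1) (b := N + 2) (by omega) (by omega),
    del_isSuperDer.sum, parity_sum, ← Finset.sum_add_distrib]
  have h1 : ∀ k, del (A k * delPow k B n) + parity (A k * delPow k B (n - 1)) =
      del (A k) * delPow k B n + parity (A k) * delPow (k + 1) B n := by
    intro k
    have h2 : delPow (k + 1) B n = del (delPow k B n) + parity (delPow k B (n - 1)) := by
      rw [← delComp_delPow hB, delComp_apply]
    rw [del_isSuperDer.mul, Function.iterate_one, parity_mul, h2, mul_add, add_assoc]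
  simp only [h1, delComp_apply, add_mul, Finset.sum_add_distrib]
  refine congrArg₂ (· + ·) ?_ ?_
  · rw [← Finset.sum_subset (Finset.Icc_subset_Icc (show n - M - 2 ≤ n - M - 1 by omega)
      (show N + 1 ≤ N + 1 by omega))]
    · refine Finset.sum_subset (Finset.Icc_subset_Icc_right (by omega)) fun k hk hk' => ?_
      rw [Finset.mem_Icc] at hk hk'
      rw [hA k (by omega), del_isSuperDer.zero, zero_mul]
    · intro k hk hk'
      rw [Finset.mem_Icc] at hk hk'
      rw [hB.delPow k n (by omega), mul_zero]
  · refine Finset.sum_nbij' (fun k => k + 1) (fun k => k - 1) ?_ ?_ ?_ ?_ ?_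
    · intro k hk
      rw [Finset.mem_Icc] at hk ⊢
      omega
    · intro k hk
      rw [Finset.mem_Icc] at hk ⊢
      omega
    · intro k _
      ring
    · intro k _
      ring
    · intro k _
      rw [add_sub_cancel_right]

/-- Upwards by the case of one δ, downwards by cancelling one δ on the left. -/
theorem delPow_comp (hA : OrderLE N A) (hB : OrderLE M B) (k : ℤ) :
    delPow k (comp A B) = comp (delPow k A) B := by
  induction k using Int.induction_on with
  | zero => rw [delPow_zero (hA.comp hB), delPow_zero hA]
  | succ k ih => rw [← delComp_delPow (hA.comp hB), ih, delComp_comp (hA.delPow _) hB,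
      delComp_delPow hA]
  | pred k ih =>
    refine delComp_injective ((hA.comp hB).delPow _) (((hA.delPow _).comp hB).mono (by omega)) ?_
    rw [delComp_delPow (hA.comp hB), delComp_comp (hA.delPow _) hB, delComp_delPow hA,
      sub_add_cancel, ih]

/-- Expanding in the coefficients of A, which multiply from the left, reduces associativity to the
compatibility of δ^k with products. -/
theorem comp_assoc (hA : OrderLE N A) (hB : OrderLE M B) {P : ℤ} (hC : OrderLE P C) :
    comp (comp A B) C = comp A (comp B C) := by
  funext n
  rw [comp_eq_sum (hA.comp hB) hC le_rfl le_rfl, comp_eq_sum hA (hB.comp hC) le_rfl le_rfl]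
  have h1 : ∀ l ∈ Finset.Icc (n - P) (N + M), comp A B l * delPow l C n =
      ∑ k ∈ Finset.Icc (n - (M + P)) N, A k * (delPow k B l * delPow l C n) := by
    intro l hl
    rw [Finset.mem_Icc] at hl
    rw [comp_eq_sum hA hB (a := n - (M + P)) (b := N) (by omega) le_rfl, Finset.sum_mul]
    exact Finset.sum_congr rfl fun k _ => mul_assoc _ _ _
  rw [Finset.sum_congr rfl h1, Finset.sum_comm]
  refine Finset.sum_congr rfl fun k hk => ?_
  rw [Finset.mem_Icc] at hk
  rw [delPow_comp hB hC, comp_eq_sum (hB.delPow k) hC (a := n - P) (b := N + M) le_rfl (by omega),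
    Finset.mul_sum]

end PsiDO

end
end SuperKP

namespace SuperKP

noncomputable section

open scoped Sealed

variable {I : Type*} [LinearOrder I]

namespace PsiDO

variable {A A' B B' C S T : PsiDO I} {M N : ℤ}

/-! ### Additivity of the product -/

theorem OrderLE.add (hA : OrderLE N A) (hB : OrderLE N B) : OrderLE N fun n => A n + B n :=
  fun n hn => by simp only; rw [hA n hn, hB n hn, add_zero]

theorem OrderLE.neg (hA : OrderLE N A) : OrderLE N fun n => -A n :=
  fun n hn => by simp only; rw [hA n hn, neg_zero]

theorem isPsiDO_add (hA : IsPsiDO A) (hB : IsPsiDO B) : IsPsiDO fun n => A n + B n := by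
  obtain ⟨hA, N, hN⟩ := isPsiDO_iff.1 hA
  obtain ⟨hB, M, hM⟩ := isPsiDO_iff.1 hB
  exact ⟨fun k => (hA k).add (hB k), max N M,
    (hN.mono (le_max_left N M)).add (hM.mono (le_max_right N M))⟩

theorem isPsiDO_neg (hA : IsPsiDO A) : IsPsiDO fun n => -A n := by
  obtain ⟨hA, N, hN⟩ := isPsiDO_iff.1 hA
  exact ⟨fun k => (hA k).neg, N, hN.neg⟩

theorem comp_add_left (hA : OrderLE N A) (hA' : OrderLE N A') (hB : OrderLE M B) (n : ℤ) :
    comp (fun n => A n + A' n) B n = comp A B n + comp A' B n := by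
  rw [comp_eq_sum (hA.add hA') hB le_rfl le_rfl, comp_eq_sum hA hB le_rfl le_rfl,
    comp_eq_sum hA' hB le_rfl le_rfl, ← Finset.sum_add_distrib]
  exact Finset.sum_congr rfl fun k _ => add_mul _ _ _

theorem comp_neg_left (hA : OrderLE N A) (hB : OrderLE M B) (n : ℤ) :
    comp (fun n => -A n) B n = -comp A B n := by
  rw [comp_eq_sum hA.neg hB le_rfl le_rfl, comp_eq_sum hA hB le_rfl le_rfl,
    ← Finset.sum_neg_distrib]
  exact Finset.sum_congr rfl fun k _ => neg_mul _ _

theorem delPow_add (hB : OrderLE M B) (hB' : OrderLE M B') (k n : ℤ) :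
    delPow k (fun n => B n + B' n) n = delPow k B n + delPow k B' n := by
  have hK : M + k < n + ((M + k - n + 1).toNat : ℤ) := by omega
  rw [delPow_eq_sum (hB.add hB') hK, delPow_eq_sum hB hK, delPow_eq_sum hB' hK,
    ← Finset.sum_add_distrib]
  exact Finset.sum_congr rfl fun i _ => leibniz_add _ _ _ _

theorem comp_add_right (hA : OrderLE N A) (hB : OrderLE M B) (hB' : OrderLE M B') (n : ℤ) :
    comp A (fun n => B n + B' n) n = comp A B n + comp A B' n := by
  rw [comp_eq_sum hA (hB.add hB') le_rfl le_rfl, comp_eq_sum hA hB le_rfl le_rfl,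
    comp_eq_sum hA hB' le_rfl le_rfl, ← Finset.sum_add_distrib]
  refine Finset.sum_congr rfl fun k _ => ?_
  rw [delPow_add hB hB', mul_add]

/-! ### Products with monomials -/

theorem mono_apply (k l : ℤ) (b : SuperFn I) : mono k b l = if l = k then b else 0 := rfl

theorem orderLE_mono (k : ℤ) (b : SuperFn I) : OrderLE k (mono k b) := fun l hl => by
  rw [mono_apply, if_neg (by omega)]

theorem isPsiDO_mono (k : ℤ) {b : SuperFn I} (hb : IsField b) : IsPsiDO (mono k b) :=
  ⟨fun l => by
    rw [mono_apply]
    split_ifs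
    exacts [hb, isField_zero], k, orderLE_mono k b⟩

theorem delPow_mono (k m n : ℤ) (b : SuperFn I) :
    delPow k (mono m b) n = if n ≤ k + m then leibniz k (k + m - n).toNat b else 0 := by
  have hK : m + k < n + ((m + k - n + 1).toNat : ℤ) := by omega
  rw [delPow_eq_sum (orderLE_mono m b) hK]
  split_ifs with h
  · rw [Finset.sum_eq_single (k + m - n).toNat]
    · rw [mono_apply, if_pos (by omega)]
    · intro i _ hi
      rw [mono_apply, if_neg (by omega), leibniz_zero]
    · intro hi
      exact absurd (Finset.mem_range.2 (by omega)) hi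
  · refine Finset.sum_eq_zero fun i _ => ?_
    rw [mono_apply, if_neg (by omega), leibniz_zero]

theorem iterate_del_zero (i : ℕ) : del^[i] (0 : SuperFn I) = 0 := by
  induction i with
  | zero => rfl
  | succ i ih => rw [Function.iterate_succ_apply', ih, del_isSuperDer.zero]

theorem leibniz_one (k : ℤ) (i : ℕ) : leibniz k i (1 : SuperFn I) = if i = 0 then 1 else 0 := by
  rw [leibniz_def, parity_one, ite_self]
  cases i with
  | zero => simp [superBinom_zero]
  | succ i =>
    rw [Function.iterate_succ_apply, del_isSuperDer.one, iterate_del_zero, smul_zero,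
      if_neg (Nat.succ_ne_zero i)]

theorem leibniz_phi_zero (k : ℤ) :
    leibniz k 0 (phi : SuperFn I) = if Even k then phi else -phi := by
  rw [leibniz_def, hasParity_one_iff.1 phi_odd]
  simp [superBinom_zero]

theorem leibniz_phi_one (k : ℤ) :
    leibniz k 1 (phi : SuperFn I) = if Even k then 0 else 1 := by
  rw [leibniz_def, Function.iterate_one]
  by_cases h : Even k
  · rw [if_pos h, superBinom_def, if_pos ⟨h, odd_one⟩, zero_smul]
  · rw [if_neg h, superBinom_def, if_neg (fun h' => h h'.1), if_pos, del_phi]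
    · simp
    · rw [Nat.cast_one, Int.even_sub_one]
      exact h

theorem leibniz_phi_add_two (k : ℤ) (i : ℕ) : leibniz k (i + 2) (phi : SuperFn I) = 0 := by
  rw [leibniz_def, hasParity_one_iff.1 phi_odd, Function.iterate_add_apply]
  have h : ∀ b : SuperFn I, b = phi ∨ b = -phi → del^[2] b = 0 := by
    rintro b (rfl | rfl)
    · change del (del phi) = 0
      rw [del_phi, del_isSuperDer.one]
    · change del (del (-phi)) = 0
      rw [del_isSuperDer.neg, del_phi, del_isSuperDer.neg, del_isSuperDer.one, neg_zero]
  rw [h _ (by split_ifs <;> simp), iterate_del_zero, smul_zero]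

theorem comp_mono_one (hA : OrderLE N A) (m n : ℤ) : comp A (mono m 1) n = A (n - m) := by
  rw [comp_eq_sum hA (orderLE_mono m 1) (b := max N (n - m)) le_rfl (le_max_left _ _),
    Finset.sum_eq_single (n - m)]
  · rw [delPow_mono, if_pos (by omega), leibniz_one, if_pos (by omega), mul_one]
  · intro k _ hk
    rw [delPow_mono]
    split_ifs
    · rw [leibniz_one, if_neg (by omega), mul_zero]
    · rw [mul_zero]
  · intro h
    exact absurd (Finset.mem_Icc.2 ⟨le_rfl, le_max_right _ _⟩) h

/-- Since δφ = 1 and δ²φ = 0, at most two Leibniz terms survive. The second comes from order k = n -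
m + 1 of A and only for odd k, hence the test for even n - m. -/
theorem comp_mono_phi (hA : OrderLE N A) (m n : ℤ) : comp A (mono m phi) n =
    A (n - m) * (if Even (n - m) then phi else -phi) +
      if Even (n - m) then A (n - m + 1) else 0 := by
  rw [comp_eq_sum hA (orderLE_mono m phi) (b := max N (n - m + 1)) le_rfl (le_max_left _ _),
    ← Finset.sum_subset (s₁ := {n - m, n - m + 1})]
  · rw [Finset.sum_pair (by omega), delPow_mono, delPow_mono, if_pos (by omega), if_pos (by omega),
      show (n - m + m - n).toNat = 0 by omega, show (n - m + 1 + m - n).toNat = 1 by omega,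
      leibniz_phi_zero, leibniz_phi_one]
    refine congrArg₂ (· + ·) rfl ?_
    by_cases h : Even (n - m)
    · rw [if_pos h, if_neg (by rwa [Int.even_add_one, not_not]), mul_one]
    · rw [if_neg h, if_pos (by rwa [Int.even_add_one]), mul_zero]
  · intro k hk
    simp only [Finset.mem_insert, Finset.mem_singleton] at hk
    rw [Finset.mem_Icc]
    have := le_max_right N (n - m + 1)
    omega
  · intro k _ hk
    simp only [Finset.mem_insert, Finset.mem_singleton, not_or] at hk
    rw [delPow_mono]
    split_ifs
    · rw [show (k + m - n).toNat = (k + m - n).toNat - 2 + 2 by omega, leibniz_phi_add_two, mul_zero]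
    · rw [mul_zero]

theorem one_eq : (one : PsiDO I) = mono 0 1 := rfl

theorem one_apply (n : ℤ) : (one : PsiDO I) n = if n = 0 then 1 else 0 := rfl

theorem orderLE_one : OrderLE 0 (one : PsiDO I) := orderLE_mono 0 1

theorem isPsiDO_one : IsPsiDO (one : PsiDO I) := isPsiDO_mono 0 isField_one

theorem comp_one (hA : OrderLE N A) : comp A one = A := by
  funext n
  rw [one_eq, comp_mono_one hA, sub_zero]

/-- The product with a differential operator on the left. -/
theorem comp_eq_sum_range {P : PsiDO I} (hB : OrderLE M B) {K : ℕ} (hneg : ∀ k < 0, P k = 0)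
    (hK : ∀ k : ℤ, (K : ℤ) ≤ k → P k = 0) (n : ℤ) :
    comp P B n = ∑ l ∈ Finset.range K, P l * delPow l B n := by
  have hP : OrderLE K P := fun k hk => hK k hk.le
  rw [comp_eq_sum hP hB (a := min 0 (n - M)) (min_le_right _ _) le_rfl]
  symm
  refine Finset.sum_of_injOn (fun l : ℕ => (l : ℤ)) ?_ ?_ ?_ fun l _ => rfl
  · intro i _ j _ h
    exact Int.ofNat_inj.1 h
  · intro l hl
    have := Finset.mem_range.1 hl
    have := min_le_left 0 (n - M)
    simp only [Finset.coe_Icc, Set.mem_Icc]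
    omega
  · intro k _ hk
    rcases lt_or_ge k 0 with h | h
    · rw [hneg k h, zero_mul]
    · rw [hK k, zero_mul]
      by_contra h'
      exact hk ⟨k.toNat, Finset.mem_coe.2 (Finset.mem_range.2 (by omega)), by simp only; omega⟩

theorem one_comp (hB : OrderLE M B) : comp one B = B := by
  funext n
  rw [comp_eq_sum_range hB (K := 1) (fun k hk => by rw [one_apply, if_neg (by omega)])
    (fun k hk => by rw [one_apply, if_neg (by omega)]), Finset.sum_range_one, one_apply, Nat.cast_zero,
    if_pos rfl, one_mul]
  exact congrFun (delPow_zero hB) n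

/-! ### Inverses -/

/-- Operators of the form `1 + (negative order)`. -/
structure IsMonic (S : PsiDO I) : Prop where
  field : ∀ k, IsField (S k)
  order : OrderLE 0 S
  zero : S 0 = 1

theorem IsMonic.isPsiDO (h : IsMonic S) : IsPsiDO S := ⟨h.field, 0, h.order⟩

/-- Left powers of `X` under the product. -/
def pow (X : PsiDO I) : ℕ → PsiDO I
  | 0 => one
  | j + 1 => comp X (pow X j)

theorem orderLE_pow {X : PsiDO I} (hX : OrderLE (-1) X) (j : ℕ) : OrderLE (-j) (pow X j) := by
  induction j with
  | zero => exact orderLE_one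
  | succ j ih => exact (hX.comp ih).mono (by push_cast; omega)

theorem isPsiDO_pow {X : PsiDO I} (hX : IsPsiDO X) (j : ℕ) : IsPsiDO (pow X j) := by
  induction j with
  | zero => exact isPsiDO_one
  | succ j ih => exact isPsiDO_comp hX ih

theorem OrderLE.sum {ι : Type*} {s : Finset ι} {F : ι → PsiDO I} (h : ∀ i ∈ s, OrderLE N (F i)) :
    OrderLE N fun n => ∑ i ∈ s, F i n :=
  fun n hn => Finset.sum_eq_zero fun i hi => h i hi n hn

theorem comp_sum_range_right (hA : OrderLE N A) {F : ℕ → PsiDO I} (hF : ∀ i, OrderLE M (F i))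
    (K : ℕ) (n : ℤ) : comp A (fun n => ∑ i ∈ Finset.range K, F i n) n =
      ∑ i ∈ Finset.range K, comp A (F i) n := by
  induction K with
  | zero =>
    have h : OrderLE (n - N - 1) fun _ => (0 : SuperFn I) := fun _ _ => rfl
    simp only [Finset.sum_range_zero]
    exact hA.comp h n (by omega)
  | succ K ih =>
    simp only [Finset.sum_range_succ]
    rw [comp_add_right hA (OrderLE.sum fun i _ => hF i) (hF K), ih]

/-- The Neumann series in X = 1 - S, which has negative order. -/
theorem IsMonic.exists_right_inverse (hS : IsMonic S) : ∃ T, IsMonic T ∧ comp S T = one := by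
  set X : PsiDO I := fun n => one n + -S n with hX
  have hX0 : OrderLE 0 X := orderLE_one.add hS.order.neg
  have hX1 : OrderLE (-1) X := by
    intro n hn
    rcases eq_or_ne n 0 with rfl | h
    · simp only [hX]
      rw [hS.zero, one_apply, if_pos rfl, add_neg_cancel]
    · exact hX0 n (by omega)
  have hXf : IsPsiDO X := isPsiDO_add isPsiDO_one (isPsiDO_neg hS.isPsiDO)
  -- As X^j has order at most -j, the coefficient of order n needs only j ≤ |n|.
  set T : PsiDO I := fun n => ∑ j ∈ Finset.range (n.natAbs + 1), pow X j n with hT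
  have hT0 : OrderLE 0 T := fun n hn => Finset.sum_eq_zero fun j _ => orderLE_pow hX1 j n (by omega)
  refine ⟨T, ⟨fun n => IsField.sum fun j _ => (isPsiDO_pow hXf j).1 n, hT0, ?_⟩, ?_⟩
  · simp only [hT]
    rw [Int.natAbs_zero, zero_add, Finset.sum_range_one]
    exact (one_apply 0).trans (if_pos rfl)
  · funext n
    set J := n.natAbs + 1 with hJ
    set P : PsiDO I := fun n => ∑ j ∈ Finset.range J, pow X j n with hP
    have hP0 : OrderLE 0 P := OrderLE.sum fun j _ => (orderLE_pow hX1 j).mono (by omega)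
    set R : PsiDO I := fun n => T n + -P n with hR
    have hR1 : OrderLE (-J) R := by
      intro m hm
      simp only [hR, hT, hP]
      rw [← sub_eq_add_neg, sub_eq_zero]
      rcases le_or_gt J (m.natAbs + 1) with h | h
      · symm
        refine Finset.sum_subset (Finset.range_mono h) fun k _ hk => ?_
        rw [Finset.mem_range, not_lt] at hk
        exact orderLE_pow hX1 k m (by omega)
      · refine Finset.sum_subset (Finset.range_mono h.le) fun k _ hk => ?_
        rw [Finset.mem_range, not_lt] at hk
        exact orderLE_pow hX1 k m (by omega)
    have h1 : T = fun n => P n + R n := by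
      funext m
      simp only [hR]
      abel
    have h2 : S = fun n => one n + -X n := by
      funext m
      simp only [hX]
      abel
    have h3 : comp S P n = one n := by
      conv_lhs => rw [h2]
      rw [comp_add_left orderLE_one hX0.neg hP0, one_comp hP0, comp_neg_left hX0 hP0, hP,
        comp_sum_range_right hX0 (M := 0) (fun j => (orderLE_pow hX1 j).mono (by omega)),
        ← sub_eq_add_neg, ← Finset.sum_sub_distrib]
      have h4 : ∑ j ∈ Finset.range J, (pow X j n - comp X (pow X j) n) = pow X 0 n - pow X J n :=
        Finset.sum_range_sub' (fun j => pow X j n) J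
      rw [h4, orderLE_pow hX1 J n (by omega), sub_zero]
      rfl
    rw [h1, comp_add_right hS.order hP0 (hR1.mono (by omega)), h3,
      hS.order.comp hR1 n (by omega), add_zero]

/-- A right inverse of the right inverse must be S itself, by associativity. -/
theorem IsMonic.exists_inverse (hS : IsMonic S) :
    ∃ T, IsMonic T ∧ comp S T = one ∧ comp T S = one := by
  obtain ⟨T, hT, h⟩ := hS.exists_right_inverse
  obtain ⟨U, hU, h'⟩ := hT.exists_right_inverse
  have : S = U := by
    rw [← comp_one hS.order, ← h', ← comp_assoc hS.order hT.order hU.order, h, one_comp hU.order]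
  exact ⟨T, hT, h, this ▸ h'⟩

end PsiDO

end
end SuperKP

namespace SuperKP

noncomputable section

open scoped Sealed

variable {I : Type*} [LinearOrder I]

namespace PsiDO

variable {A A' B B' C S T : PsiDO I} {M N : ℤ}

/-! ### Symbols: `A · e = sym A * e` -/

/-- The symbol of an operator, where `δ ^ (2 m)` and `δ ^ (2 m + 1)` have the symbols `z ^ m` and
`z ^ m (θ + φ z)`. -/
def sym (A : PsiDO I) : SuperFn I :=
  -- The power δ^(2m-1) has the symbol z^(m-1)θ + φz^m up to order of factors, so it also
  -- contributes to the coefficient of z^m through φ.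
  zSeries fun m => A (2 * m) + A (2 * m + 1) * theta + A (2 * m - 1) * phi

theorem zCoef_sym (hA : IsPsiDO A) (m : ℤ) :
    zCoef m (sym A) = A (2 * m) + A (2 * m + 1) * theta + A (2 * m - 1) * phi := by
  obtain ⟨hf, N, hN⟩ := isPsiDO_iff.1 hA
  refine zCoef_zSeries (N := max N 0 + 1) (fun m hm => ?_) (fun m => ?_) m
  · have := le_max_left N 0
    have := le_max_right N 0
    rw [hN _ (by omega), hN _ (by omega), hN _ (by omega), zero_mul, zero_mul, add_zero, add_zero]
  · exact ((hf _).zconst.add ((hf _).zconst.mul zconst_theta)).add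
      ((hf _).zconst.mul zconst_phi)

theorem sym_add (hA : IsPsiDO A) (hB : IsPsiDO B) : sym (fun n => A n + B n) = sym A + sym B :=
  zCoef_ext fun m => by
    rw [zCoef_add, zCoef_sym (isPsiDO_add hA hB), zCoef_sym hA, zCoef_sym hB]
    simp only [add_mul]
    abel

theorem thetaCoef_mul_theta {f : SuperFn I} (hf : OddFree thetaVar f) :
    thetaCoef (f * theta) = f := by rw [thetaCoef_mul_left hf, thetaCoef_theta, mul_one]

/-- The θ-parts of the coefficients of z^m return the odd orders; after subtracting the odd orders
the even ones remain. -/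
theorem sym_injective (hA : IsPsiDO A) (hB : IsPsiDO B) (h : sym A = sym B) : A = B := by
  have h1 : ∀ m, A (2 * m) + A (2 * m + 1) * theta + A (2 * m - 1) * phi =
      B (2 * m) + B (2 * m + 1) * theta + B (2 * m - 1) * phi := fun m => by
    rw [← zCoef_sym hA, ← zCoef_sym hB, h]
  have h2 : ∀ {C : PsiDO I}, IsPsiDO C → ∀ m,
      thetaCoef (C (2 * m) + C (2 * m + 1) * theta + C (2 * m - 1) * phi) = C (2 * m + 1) := by
    intro C hC m
    rw [thetaCoef_add, thetaCoef_add, thetaCoef_of_free (hC.1 _).thetaFree,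
      thetaCoef_mul_theta (hC.1 _).thetaFree,
      thetaCoef_of_free ((hC.1 _).thetaFree.mul thetaFree_phi), zero_add, add_zero]
  have h3 : ∀ m, A (2 * m + 1) = B (2 * m + 1) := fun m => by
    rw [← h2 hA, ← h2 hB, h1]
  have h4 : ∀ m, A (2 * m) = B (2 * m) := fun m => by
    have h5 := h3 (m - 1)
    rw [show 2 * (m - 1) + 1 = 2 * m - 1 by ring] at h5
    have := h1 m
    rwa [h3, h5, add_left_inj, add_left_inj] at this
  funext k
  rcases Int.even_or_odd' k with ⟨m, rfl | rfl⟩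
  · exact h4 m
  · exact h3 m

theorem degLE_sym (hA : IsPsiDO A) (hN : OrderLE N A) {a : ℤ} (ha : N ≤ 2 * a) :
    DegLE a (sym A) :=
  degLE_iff.2 fun m hm => by
    rw [zCoef_sym hA, hN _ (by omega), hN _ (by omega), hN _ (by omega), zero_mul, zero_mul,
      add_zero, add_zero]

theorem sym_mono (k : ℤ) {b : SuperFn I} (hb : IsField b) :
    sym (mono k b) = b * (zpow (k / 2) * if Even k then 1 else tau) := by
  refine zCoef_ext fun m => ?_
  rw [zCoef_sym (isPsiDO_mono k hb), zCoef_mul_left hb.zconst, mono_apply, mono_apply, mono_apply]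
  rcases Int.even_or_odd' k with ⟨a, rfl | rfl⟩
  · rw [if_pos (show Even (2 * a) by simp), mul_one, zCoef_zpow, if_neg (by omega : ¬ 2 * m + 1 = 2 * a),
      if_neg (by omega : ¬ 2 * m - 1 = 2 * a), zero_mul, zero_mul, add_zero, add_zero,
      show 2 * a / 2 = a by omega]
    by_cases h : m = a
    · rw [if_pos (by omega), if_pos h, mul_one]
    · rw [if_neg (by omega), if_neg h, mul_zero]
  · rw [if_neg (show ¬ Even (2 * a + 1) by simp), zCoef_mul_tau, if_neg (by omega : ¬ 2 * m = 2 * a + 1), zero_add,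
      show (2 * a + 1) / 2 = a by omega, mul_add]
    refine congrArg₂ (· + ·) ?_ ?_
    · by_cases h : m = a
      · rw [if_pos (by omega), if_pos h]
      · rw [if_neg (by omega), if_neg h, zero_mul, mul_zero]
    · by_cases h : m = a + 1
      · rw [if_pos (by omega), if_pos h]
      · rw [if_neg (by omega), if_neg h, zero_mul, mul_zero]

theorem delPowWave_def (k : ℤ) : (delPowWave k : SuperFn I) =
    zpow (k / 2) * if Even k then vacuumWave else del vacuumWave := rfl

theorem mul_delPowWave (k : ℤ) {b : SuperFn I} (hb : IsField b) :
    b * delPowWave k = sym (mono k b) * vacuumWave := by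
  rw [sym_mono k hb, delPowWave_def, mul_assoc, mul_assoc, del_vacuumWave]
  split_ifs
  · rw [one_mul]
  · rfl

theorem sym_zero : sym (fun _ => (0 : SuperFn I)) = 0 :=
  zCoef_ext fun m => by
    rw [zCoef_sym ⟨fun _ => isField_zero, 0, fun _ _ => rfl⟩, zCoef_zero]
    simp

theorem sym_sum {ι : Type*} (s : Finset ι) {F : ι → PsiDO I} (hF : ∀ i, IsPsiDO (F i)) :
    IsPsiDO (fun n => ∑ i ∈ s, F i n) ∧ sym (fun n => ∑ i ∈ s, F i n) = ∑ i ∈ s, sym (F i) := by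
  induction s using Finset.cons_induction with
  | empty =>
    simp only [Finset.sum_empty]
    exact ⟨⟨fun _ => isField_zero, 0, fun _ _ => rfl⟩, sym_zero⟩
  | cons a s ha ih =>
    simp only [Finset.sum_cons]
    exact ⟨isPsiDO_add (hF a) ih.1, by rw [sym_add (hF a) ih.1, ih.2]⟩

/-- The symbol computes the termwise action. For a fixed coefficient, the vacuum wave enters through
finitely many monomials, each of bounded degree in z. Operators of order at most 2K, whose symbols
have degree at most K, therefore do not contribute, and above that order the sum is finite. -/
theorem coef_sym_mul_vacuumWave (hS : IsPsiDO S) (n : ℕ →₀ ℕ) (Q : Finset (OddVar I)) (m : ℤ) :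
    coef (sym S * vacuumWave) n Q m = ∑ᶠ k : ℤ, coef (S k * delPowWave k) n Q m := by
  obtain ⟨hf, N, hN⟩ := isPsiDO_iff.1 hS
  obtain ⟨K, hK⟩ := exists_degLE_coef_mul_eq_zero (vacuumWave : SuperFn I) n Q m
  have h1 : ∀ k, S k * delPowWave k = sym (mono k (S k)) * vacuumWave :=
    fun k => mul_delPowWave k (hf k)
  set s := Finset.Icc (2 * K + 1) N with hs
  have h2 := sym_sum s (F := fun k => mono k (S k)) fun k => isPsiDO_mono k (hf k)
  set R : PsiDO I := fun l => S l + -∑ k ∈ s, mono k (S k) l with hR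
  have hRf : IsPsiDO R := isPsiDO_add hS (isPsiDO_neg h2.1)
  have hR1 : OrderLE (2 * K) R := by
    intro l hl
    simp only [hR]
    rw [← sub_eq_add_neg, sub_eq_zero]
    by_cases h : l ≤ N
    · rw [Finset.sum_eq_single l]
      · rw [mono_apply, if_pos rfl]
      · intro k _ hk
        rw [mono_apply, if_neg hk.symm]
      · intro h'
        exact absurd (Finset.mem_Icc.2 ⟨by omega, h⟩) h'
    · rw [hN l (by omega)]
      symm
      refine Finset.sum_eq_zero fun k hk => ?_
      rw [Finset.mem_Icc] at hk
      rw [mono_apply, if_neg (by omega)]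
  have h3 : S = fun l => (∑ k ∈ s, mono k (S k) l) + R l := by
    funext l
    simp only [hR]
    abel
  have h4 : sym S = ∑ k ∈ s, sym (mono k (S k)) + sym R := by
    conv_lhs => rw [h3]
    rw [sym_add h2.1 hRf, h2.2]
  rw [h4, add_mul, coef_add, hK _ (degLE_sym hRf hR1 le_rfl), add_zero, Finset.sum_mul, coef_sum,
    finsum_eq_sum_of_support_subset (s := s)]
  · exact Finset.sum_congr rfl fun k _ => by rw [h1]
  · intro k hk
    by_contra h
    apply hk
    rw [hs, Finset.coe_Icc, Set.mem_Icc, not_and_or] at h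
    rcases h with h | h
    · simp only
      rw [h1]
      exact hK _ (degLE_sym (isPsiDO_mono k (hf k)) (orderLE_mono k (S k)) (by omega))
    · simp only
      rw [hN k (by omega), zero_mul]
      rfl

theorem isDressed_iff (hS : IsPsiDO S) {Psi : SuperFn I} :
    IsDressed S Psi ↔ Psi = sym S * vacuumWave := by
  constructor
  · intro h
    refine coef_ext fun n Q m => ?_
    rw [coef_sym_mul_vacuumWave hS]
    exact h n Q m
  · rintro rfl n Q m
    exact coef_sym_mul_vacuumWave hS n Q m

/-! ### Derivatives of symbols -/

theorem isPsiDO_delComp (hA : IsPsiDO A) : IsPsiDO (delComp A) := by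
  obtain ⟨hf, N, hN⟩ := isPsiDO_iff.1 hA
  exact ⟨fun k => (hf k).del.add (hf (k - 1)).parity, N + 1, hN.delComp⟩

theorem zCoef_mul_tau_right (m : ℤ) (f : SuperFn I) :
    zCoef m (f * tau) = zCoef m f * theta + zCoef (m - 1) f * phi := by
  have h : f * tau = f * theta + f * phi * zpow 1 := by
    rw [tau, mul_add, mul_assoc]
  rw [h, zCoef_add, zCoef_mul_right zconst_theta, zCoef_mul_zpow, zCoef_mul_right zconst_phi]

theorem sym_delComp (hA : IsPsiDO A) : sym (delComp A) = del (sym A) + parity (sym A) * tau := by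
  refine zCoef_ext fun m => ?_
  rw [zCoef_sym (isPsiDO_delComp hA), zCoef_add, zCoef_del, zCoef_mul_tau_right, zCoef_parity,
    zCoef_parity, zCoef_sym hA, zCoef_sym hA]
  simp only [delComp_apply, del_isSuperDer.add, parity_add, parity_mul, del_isSuperDer.mul,
    Function.iterate_one, del_theta, del_phi, hasParity_one_iff.1 theta_odd,
    hasParity_one_iff.1 phi_odd]
  rw [show 2 * m + 1 - 1 = 2 * m by ring, show 2 * m - 1 - 1 = 2 * (m - 1) by ring,
    show 2 * (m - 1) + 1 = 2 * m - 1 by ring]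
  simp only [add_mul, mul_neg, neg_mul, mul_assoc, theta_mul_theta, phi_mul_phi, mul_zero, mul_one,
    theta_mul_phi]
  abel

/-- Applying δ to the function A · e is composing the operator A with δ on the left. -/
theorem del_sym_mul_vacuumWave (hA : IsPsiDO A) :
    del (sym A * vacuumWave) = sym (delComp A) * vacuumWave := by
  rw [del_isSuperDer.mul, Function.iterate_one, del_vacuumWave, sym_delComp hA, add_mul, mul_assoc]

theorem isPsiDO_delPow (hA : IsPsiDO A) (k : ℤ) : IsPsiDO (delPow k A) := by
  obtain ⟨hf, N, hN⟩ := isPsiDO_iff.1 hA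
  exact ⟨isField_delPow hN hf k, N + k, hN.delPow k⟩

theorem iterate_del_sym_mul_vacuumWave (hA : IsPsiDO A) (l : ℕ) :
    del^[l] (sym A * vacuumWave) = sym (delPow l A) * vacuumWave := by
  obtain ⟨-, N, hN⟩ := isPsiDO_iff.1 hA
  induction l with
  | zero => rw [Nat.cast_zero, delPow_zero hN]; rfl
  | succ l ih => rw [Function.iterate_succ_apply', ih, del_sym_mul_vacuumWave (isPsiDO_delPow hA l),
      delComp_delPow hN, Nat.cast_succ]

/-- For a differential operator P the composite PA acts as P applied to A · e. Combined with
`sym_injective`, membership in the span of the derivatives becomes an identity of operators. -/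
theorem sym_comp_mul_vacuumWave (hA : IsPsiDO A) {P : PsiDO I} {K : ℕ} (hP : ∀ k, IsField (P k))
    (hneg : ∀ k < 0, P k = 0) (hK : ∀ k : ℤ, (K : ℤ) ≤ k → P k = 0) :
    sym (comp P A) * vacuumWave =
      ∑ l ∈ Finset.range K, P l * del^[l] (sym A * vacuumWave) := by
  have hN := hA
  obtain ⟨-, N, hN⟩ := isPsiDO_iff.1 hN
  have hP' : IsPsiDO P := ⟨hP, K, fun k hk => hK k hk.le⟩
  have h1 : sym (comp P A) = ∑ l ∈ Finset.range K, P l * sym (delPow l A) := by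
    refine zCoef_ext fun m => ?_
    rw [zCoef_sym (isPsiDO_comp hP' hA), comp_eq_sum_range hN hneg hK, comp_eq_sum_range hN hneg hK,
      comp_eq_sum_range hN hneg hK, zCoef_sum, Finset.sum_mul, Finset.sum_mul,
      ← Finset.sum_add_distrib, ← Finset.sum_add_distrib]
    refine Finset.sum_congr rfl fun l _ => ?_
    rw [zCoef_mul_left (hP l).zconst, zCoef_sym (isPsiDO_delPow hA l), mul_add, mul_add, mul_assoc,
      mul_assoc]
  rw [h1, Finset.sum_mul]
  exact Finset.sum_congr rfl fun l _ => by
    rw [iterate_del_sym_mul_vacuumWave hA, mul_assoc]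

theorem isPsiDO_dtCoef (hA : IsPsiDO A) (n : ℕ) : IsPsiDO (dtCoef n A) := by
  obtain ⟨hf, N, hN⟩ := isPsiDO_iff.1 hA
  refine ⟨fun k => (hf k).dt n, N, fun k hk => ?_⟩
  change dt n (A k) = 0
  rw [hN k hk, (dt_isSuperDer n).zero]

theorem dt_sym (hA : IsPsiDO A) (n : ℕ) : dt n (sym A) = sym (dtCoef n A) := by
  refine zCoef_ext fun m => ?_
  rw [zCoef_dt, zCoef_sym hA, zCoef_sym (isPsiDO_dtCoef hA n), (dt_isSuperDer n).add,
    (dt_isSuperDer n).add, (dt_isSuperDer n).mul, (dt_isSuperDer n).mul, dt_theta, dt_phi, mul_zero,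
    mul_zero, add_zero, add_zero]
  rfl

/-! ### The flows -/

/-- The operator `∂_x ^ j` or `∂_φ ∂_x ^ j` belonging to the time `t_n`. -/
def flowOp (n : ℕ) : PsiDO I := if Even n then dxPow (n / 2) else dphiDxPow (n / 2)

theorem flowOp_even (j : ℕ) : flowOp (I := I) (2 * j) = mono (2 * j) 1 := by
  rw [flowOp, if_pos (by simp), show 2 * j / 2 = j by omega]
  rfl

theorem flowOp_odd (j : ℕ) : flowOp (I := I) (2 * j + 1) =
    fun k => mono (2 * j + 1) 1 k + -mono (2 * j + 2) phi k := by
  rw [flowOp, if_neg (by simp), show (2 * j + 1) / 2 = j by omega]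
  funext k
  rw [← sub_eq_add_neg]
  rfl

theorem isPsiDO_flowOp (n : ℕ) : IsPsiDO (flowOp (I := I) n) := by
  rcases Nat.even_or_odd' n with ⟨j, rfl | rfl⟩
  · rw [flowOp_even]
    exact isPsiDO_mono _ isField_one
  · rw [flowOp_odd]
    exact isPsiDO_add (isPsiDO_mono _ isField_one) (isPsiDO_neg (isPsiDO_mono _ isField_phi))

theorem comp_neg_right (hA : OrderLE N A) (hB : OrderLE M B) (n : ℤ) :
    comp A (fun n => -B n) n = -comp A B n := by
  rw [eq_neg_iff_add_eq_zero, ← comp_add_right hA hB.neg hB]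
  have h : (fun n => -B n + B n) = fun _ => (0 : SuperFn I) := by
    funext n
    exact neg_add_cancel _
  rw [h, comp_eq_sum hA (M := n - N - 1) (fun _ _ => rfl) le_rfl le_rfl,
    Finset.Icc_eq_empty (by omega), Finset.sum_empty]

/-- Right composition with ∂_x^j multiplies the symbol by z^j. For ∂_φ = δ - φ∂_x the subtracted
term removes the φz from the symbol of δ and leaves θ. -/
theorem sym_comp_flowOp (hA : IsPsiDO A) (n : ℕ) :
    sym (comp A (flowOp n)) = sym A * vacuum n := by
  refine zCoef_ext fun m => ?_
  rw [zCoef_sym (isPsiDO_comp hA (isPsiDO_flowOp n))]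
  obtain ⟨-, N, hN⟩ := isPsiDO_iff.1 hA
  rcases Nat.even_or_odd' n with ⟨j, rfl | rfl⟩
  · rw [flowOp_even, comp_mono_one hN, comp_mono_one hN, comp_mono_one hN, vacuum_two_mul,
      zCoef_mul_zpow, zCoef_sym hA]
    rw [show 2 * m - 2 * (j : ℤ) = 2 * (m - j) by ring,
      show 2 * m + 1 - 2 * (j : ℤ) = 2 * (m - j) + 1 by ring,
      show 2 * m - 1 - 2 * (j : ℤ) = 2 * (m - j) - 1 by ring]
  · have h1 : ∀ k, comp A (flowOp (2 * j + 1)) k = A (k - (2 * j + 1)) +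
        -(A (k - (2 * j + 2)) * (if Even (k - (2 * j + 2)) then phi else -phi) +
          if Even (k - (2 * j + 2)) then A (k - (2 * j + 1)) else 0) := by
      intro k
      rw [flowOp_odd, comp_add_right hN (M := 2 * j + 2) ((orderLE_mono _ _).mono (by omega))
        (orderLE_mono _ _).neg, comp_neg_right hN (orderLE_mono _ _), comp_mono_one hN,
        comp_mono_phi hN, show k - (2 * (j : ℤ) + 2) + 1 = k - (2 * j + 1) by ring]
    have e1 : Even (2 * m - (2 * (j : ℤ) + 2)) := ⟨m - j - 1, by ring⟩
    have e2 : ¬ Even (2 * m + 1 - (2 * (j : ℤ) + 2)) := by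
      rw [Int.not_even_iff_odd]
      exact ⟨m - j - 1, by ring⟩
    have e3 : ¬ Even (2 * m - 1 - (2 * (j : ℤ) + 2)) := by
      rw [Int.not_even_iff_odd]
      exact ⟨m - j - 2, by ring⟩
    rw [h1, h1, h1, if_pos e1, if_pos e1, if_neg e2, if_neg e2, if_neg e3, if_neg e3,
      vacuum_two_mul_add_one, ← mul_assoc, zCoef_mul_right zconst_theta, zCoef_mul_zpow,
      zCoef_sym hA]
    rw [show 2 * m + 1 - (2 * (j : ℤ) + 1) = 2 * (m - j) by ring,
      show 2 * m + 1 - (2 * (j : ℤ) + 2) = 2 * (m - j) - 1 by ring,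
      show 2 * m - 1 - (2 * (j : ℤ) + 1) = 2 * m - (2 * j + 2) by ring]
    simp only [add_mul, mul_neg, add_zero, neg_neg, mul_assoc, phi_mul_phi, theta_mul_theta,
      mul_zero]
    abel

/-- The derivative of the vacuum wave is multiplication by z^j or z^jθ, which is composition of A
with the flow operator on the right. -/
theorem dt_sym_mul_vacuumWave (hA : IsPsiDO A) (he : HasParity 0 (sym A)) {n : ℕ} (hn : 0 < n) :
    dt n (sym A * vacuumWave) =
      sym (fun k => dtCoef n A k + comp A (flowOp n) k) * vacuumWave := by
  rw [sym_add (isPsiDO_dtCoef hA n) (isPsiDO_comp hA (isPsiDO_flowOp n)), sym_comp_flowOp hA,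
    (dt_isSuperDer n).mul_of_even he, dt_sym hA, dt_vacuumWave hn, add_mul, mul_assoc]

end PsiDO

end
end SuperKP

/-! ### Sato's criterion for the flows of JSKP -/

namespace SuperKP

noncomputable section

open scoped Sealed

variable {I : Type*} [LinearOrder I]

namespace PsiDO

variable {A B C S T : PsiDO I} {M N : ℤ}

theorem solvesJSKP_iff_flowOp : SolvesJSKP S ↔
    ∃ T : PsiDO I, IsPsiDO T ∧ comp S T = one ∧ comp T S = one ∧ ∀ n, 0 < n → ∀ k,
      dtCoef n S k = -comp (negPart (comp (comp S (flowOp n)) T)) S k := by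
  have e1 : ∀ i, flowOp (I := I) (2 * i + 2) = dxPow (i + 1) := fun i => by
    rw [flowOp, if_pos ⟨i + 1, by ring⟩, show (2 * i + 2) / 2 = i + 1 by omega]
  have e2 : ∀ i, flowOp (I := I) (2 * i + 1) = dphiDxPow i := fun i => by
    rw [flowOp, if_neg (by simp), show (2 * i + 1) / 2 = i by omega]
  constructor
  · rintro ⟨T, hT, h1, h2, h⟩
    refine ⟨T, hT, h1, h2, fun n hn k => ?_⟩
    rcases Nat.even_or_odd' n with ⟨i, rfl | rfl⟩
    · obtain ⟨j, rfl⟩ : ∃ j, i = j + 1 := ⟨i - 1, by omega⟩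
      rw [show 2 * (j + 1) = 2 * j + 2 by ring, e1]
      exact congrFun (h j).1 k
    · rw [e2]
      exact congrFun (h i).2 k
  · rintro ⟨T, hT, h1, h2, h⟩
    refine ⟨T, hT, h1, h2, fun i => ⟨?_, ?_⟩⟩
    · have := h (2 * i + 2) (by omega)
      rw [e1] at this
      exact funext this
    · have := h (2 * i + 1) (by omega)
      rw [e2] at this
      exact funext this

theorem negPart_apply (A : PsiDO I) (k : ℤ) : negPart A k = if k < 0 then A k else 0 := rfl

theorem orderLE_negPart (A : PsiDO I) : OrderLE (-1) (negPart A) := fun k hk => by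
  rw [negPart_apply, if_neg (by omega)]

theorem isPsiDO_negPart (hA : IsPsiDO A) : IsPsiDO (negPart A) :=
  ⟨fun k => by
    rw [negPart_apply]
    split_ifs
    exacts [hA.1 k, isField_zero], -1, orderLE_negPart A⟩

theorem dtCoef_apply (n : ℕ) (A : PsiDO I) (k : ℤ) : dtCoef n A k = dt n (A k) := rfl

theorem IsMonic.orderLE_dtCoef (hS : IsMonic S) (n : ℕ) : OrderLE (-1) (dtCoef n S) := by
  intro k hk
  rw [dtCoef_apply]
  rcases eq_or_ne k 0 with rfl | h
  · rw [hS.zero, (dt_isSuperDer n).one]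
  · rw [hS.order k (by omega), (dt_isSuperDer n).zero]

/-- One flow of the hierarchy holds iff the `t_n`-derivative of the wave function is a differential
operator applied to it. -/
theorem flow_iff (hS : IsMonic S) (he : HasParity 0 (sym S)) (hT : IsMonic T)
    (h1 : comp S T = one) (h2 : comp T S = one) {n : ℕ} (hn : 0 < n) :
    (∀ k, dtCoef n S k = -comp (negPart (comp (comp S (flowOp n)) T)) S k) ↔
      dt n (sym S * vacuumWave) ∈ fieldSpan fun l => del^[l] (sym S * vacuumWave) := by
  have hP := hT.order
  obtain ⟨-, Q, hQ⟩ := isPsiDO_iff.1 (isPsiDO_flowOp (I := I) n)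
  set X := comp (comp S (flowOp n)) T with hX
  have hXp : IsPsiDO X := isPsiDO_comp (isPsiDO_comp hS.isPsiDO (isPsiDO_flowOp n)) hT.isPsiDO
  have hXo := (hS.order.comp hQ).comp hP
  have hXS : comp X S = comp S (flowOp n) := by
    rw [hX, comp_assoc (hS.order.comp hQ) hP hS.order, h2, comp_one (hS.order.comp hQ)]
  rw [dt_sym_mul_vacuumWave hS.isPsiDO he hn]
  constructor
  · intro h
    -- Y is the differential part of S∂S⁻¹, where ∂ is the flow operator. The flow equation reads
    -- ∂_n S + S∂ = YS, so Y computes ∂_nΨ.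
    set Y : PsiDO I := fun k => X k + -negPart X k with hY
    have hYp : IsPsiDO Y := isPsiDO_add hXp (isPsiDO_neg (isPsiDO_negPart hXp))
    obtain ⟨-, K, hK⟩ := isPsiDO_iff.1 hYp
    have e1 : (fun k => dtCoef n S k + comp S (flowOp n) k) = comp Y S := by
      funext k
      rw [h k, hY, comp_add_left (hXo.mono (le_max_left _ (-1)))
        ((orderLE_negPart X).neg.mono (le_max_right _ _)) hS.order,
        comp_neg_left (orderLE_negPart X) hS.order, hXS, add_comm]
    rw [e1, sym_comp_mul_vacuumWave hS.isPsiDO (K := K.toNat + 1) (fun k => hYp.1 k)]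
    · exact sum_mem fun l _ => mul_mem_fieldSpan (hYp.1 _) l
    · intro k hk
      simp only [hY]
      rw [negPart_apply, if_pos hk, add_neg_cancel]
    · intro k hk
      exact hK k (by omega)
  · intro h
    obtain ⟨K, b, hb, hsum⟩ := mem_fieldSpan_iff.1 h
    -- The differential operator with the given coefficients; comparison of symbols gives ∂_n S + S∂
    -- = YS.
    set Y : PsiDO I := fun k => if 0 ≤ k ∧ k < K then b k.toNat else 0 with hY
    have hYf : ∀ k, IsField (Y k) := fun k => by
      simp only [hY]
      split_ifs
      exacts [hb _, isField_zero]
    have hYn : ∀ k < 0, Y k = 0 := fun k hk => if_neg (by omega)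
    have hYK : ∀ k : ℤ, (K : ℤ) ≤ k → Y k = 0 := fun k hk => if_neg (by omega)
    have hYo : OrderLE K Y := fun k hk => hYK k hk.le
    have e1 : (fun k => dtCoef n S k + comp S (flowOp n) k) = comp Y S := by
      refine sym_injective (isPsiDO_add (isPsiDO_dtCoef hS.isPsiDO n)
        (isPsiDO_comp hS.isPsiDO (isPsiDO_flowOp n))) (isPsiDO_comp ⟨hYf, K, hYo⟩ hS.isPsiDO) ?_
      refine (vacuumWave_isUnit (I := I)).mul_right_cancel ?_
      rw [sym_comp_mul_vacuumWave hS.isPsiDO hYf hYn hYK, hsum]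
      refine Finset.sum_congr rfl fun l hl => ?_
      have : Y l = b l := by
        simp only [hY]
        rw [if_pos ⟨by omega, by exact_mod_cast Finset.mem_range.1 hl⟩, Int.toNat_natCast]
      rw [this]
    have hE := hS.orderLE_dtCoef n
    -- Multiplication by S⁻¹ gives S∂S⁻¹ = Y - (∂_n S)S⁻¹. The last term has negative order because
    -- the leading coefficient 1 of S is constant, so it is the whole negative part.
    have e2 : ∀ k, X k = Y k + -comp (dtCoef n S) T k := by
      intro k
      have h3 : comp (fun k => dtCoef n S k + comp S (flowOp n) k) T k = Y k := by
        rw [e1, comp_assoc hYo hS.order hP, h1, comp_one hYo]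
      rw [comp_add_left (hE.mono (le_max_left _ (0 + Q)))
        ((hS.order.comp hQ).mono (le_max_right _ _)) hP] at h3
      rw [← h3]
      abel
    have e3 : negPart X = fun k => -comp (dtCoef n S) T k := by
      funext k
      rw [negPart_apply]
      split_ifs with hk
      · rw [e2, hYn k hk, zero_add]
      · rw [hE.comp hP k (by omega), neg_zero]
    intro k
    rw [e3, comp_neg_left (hE.comp hP) hS.order, neg_neg, comp_assoc hE hP hS.order, h2, comp_one hE]

theorem solvesJSKP_iff (hS : IsMonic S) (he : HasParity 0 (sym S)) : SolvesJSKP S ↔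
    ∀ n, 0 < n → dt n (sym S * vacuumWave) ∈ fieldSpan fun l => del^[l] (sym S * vacuumWave) := by
  obtain ⟨T, hT, h1, h2⟩ := hS.exists_inverse
  rw [solvesJSKP_iff_flowOp]
  constructor
  · rintro ⟨T', hT', h1', h2', h⟩ n hn
    obtain ⟨-, P, hP⟩ := isPsiDO_iff.1 hT'
    -- The inverse is unique, so the one in the definition of the hierarchy may be taken monic.
    have h3 : T' = T := by
      rw [← comp_one hP, ← h1, ← comp_assoc hP hS.order hT.order, h2', one_comp hT.order]
    rw [h3] at h
    exact (flow_iff hS he hT h1 h2 hn).1 (h n hn)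
  · intro h
    exact ⟨T, hT.isPsiDO, h1, h2, fun n hn => (flow_iff hS he hT h1 h2 hn).2 (h n hn)⟩

end PsiDO

end
end SuperKP

namespace SuperKP

noncomputable section

open scoped Sealed

variable {I : Type*} [LinearOrder I]

/-! ### Expansion in `θ` and `φ` -/

/-- The function with components `p, q, r, s`, with `φ` written on the left and `θ` on the right. -/
def quad (p q r s : SuperFn I) : SuperFn I := p + q * theta + phi * r + phi * s * theta

variable {p q r s p' q' r' s' f : SuperFn I}

theorem theta_mul (f : SuperFn I) : theta * f = parity f * theta := theta_odd.odd_comm f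

theorem mul_phi (f : SuperFn I) : f * phi = phi * parity f := by
  rw [phi_odd.odd_comm, parity_parity]

/-- Moving a coefficient past φ or θ costs only a parity involution. The one further sign is θφ =
-φθ, visible in the term with q and r'. -/
theorem quad_mul : quad p q r s * quad p' q' r' s' =
    quad (p * p') (p * q' + q * parity p') (parity p * r' + r * p')
      (parity p * s' - parity q * parity r' + r * q' + s * parity p') := by
  have hp : ∀ f g : SuperFn I, f * (phi * g) = phi * (parity f * g) := fun f g => by
    rw [← mul_assoc, mul_phi, mul_assoc]
  have ht : ∀ f g : SuperFn I, theta * (f * g) = parity f * (theta * g) := fun f g => by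
    rw [← mul_assoc, theta_mul, mul_assoc]
  have hpp : ∀ f : SuperFn I, phi * (phi * f) = 0 := fun f => by
    rw [← mul_assoc, phi_mul_phi, zero_mul]
  have htp : ∀ f : SuperFn I, theta * (phi * f) = -(phi * (theta * f)) := fun f => by
    rw [← mul_assoc, theta_mul_phi, neg_mul, mul_assoc]
  have e1 : q * (theta * (q' * theta)) = 0 := by
    rw [ht, theta_mul_theta, mul_zero, mul_zero]
  have e2 : phi * (s * (theta * (q' * theta))) = 0 := by
    rw [ht, theta_mul_theta, mul_zero, mul_zero, mul_zero]
  have e3 : q * (theta * (phi * r')) = -(phi * (parity q * (parity r' * theta))) := by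
    rw [htp, mul_neg, hp, theta_mul]
  have e4 : q * (theta * (phi * (s' * theta))) = 0 := by
    rw [htp, ht, theta_mul_theta, mul_zero, mul_zero, neg_zero, mul_zero]
  have e5 : ∀ g, phi * (s * (theta * (phi * g))) = 0 := fun g => by
    rw [htp, mul_neg, hp, mul_neg, hpp, neg_zero]
  have e6 : ∀ g, phi * (r * (phi * g)) = 0 := fun g => by
    rw [hp, hpp]
  simp only [quad, mul_add, add_mul, mul_assoc, sub_mul, mul_sub, e1, e2, e3, e4, e5, e6, hp p,
    theta_mul p']
  abel

theorem quad_add : quad p q r s + quad p' q' r' s' = quad (p + p') (q + q') (r + r') (s + s') := by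
  simp only [quad, mul_add, add_mul]
  abel

theorem quad_sub : quad p q r s - quad p' q' r' s' = quad (p - p') (q - q') (r - r') (s - s') := by
  simp only [quad, mul_sub, sub_mul]
  abel

theorem del_of_phiFree (hf : OddFree phiVar f) : del f = phi * dx f := by
  have : dphi f = 0 := hf
  rw [del_def, this, zero_add]

theorem del_quad (hp : OddFree phiVar p) (hq : OddFree phiVar q) (hr : OddFree phiVar r)
    (hs : OddFree phiVar s) : del (quad p q r s) = quad r s (dx p) (dx q) := by
  simp only [quad]
  rw [del_isSuperDer.add, del_isSuperDer.add, del_isSuperDer.add, del_isSuperDer.mul q,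
    del_isSuperDer.mul phi, del_isSuperDer.mul (phi * s), del_isSuperDer.mul phi, del_theta, del_phi,
    del_of_phiFree hp, del_of_phiFree hq, del_of_phiFree hr, del_of_phiFree hs, Function.iterate_one,
    hasParity_one_iff.1 phi_odd, neg_mul, neg_mul, ← mul_assoc phi phi, ← mul_assoc phi phi,
    phi_mul_phi]
  simp only [zero_mul, neg_zero, add_zero, one_mul, mul_zero]
  abel

/-- The components of a function. -/
def comp00 (f : SuperFn I) : SuperFn I :=
  (f - thetaCoef f * theta) - phi * dphi (f - thetaCoef f * theta)
def comp01 (f : SuperFn I) : SuperFn I := thetaCoef f - phi * dphi (thetaCoef f)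
def comp10 (f : SuperFn I) : SuperFn I := dphi (f - thetaCoef f * theta)
def comp11 (f : SuperFn I) : SuperFn I := dphi (thetaCoef f)

theorem quad_comp (f : SuperFn I) : quad (comp00 f) (comp01 f) (comp10 f) (comp11 f) = f := by
  simp only [quad, comp00, comp01, comp10, comp11, sub_mul]
  abel

/-- Free of `θ` and `φ`. -/
def Free (f : SuperFn I) : Prop := OddFree thetaVar f ∧ OddFree phiVar f

namespace Free

theorem add (hp : Free p) (hq : Free q) : Free (p + q) := ⟨hp.1.add hq.1, hp.2.add hq.2⟩
theorem sub (hp : Free p) (hq : Free q) : Free (p - q) := ⟨hp.1.sub hq.1, hp.2.sub hq.2⟩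
theorem neg (hp : Free p) : Free (-p) := ⟨hp.1.neg, hp.2.neg⟩
theorem mul (hp : Free p) (hq : Free q) : Free (p * q) := ⟨hp.1.mul hq.1, hp.2.mul hq.2⟩
theorem dx (hp : Free p) : Free (SuperKP.dx p) := ⟨hp.1.dx, hp.2.dx⟩

end Free

theorem free_one : Free (1 : SuperFn I) := ⟨oddFree_one _, oddFree_one _⟩
theorem free_zero : Free (0 : SuperFn I) := ⟨oddFree_zero _, oddFree_zero _⟩
theorem free_zpow (k : ℤ) : Free (zpow k : SuperFn I) := ⟨oddFree_zpow _ k, oddFree_zpow _ k⟩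

theorem thetaFree_sub_phi_mul (hf : OddFree thetaVar f) :
    OddFree thetaVar (f - phi * dphi f) := hf.sub (thetaFree_phi.mul (hf.dOdd phiVar))

theorem free_comp00 (f : SuperFn I) : Free (comp00 f) :=
  ⟨thetaFree_sub_phi_mul (thetaFree_sub_thetaCoef f), phiFree_sub_dphi _⟩
theorem free_comp01 (f : SuperFn I) : Free (comp01 f) :=
  ⟨thetaFree_sub_phi_mul (thetaFree_thetaCoef f), phiFree_sub_dphi _⟩
theorem free_comp10 (f : SuperFn I) : Free (comp10 f) :=
  ⟨(thetaFree_sub_thetaCoef f).dOdd phiVar, phiFree_dphi _⟩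
theorem free_comp11 (f : SuperFn I) : Free (comp11 f) :=
  ⟨(thetaFree_thetaCoef f).dOdd phiVar, phiFree_dphi _⟩

theorem dphi_phi_mul (hf : OddFree phiVar f) : dphi (phi * f) = f := by
  have : dphi f = 0 := hf
  rw [dphi_isSuperDer.mul, this, dphi_phi, mul_zero, add_zero, one_mul]

theorem thetaCoef_quad (hp : Free p) (hq : Free q) (hr : Free r) (hs : Free s) :
    thetaCoef (quad p q r s) = q + phi * s := by
  rw [quad, thetaCoef_add, thetaCoef_add, thetaCoef_add, thetaCoef_of_free hp.1,
    thetaCoef_mul_left hq.1, thetaCoef_theta, thetaCoef_of_free (thetaFree_phi.mul hr.1),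
    thetaCoef_mul_left (thetaFree_phi.mul hs.1), thetaCoef_theta, mul_one, mul_one, zero_add,
    add_zero]

theorem dphi_add_phi_mul (hp : OddFree phiVar p) (hr : OddFree phiVar r) :
    dphi (p + phi * r) = r := by
  have : dphi p = 0 := hp
  rw [dphi_isSuperDer.add, this, dphi_phi_mul hr, zero_add]

section
variable (hp : Free p) (hq : Free q) (hr : Free r) (hs : Free s)
include hp hq hr hs

theorem comp01_quad : comp01 (quad p q r s) = q := by
  rw [comp01, thetaCoef_quad hp hq hr hs, dphi_add_phi_mul hq.2 hs.2, add_sub_cancel_right]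

theorem comp11_quad : comp11 (quad p q r s) = s := by
  rw [comp11, thetaCoef_quad hp hq hr hs, dphi_add_phi_mul hq.2 hs.2]

theorem quad_sub_thetaCoef :
    quad p q r s - thetaCoef (quad p q r s) * theta = p + phi * r := by
  rw [thetaCoef_quad hp hq hr hs, quad, add_mul]
  abel

theorem comp10_quad : comp10 (quad p q r s) = r := by
  rw [comp10, quad_sub_thetaCoef hp hq hr hs, dphi_add_phi_mul hp.2 hr.2]

theorem comp00_quad : comp00 (quad p q r s) = p := by
  rw [comp00, quad_sub_thetaCoef hp hq hr hs, dphi_add_phi_mul hp.2 hr.2, add_sub_cancel_right]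

end

theorem quad_injective (hp : Free p) (hq : Free q) (hr : Free r) (hs : Free s) (hp' : Free p')
    (hq' : Free q') (hr' : Free r') (hs' : Free s') (h : quad p q r s = quad p' q' r' s') :
    p = p' ∧ q = q' ∧ r = r' ∧ s = s' :=
  ⟨by rw [← comp00_quad hp hq hr hs, h, comp00_quad hp' hq' hr' hs'],
    by rw [← comp01_quad hp hq hr hs, h, comp01_quad hp' hq' hr' hs'],
    by rw [← comp10_quad hp hq hr hs, h, comp10_quad hp' hq' hr' hs'],
    by rw [← comp11_quad hp hq hr hs, h, comp11_quad hp' hq' hr' hs']⟩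

theorem HasParity.dphi {k : ℕ} (hf : HasParity k f) : HasParity (1 + k) (SuperKP.dphi f) :=
  dphi_isSuperDer.hasParity hf

theorem HasParity.phi_mul_dphi {k : ℕ} (hf : HasParity k f) :
    HasParity k (phi * SuperKP.dphi f) :=
  HasParity.congr (by omega) (phi_odd.mul hf.dphi)

theorem hasParity_thetaCoef {k : ℕ} (hf : HasParity k f) : HasParity (k + 1) (thetaCoef f) := by
  have h := (dOdd_isSuperDer thetaVar).hasParity hf
  have h1 : thetaCoef f = (-1) ^ (1 + k) * dOdd thetaVar f := hasParity_iff.1 h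
  rw [h1]
  rcases Nat.even_or_odd (1 + k) with h' | h'
  · rw [h'.neg_one_pow, one_mul]
    exact h.congr (by omega)
  · rw [h'.neg_one_pow, neg_one_mul]
    exact h.neg.congr (by omega)

theorem hasParity_sub_thetaCoef {k : ℕ} (hf : HasParity k f) :
    HasParity k (f - thetaCoef f * theta) :=
  hf.sub (((hasParity_thetaCoef hf).mul theta_odd).congr (by omega))

theorem hasParity_comp00 {k : ℕ} (hf : HasParity k f) : HasParity k (comp00 f) :=
  (hasParity_sub_thetaCoef hf).sub (hasParity_sub_thetaCoef hf).phi_mul_dphi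
theorem hasParity_comp01 {k : ℕ} (hf : HasParity k f) : HasParity (k + 1) (comp01 f) :=
  (hasParity_thetaCoef hf).sub (hasParity_thetaCoef hf).phi_mul_dphi
theorem hasParity_comp10 {k : ℕ} (hf : HasParity k f) : HasParity (k + 1) (comp10 f) :=
  (hasParity_sub_thetaCoef hf).dphi.congr (by omega)
theorem hasParity_comp11 {k : ℕ} (hf : HasParity k f) : HasParity k (comp11 f) :=
  (hasParity_thetaCoef hf).dphi.congr (by omega)

theorem DegLE.thetaCoef {a : ℤ} (hf : DegLE a f) : DegLE a (SuperKP.thetaCoef f) :=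
  (hf.dOdd thetaVar).parity
theorem DegLE.phi_mul_dphi {a : ℤ} (hf : DegLE a f) : DegLE a (phi * SuperKP.dphi f) :=
  (hf.dOdd phiVar).zconst_mul zconst_phi
theorem DegLE.sub_thetaCoef {a : ℤ} (hf : DegLE a f) :
    DegLE a (f - SuperKP.thetaCoef f * theta) := hf.sub (hf.thetaCoef.mul_zconst zconst_theta)
theorem DegLE.comp00 {a : ℤ} (hf : DegLE a f) : DegLE a (SuperKP.comp00 f) :=
  hf.sub_thetaCoef.sub hf.sub_thetaCoef.phi_mul_dphi
theorem DegLE.comp01 {a : ℤ} (hf : DegLE a f) : DegLE a (SuperKP.comp01 f) :=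
  hf.thetaCoef.sub hf.thetaCoef.phi_mul_dphi
theorem DegLE.comp10 {a : ℤ} (hf : DegLE a f) : DegLE a (SuperKP.comp10 f) :=
  hf.sub_thetaCoef.dOdd phiVar
theorem DegLE.comp11 {a : ℤ} (hf : DegLE a f) : DegLE a (SuperKP.comp11 f) :=
  hf.thetaCoef.dOdd phiVar

theorem comp01_sub (f g : SuperFn I) : comp01 (f - g) = comp01 f - comp01 g := by
  simp only [comp01, thetaCoef_sub, dphi_isSuperDer.sub, mul_sub]
  abel

/-! ### Components of Faà di Bruno generators -/

theorem quad_degLE {a : ℤ} (hp : DegLE a p) (hq : DegLE a q) (hr : DegLE a r) (hs : DegLE a s) :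
    DegLE a (quad p q r s) :=
  ((hp.add (hq.mul_zconst zconst_theta)).add (hr.zconst_mul zconst_phi)).add
    ((hs.zconst_mul zconst_phi).mul_zconst zconst_theta)

theorem tau_eq_quad : (tau : SuperFn I) = quad 0 1 (zpow 1) 0 := by
  rw [quad, tau]
  simp

/-- No sign arises from moving θ to the right: a is even, and in θφψ the signs from passing φ and
the odd ψ cancel. -/
theorem gen_eq_quad {c : Components I} (hc : c.Admissible) :
    c.gen = quad c.nu c.a c.h c.psi := by
  have h : c.gen = c.nu + theta * c.a + phi * c.h + theta * phi * c.psi := rfl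
  rw [h, quad, theta_mul, hasParity_zero_iff.1 hc.a_even, theta_mul_phi, neg_mul, mul_assoc,
    theta_mul, hasParity_one_iff.1 hc.psi_odd, neg_mul, mul_neg, neg_neg, ← mul_assoc]

theorem Components.Admissible.free {c : Components I} (hc : c.Admissible) :
    Free c.nu ∧ Free c.a ∧ Free c.h ∧ Free c.psi :=
  ⟨⟨hc.thetaFree.1, hc.phiFree.1⟩, ⟨hc.thetaFree.2.1, hc.phiFree.2.1⟩,
    ⟨hc.thetaFree.2.2.1, hc.phiFree.2.2.1⟩, ⟨hc.thetaFree.2.2.2, hc.phiFree.2.2.2⟩⟩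

theorem gen_odd {c : Components I} (hc : c.Admissible) : HasParity 1 c.gen := by
  rw [gen_eq_quad hc, quad]
  exact ((hc.nu_odd.add (hc.a_even.even_mul_odd theta_odd)).add
    (phi_odd.odd_mul_even hc.h_even)).add ((phi_odd.odd_mul_odd hc.psi_odd).even_mul_odd theta_odd)

theorem gen_isNeg {c : Components I} (hc : c.Admissible) : IsNeg (c.gen - tau) := by
  rw [gen_eq_quad hc, tau_eq_quad, quad_sub, isNeg_iff]
  refine quad_degLE ?_ (isNeg_iff.1 hc.a_neg) (isNeg_iff.1 hc.h_neg) ?_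
  · rw [sub_zero]
    exact isNeg_iff.1 hc.nu_neg
  · rw [sub_zero]
    exact isNeg_iff.1 hc.psi_neg

theorem gen_injective {c c' : Components I} (hc : c.Admissible) (hc' : c'.Admissible)
    (h : c.gen = c'.gen) : c = c' := by
  rw [gen_eq_quad hc, gen_eq_quad hc'] at h
  obtain ⟨f1, f2, f3, f4⟩ := hc.free
  obtain ⟨f1', f2', f3', f4'⟩ := hc'.free
  obtain ⟨h1, h2, h3, h4⟩ := quad_injective f1 f2 f3 f4 f1' f2' f3' f4' h
  cases c
  cases c'
  simp only at h1 h2 h3 h4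
  subst h1 h2 h3 h4
  rfl

/-- Together with `gen_odd` and `gen_isNeg`: the generators are exactly the odd elements of τ + V⁻.
The terms 1 in a and z in h are the components of τ. -/
theorem exists_components {G : SuperFn I} (hG : HasParity 1 G) (hn : IsNeg (G - tau)) :
    ∃ c : Components I, c.Admissible ∧ c.gen = G := by
  have hn' := isNeg_iff.1 hn
  have h0 : G = quad (comp00 (G - tau)) (1 + comp01 (G - tau)) (zpow 1 + comp10 (G - tau))
      (comp11 (G - tau)) := by
    have h := quad_comp (G - tau)
    have h1 : G = (G - tau) + tau := by abel
    conv_lhs => rw [h1, ← h, tau_eq_quad, quad_add]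
    rw [add_zero, add_zero, ← tau_eq_quad, add_comm 1, add_comm (zpow 1)]
  have ho : HasParity 1 (G - tau) := hG.sub tau_odd
  have hc : (Components.mk (comp00 (G - tau)) (1 + comp01 (G - tau)) (zpow 1 + comp10 (G - tau))
      (comp11 (G - tau))).Admissible := by
    refine ⟨hasParity_comp00 ho, ?_, ?_, hasParity_comp11 ho, ⟨(free_comp00 _).2, ?_, ?_,
      (free_comp11 _).2⟩, ⟨(free_comp00 _).1, ?_, ?_, (free_comp11 _).1⟩, isNeg_iff.2 hn'.comp00, ?_,
      ?_, isNeg_iff.2 hn'.comp11⟩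
    · exact HasParity.one.add ((hasParity_comp01 ho).congr (by omega))
    · exact (zpow_even 1).add ((hasParity_comp10 ho).congr (by omega))
    · exact (free_one.add (free_comp01 _)).2
    · exact ((free_zpow 1).add (free_comp10 _)).2
    · exact (free_one.add (free_comp01 _)).1
    · exact ((free_zpow 1).add (free_comp10 _)).1
    · have := hn'.comp01
      rw [← isNeg_iff, ← add_sub_cancel_left 1 (comp01 (G - tau))] at this
      exact this
    · have := hn'.comp10
      rw [← isNeg_iff, ← add_sub_cancel_left (zpow 1) (comp10 (G - tau))] at this
      exact this
  exact ⟨_, hc, by rw [gen_eq_quad hc]; exact h0.symm⟩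

end
end SuperKP

namespace SuperKP

noncomputable section

open scoped Sealed

variable {I : Type*} [LinearOrder I]

open PsiDO

variable {d d' : Dressing I} {g : SuperFn I}

/-! ### Dressing operators -/

namespace Dressing

theorem op_zero (d : Dressing I) : d.op 0 = 1 := rfl

theorem op_pos (d : Dressing I) (k : ℤ) (hk : 0 < k) : d.op k = 0 := by
  obtain ⟨j, rfl⟩ : ∃ j : ℕ, k = Int.ofNat (j + 1) := ⟨(k - 1).toNat, by
    rw [Int.ofNat_eq_natCast]; push_cast; omega⟩
  rfl

theorem op_odd (d : Dressing I) (i : ℕ) : d.op (-(2 * i + 1)) = d.eta i + phi * d.w i := by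
  have h : (-(2 * i + 1) : ℤ) = Int.negSucc (2 * i) := by
    rw [Int.negSucc_eq]; push_cast; ring
  have h1 : d.op (Int.negSucc (2 * i)) = if Even (2 * i) then
    d.eta (2 * i / 2) + phi * d.w (2 * i / 2) else d.u (2 * i / 2) + phi * d.xi (2 * i / 2) := rfl
  rw [h, h1, if_pos (by simp), show 2 * i / 2 = i by omega]

theorem op_even (d : Dressing I) (i : ℕ) : d.op (-(2 * i + 2)) = d.u i + phi * d.xi i := by
  have h : (-(2 * i + 2) : ℤ) = Int.negSucc (2 * i + 1) := by
    rw [Int.negSucc_eq]; push_cast; ring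
  have h1 : d.op (Int.negSucc (2 * i + 1)) = if Even (2 * i + 1) then
    d.eta ((2 * i + 1) / 2) + phi * d.w ((2 * i + 1) / 2) else
    d.u ((2 * i + 1) / 2) + phi * d.xi ((2 * i + 1) / 2) := rfl
  rw [h, h1, if_neg (by simp), show (2 * i + 1) / 2 = i by omega]

theorem isMonic (hd : d.Admissible) : IsMonic d.op where
  zero := d.op_zero
  order := d.op_pos
  field k := by
    rcases lt_trichotomy k 0 with h | rfl | h
    · rcases Int.even_or_odd' k with ⟨m, rfl | rfl⟩
      · rw [show 2 * m = -(2 * ((-m - 1).toNat : ℤ) + 2) by omega, op_even]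
        exact (hd.u_even _).1.add (isField_phi.mul (hd.xi_odd _).1)
      · rw [show 2 * m + 1 = -(2 * ((-m - 1).toNat : ℤ) + 1) by omega, op_odd]
        exact (hd.eta_odd _).1.add (isField_phi.mul (hd.w_even _).1)
    · exact isField_one
    · rw [op_pos _ _ h]
      exact isField_zero

end Dressing

section NegSeries

variable {b c : ℕ → SuperFn I}

theorem zCoef_negSeries_zero (hb : ∀ i, IsField (b i)) : zCoef 0 (negSeries b) = 0 := by
  rw [zCoef_negSeries fun i => (hb i).zconst, if_neg (by omega)]

theorem zCoef_negSeries_neg (hb : ∀ i, IsField (b i)) (i : ℕ) :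
    zCoef (-(i + 1)) (negSeries b) = b i := by
  rw [zCoef_negSeries fun i => (hb i).zconst, if_pos (by omega)]
  congr 1
  omega

/-- Equality of functions of degree at most `0`. -/
theorem ext_of_degLE_zero {f g : SuperFn I} (hf : DegLE 0 f) (hg : DegLE 0 g)
    (h0 : zCoef 0 f = zCoef 0 g) (h : ∀ i : ℕ, zCoef (-(i + 1)) f = zCoef (-(i + 1)) g) :
    f = g :=
  zCoef_ext fun m => by
    rcases lt_trichotomy m 0 with hm | rfl | hm
    · rw [show m = -(((-m - 1).toNat : ℤ) + 1) by omega]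
      exact h _
    · exact h0
    · rw [hf.zCoef_eq_zero hm, hg.zCoef_eq_zero hm]

theorem degLE_negSeries (b : ℕ → SuperFn I) : DegLE (-1) (negSeries b) :=
  isNeg_iff.1 (isNeg_negSeries b)

theorem negSeries_add (hb : ∀ i, IsField (b i)) (hc : ∀ i, IsField (c i)) :
    negSeries (fun i => b i + c i) = negSeries b + negSeries c :=
  ext_of_degLE_zero ((degLE_negSeries _).mono (by omega))
    (((degLE_negSeries b).add (degLE_negSeries c)).mono (by omega))
    (by rw [zCoef_add, zCoef_negSeries_zero hb, zCoef_negSeries_zero hc,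
      zCoef_negSeries_zero fun i => (hb i).add (hc i), add_zero])
    fun i => by rw [zCoef_add, zCoef_negSeries_neg hb, zCoef_negSeries_neg hc,
      zCoef_negSeries_neg fun i => (hb i).add (hc i)]

theorem negSeries_neg (hb : ∀ i, IsField (b i)) : negSeries (fun i => -b i) = -negSeries b :=
  ext_of_degLE_zero ((degLE_negSeries _).mono (by omega))
    ((degLE_negSeries b).neg.mono (by omega))
    (by rw [zCoef_neg, zCoef_negSeries_zero hb, zCoef_negSeries_zero fun i => (hb i).neg, neg_zero])
    fun i => by rw [zCoef_neg, zCoef_negSeries_neg hb, zCoef_negSeries_neg fun i => (hb i).neg]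

theorem negSeries_sub (hb : ∀ i, IsField (b i)) (hc : ∀ i, IsField (c i)) :
    negSeries (fun i => b i - c i) = negSeries b - negSeries c := by
  simp only [sub_eq_add_neg]
  rw [negSeries_add hb fun i => (hc i).neg, negSeries_neg hc]

theorem negSeries_dx (hb : ∀ i, IsField (b i)) : negSeries (fun i => dx (b i)) = dx (negSeries b) :=
  ext_of_degLE_zero ((degLE_negSeries _).mono (by omega))
    ((degLE_negSeries b).dx.mono (by omega))
    (by rw [zCoef_dx, zCoef_negSeries_zero hb, zCoef_negSeries_zero fun i => (hb i).dx,
      dx_isSuperDer.zero])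
    fun i => by rw [zCoef_dx, zCoef_negSeries_neg hb, zCoef_negSeries_neg fun i => (hb i).dx]

theorem zpow_mul_negSeries (hb : ∀ i, IsField (b i)) :
    zpow 1 * negSeries b = b 0 + negSeries fun i => b (i + 1) := by
  refine ext_of_degLE_zero (by simpa using (degLE_zpow 1).mul (degLE_negSeries b))
    ((hb 0).zconst.degLE.add ((degLE_negSeries _).mono (by omega))) ?_ fun i => ?_
  · have := zCoef_negSeries_neg hb 0
    rw [zCoef_zpow_mul, zCoef_add, zCoef_zero_of_zconst (hb 0).zconst,
      zCoef_negSeries_zero fun i => hb (i + 1), add_zero, ← this]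
    rfl
  · have := zCoef_negSeries_neg hb (i + 1)
    rw [zCoef_zpow_mul, zCoef_add, zCoef_of_ne (hb 0).zconst (by omega), zero_add,
      zCoef_negSeries_neg fun i => hb (i + 1), ← this]
    congr 1

theorem zCoef_neg_one_pow_mul (k : ℤ) (p : ℕ) (f : SuperFn I) :
    zCoef k ((-1) ^ p * f) = (-1) ^ p * zCoef k f := by
  rcases Nat.even_or_odd p with h | h
  · rw [h.neg_one_pow, one_mul, one_mul]
  · rw [h.neg_one_pow, neg_one_mul, neg_one_mul, zCoef_neg]

theorem negSeries_hasParity {p : ℕ} (hf : ∀ i, IsField (b i)) (hb : ∀ i, HasParity p (b i)) :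
    HasParity p (negSeries b) := by
  rw [hasParity_iff]
  refine ext_of_degLE_zero ((degLE_negSeries b).parity.mono (by omega))
    (degLE_neg_one_pow_mul ((degLE_negSeries b).mono (by omega)) p) ?_ fun i => ?_
  · rw [zCoef_neg_one_pow_mul, zCoef_parity, zCoef_negSeries_zero hf, parity_zero, mul_zero]
  · rw [zCoef_neg_one_pow_mul, zCoef_parity, zCoef_negSeries_neg hf]
    exact hasParity_iff.1 (hb i)

theorem negSeries_free (hb : ∀ i, IsField (b i) ∧ PhiFree (b i)) : Free (negSeries b) := by
  have h : ∀ o : OddVar I, (∀ i, OddFree o (b i)) → OddFree o (negSeries b) := fun o ho => by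
    refine oddFree_of_zCoef fun k => ?_
    rw [zCoef_negSeries fun i => (hb i).1.zconst]
    split_ifs
    exacts [ho _, oddFree_zero o]
  exact ⟨h _ fun i => (hb i).1.thetaFree, h _ fun i => (hb i).2⟩

end NegSeries

namespace Dressing

/-- The components of the symbol of a dressing operator. -/
def symA (d : Dressing I) : SuperFn I := 1 + negSeries d.u
def symB (d : Dressing I) : SuperFn I := negSeries d.eta
-- The term η_{i+1} δ^{-(2i+1)} has the part η_{i+1} φ z^{-i} = -φ η_{i+1} z^{-i}. This explains the
-- sign and the shift against ξ, and leaves -η_1 as the only coefficient of z^0.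
def symC (d : Dressing I) : SuperFn I := -d.eta 0 + negSeries fun i => d.xi i - d.eta (i + 1)
def symD (d : Dressing I) : SuperFn I := negSeries d.w

section
variable (hd : d.Admissible)
include hd

theorem field_C (i : ℕ) : IsField (d.xi i - d.eta (i + 1)) := (hd.xi_odd _).1.sub (hd.eta_odd _).1

theorem symA_even : HasParity 0 d.symA :=
  HasParity.one.add (negSeries_hasParity (fun i => (hd.u_even i).1) fun i => (hd.u_even i).2.2)
theorem symB_odd : HasParity 1 d.symB :=
  negSeries_hasParity (fun i => (hd.eta_odd i).1) fun i => (hd.eta_odd i).2.2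
theorem symC_odd : HasParity 1 d.symC :=
  (hd.eta_odd 0).2.2.neg.add (negSeries_hasParity (field_C hd)
    fun i => (hd.xi_odd i).2.2.sub (hd.eta_odd (i + 1)).2.2)
theorem symD_even : HasParity 0 d.symD :=
  negSeries_hasParity (fun i => (hd.w_even i).1) fun i => (hd.w_even i).2.2

theorem eta_free (i : ℕ) : Free (d.eta i) := ⟨(hd.eta_odd i).1.thetaFree, (hd.eta_odd i).2.1⟩

theorem symA_free : Free d.symA :=
  free_one.add (negSeries_free fun i => ⟨(hd.u_even i).1, (hd.u_even i).2.1⟩)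
theorem symB_free : Free d.symB :=
  negSeries_free fun i => ⟨(hd.eta_odd i).1, (hd.eta_odd i).2.1⟩
theorem symC_free : Free d.symC :=
  (eta_free hd 0).neg.add (negSeries_free fun i =>
    ⟨field_C hd i, phiFree_iff.1 (hd.xi_odd i).2.1 |>.sub (hd.eta_odd (i + 1)).2.1⟩)
theorem symD_free : Free d.symD :=
  negSeries_free fun i => ⟨(hd.w_even i).1, (hd.w_even i).2.1⟩

theorem symA_degLE : DegLE 0 d.symA := zconst_one.degLE.add ((degLE_negSeries _).mono (by omega))
theorem symB_degLE : DegLE 0 d.symB := (degLE_negSeries _).mono (by omega)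
theorem symC_degLE : DegLE 0 d.symC :=
  (hd.eta_odd 0).1.zconst.degLE.neg.add ((degLE_negSeries _).mono (by omega))
theorem symD_degLE : DegLE 0 d.symD := (degLE_negSeries _).mono (by omega)

theorem sym_op : sym d.op = quad d.symA d.symB d.symC d.symD := by
  have z : ∀ m, zCoef m (quad d.symA d.symB d.symC d.symD) = quad (zCoef m d.symA) (zCoef m d.symB)
      (zCoef m d.symC) (zCoef m d.symD) := fun m => by
    simp only [quad]
    rw [zCoef_add, zCoef_add, zCoef_add, zCoef_mul_right zconst_theta, zCoef_mul_left zconst_phi,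
      zCoef_mul_right zconst_theta, zCoef_mul_left zconst_phi]
  refine ext_of_degLE_zero (degLE_sym (isMonic hd).isPsiDO (isMonic hd).order (by simp))
    (quad_degLE (symA_degLE hd) (symB_degLE hd) (symC_degLE hd) (symD_degLE hd)) ?_ fun i => ?_
  · rw [zCoef_sym (isMonic hd).isPsiDO, z, symA, symB, symC, symD, zCoef_add, zCoef_add,
      zCoef_negSeries_zero fun i => (hd.u_even i).1, zCoef_negSeries_zero fun i => (hd.eta_odd i).1,
      zCoef_negSeries_zero (field_C hd), zCoef_negSeries_zero fun i => (hd.w_even i).1,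
      zCoef_neg, zCoef_zero_of_zconst zconst_one, zCoef_zero_of_zconst (hd.eta_odd 0).1.zconst,
      mul_zero, op_zero, op_pos _ _ (by simp)]
    -- At z^0 only δ⁻¹ contributes besides 1: η_1 gives -φη_1, and φw_1 dies against φ.
    have h := op_odd d 0
    rw [show (0 : ℤ) - 1 = -(2 * ((0 : ℕ) : ℤ) + 1) by simp, h, quad, mul_phi, parity_add,
      parity_mul, hasParity_one_iff.1 phi_odd, mul_add, hasParity_one_iff.1 (hd.eta_odd 0).2.2,
      neg_mul, mul_neg, mul_neg, ← mul_assoc, phi_mul_phi]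
    simp
  · have c1 : (-(i + 1) : ℤ) ≠ 0 := by omega
    rw [zCoef_sym (isMonic hd).isPsiDO, z, symA, symB, symC, symD, zCoef_add, zCoef_add,
      zCoef_negSeries_neg fun i => (hd.u_even i).1, zCoef_negSeries_neg fun i => (hd.eta_odd i).1,
      zCoef_negSeries_neg (field_C hd), zCoef_negSeries_neg fun i => (hd.w_even i).1,
      zCoef_neg, zCoef_of_ne zconst_one c1, zCoef_of_ne (hd.eta_odd 0).1.zconst c1]
    have h1 := op_even d i
    have h2 := op_odd d i
    have h3 := op_odd d (i + 1)
    rw [show (2 * (-(i + 1)) : ℤ) = -(2 * (i : ℤ) + 2) by ring, h1,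
      show (-(2 * (i : ℤ) + 2) + 1) = -(2 * (i : ℤ) + 1) by ring, h2,
      show (-(2 * (i : ℤ) + 2) - 1) = -(2 * ((i + 1 : ℕ) : ℤ) + 1) by push_cast; ring, h3, quad,
      mul_phi, parity_add, parity_mul, hasParity_one_iff.1 phi_odd, mul_add,
      hasParity_one_iff.1 (hd.eta_odd (i + 1)).2.2, neg_mul, mul_neg, mul_neg, ← mul_assoc phi phi,
      phi_mul_phi]
    simp only [add_mul, mul_sub, zero_mul, neg_zero, add_zero, zero_add]
    abel

theorem sym_op_even : HasParity 0 (sym d.op) := by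
  rw [sym_op hd, quad]
  exact (((symA_even hd).add ((symB_odd hd).odd_mul_odd theta_odd)).add
    (phi_odd.odd_mul_odd (symC_odd hd))).add ((phi_odd.odd_mul_even (symD_even hd)).odd_mul_odd
      theta_odd)

end

/-- The series `Φ / e` belonging to a dressing operator. -/
def firstSymbol (d : Dressing I) : SuperFn I := sym d.op * (1 + phi * d.eta 0)

end Dressing

open Dressing

theorem fexp_phi_mul (b : SuperFn I) :
    fexp (phi * b) = 1 + phi * b := by
  refine fexp_of_sq (((ordGE_oddVar phiVar).mul (OrdGE.any b)).mono (by omega)) ?_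
  rw [mul_assoc, ← mul_assoc b, mul_phi, mul_assoc, ← mul_assoc phi phi, phi_mul_phi, zero_mul]

theorem phi_mul_even {b : SuperFn I} (hb : HasParity 1 b) : HasParity 0 (1 + phi * b) :=
  HasParity.one.add (phi_odd.odd_mul_odd hb)

theorem one_add_phi_mul_one_sub {b : SuperFn I} :
    (1 + phi * b) * (1 - phi * b) = 1 := by
  have h : phi * b * (phi * b) = 0 := by
    rw [mul_assoc, ← mul_assoc b, mul_phi, mul_assoc, ← mul_assoc phi phi, phi_mul_phi, zero_mul]
  rw [mul_sub, mul_one, add_mul, one_mul, h]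
  abel

theorem one_sub_phi_mul_one_add {b : SuperFn I} :
    (1 - phi * b) * (1 + phi * b) = 1 := by
  have := one_add_phi_mul_one_sub (b := -b)
  rwa [mul_neg, ← sub_eq_add_neg, sub_neg_eq_add] at this

theorem firstSymbol_mul (d : Dressing I) :
    d.firstSymbol * (1 - phi * d.eta 0) = sym d.op := by
  rw [firstSymbol, mul_assoc, one_add_phi_mul_one_sub, mul_one]

theorem isDressed_op_iff (hd : d.Admissible) {Psi : SuperFn I} :
    IsDressed d.op Psi ↔ Psi = sym d.op * vacuumWave := isDressed_iff (isMonic hd).isPsiDO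

theorem isFirstWave_iff (hd : d.Admissible) {F : SuperFn I} :
    IsFirstWave d F ↔ F = d.firstSymbol * vacuumWave := by
  have key : sym d.op * vacuumWave * fexp (phi * d.eta 0) = d.firstSymbol * vacuumWave := by
    rw [fexp_phi_mul, firstSymbol, mul_assoc, mul_assoc, vacuumWave_even.comm]
  constructor
  · rintro ⟨Psi, h, rfl⟩
    rw [(isDressed_op_iff hd).1 h]
    exact key
  · intro h
    exact ⟨_, (isDressed_op_iff hd).2 rfl, h.trans key.symm⟩

theorem firstSymbol_even (hd : d.Admissible) : HasParity 0 d.firstSymbol :=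
  (sym_op_even hd).mul_even (phi_mul_even (hd.eta_odd 0).2.2)

end
end SuperKP

namespace SuperKP

noncomputable section

open scoped Sealed

variable {I : Type*} [LinearOrder I]

open PsiDO Dressing

variable {d d' : Dressing I} {g : SuperFn I}

/-! ### Dressing operators and even elements of `1 + V⁻` -/

theorem firstSymbol_eq_quad (hd : d.Admissible) : d.firstSymbol =
    quad d.symA d.symB (d.symA * d.eta 0 + d.symC) (d.symD - d.symB * d.eta 0) := by
  have h : (1 + phi * d.eta 0 : SuperFn I) = quad 1 0 (d.eta 0) 0 := by
    rw [quad]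
    simp
  rw [firstSymbol, h, sym_op hd, quad_mul, hasParity_zero_iff.1 (symA_even hd),
    hasParity_one_iff.1 (symB_odd hd), hasParity_one_iff.1 (hd.eta_odd 0).2.2, parity_one]
  congr 1
  · rw [mul_one]
  · rw [mul_zero, zero_add, mul_one]
  · rw [mul_one]
  · rw [mul_zero, mul_zero, mul_one, neg_mul_neg]
    abel

theorem isNeg_negSeries_sub (b : ℕ → SuperFn I) (f : SuperFn I) :
    DegLE (-1) (f + negSeries b - f) := by
  rw [add_sub_cancel_left]
  exact degLE_negSeries b

/-- Modulo V⁻ the symbol of S is 1 - φη_1, whose inverse is 1 + φη_1. This normalisation is the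
reason for the first wave function. -/
theorem firstSymbol_isNeg (hd : d.Admissible) : IsNeg (d.firstSymbol - 1) := by
  have h1 : (1 - phi * d.eta 0 : SuperFn I) = quad 1 0 (-d.eta 0) 0 := by
    rw [quad, sub_eq_add_neg, mul_neg]
    simp
  have h2 : DegLE (-1) (sym d.op - (1 - phi * d.eta 0)) := by
    rw [h1, sym_op hd, quad_sub]
    refine quad_degLE (isNeg_negSeries_sub _ _) ?_ (isNeg_negSeries_sub _ _) ?_
    · rw [sub_zero]
      exact degLE_negSeries _
    · rw [sub_zero]
      exact degLE_negSeries _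
  have h3 : d.firstSymbol - 1 = (sym d.op - (1 - phi * d.eta 0)) * (1 + phi * d.eta 0) := by
    rw [sub_mul, one_sub_phi_mul_one_add, firstSymbol]
  rw [isNeg_iff, h3]
  exact h2.mul_zconst (zconst_one.add (zconst_phi.mul (hd.eta_odd 0).1.zconst))

theorem free_eta (hd : d.Admissible) : Free (d.symA * d.eta 0 + d.symC) ∧
    Free (d.symD - d.symB * d.eta 0) :=
  ⟨((symA_free hd).mul (eta_free hd 0)).add (symC_free hd),
    (symD_free hd).sub ((symB_free hd).mul (eta_free hd 0))⟩

theorem comp01_firstSymbol (hd : d.Admissible) : comp01 d.firstSymbol = d.symB := by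
  rw [firstSymbol_eq_quad hd]
  exact comp01_quad (symA_free hd) (symB_free hd) (free_eta hd).1 (free_eta hd).2

/-- The factor 1 + φη_1 does not change the θ-component at φ = 0, so η_1 can be read off from the
first symbol and the factor undone. -/
theorem eta_zero_eq (hd : d.Admissible) : d.eta 0 = zCoef (-1) (comp01 d.firstSymbol) := by
  rw [comp01_firstSymbol hd, symB, ← zCoef_negSeries_neg (fun i => (hd.eta_odd i).1) 0]
  simp

theorem negSeries_injective {b c : ℕ → SuperFn I} (hb : ∀ i, IsField (b i))
    (hc : ∀ i, IsField (c i)) (h : negSeries b = negSeries c) : b = c := by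
  funext i
  rw [← zCoef_negSeries_neg hb, h, zCoef_negSeries_neg hc]

theorem firstSymbol_injective (hd : d.Admissible) (hd' : d'.Admissible)
    (h : d.firstSymbol = d'.firstSymbol) : d = d' := by
  have h0 : d.eta 0 = d'.eta 0 := by rw [eta_zero_eq hd, h, eta_zero_eq hd']
  rw [firstSymbol_eq_quad hd, firstSymbol_eq_quad hd'] at h
  obtain ⟨hA, hB, hC, hD⟩ := quad_injective (symA_free hd) (symB_free hd) (free_eta hd).1
    (free_eta hd).2 (symA_free hd') (symB_free hd') (free_eta hd').1 (free_eta hd').2 h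
  rw [hA, h0, add_right_inj, symC, symC, h0, add_right_inj] at hC
  rw [hB, h0, sub_left_inj] at hD
  have e1 := negSeries_injective (fun i => (hd.u_even i).1) (fun i => (hd'.u_even i).1)
    (add_left_cancel hA)
  have e2 := negSeries_injective (fun i => (hd.eta_odd i).1) (fun i => (hd'.eta_odd i).1) hB
  have e3 := negSeries_injective (fun i => (hd.w_even i).1) (fun i => (hd'.w_even i).1) hD
  have e4 : d.xi = d'.xi := by
    funext i
    have := congrFun (negSeries_injective (field_C hd) (field_C hd') hC) i
    rwa [e2, sub_left_inj] at this
  cases d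
  cases d'
  simp only at e1 e2 e3 e4
  subst e1 e2 e3 e4
  rfl

theorem negSeries_zCoef {f : SuperFn I} (hf : DegLE (-1) f) :
    negSeries (fun i => zCoef (-(i + 1)) f) = f :=
  zCoef_ext fun m => by
    rw [zCoef_negSeries fun i => zconst_zCoef _ f]
    split_ifs with h
    · congr 1
      omega
    · rw [hf.zCoef_eq_zero (by omega)]

theorem HasParity.zCoef {p : ℕ} {f : SuperFn I} (hf : HasParity p f) (k : ℤ) :
    HasParity p (SuperKP.zCoef k f) := by
  rw [hasParity_iff, ← zCoef_parity, hasParity_iff.1 hf, zCoef_neg_one_pow_mul]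

theorem isField_phiFree_zCoef {f : SuperFn I} (hf : Free f) (k : ℤ) :
    IsField (zCoef k f) ∧ PhiFree (zCoef k f) := ⟨isField_zCoef hf.1 k, hf.2.zCoef k⟩

/-- The θ-component gives all η, in particular η_1; then the φ- and φθ-components in
`firstSymbol_eq_quad` are solved for ξ and w. -/
theorem exists_dressing (hg : HasParity 0 g) (hn : IsNeg (g - 1)) :
    ∃ d : Dressing I, d.Admissible ∧ d.firstSymbol = g := by
  have hq := quad_comp (g - 1)
  set p := comp00 (g - 1) with hp
  set q := comp01 (g - 1) with hq'
  set r := comp10 (g - 1) with hr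
  set s := comp11 (g - 1) with hs
  have hg1 : HasParity 0 (g - 1) := hg.sub HasParity.one
  have pp : HasParity 0 p := hasParity_comp00 hg1
  have pq : HasParity 1 q := hasParity_comp01 hg1
  have pr : HasParity 1 r := hasParity_comp10 hg1
  have ps : HasParity 0 s := hasParity_comp11 hg1
  have fp : Free p := free_comp00 _
  have fq : Free q := free_comp01 _
  have fr : Free r := free_comp10 _
  have fs : Free s := free_comp11 _
  have dp : DegLE (-1) p := (isNeg_iff.1 hn).comp00
  have dq : DegLE (-1) q := (isNeg_iff.1 hn).comp01
  have dr : DegLE (-1) r := (isNeg_iff.1 hn).comp10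
  have ds : DegLE (-1) s := (isNeg_iff.1 hn).comp11
  set eta : ℕ → SuperFn I := fun i => zCoef (-(i + 1)) q with heta
  have hE : ∀ i, IsField (eta i) ∧ PhiFree (eta i) ∧ HasParity 1 (eta i) := fun i =>
    ⟨(isField_phiFree_zCoef fq _).1, (isField_phiFree_zCoef fq _).2, pq.zCoef _⟩
  have fE : Free (eta 0) := ⟨(hE 0).1.thetaFree, (hE 0).2.1⟩
  have fC : Free (r - p * eta 0) := fr.sub (fp.mul fE)
  have fD : Free (s + q * eta 0) := fs.add (fq.mul fE)
  have dC : DegLE (-1) (r - p * eta 0) := dr.sub (dp.mul_zconst (hE 0).1.zconst)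
  have dD : DegLE (-1) (s + q * eta 0) := ds.add (dq.mul_zconst (hE 0).1.zconst)
  -- The φ-component (1 + p)η_1 + C must equal r and D - qη_1 must equal s, whence the corrections
  -- pη_1 and qη_1. Adding η_{i+1} undoes the difference ξ_i - η_{i+1} in C.
  set d : Dressing I := ⟨fun i => zCoef (-(i + 1)) p,
    fun i => zCoef (-(i + 1)) (r - p * eta 0) + eta (i + 1), eta,
    fun i => zCoef (-(i + 1)) (s + q * eta 0)⟩ with hd'
  have hd : d.Admissible := by
    refine ⟨fun i => ⟨(isField_phiFree_zCoef fp _).1, (isField_phiFree_zCoef fp _).2, pp.zCoef _⟩,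
      fun i => ⟨(isField_phiFree_zCoef fC _).1.add (hE _).1,
        OddFree.add (isField_phiFree_zCoef fC _).2 (hE _).2.1,
        ((pr.sub (pp.even_mul_odd (hE 0).2.2)).zCoef _).add (hE _).2.2⟩, hE,
      fun i => ⟨(isField_phiFree_zCoef fD _).1, (isField_phiFree_zCoef fD _).2,
        (ps.add (pq.odd_mul_odd (hE 0).2.2)).zCoef _⟩⟩
  refine ⟨d, hd, ?_⟩
  have eA : d.symA = 1 + p := by rw [symA, hd', negSeries_zCoef dp]
  have eB : d.symB = q := by rw [symB, hd', heta, negSeries_zCoef dq]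
  have eC : d.symC = -eta 0 + (r - p * eta 0) := by
    rw [symC, hd']
    simp only [add_sub_cancel_right]
    rw [negSeries_zCoef dC]
  have eD : d.symD = s + q * eta 0 := by rw [symD, hd', negSeries_zCoef dD]
  have h1 : (1 : SuperFn I) = quad 1 0 0 0 := by
    rw [quad]
    simp
  have h2 : g = quad p q r s + 1 := by rw [hq]; abel
  rw [firstSymbol_eq_quad hd, eA, eB, eC, eD, h2]
  conv_rhs => rw [h1, quad_add]
  have h3 : d.eta 0 = eta 0 := rfl
  rw [h3]
  congr 1
  · abel
  · abel
  · rw [add_mul, one_mul]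
    abel
  · abel

/-! ### The change of coordinates -/

theorem eq_iff_of_sub_eq_neg {A : Type*} [AddCommGroup A] {a b c d : A} (h : a - b = d - c) :
    a = b ↔ c = d := by rw [← sub_eq_zero, h, sub_eq_zero, eq_comm]

theorem coordChange_def {c : Components I} {nu0 : SuperFn I} : CoordChange d c nu0 ↔
    (nu0 + c.nu) * d.symA = d.symC ∧
    c.a * d.symA - d.symB * (nu0 + c.nu) = 1 + negSeries (fun i => d.u i + d.w i) ∧
    c.h * d.symA = zpow 1 + d.u 0 + d.eta 0 * (nu0 + c.nu) +
      negSeries (fun i => dx (d.u i) + d.u (i + 1)) +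
      (nu0 + c.nu) * negSeries (fun i => d.xi i - d.eta (i + 1)) ∧
    c.psi * d.symA = c.a * (d.eta 0 + negSeries fun i => d.eta (i + 1) - d.xi i) +
      (nu0 + c.nu) * d.symD - c.h * d.symB + negSeries fun i => dx (d.eta i) + d.xi i :=
  ⟨fun h => ⟨h.nu_eq, h.a_eq, h.h_eq, h.psi_eq⟩, fun h => ⟨h.1, h.2.1, h.2.2.1, h.2.2.2⟩⟩

/-- Each equation of (*) is transposed so that one side contains only derivatives and multiples by z
of the symbol and the other only products with 𝔥. The index shifts in (*) are multiplication by z,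
which turns the first coefficient of a negative series into its term of degree 0. -/
theorem coordChange_iff_quad (hd : d.Admissible) {c : Components I} {nu0 : SuperFn I}
    (hnu : HasParity 1 (nu0 + c.nu)) : CoordChange d c nu0 ↔
      d.symC = (nu0 + c.nu) * d.symA ∧
      d.symD + d.symA = (nu0 + c.nu) * d.symB + c.a * d.symA ∧
      dx d.symA + d.symA * zpow 1 = -((nu0 + c.nu) * d.symC) + c.h * d.symA ∧
      dx d.symB + (d.symB * zpow 1 + d.symC) =
        -((nu0 + c.nu) * d.symD) + c.a * d.symC + c.h * d.symB + c.psi * d.symA := by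
  have fu := fun i => (hd.u_even i).1
  have fw := fun i => (hd.w_even i).1
  have fe := fun i => (hd.eta_odd i).1
  have fx := fun i => (hd.xi_odd i).1
  rw [coordChange_def]
  refine and_congr eq_comm (and_congr (eq_iff_of_sub_eq_neg ?_) (and_congr
    (eq_iff_of_sub_eq_neg ?_) (eq_iff_of_sub_eq_neg ?_)))
  · rw [negSeries_add fu fw, (symB_odd hd).anticomm hnu, symA, symD]
    abel
  · have e1 : d.symA * zpow 1 = zpow 1 + (d.u 0 + negSeries fun i => d.u (i + 1)) := by
      rw [← (zpow_even 1).comm, symA, mul_add, mul_one, zpow_mul_negSeries fu]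
    have e2 : dx d.symA = dx (negSeries d.u) := by
      rw [symA, dx_isSuperDer.add, dx_isSuperDer.one, zero_add]
    rw [e1, e2, negSeries_add (fun i => (fu i).dx) fun i => fu (i + 1), negSeries_dx fu, symC,
      (hd.eta_odd 0).2.2.anticomm hnu, mul_add (nu0 + c.nu), mul_neg (nu0 + c.nu)]
    abel
  · have e1 : d.symB * zpow 1 = d.eta 0 + negSeries fun i => d.eta (i + 1) := by
      rw [← (zpow_even 1).comm, symB, zpow_mul_negSeries fe]
    rw [e1, negSeries_add (fun i => (fe i).dx) fx, negSeries_dx fe, symC,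
      negSeries_sub (fun i => fe (i + 1)) fx, negSeries_sub fx fun i => fe (i + 1)]
    simp only [mul_add, mul_sub, mul_neg, symB]
    abel

/-- Division of δΨ = 𝔥Ψ by the vacuum wave leaves δ(`sym S`) + `sym S` · τ = 𝔥 · `sym S`, and
comparison of its four components in θ and φ gives the four equations. -/
theorem coordChange_iff (hd : d.Admissible) {c : Components I} {nu0 : SuperFn I}
    (h : IsEnhanced c nu0) : CoordChange d c nu0 ↔
      del (sym d.op * vacuumWave) = (c.gen + nu0) * (sym d.op * vacuumWave) := by
  have hc := h.admissible
  have fnu : Free (nu0 + c.nu) := Free.add ⟨h.field.thetaFree, h.phiFree⟩ hc.free.1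
  have pnu : parity (nu0 + c.nu) = -(nu0 + c.nu) := hasParity_one_iff.1 (h.odd.add hc.nu_odd)
  have h1 : c.gen + nu0 = quad (nu0 + c.nu) c.a c.h c.psi := by
    rw [gen_eq_quad hc, quad, quad]
    abel
  have pz : parity (zpow 1 : SuperFn I) = zpow 1 := hasParity_zero_iff.1 (zpow_even 1)
  have h2 : del (sym d.op) + sym d.op * tau = quad d.symC (d.symD + d.symA)
      (dx d.symA + d.symA * zpow 1) (dx d.symB + (d.symB * zpow 1 + d.symC)) := by
    rw [sym_op hd, del_quad (symA_free hd).2 (symB_free hd).2 (symC_free hd).2 (symD_free hd).2,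
      tau_eq_quad, quad_mul, quad_add, hasParity_zero_iff.1 (symA_even hd),
      hasParity_one_iff.1 (symB_odd hd), pz, parity_zero]
    simp only [mul_zero, mul_one, add_zero, neg_mul, sub_neg_eq_add, zero_add]
  have h3 : (c.gen + nu0) * sym d.op = quad ((nu0 + c.nu) * d.symA)
      ((nu0 + c.nu) * d.symB + c.a * d.symA) (-((nu0 + c.nu) * d.symC) + c.h * d.symA)
      (-((nu0 + c.nu) * d.symD) + c.a * d.symC + c.h * d.symB + c.psi * d.symA) := by
    rw [h1, sym_op hd, quad_mul, pnu, hasParity_zero_iff.1 hc.a_even,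
      hasParity_zero_iff.1 (symA_even hd), hasParity_one_iff.1 (symC_odd hd)]
    simp only [neg_mul, mul_neg, sub_neg_eq_add]
  have h4 : del (sym d.op * vacuumWave) = (del (sym d.op) + sym d.op * tau) * vacuumWave := by
    rw [del_isSuperDer.mul_of_even (sym_op_even hd), del_vacuumWave, add_mul, mul_assoc]
  rw [coordChange_iff_quad hd (h.odd.add hc.nu_odd), h4, ← mul_assoc, (vacuumWave_isUnit (I := I)).mul_left_inj, h2, h3]
  have fz := free_zpow (I := I) 1
  have fA := symA_free hd
  have fB := symB_free hd
  have fC := symC_free hd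
  have fD := symD_free hd
  obtain ⟨-, fa, fh, fpsi⟩ := hc.free
  constructor
  · rintro ⟨e1, e2, e3, e4⟩
    rw [← e1, ← e2, ← e3, ← e4]
  · exact quad_injective fC (fD.add fA) (fA.dx.add (fA.mul fz))
      (fB.dx.add ((fB.mul fz).add fC)) (fnu.mul fA) ((fnu.mul fB).add (fa.mul fA))
      ((fnu.mul fC).neg.add (fh.mul fA))
      ((((fnu.mul fD).neg.add (fa.mul fC)).add (fh.mul fB)).add (fpsi.mul fA))

end
end SuperKP

/-! ### Properties that a primitive inherits from its form -/

namespace GrassmannPowerSeries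

open GrassmannSeries

variable {O K : Type*} [LinearOrder O] [CommRing K] [Algebra ℂ K]

/-- Every coefficient of a primitive is a scalar multiple of a coefficient of the form, so
conditions on powers of z carry over. -/
theorem mem_of_mem_primitiveValues {P : O → Prop} {b : ℕ → Ser O K} {c : O → Ser O K}
    {n : ℕ →₀ ℕ} {S : Finset O} {Q : K → Prop} (h0 : Q 0) (hQ : ∀ (r : ℂ) y, Q y → Q (r • y))
    (hb : ∀ i m, Q (b i m S)) (hc : ∀ o ∈ S, P o → Q (c o n (S.erase o))) {y : K}
    (hy : y = 0 ∨ y ∈ primitiveValues P b c n S) : Q y := by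
  rcases hy with rfl | ⟨i, -, rfl⟩ | ⟨o, ho, hP, rfl⟩
  · exact h0
  · exact hQ _ _ (hb _ _)
  · rcases Nat.even_or_odd (inversions {o} (S.erase o)) with h | h
    · rw [h.neg_one_pow, one_mul]
      exact hc o ho hP
    · have := hQ (-1) _ (hc o ho hP)
      rwa [neg_one_smul, ← neg_one_mul, ← h.neg_one_pow] at this

theorem eq_zero_of_mem_primitiveValues {P : O → Prop} {b : ℕ → Ser O K} {c : O → Ser O K}
    {n : ℕ →₀ ℕ} {S : Finset O} (hb : ∀ i m, b i m S = 0)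
    (hc : ∀ o ∈ S, P o → c o n (S.erase o) = 0) {y : K}
    (hy : y = 0 ∨ y ∈ primitiveValues P b c n S) : y = 0 := by
  rcases hy with rfl | ⟨i, -, rfl⟩ | ⟨o, ho, hP, rfl⟩
  · rfl
  · rw [hb]
    exact smul_zero _
  · rw [hc o ho hP]
    exact mul_zero _

theorem par_eq_self {f : Ser O K} (h : ∀ n S, Odd S.card → f n S = 0) : par f = f := by
  funext n
  refine GrassmannSeries.ext fun S => ?_
  change (-1) ^ S.card * f n S = f n S
  rcases Nat.even_or_odd S.card with hS | hS
  · rw [hS.neg_one_pow, one_mul]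
  · rw [h n S hS, mul_zero]

end GrassmannPowerSeries

namespace SuperKP

noncomputable section

open scoped Sealed

variable {I : Type*} [LinearOrder I]

/-! ### Wave functions of solutions of HSKP -/

/-- The component of a form in the direction of an odd variable. -/
def oddComponent (bphi : SuperFn I) (b : ℕ → SuperFn I) (o : OddVar I) : SuperFn I :=
  match ofLex o with
  | Sum.inr 1 => bphi
  | Sum.inr (j + 2) => b (2 * j + 1)
  | _ => 0

/-- The component of a form in the direction of an even variable. -/
def evenComponent (bx : SuperFn I) (b : ℕ → SuperFn I) : ℕ → SuperFn I
  | 0 => bx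
  | i + 1 => b (2 * (i + 1))

/-- The Poincaré lemma in the coordinates x, φ, t_n. Parity and negativity pass from the form to L,
because each coefficient of L is 0 or a multiple of one of the form. -/
theorem exists_primitive_times {bx bphi : SuperFn I} {b : ℕ → SuperFn I}
    (htt : ∀ j n, 0 < j → 0 < n → dt n (b j) = (-1) ^ (j * n) * dt j (b n))
    (hxt : ∀ n, 0 < n → dx (b n) = dt n bx) (hxp : dx bphi = dphi bx)
    (hpt : ∀ n, 0 < n → dphi (b n) = (-1) ^ n * dt n bphi) (hpp : dphi bphi = 0)
    (ex : HasParity 0 bx) (ephi : HasParity 1 bphi) (et : ∀ n, 0 < n → HasParity n (b n))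
    (nx : IsNeg bx) (nphi : IsNeg bphi) (nt : ∀ n, 0 < n → IsNeg (b n)) :
    ∃ L : SuperFn I, dx L = bx ∧ dphi L = bphi ∧ (∀ n, 0 < n → dt n L = b n) ∧ OrdGE 1 L ∧
      HasParity 0 L ∧ IsNeg L := by
  let _ : Algebra ℂ (LaurentSeries ℂ) := HahnSeries.instAlgebra
  have d1 : ∀ i, dEven (I := I) (i + 1) = dt (2 * (i + 1)) := fun i => by
    rw [dt_of_even (by simp), show 2 * (i + 1) / 2 = i + 1 by omega]
  have d2 : ∀ j, dOdd (I := I) (oddTimeVar j) = dt (2 * j + 1) := fun j => by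
    rw [dt_of_odd (by simp), show (2 * j + 1) / 2 = j by omega]
  -- The variable θ and the generators of Λ are treated as constants: no derivative of L in these
  -- directions is prescribed.
  set P : OddVar I → Prop := fun o => o = phiVar ∨ ∃ j, o = oddTimeVar j with hP
  have hee : ∀ i j, dEven i (evenComponent bx b j) = dEven j (evenComponent bx b i) := by
    rintro (_ | i) (_ | j)
    · rfl
    · rw [d1]
      exact hxt _ (by omega)
    · rw [d1]
      exact (hxt _ (by omega)).symm
    · rw [d1, d1]
      refine (htt (2 * (j + 1)) (2 * (i + 1)) (by omega) (by omega)).trans ?_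
      rw [Even.neg_one_pow ⟨(j + 1) * (2 * (i + 1)), by ring⟩, one_mul]
      rfl
  have heo : ∀ i o, P o → dEven i (oddComponent bphi b o) = dOdd o (evenComponent bx b i) := by
    rintro (_ | i) o (rfl | ⟨j, rfl⟩)
    · exact hxp
    · rw [d2]
      exact hxt _ (by omega)
    · have := hpt (2 * (i + 1)) (by omega)
      rw [Even.neg_one_pow (by simp), one_mul] at this
      rw [d1]
      exact this.symm
    · rw [d1, d2]
      refine (htt (2 * j + 1) (2 * (i + 1)) (by omega) (by omega)).trans ?_
      rw [Even.neg_one_pow ⟨(2 * j + 1) * (i + 1), by ring⟩, one_mul]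
      rfl
  have hoo : ∀ o p, P o → P p →
      dOdd o (oddComponent bphi b p) = -dOdd p (oddComponent bphi b o) := by
    have h1 : ∀ j, dphi (b (2 * j + 1)) = -dt (2 * j + 1) bphi := fun j => by
      rw [hpt _ (by omega), Odd.neg_one_pow (by simp), neg_one_mul]
    rintro o p (rfl | ⟨i, rfl⟩) (rfl | ⟨j, rfl⟩)
    · have h : dOdd phiVar (oddComponent bphi b phiVar) = 0 := hpp
      rw [h, neg_zero]
    · rw [d2]
      exact h1 j
    · rw [d2]
      exact (neg_eq_iff_eq_neg.2 (h1 i)).symm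
    · rw [d2, d2]
      refine (htt (2 * j + 1) (2 * i + 1) (by omega) (by omega)).trans ?_
      rw [Odd.neg_one_pow (by simp [parity_simps]), neg_one_mul]
      rfl
  have hs : ∀ o, P o → dOdd o (oddComponent bphi b o) = 0 := fun o ho =>
    GrassmannPowerSeries.eq_zero_of_eq_neg laurent_add_self (hoo o o ho ho)
  obtain ⟨L, h1, h2, h3, h4⟩ := GrassmannPowerSeries.exists_primitive (K := LaurentSeries ℂ)
    (P := P) (b := evenComponent bx b) (c := oddComponent bphi b) hee heo
    (fun o p ho hp => hoo o p ho hp) hs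
  refine ⟨L, h1 0, h2 phiVar (Or.inl rfl), fun n hn => ?_, ordGE_one_iff.2 h3, ?_, ?_⟩
  · rcases Nat.even_or_odd' n with ⟨j, rfl | rfl⟩
    · obtain ⟨i, rfl⟩ : ∃ i, j = i + 1 := ⟨j - 1, by omega⟩
      rw [← d1]
      exact h1 (i + 1)
    · rw [← d2]
      exact h2 _ (Or.inr ⟨j, rfl⟩)
  · rw [hasParity_zero_iff]
    refine GrassmannPowerSeries.par_eq_self fun n S h => ?_
    refine GrassmannPowerSeries.eq_zero_of_mem_primitiveValues (fun i m => ?_)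
      (fun o ho hPo => ?_) (h4 n S)
    · rcases i with _ | i
      · exact ex.apply_eq_zero_of_even m S h
      · exact HasParity.apply_eq_zero_of_even
          ((hasParity_even_iff (by simp)).1 (et (2 * (i + 1)) (by omega))) m S h
    · have hcard : Even (S.erase o).card := by
        rw [Finset.card_erase_of_mem ho]
        exact Nat.Odd.sub_odd h odd_one
      rcases hPo with rfl | ⟨j, rfl⟩
      · exact ephi.apply_eq_zero_of_odd n _ hcard
      · exact HasParity.apply_eq_zero_of_odd
          ((hasParity_odd_iff (by simp)).1 (et (2 * j + 1) (by omega))) n _ hcard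
  · intro n S m hm
    refine GrassmannPowerSeries.mem_of_mem_primitiveValues
      (Q := fun y : LaurentSeries ℂ => HahnSeries.coeff y (-m) = 0) rfl (fun r y hy => ?_)
      (fun i k => ?_) (fun o ho hPo => ?_) (h4 n S)
    · have h : HahnSeries.coeff (r • y) (-m) = r • HahnSeries.coeff y (-m) :=
        HahnSeries.coeff_smul ..
      rw [h, hy]
      exact mul_zero r
    · rcases i with _ | i
      · exact nx k S m hm
      · exact nt (2 * (i + 1)) (by omega) k S m hm
    · rcases hPo with rfl | ⟨j, rfl⟩
      · exact nphi n _ m hm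
      · exact nt (2 * j + 1) (by omega) n _ m hm

variable {G : SuperFn I} {H : ℕ → SuperFn I}

/-- The logarithm of the dressing part of the wave function. -/
theorem exists_log_wave (hG : HasParity 1 G) (hn : IsNeg (G - tau)) (hH : IsCurrents G H)
    (flow : ∀ k, 0 < k → dt k G = (-1) ^ k * del (H k)) :
    ∃ L : SuperFn I, OrdGE 1 L ∧ HasParity 0 L ∧ IsNeg L ∧ del L = G - tau ∧
      ∀ n, 0 < n → dt n L = H n - vacuum n := by
  have hb0 : ∀ n, dt n (G - tau) = dt n G := fun n => by
    rw [(dt_isSuperDer n).sub, dt_tau, sub_zero]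
  have hdphi : ∀ f : SuperFn I, dphi f = del f - phi * dx f := fun f => by
    rw [del_def]
    abel
  have hdtx : ∀ n, 0 < n → dt n (del (G - tau)) = dx (H n) := fun n h => by
    rw [dt_del, hb0, flow n h, del_isSuperDer.neg_one_pow_mul, neg_one_pow_mul_self, del_del]
  have hdtphi : ∀ n, 0 < n → dt n (G - tau - phi * del (G - tau)) = (-1) ^ n * dphi (H n) := by
    intro n h
    rw [(dt_isSuperDer n).sub, hb0, flow n h, (dt_isSuperDer n).odd_const_mul phi_odd (dt_phi n),
      hdtx n h, hdphi, mul_sub]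
  have hdphix : dphi (del (G - tau)) = dx (G - tau) - phi * dx (del (G - tau)) := by
    rw [hdphi, del_del]
  have hnx : DegLE (-1) (del (G - tau)) := (isNeg_iff.1 hn).del
  -- With b = G - τ, the equation δL = b is equivalent to ∂_x L = δb and ∂_φ L = b - φδb, because
  -- ∂_x = δ² and ∂_φ = δ - φ∂_x.
  obtain ⟨L, h1, h2, h3, h4, h5, h6⟩ := exists_primitive_times (bx := del (G - tau))
    (bphi := G - tau - phi * del (G - tau)) (b := fun n => H n - vacuum n)
    (fun j n hj hn' => by
      rw [(dt_isSuperDer n).sub, (dt_isSuperDer j).sub, dt_vacuum, dt_vacuum, sub_zero, sub_zero]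
      exact zero_curvature hG hn hH flow hj hn')
    (fun n h => by
      have : dx (vacuum n : SuperFn I) = 0 := by
        have := dt_vacuum (I := I) 0
        rcases Nat.even_or_odd' n with ⟨j, rfl | rfl⟩
        · rw [vacuum_two_mul, dx_zpow]
        · rw [vacuum_two_mul_add_one, dx_isSuperDer.mul, dx_zpow, dx_theta, zero_mul, mul_zero,
            add_zero]
      rw [dx_isSuperDer.sub, this, sub_zero, hdtx n h])
    (by rw [hdphix, dx_isSuperDer.sub, dx_isSuperDer.mul_of_hasParity phi_odd, dx_phi, zero_mul,
          zero_add, mul_zero, pow_zero, one_mul])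
    (fun n h => by
      have : dphi (vacuum n : SuperFn I) = 0 := by
        rcases Nat.even_or_odd' n with ⟨j, rfl | rfl⟩
        · rw [vacuum_two_mul, dphi_zpow]
        · rw [vacuum_two_mul_add_one, dphi_isSuperDer.mul, dphi_zpow, dphi_theta, zero_mul, mul_zero,
            add_zero]
      rw [dphi_isSuperDer.sub, this, sub_zero, hdtphi n h, neg_one_pow_mul_self])
    (by
      rw [dphi_isSuperDer.sub, dphi_isSuperDer.mul, dphi_phi, one_mul, hdphix, Function.iterate_one,
        hasParity_one_iff.1 phi_odd, hdphi (G - tau), mul_sub, ← mul_assoc, neg_mul, neg_mul,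
        phi_mul_phi]
      simp only [zero_mul, neg_zero, sub_zero]
      abel)
    (HasParity.congr (by omega) (del_isSuperDer.hasParity (hG.sub tau_odd)))
    ((hG.sub tau_odd).sub (phi_odd.odd_mul_even
      (HasParity.congr (by omega) (del_isSuperDer.hasParity (hG.sub tau_odd)))))
    (fun n _ => (current_hasParity hG hn hH n).sub (vacuum_hasParity n))
    (isNeg_iff.2 hnx)
    (isNeg_iff.2 ((isNeg_iff.1 hn).sub (hnx.zconst_mul zconst_phi)))
    (fun n _ => (isCurrents_iff.1 hH n).2)
  refine ⟨L, h4, h5, h6, ?_, h3⟩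
  rw [del_def, h1, h2]
  abel

/-- The dressing part of the wave function of a solution. -/
theorem exists_wave (hG : HasParity 1 G) (hn : IsNeg (G - tau)) (hH : IsCurrents G H)
    (flow : ∀ k, 0 < k → dt k G = (-1) ^ k * del (H k)) :
    ∃ g : SuperFn I, HasParity 0 g ∧ IsNeg (g - 1) ∧ del g = (G - tau) * g ∧
      ∀ n, 0 < n → dt n g = (H n - vacuum n) * g := by
  obtain ⟨L, h1, h2, h3, h4, h5⟩ := exists_log_wave hG hn hH flow
  refine ⟨fexp L, fexp_even h2 h1, fexp_isNeg h3 h1, ?_, fun n h => ?_⟩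
  · rw [del_isFormalDer.fexp h2 h1, h4]
  · rw [(dt_isFormalDer n).fexp h2 h1, h5 n h]

end
end SuperKP

namespace SuperKP

noncomputable section

open scoped Sealed

variable {I : Type*} [LinearOrder I] {G F g q kappa : SuperFn I} {H : ℕ → SuperFn I}

/-! ### Wave functions and their gauge transformations -/

/-- `F` is an invertible even wave function with logarithmic derivatives `G` and `H n`. -/
structure IsWave (G : SuperFn I) (H : ℕ → SuperFn I) (F : SuperFn I) : Prop where
  even : HasParity 0 F
  unit : IsUnit F
  del_eq : del F = G * F
  dt_eq : ∀ n, 0 < n → dt n F = H n * F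

theorem eq_of_mul_unit {a b : SuperFn I} (hF : IsUnit F) (h : a * F = b * F) : a = b :=
  hF.mul_right_cancel h

theorem del_mul_vacuumWave_iff (hg : HasParity 0 g) :
    del (g * vacuumWave) = G * (g * vacuumWave) ↔ del g = (G - tau) * g := by
  have h : del (g * vacuumWave) - G * (g * vacuumWave) =
      (del g - (G - tau) * g) * vacuumWave := by
    rw [del_isSuperDer.mul_of_even hg, del_vacuumWave, ← mul_assoc g, hg.comm tau]
    simp only [sub_mul, mul_assoc]
    abel
  constructor
  · intro h1
    rw [← sub_eq_zero]
    refine eq_of_mul_unit vacuumWave_isUnit ?_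
    rw [← h, h1, sub_self, zero_mul]
  · intro h1
    rw [← sub_eq_zero, h, h1, sub_self, zero_mul]

theorem dt_mul_vacuumWave_iff (hg : HasParity 0 g) {n : ℕ} (hn : 0 < n) {f : SuperFn I} :
    dt n (g * vacuumWave) = f * (g * vacuumWave) ↔ dt n g = (f - vacuum n) * g := by
  have h : dt n (g * vacuumWave) - f * (g * vacuumWave) =
      (dt n g - (f - vacuum n) * g) * vacuumWave := by
    rw [(dt_isSuperDer n).mul_of_even hg, dt_vacuumWave hn, ← mul_assoc g, hg.comm (vacuum n)]
    simp only [sub_mul, mul_assoc]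
    abel
  constructor
  · intro h1
    rw [← sub_eq_zero]
    refine eq_of_mul_unit vacuumWave_isUnit ?_
    rw [← h, h1, sub_self, zero_mul]
  · intro h1
    rw [← sub_eq_zero, h, h1, sub_self, zero_mul]

theorem isWave_mul_vacuumWave_iff (hg : HasParity 0 g) (hn : IsNeg (g - 1)) :
    IsWave G H (g * vacuumWave) ↔
      del g = (G - tau) * g ∧ ∀ n, 0 < n → dt n g = (H n - vacuum n) * g :=
  ⟨fun h => ⟨(del_mul_vacuumWave_iff hg).1 h.del_eq,
    fun n hn => (dt_mul_vacuumWave_iff hg hn).1 (h.dt_eq n hn)⟩,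
  fun h => ⟨hg.mul_even vacuumWave_even, (isUnit_of_isNeg hn).mul vacuumWave_isUnit,
    (del_mul_vacuumWave_iff hg).2 h.1, fun n hn => (dt_mul_vacuumWave_iff hg hn).2 (h.2 n hn)⟩⟩

theorem mul_phi_mul_self (hq : HasParity 1 q) : q * (phi * q) = 0 := by
  rw [← mul_assoc, hq.anticomm phi_odd, neg_mul, mul_assoc, hq.sq_eq_zero, mul_zero, neg_zero]

/-- For q independent of φ, δ(φq) = q, since the remaining term contains φ²; and qφq = 0 because q
is odd. -/
theorem del_gauge (hq : HasParity 1 q) (hf : OddFree phiVar q) :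
    del (1 - phi * q) = -q * (1 - phi * q) := by
  rw [del_isSuperDer.sub, del_isSuperDer.one, del_isSuperDer.mul_of_hasParity phi_odd, del_phi,
    del_of_phiFree hf, ← mul_assoc phi phi, phi_mul_phi, mul_sub, neg_mul, neg_mul,
    mul_phi_mul_self hq]
  simp

theorem dt_phi_mul (n : ℕ) (f : SuperFn I) : dt n (phi * f) = (-1) ^ n * (phi * dt n f) :=
  (dt_isSuperDer n).odd_const_mul phi_odd (dt_phi n) f

theorem dt_gauge (n : ℕ) : dt n (1 - phi * q) = -dt n (phi * q) * (1 - phi * q) := by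
  have h : dt n (phi * q) * (phi * q) = 0 := by
    rw [dt_phi_mul, mul_assoc, mul_assoc, ← mul_assoc (dt n q), mul_phi, mul_assoc,
      ← mul_assoc phi phi, phi_mul_phi, zero_mul, mul_zero]
  rw [(dt_isSuperDer n).sub, (dt_isSuperDer n).one, mul_sub, neg_mul, neg_mul, h]
  simp

theorem gauge_even (hq : HasParity 1 q) : HasParity 0 (1 - phi * q) :=
  HasParity.one.sub (phi_odd.odd_mul_odd hq)

theorem gauge_isUnit : IsUnit (1 - phi * q) :=
  isUnit_iff_exists.2 ⟨1 + phi * q, one_sub_phi_mul_one_add, one_add_phi_mul_one_sub⟩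

theorem IsWave.gauge (hF : IsWave G H F) (hq : HasParity 1 q) (hf : OddFree phiVar q) :
    IsWave (G - q) (fun n => H n - dt n (phi * q)) (F * (1 - phi * q)) where
  even := hF.even.mul_even (gauge_even hq)
  unit := hF.unit.mul gauge_isUnit
  del_eq := by
    rw [del_isSuperDer.mul_of_even hF.even, del_gauge hq hf, hF.del_eq, ← mul_assoc F, hF.even.comm,
      sub_mul, neg_mul, neg_mul, mul_assoc, mul_assoc, ← sub_eq_add_neg]
  dt_eq n hn := by
    rw [(dt_isSuperDer n).mul_of_even hF.even, dt_gauge, hF.dt_eq n hn, ← mul_assoc F, hF.even.comm,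
      sub_mul, neg_mul, neg_mul, mul_assoc, mul_assoc, ← sub_eq_add_neg]

theorem IsWave.mem_iff (hF : IsWave G H F) (hG : HasParity 1 G) {n : ℕ} (hn : 0 < n) :
    H n ∈ fieldSpan (iterate G) ↔ dt n F ∈ fieldSpan fun l => del^[l] F := by
  rw [mem_fieldSpan_wave_iff hG hF.del_eq hF.unit, hF.dt_eq n hn]

/-- The gauge factor is a superfield with superfield inverse, so F and its transform have the same
span of derivatives. The Leibniz rule only adds a superfield multiple of F. -/
theorem dt_gauge_mem_fieldSpan (hq : IsField q) {n : ℕ}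
    (h : dt n F ∈ fieldSpan fun l => del^[l] F) (hp : HasParity 1 q) :
    dt n ((1 - phi * q) * F) ∈ fieldSpan fun l => del^[l] ((1 - phi * q) * F) := by
  have hE : IsField (1 - phi * q) := isField_one.sub (isField_phi.mul hq)
  have h1 : (1 + phi * q) * ((1 - phi * q) * F) = F := by
    rw [← mul_assoc, one_add_phi_mul_one_sub, one_mul]
  have h2 : ∀ f, f ∈ (fieldSpan fun l => del^[l] F) →
      f ∈ fieldSpan fun l => del^[l] ((1 - phi * q) * F) := fun f hf =>
    fieldSpan_gauge (E := 1 + phi * q) (isField_one.add (isField_phi.mul hq)) (by rwa [h1])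
  rw [(dt_isSuperDer n).mul_of_even (gauge_even hp)]
  refine add_mem (h2 _ ?_) (field_mul_mem_fieldSpan hE (h2 _ h))
  exact mul_mem_fieldSpan (x := fun l => del^[l] F) (hE.dt n) 0

theorem dt_ungauge_mem_fieldSpan (hq : IsField q) {n : ℕ} (hp : HasParity 1 q)
    (h : dt n ((1 - phi * q) * F) ∈ fieldSpan fun l => del^[l] ((1 - phi * q) * F)) :
    dt n F ∈ fieldSpan fun l => del^[l] F := by
  have h1 := dt_gauge_mem_fieldSpan hq.neg h hp.neg
  rwa [mul_neg, sub_neg_eq_add, ← mul_assoc, one_add_phi_mul_one_sub, one_mul] at h1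

/-! ### Residues and potentials -/

/-- Multiplication by φ expresses evaluation at φ = 0, and it is injective on functions independent
of φ. -/
theorem phi_mul_cancel {a b : SuperFn I} (ha : OddFree phiVar a) (hb : OddFree phiVar b)
    (h : phi * a = phi * b) : a = b := by
  rw [← dphi_phi_mul ha, h, dphi_phi_mul hb]

theorem phi_mul_comp01 (f : SuperFn I) : phi * comp01 f = phi * thetaCoef f := by
  rw [comp01, mul_sub, ← mul_assoc phi phi, phi_mul_phi, zero_mul, sub_zero]

theorem zCoef_comp01 (k : ℤ) (f : SuperFn I) : zCoef k (comp01 f) = comp01 (zCoef k f) := by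
  rw [comp01, comp01, zCoef_sub, zCoef_mul_left zconst_phi, zCoef_dphi, thetaCoef_zCoef]

/-- The product f(g - 1) has degree at most -2. Hence taking the residue linearises equations of the
form ∂g = fg. -/
theorem zCoef_neg_one_mul {f : SuperFn I} (hf : IsNeg f) (hn : IsNeg (g - 1)) :
    zCoef (-1) (f * g) = zCoef (-1) f := by
  have h : f * g = f + f * (g - 1) := by
    rw [mul_sub, mul_one]
    abel
  rw [h, zCoef_add, ((isNeg_iff.1 hf).mul (isNeg_iff.1 hn)).zCoef_eq_zero (by norm_num), add_zero]

theorem zCoef_neg_one_vacuum (n : ℕ) : zCoef (-1) (vacuum n : SuperFn I) = 0 := by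
  rcases Nat.even_or_odd' n with ⟨j, rfl | rfl⟩
  · rw [vacuum_two_mul, zCoef_zpow, if_neg (by omega)]
  · rw [vacuum_two_mul_add_one, zCoef_zpow_mul, zCoef_of_ne zconst_theta (by omega)]

/-- From ∂_x = δ²: the square of the odd logarithmic derivative vanishes. -/
theorem dx_of_del_eq (hG : HasParity 1 G) (h : del g = (G - tau) * g) :
    dx g = del (G - tau) * g := by
  have hp := hG.sub tau_odd
  rw [← del_del, h, del_isSuperDer.mul_of_hasParity hp, h, ← mul_assoc, ← mul_assoc, mul_assoc _ _ (G - tau)]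
  rw [hp.sq_eq_zero, mul_zero, zero_mul, add_zero]

theorem phi_mul_dx_comp01 (hG : HasParity 1 G) (hGn : IsNeg (G - tau)) (hn : IsNeg (g - 1))
    (h : del g = (G - tau) * g) :
    phi * dx (zCoef (-1) (comp01 g)) = phi * residue (del G) := by
  have h1 : dx (phi * zCoef (-1) (comp01 g)) = phi * dx (zCoef (-1) (comp01 g)) := by
    rw [dx_isSuperDer.odd_const_mul phi_odd dx_phi, pow_zero, one_mul]
  rw [← h1, zCoef_comp01, phi_mul_comp01, dx_isSuperDer.odd_const_mul phi_odd dx_phi, pow_zero,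
    one_mul, ← thetaCoef_dx, ← zCoef_dx, dx_of_del_eq hG h,
    zCoef_neg_one_mul (isNeg_iff.2 (isNeg_iff.1 hGn).del) hn, del_isSuperDer.sub, del_tau, zCoef_sub,
    zCoef_zpow, if_neg (by norm_num), sub_zero, residue_eq]

theorem isPotential_iff : IsPotential H q ↔ IsField q ∧ HasParity 1 q ∧ OddFree phiVar q ∧
    (∀ n, 0 < n → phi * dt n q = phi * residue (H n)) ∧ phi * dx q = phi * residue (H 2) :=
  ⟨fun h => ⟨h.field, h.odd, h.phiFree, h.dt_eq, h.dx_eq⟩,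
    fun h => ⟨h.1, h.2.1, h.2.2.1, h.2.2.2.1, h.2.2.2.2⟩⟩

/-- The residue of ∂_n g = (H^(n) - vacuum)g is linear in H^(n), and the vacuum has no z⁻¹. The
direction x works in the same way with H^(2) = δG. -/
theorem isPotential_of_wave (hG : HasParity 1 G) (hGn : IsNeg (G - tau)) (hH : IsCurrents G H)
    (hg : HasParity 0 g) (hn : IsNeg (g - 1)) (h : del g = (G - tau) * g)
    (ht : ∀ n, 0 < n → dt n g = (H n - vacuum n) * g) :
    IsPotential H (zCoef (-1) (comp01 g)) := by
  refine isPotential_iff.2 ⟨(isField_phiFree_zCoef (free_comp01 g) _).1,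
    (hasParity_comp01 hg).zCoef _, (isField_phiFree_zCoef (free_comp01 g) _).2, fun n hn' => ?_,
    by rw [phi_mul_dx_comp01 hG hGn hn h, current_two hG hGn hH]⟩
  have e : ∀ f : SuperFn I, phi * dt n f = (-1) ^ n * dt n (phi * f) := fun f => by
    rw [dt_phi_mul, neg_one_pow_mul_self]
  rw [e, zCoef_comp01, phi_mul_comp01, dt_phi_mul, neg_one_pow_mul_self, ← thetaCoef_dt,
    ← zCoef_dt, ht n hn', zCoef_neg_one_mul ((isCurrents_iff.1 hH n).2) hn, zCoef_sub,
    zCoef_neg_one_vacuum, sub_zero, residue_eq]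

/-- δ moves the φθ-component ψ of the generator into the θ-component, and the rest is killed by φ.
-/
theorem phi_mul_residue_del_gen {c : Components I} (hc : c.Admissible) :
    phi * residue (del c.gen) = phi * zCoef (-1) c.psi := by
  obtain ⟨f1, f2, f3, f4⟩ := hc.free
  rw [gen_eq_quad hc, del_quad f1.2 f2.2 f3.2 f4.2, residue_eq, thetaCoef_zCoef,
    thetaCoef_quad f3 f4 f1.dx f2.dx, ← zCoef_mul_left zconst_phi, mul_add, ← mul_assoc phi phi,
    phi_mul_phi, zero_mul, add_zero, zCoef_mul_left zconst_phi]

/-- The correction in the enhanced current is -∂_n(φq), the effect of the gauge factor exp(-φq) on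
the logarithmic derivative. -/
theorem enhanced_eq (hq : IsPotential H q) {n : ℕ} (hn : 0 < n) :
    enhanced H n = H n - dt n (phi * q) := by
  have h : enhanced H n = H n + (-1) ^ (n + 1) * (phi * residue (H n)) := rfl
  rw [h, ← (isPotential_iff.1 hq).2.2.2.1 n hn, dt_phi_mul, pow_succ, mul_neg_one, neg_mul, ← sub_eq_add_neg]

/-! ### Constants -/

theorem isConstant_iff : IsConstant kappa ↔ HasParity 0 kappa ∧ IsNeg (kappa - 1) ∧ dx kappa = 0 ∧
    dphi kappa = 0 ∧ ∀ n, 0 < n → dt n kappa = 0 :=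
  ⟨fun h => ⟨h.even, h.neg, h.dx_eq, h.dphi_eq, h.dt_eq⟩,
    fun h => ⟨h.1, h.2.1, h.2.2.1, h.2.2.2.1, h.2.2.2.2⟩⟩

theorem IsConstant.del_eq (hk : IsConstant kappa) : del kappa = 0 := by
  obtain ⟨-, -, h1, h2, -⟩ := isConstant_iff.1 hk
  rw [del_def, h2, h1, mul_zero, add_zero]

theorem isNeg_mul_sub_one {f : SuperFn I} (hf : IsNeg (f - 1)) (hg : IsNeg (g - 1)) :
    IsNeg (f * g - 1) := by
  have h : f * g - 1 = (f - 1) * (g - 1) + (f - 1) + (g - 1) := by noncomm_ring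
  rw [h, isNeg_iff]
  rw [isNeg_iff] at hf hg
  exact (((hf.mul hg).mono (by norm_num)).add hf).add hg

theorem IsWave.mul_constant (hF : IsWave G H F) (hk : IsConstant kappa) :
    IsWave G H (F * kappa) where
  even := hF.even.mul_even hk.even
  unit := hF.unit.mul (isUnit_of_isNeg hk.neg)
  del_eq := by
    rw [del_isSuperDer.mul_of_even hF.even, hk.del_eq, mul_zero, add_zero, hF.del_eq, mul_assoc]
  dt_eq n hn := by
    rw [(dt_isSuperDer n).mul_of_even hF.even, (isConstant_iff.1 hk).2.2.2.2 n hn, mul_zero, add_zero, hF.dt_eq n hn,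
      mul_assoc]

/-- Equal logarithmic derivatives leave δκ = 0 and ∂_nκ = 0; then ∂_xκ = δ²κ = 0, and ∂_φκ = 0
follows. -/
theorem IsWave.isConstant (hF : IsWave G H F) (hk : HasParity 0 kappa) (hn : IsNeg (kappa - 1))
    (hFk : IsWave G H (F * kappa)) : IsConstant kappa := by
  have h0 : ∀ f, F * f = 0 → f = 0 := fun f h => hF.unit.mul_left_cancel (by rw [h, mul_zero])
  have h1 : del kappa = 0 := by
    have h := hFk.del_eq
    rw [del_isSuperDer.mul_of_even hF.even, hF.del_eq, mul_assoc, add_eq_left] at h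
    exact h0 _ h
  have h2 : dx kappa = 0 := by rw [← del_del, h1, del_isSuperDer.zero]
  refine isConstant_iff.2 ⟨hk, hn, h2, ?_, fun n hn => ?_⟩
  · rwa [del_def, h2, mul_zero, add_zero] at h1
  · have h := hFk.dt_eq n hn
    rw [(dt_isSuperDer n).mul_of_even hF.even, hF.dt_eq n hn, mul_assoc, add_eq_left] at h
    exact h0 _ h

theorem isConstant_theta {gamma : SuperFn I} (hf : IsField gamma) (hp : HasParity 1 gamma)
    (hphi : OddFree phiVar gamma) (hx : dx gamma = 0) (ht : ∀ n, 0 < n → dt n gamma = 0) :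
    IsConstant (1 + gamma * theta * zpow (-1)) := by
  have h0 : ∀ {p : ℕ} {D : SuperFn I → SuperFn I}, IsSuperDer p D → D gamma = 0 → D theta = 0 →
      D (zpow (-1)) = 0 → D (1 + gamma * theta * zpow (-1)) = 0 := fun h h1 h2 h3 => by
    rw [h.add, h.one, h.mul, h.mul, h1, h2, h3]
    simp
  refine isConstant_iff.2 ⟨HasParity.one.add ((hp.odd_mul_odd theta_odd).mul_even (zpow_even _)), ?_,
    h0 dx_isSuperDer hx dx_theta (dx_zpow _), h0 dphi_isSuperDer hphi dphi_theta (dphi_zpow _),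
    fun n hn => h0 (dt_isSuperDer n) (ht n hn) (dt_theta n) (dt_zpow n _)⟩
  rw [add_sub_cancel_left, isNeg_iff]
  exact (degLE_zpow _).zconst_mul (hf.zconst.mul zconst_theta)

/-- Because g begins with 1, the constant 1 + γθz⁻¹ shifts the residue of g by exactly γ; this
adjusts the potential of a wave function. -/
theorem zCoef_comp01_mul_constant {gamma : SuperFn I} (hf : IsField gamma)
    (hphi : OddFree phiVar gamma) (hn : IsNeg (g - 1)) :
    zCoef (-1) (comp01 (g * (1 + gamma * theta * zpow (-1)))) =
      zCoef (-1) (comp01 g) + gamma := by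
  have h1 : zCoef (-1) (g * (1 + gamma * theta * zpow (-1))) =
      zCoef (-1) g + gamma * theta := by
    have h2 : g = 1 + (g - 1) := by abel
    have h3 : zCoef 0 g = 1 := by
      rw [h2, zCoef_add, zCoef_zero_of_zconst zconst_one, isNeg_iff_zCoef.1 hn 0 le_rfl, add_zero]
    rw [mul_add, mul_one, zCoef_add, ← mul_assoc, zCoef_mul_zpow, sub_self,
      zCoef_mul_right (hf.zconst.mul zconst_theta), h3, one_mul]
  have h4 : gamma * theta = quad 0 gamma 0 0 := by
    rw [quad]
    simp
  have h5 : comp01 (zCoef (-1) g + gamma * theta) - comp01 (zCoef (-1) g) = gamma := by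
    rw [← comp01_sub, add_sub_cancel_left, h4,
      comp01_quad free_zero ⟨hf.thetaFree, hphi⟩ free_zero free_zero]
  rw [zCoef_comp01, h1, zCoef_comp01, ← sub_eq_iff_eq_add', h5]

end
end SuperKP

namespace SuperKP

noncomputable section

open scoped Sealed

open PsiDO

variable {I : Type*} [LinearOrder I] {G F g q nu0 kappa : SuperFn I} {H : ℕ → SuperFn I}
  {c : Components I} {d d' : Dressing I}

/-! ### From HSKP to JSKP -/

theorem solvesHSKP_iff : SolvesHSKP c H ↔ c.Admissible ∧ IsCurrents c.gen H ∧
    ∀ k, 0 < k → dt k c.gen = (-1) ^ k * del (H k) :=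
  ⟨fun h => ⟨h.admissible, h.currents, h.flow⟩, fun h => ⟨h.1, h.2.1, h.2.2⟩⟩

theorem SolvesHSKP.exists_isWave (h : SolvesHSKP c H) :
    ∃ g : SuperFn I, HasParity 0 g ∧ IsNeg (g - 1) ∧ IsWave c.gen H (g * vacuumWave) := by
  obtain ⟨hc, hH, hf⟩ := solvesHSKP_iff.1 h
  obtain ⟨g, h1, h2, h3⟩ := exists_wave (gen_odd hc) (gen_isNeg hc) hH hf
  exact ⟨g, h1, h2, (isWave_mul_vacuumWave_iff h1 h2).2 h3⟩

theorem IsWave.isPotential (hF : IsWave c.gen H (g * vacuumWave)) (hc : c.Admissible)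
    (hH : IsCurrents c.gen H) (hg : HasParity 0 g) (hn : IsNeg (g - 1)) :
    IsPotential H (zCoef (-1) (comp01 g)) :=
  isPotential_of_wave (gen_odd hc) (gen_isNeg hc) hH hg hn
    ((isWave_mul_vacuumWave_iff hg hn).1 hF).1 ((isWave_mul_vacuumWave_iff hg hn).1 hF).2

theorem IsPotential.eq_add_constant (hq : IsPotential H q) (hq' : IsPotential H nu0) :
    dx (q - nu0) = 0 ∧ ∀ n, 0 < n → dt n (q - nu0) = 0 := by
  obtain ⟨-, -, h1, h2, h3⟩ := isPotential_iff.1 hq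
  obtain ⟨-, -, h1', h2', h3'⟩ := isPotential_iff.1 hq'
  refine ⟨?_, fun n hn => ?_⟩
  · rw [dx_isSuperDer.sub, sub_eq_zero]
    exact phi_mul_cancel h1.dx h1'.dx (h3.trans h3'.symm)
  · rw [(dt_isSuperDer n).sub, sub_eq_zero]
    exact phi_mul_cancel (h1.dt n) (h1'.dt n) ((h2 n hn).trans (h2' n hn).symm)

/-- The given potential and that of some wave function differ by an odd constant γ, which the factor
1 + γθz⁻¹ absorbs without changing the logarithmic derivatives. -/
theorem SolvesHSKP.exists_isWave_of_isPotential (h : SolvesHSKP c H) (hq : IsPotential H q) :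
    ∃ g : SuperFn I, HasParity 0 g ∧ IsNeg (g - 1) ∧ IsWave c.gen H (g * vacuumWave) ∧
      zCoef (-1) (comp01 g) = q := by
  obtain ⟨g, h1, h2, h3⟩ := h.exists_isWave
  have hp := h3.isPotential h.admissible h.currents h1 h2
  obtain ⟨hx, ht⟩ := hq.eq_add_constant hp
  obtain ⟨f1, f2, f3, -⟩ := isPotential_iff.1 hq
  obtain ⟨p1, p2, p3, -⟩ := isPotential_iff.1 hp
  have hk := isConstant_theta (f1.sub p1) (f2.sub p2) (f3.sub p3) hx ht
  obtain ⟨k1, k2, -⟩ := isConstant_iff.1 hk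
  refine ⟨_, h1.mul_even k1, isNeg_mul_sub_one h2 k2, ?_,
    (zCoef_comp01_mul_constant (f1.sub p1) (f3.sub p3) h2).trans (add_sub_cancel _ _)⟩
  have h4 := h3.mul_constant hk
  rwa [mul_assoc, vacuumWave_even.comm, ← mul_assoc] at h4

/-- The corrections are derivatives of the single function -φq, so they satisfy the same relation as
the currents, by supercommutation of the ∂_n. -/
theorem SolvesHSKP.dt_enhanced (h : SolvesHSKP c H) {j n : ℕ} (hj : 0 < j) (hn : 0 < n) :
    dt n (enhanced H j) = (-1) ^ (j * n) * dt j (enhanced H n) := by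
  obtain ⟨g, h1, h2, h3⟩ := h.exists_isWave
  have hp := h3.isPotential h.admissible h.currents h1 h2
  obtain ⟨hc, hH, hf⟩ := solvesHSKP_iff.1 h
  rw [enhanced_eq hp hj, enhanced_eq hp hn, (dt_isSuperDer n).sub, (dt_isSuperDer j).sub,
    zero_curvature (gen_odd hc) (gen_isNeg hc) hH hf hj hn, dt_dt n j, mul_comm n j, mul_sub]

theorem SolvesHSKP.dx_potential (h : SolvesHSKP c H) (hq : IsPotential H q) :
    dx q = zCoef (-1) c.psi := by
  have hc := h.admissible
  obtain ⟨-, -, f, -, hx⟩ := isPotential_iff.1 hq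
  refine phi_mul_cancel f.dx (hc.free.2.2.2.2.zCoef _) ?_
  rw [hx, current_two (gen_odd hc) (gen_isNeg hc) h.currents, phi_mul_residue_del_gen hc]

theorem sym_op_mul_vacuumWave (d : Dressing I) :
    sym d.op * vacuumWave = d.firstSymbol * vacuumWave * (1 - phi * d.eta 0) := by
  rw [mul_assoc, vacuumWave_even.comm, ← mul_assoc, firstSymbol_mul]

theorem IsWave.enhanced (hF : IsWave G H F) (hq : IsPotential H q) :
    IsWave (G - q) (SuperKP.enhanced H) (F * (1 - phi * q)) := by
  obtain ⟨-, h1, h2, -⟩ := isPotential_iff.1 hq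
  have h := hF.gauge h1 h2
  exact ⟨h.even, h.unit, h.del_eq, fun n hn => by rw [enhanced_eq hq hn, h.dt_eq n hn]⟩

theorem IsWave.of_enhanced (hF : IsWave (G - q) (SuperKP.enhanced H) F) (hq : IsPotential H q) :
    IsWave G H (F * (1 + phi * q)) := by
  obtain ⟨-, h1, h2, -⟩ := isPotential_iff.1 hq
  have h := hF.gauge h1.neg h2.neg
  rw [sub_neg_eq_add, sub_add_cancel, mul_neg, sub_neg_eq_add] at h
  refine ⟨h.even, h.unit, h.del_eq, fun n hn => ?_⟩
  rw [h.dt_eq n hn, enhanced_eq hq hn, (dt_isSuperDer n).neg]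
  refine congrArg (· * _) ?_
  abel

theorem SolvesHSKP.exists_dressing (h : SolvesHSKP c H) (hq : IsPotential H q) :
    ∃ Phi Psi : SuperFn I, ∃ d : Dressing I,
      HasParity 0 Phi ∧ IsUnit Phi ∧ (∀ n, 0 < n → dt n Phi = H n * Phi) ∧
      del Phi = c.gen * Phi ∧ Psi = Phi * fexp (-(phi * q)) ∧ IsUnit Psi ∧
      (∀ n, 0 < n → dt n Psi = enhanced H n * Psi) ∧ del Psi = (c.gen - q) * Psi ∧
      d.Admissible ∧ IsDressed d.op Psi := by
  obtain ⟨g, h1, h2, h3, h4⟩ := h.exists_isWave_of_isPotential hq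
  obtain ⟨d, hd, rfl⟩ := SuperKP.exists_dressing h1 h2
  -- The potential is thereby η_1, so the gauge factor exp(-φq) is the one that turns the first
  -- symbol back into the symbol of S.
  rw [← eta_zero_eq hd] at h4
  subst h4
  have h5 := h3.enhanced hq
  refine ⟨_, _, d, h3.even, h3.unit, h3.dt_eq, h3.del_eq, ?_, h5.unit, h5.dt_eq, h5.del_eq, hd,
    (isDressed_op_iff hd).2 (sym_op_mul_vacuumWave d).symm⟩
  rw [← mul_neg, fexp_phi_mul, mul_neg, ← sub_eq_add_neg]

/-- Currents in W mean ∂_nΦ in the span of the δ^l Φ; the gauge factor transfers this to Ψ, where it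
is Sato's criterion. -/
theorem solvesJSKP_of_isWave (hd : d.Admissible) (hG : HasParity 1 G)
    (hmem : ∀ n, 0 < n → H n ∈ fieldSpan (iterate G))
    (hF : IsWave G H (d.firstSymbol * vacuumWave)) : PsiDO.SolvesJSKP d.op := by
  refine (PsiDO.solvesJSKP_iff (Dressing.isMonic hd) (Dressing.sym_op_even hd)).2 fun n hn => ?_
  have h1 := dt_gauge_mem_fieldSpan (hd.eta_odd 0).1 ((hF.mem_iff hG hn).1 (hmem n hn))
    (hd.eta_odd 0).2.2
  rwa [(gauge_even (hd.eta_odd 0).2.2).comm, ← sym_op_mul_vacuumWave d] at h1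

/-- Comparison of the coefficients of z^0 in the first equation of (*). -/
theorem CoordChange.nu0_eq (h : CoordChange d c nu0) (hd : d.Admissible) (he : IsEnhanced c nu0) :
    nu0 = -d.eta 0 := by
  have h1 := congrArg (zCoef 0) (coordChange_def.1 h).1
  have h2 : (nu0 + c.nu) * d.symA =
      nu0 + (c.nu + c.nu * negSeries d.u + nu0 * negSeries d.u) := by
    rw [Dressing.symA]
    noncomm_ring
  have hnu := isNeg_iff.1 he.admissible.nu_neg
  have h3 : DegLE (-1) (c.nu + c.nu * negSeries d.u + nu0 * negSeries d.u) :=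
    (hnu.add ((hnu.mul (degLE_negSeries d.u)).mono (by norm_num))).add
      ((degLE_negSeries d.u).zconst_mul he.field.zconst)
  rw [h2, zCoef_add, h3.zCoef_eq_zero (by norm_num), zCoef_zero_of_zconst he.field.zconst, add_zero,
    Dressing.symC, zCoef_add, zCoef_zero_of_zconst (hd.eta_odd 0).1.zconst.neg,
    zCoef_negSeries_zero (Dressing.field_C hd), add_zero] at h1
  exact h1

theorem IsPotential.isEnhanced_neg (h : IsPotential H q) (hc : c.Admissible) : IsEnhanced c (-q) :=
  ⟨hc, (isPotential_iff.1 h).1.neg, (isPotential_iff.1 h).2.1.neg,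
    OddFree.neg (isPotential_iff.1 h).2.2.1⟩

theorem isEnhanced_neg_eta (hd : d.Admissible) (hc : c.Admissible) : IsEnhanced c (-d.eta 0) :=
  ⟨hc, (hd.eta_odd 0).1.neg, (hd.eta_odd 0).2.2.neg, (Dressing.eta_free hd 0).2.neg⟩

theorem SolvesHSKP.dressing_properties (h : SolvesHSKP c H) (hq : IsPotential H q)
    {Psi : SuperFn I} (hd : d.Admissible) (hP : IsDressed d.op Psi)
    (ht : ∀ n, 0 < n → dt n Psi = enhanced H n * Psi) (hdel : del Psi = (c.gen - q) * Psi) :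
    (∀ n, 0 < n → ∃ (N : ℕ) (Gam : ℕ → SuperFn I), (∀ l, IsField (Gam l)) ∧
      enhanced H n = ∑ l ∈ Finset.range N, Gam l * iterate (c.gen - q) l ∧
      dt n Psi = ∑ l ∈ Finset.range N, Gam l * del^[l] Psi) ∧
    PsiDO.SolvesJSKP d.op ∧ CoordChange d c (-q) := by
  obtain ⟨hc, hH, -⟩ := solvesHSKP_iff.1 h
  obtain rfl := (isDressed_op_iff hd).1 hP
  obtain ⟨f1, f2, f3, -⟩ := isPotential_iff.1 hq
  have hcc : CoordChange d c (-q) := (coordChange_iff hd (hq.isEnhanced_neg hc)).2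
    (by rw [hdel, sub_eq_add_neg])
  -- Here q is not normalised in advance: (*) forces ν_0 = -η_1, and so q = η_1.
  have hq0 : q = d.eta 0 := neg_inj.1 (hcc.nu0_eq hd (hq.isEnhanced_neg hc))
  have hu : IsUnit (sym d.op * vacuumWave) := by
    rw [sym_op_mul_vacuumWave d]
    exact ((isUnit_of_isNeg (firstSymbol_isNeg hd)).mul vacuumWave_isUnit).mul gauge_isUnit
  have hW : IsWave (c.gen - q) (enhanced H) (sym d.op * vacuumWave) :=
    ⟨(Dressing.sym_op_even hd).mul_even vacuumWave_even, hu, hdel, ht⟩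
  -- Undoing the gauge with q = η_1 returns the first wave function of S, to which the currents in W
  -- apply.
  have hF : IsWave c.gen H (d.firstSymbol * vacuumWave) := by
    have h1 := hW.of_enhanced hq
    rwa [sym_op_mul_vacuumWave d, hq0, mul_assoc, one_sub_phi_mul_one_add, mul_one] at h1
  have hJ := solvesJSKP_of_isWave hd (gen_odd hc) (fun n _ => (isCurrents_iff.1 hH n).1) hF
  have ho : HasParity 1 (c.gen - q) := (gen_odd hc).sub f2
  refine ⟨fun n hn => ?_, hJ, hcc⟩
  have hm := (hW.mem_iff ho hn).2 ((PsiDO.solvesJSKP_iff (Dressing.isMonic hd)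
    (Dressing.sym_op_even hd)).1 hJ n hn)
  obtain ⟨N, b, hb, he⟩ := mem_fieldSpan_iff.1 hm
  refine ⟨N, b, hb, he, ?_⟩
  rw [ht n hn, he, Finset.sum_mul]
  refine Finset.sum_congr rfl fun l _ => ?_
  rw [mul_assoc, iterate_mul_wave ho hdel]

/-! ### From JSKP to HSKP -/

/-- The gauge factor 1 + φη_1 has logarithmic derivative η_1 under δ, cancelling ν_0 = -η_1. -/
theorem del_of_coordChange (hd : d.Admissible) (he : IsEnhanced c nu0)
    (hcc : CoordChange d c nu0) :
    del (d.firstSymbol * vacuumWave) = c.gen * (d.firstSymbol * vacuumWave) := by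
  have h1 := (coordChange_iff hd he).1 hcc
  have h2 := hcc.nu0_eq hd he
  subst h2
  have h4 : sym d.op * vacuumWave * (1 + phi * d.eta 0) = d.firstSymbol * vacuumWave := by
    rw [sym_op_mul_vacuumWave d, mul_assoc, one_sub_phi_mul_one_add, mul_one]
  have h5 : del (1 + phi * d.eta 0) = d.eta 0 * (1 + phi * d.eta 0) := by
    have := del_gauge (hd.eta_odd 0).2.2.neg (Dressing.eta_free hd 0).2.neg
    rwa [mul_neg, sub_neg_eq_add, neg_neg] at this
  have h6 : HasParity 0 (sym d.op * vacuumWave) :=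
    (Dressing.sym_op_even hd).mul_even vacuumWave_even
  rw [← h4, del_isSuperDer.mul_of_even h6, h1, h5, ← mul_assoc (sym d.op * vacuumWave), h6.comm,
    add_mul, add_mul, neg_mul, neg_mul, mul_assoc, mul_assoc]
  abel

theorem coordChange_of_del (hd : d.Admissible) (hc : c.Admissible)
    (h : del (d.firstSymbol * vacuumWave) = c.gen * (d.firstSymbol * vacuumWave)) :
    CoordChange d c (-d.eta 0) := by
  have he : HasParity 0 (d.firstSymbol * vacuumWave) :=
    (firstSymbol_even hd).mul_even vacuumWave_even
  refine (coordChange_iff hd (isEnhanced_neg_eta hd hc)).2 ?_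
  rw [sym_op_mul_vacuumWave d, del_isSuperDer.mul_of_even he, h,
    del_gauge (hd.eta_odd 0).2.2 (Dressing.eta_free hd 0).2,
    ← mul_assoc (d.firstSymbol * vacuumWave), he.comm, add_mul]
  simp only [mul_assoc]

theorem degLE_mul_of_isNeg {a : ℤ} {f y : SuperFn I} (hf : DegLE a f) (hy : IsNeg (y - 1)) :
    DegLE a (f * y) := by
  have h : f * y = f * (y - 1) + f := by rw [mul_sub, mul_one, sub_add_cancel]
  rw [h]
  exact ((hf.mul (isNeg_iff.1 hy)).mono (by omega)).add hf

/-- The quotient of δΦ by Φ is τ plus an odd element of V⁻, hence a generator. -/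
theorem exists_gen (hd : d.Admissible) : ∃ c : Components I, c.Admissible ∧
    del (d.firstSymbol * vacuumWave) = c.gen * (d.firstSymbol * vacuumWave) := by
  obtain ⟨y, h1, h2, h3⟩ := exists_inverse (firstSymbol_isNeg hd)
  have he := firstSymbol_even hd
  have hy := even_of_mul_eq_one he h1
  have hdel : DegLE (-1) (del d.firstSymbol) := by
    have h := (isNeg_iff.1 (firstSymbol_isNeg hd)).del
    rwa [del_isSuperDer.sub, del_isSuperDer.one, sub_zero] at h
  obtain ⟨c, hc, h4⟩ := exists_components (G := tau + del d.firstSymbol * y)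
    (tau_odd.add ((HasParity.congr (by omega) (del_isSuperDer.hasParity he)).odd_mul_even hy))
    (by
      rw [add_sub_cancel_left, isNeg_iff]
      exact degLE_mul_of_isNeg hdel h3)
  refine ⟨c, hc, (del_mul_vacuumWave_iff he).2 ?_⟩
  rw [h4, add_sub_cancel_left, mul_assoc, h2, mul_one]

/-- Since Φ is invertible, δΦ = ĥΦ determines ĥ and with it the components; ν_0 is forced by the
coefficient of z^0. -/
theorem existsUnique_coordChange (hd : d.Admissible) :
    ∃! p : Components I × SuperFn I, IsEnhanced p.1 p.2 ∧ CoordChange d p.1 p.2 := by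
  obtain ⟨c, hc, h⟩ := exists_gen hd
  refine ⟨(c, -d.eta 0), ⟨isEnhanced_neg_eta hd hc, coordChange_of_del hd hc h⟩, ?_⟩
  rintro ⟨c', nu0⟩ ⟨he, hcc⟩
  have h1 := del_of_coordChange hd he hcc
  have h2 : IsUnit (d.firstSymbol * vacuumWave) :=
    (isUnit_of_isNeg (firstSymbol_isNeg hd)).mul vacuumWave_isUnit
  exact Prod.ext (gen_injective he.admissible hc (eq_of_mul_unit h2 (h1.symm.trans h)))
    (hcc.nu0_eq hd he)

theorem dx_nu0_add (hd : d.Admissible) (he : IsEnhanced c nu0) (hcc : CoordChange d c nu0) :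
    dx nu0 + zCoef (-1) c.psi = 0 := by
  have hc := he.admissible
  obtain rfl := hcc.nu0_eq hd he
  have h1 := (del_mul_vacuumWave_iff (firstSymbol_even hd)).1 (del_of_coordChange hd he hcc)
  have h2 := phi_mul_dx_comp01 (gen_odd hc) (gen_isNeg hc) (firstSymbol_isNeg hd) h1
  rw [phi_mul_residue_del_gen hc, ← eta_zero_eq hd] at h2
  rw [dx_isSuperDer.neg, phi_mul_cancel (Dressing.eta_free hd 0).2.dx (hc.free.2.2.2.2.zCoef _) h2,
    neg_add_cancel]

/-- The flow equation is the compatibility of the two logarithmic derivatives: in ∂_nδF = (-1)^n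
δ∂_nF the products of G and H^(n) cancel. -/
theorem IsWave.flow (hW : IsWave G H F) (hG : HasParity 1 G) {n : ℕ} (hn : 0 < n)
    (hp : HasParity n (H n)) : dt n G = (-1) ^ n * del (H n) := by
  refine eq_of_mul_unit hW.unit ?_
  have h := dt_del n F
  rw [hW.del_eq, hW.dt_eq n hn, (dt_isSuperDer n).mul_of_hasParity hG, hW.dt_eq n hn,
    del_isSuperDer.mul_of_hasParity hp, hW.del_eq, ← mul_assoc G, hG.comm_mul hp, mul_add, mul_one,
    mul_assoc ((-1) ^ (1 * n)), one_mul, neg_one_pow_mul_self, mul_assoc (H n),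
    neg_one_pow_mul_self, ← mul_assoc] at h
  rw [mul_assoc]
  exact add_right_cancel h

theorem exists_seq {A : Type*} (a : A) (f : ℕ → A) :
    ∃ H : ℕ → A, H 0 = a ∧ ∀ n, 0 < n → H n = f n :=
  ⟨fun n => if n = 0 then a else f n, if_pos rfl, fun _ hn => if_neg (Nat.pos_iff_ne_zero.1 hn)⟩

theorem exists_isWave_of_gen (hg : HasParity 0 g) (hn : IsNeg (g - 1))
    (h : del (g * vacuumWave) = G * (g * vacuumWave)) :
    ∃ H, IsWave G H (g * vacuumWave) ∧ H 0 = 1 ∧ (∀ n, 0 < n → HasParity n (H n)) ∧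
      ∀ n, 0 < n → IsNeg (H n - vacuum n) := by
  obtain ⟨y, h1, h2, h3⟩ := exists_inverse hn
  have hy := even_of_mul_eq_one hg h1
  -- The logarithmic derivatives of g · e, with y the inverse of g. Index 0 is set apart because
  -- there is no time t_0; its current is 1.
  obtain ⟨H, hH0, hH'⟩ := exists_seq (1 : SuperFn I) fun n => vacuum n + dt n g * y
  have hH : ∀ n, 0 < n → H n - vacuum n = dt n g * y := fun n h0 => by
    rw [hH' n h0]
    exact add_sub_cancel_left _ _
  refine ⟨H, (isWave_mul_vacuumWave_iff hg hn).2 ⟨(del_mul_vacuumWave_iff hg).1 h, fun n h0 => ?_⟩,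
    hH0, fun n h0 => ?_, fun n h0 => ?_⟩
  · rw [hH n h0, mul_assoc, h2, mul_one]
  · rw [hH' n h0]
    refine (vacuum_hasParity n).add (HasParity.congr (p := n + 0 + 0) (by omega) ?_)
    exact ((dt_isSuperDer n).hasParity hg).mul hy
  · have hdt := (isNeg_iff.1 hn).dt n
    rw [(dt_isSuperDer n).sub, (dt_isSuperDer n).one, sub_zero] at hdt
    rw [hH n h0, isNeg_iff]
    exact degLE_mul_of_isNeg hdt h3

theorem vacuum_zero : (vacuum 0 : SuperFn I) = 1 := by
  have h := vacuum_two_mul (I := I) 0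
  rwa [Nat.mul_zero, Nat.cast_zero, zpow_zero] at h

theorem SolvesJSKP.dt_mem_fieldSpan (hd : d.Admissible) (hJ : SolvesJSKP d.op) {n : ℕ}
    (hn : 0 < n) : dt n (d.firstSymbol * vacuumWave) ∈
      fieldSpan fun l => del^[l] (d.firstSymbol * vacuumWave) := by
  refine dt_ungauge_mem_fieldSpan (hd.eta_odd 0).1 (hd.eta_odd 0).2.2 ?_
  rw [(gauge_even (hd.eta_odd 0).2.2).comm, ← sym_op_mul_vacuumWave d]
  exact (solvesJSKP_iff (Dressing.isMonic hd) (Dressing.sym_op_even hd)).1 hJ n hn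

/-- JSKP puts the logarithmic derivatives of Φ into W. Their leading terms are those of the
currents, so they are the currents, and the flow equations hold by compatibility. -/
theorem exists_currents (hd : d.Admissible) (hJ : SolvesJSKP d.op) (hc : c.Admissible)
    (h : del (d.firstSymbol * vacuumWave) = c.gen * (d.firstSymbol * vacuumWave)) :
    ∃ H, SolvesHSKP c H ∧ IsWave c.gen H (d.firstSymbol * vacuumWave) := by
  have hG := gen_odd hc
  obtain ⟨H, hW, hH0, hp, hn⟩ := exists_isWave_of_gen (firstSymbol_even hd) (firstSymbol_isNeg hd) h
  refine ⟨H, solvesHSKP_iff.2 ⟨hc, isCurrents_iff.2 fun n => ?_, fun n h0 => hW.flow hG h0 (hp n h0)⟩,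
    hW⟩
  rcases Nat.eq_zero_or_pos n with rfl | h0
  · rw [hH0, vacuum_zero, sub_self, isNeg_iff]
    exact ⟨self_mem_fieldSpan _ 0, DegLE.zero⟩
  · exact ⟨(hW.mem_iff hG h0).2 (SolvesJSKP.dt_mem_fieldSpan hd hJ h0), hn n h0⟩

theorem solution_of_coordChange (hd : d.Admissible) (he : IsEnhanced c nu0)
    (hcc : CoordChange d c nu0) :
    ∃ Psi : SuperFn I, IsDressed d.op Psi ∧ HasParity 0 Psi ∧ IsUnit Psi ∧
      del Psi = (c.gen + nu0) * Psi ∧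
      (SolvesJSKP d.op → ∃ H, SolvesHSKP c H ∧ IsPotential H (-nu0) ∧
        ∀ n, 0 < n → dt n Psi = enhanced H n * Psi) := by
  have hc := he.admissible
  refine ⟨_, (isDressed_op_iff hd).2 rfl, (Dressing.sym_op_even hd).mul_even vacuumWave_even, ?_,
    (coordChange_iff hd he).1 hcc, fun hJ => ?_⟩
  · rw [sym_op_mul_vacuumWave d]
    exact ((isUnit_of_isNeg (firstSymbol_isNeg hd)).mul vacuumWave_isUnit).mul gauge_isUnit
  · obtain ⟨H, hH, hW⟩ := exists_currents hd hJ hc (del_of_coordChange hd he hcc)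
    have hp := hW.isPotential hc hH.currents (firstSymbol_even hd) (firstSymbol_isNeg hd)
    rw [← eta_zero_eq hd] at hp
    obtain rfl := hcc.nu0_eq hd he
    rw [neg_neg]
    refine ⟨H, hH, hp, fun n h0 => ?_⟩
    rw [sym_op_mul_vacuumWave d]
    exact (hW.enhanced hp).dt_eq n h0

/-! ### The isomorphism -/

theorem exists_solvesHSKP_iff (c : Components I) : (∃ H, SolvesHSKP c H) ↔
    ∃ d : Dressing I, d.Admissible ∧ SolvesJSKP d.op ∧ Corresponds d c := by
  constructor
  · rintro ⟨H, h⟩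
    obtain ⟨g, h1, h2, h3⟩ := h.exists_isWave
    have hq := h3.isPotential h.admissible h.currents h1 h2
    obtain ⟨-, Psi, d, -, -, -, -, -, -, h4, h5, hd, h6⟩ := h.exists_dressing hq
    obtain ⟨-, h7, h8⟩ := h.dressing_properties hq hd h6 h4 h5
    exact ⟨d, hd, h7, _, hq.isEnhanced_neg h.admissible, h8⟩
  · rintro ⟨d, hd, hJ, nu0, he, hcc⟩
    obtain ⟨H, hH, -⟩ := exists_currents hd hJ he.admissible (del_of_coordChange hd he hcc)
    exact ⟨H, hH⟩

theorem exists_firstWave_iff (hd : d.Admissible) (hd' : d'.Admissible) :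
    (∃ Phi, IsFirstWave d Phi ∧ IsFirstWave d' (Phi * kappa)) ↔
      d'.firstSymbol = d.firstSymbol * kappa := by
  have h : d.firstSymbol * vacuumWave * kappa = d.firstSymbol * kappa * vacuumWave := by
    rw [mul_assoc, vacuumWave_even.comm, ← mul_assoc]
  constructor
  · rintro ⟨Phi, h1, h2⟩
    obtain rfl := (isFirstWave_iff hd).1 h1
    refine eq_of_mul_unit vacuumWave_isUnit ?_
    rw [← (isFirstWave_iff hd').1 h2, h]
  · intro h1
    refine ⟨_, (isFirstWave_iff hd).2 rfl, (isFirstWave_iff hd').2 ?_⟩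
    rw [h1]
    exact h

/-- Solutions corresponding to the same ĥ have first wave functions with the same generator and
currents, so κ is their quotient; conversely a constant factor preserves both. -/
theorem corresponds_iff_constant (hd : d.Admissible) (hJ : SolvesJSKP d.op) (hC : Corresponds d c)
    (hd' : d'.Admissible) : (SolvesJSKP d'.op ∧ Corresponds d' c) ↔
      ∃ kappa Phi, IsConstant kappa ∧ IsFirstWave d Phi ∧ IsFirstWave d' (Phi * kappa) := by
  obtain ⟨nu0, he, hcc⟩ := hC
  have hc := he.admissible
  have hn := firstSymbol_isNeg hd
  have hn' := firstSymbol_isNeg hd'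
  obtain ⟨H, hH, hW⟩ := exists_currents hd hJ hc (del_of_coordChange hd he hcc)
  have hcomm : ∀ kappa, d.firstSymbol * vacuumWave * kappa =
      d.firstSymbol * kappa * vacuumWave := fun kappa => by
    rw [mul_assoc, vacuumWave_even.comm, ← mul_assoc]
  constructor
  · rintro ⟨hJ', nu0', he', hcc'⟩
    obtain ⟨H', hH', hW'⟩ := exists_currents hd' hJ' hc (del_of_coordChange hd' he' hcc')
    -- The currents depend on the generator alone, so both first wave functions satisfy the same
    -- equations.
    obtain rfl := isCurrents_unique (gen_odd hc) (gen_isNeg hc) hH.currents hH'.currents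
    obtain ⟨y, h1, h2, h3⟩ := exists_inverse hn
    have hy := even_of_mul_eq_one (firstSymbol_even hd) h1
    have h4 : d'.firstSymbol = d.firstSymbol * (y * d'.firstSymbol) := by
      rw [← mul_assoc, h1, one_mul]
    have hk : IsConstant (y * d'.firstSymbol) :=
      hW.isConstant (hy.mul_even (firstSymbol_even hd')) (isNeg_mul_sub_one h3 hn')
        (by rwa [hcomm, ← h4])
    obtain ⟨Phi, h5⟩ := (exists_firstWave_iff hd hd').2 h4
    exact ⟨_, Phi, hk, h5⟩
  · rintro ⟨kappa, Phi, hk, h1⟩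
    have h2 := (exists_firstWave_iff hd hd').1 ⟨Phi, h1⟩
    have hW' := hW.mul_constant hk
    rw [hcomm, ← h2] at hW'
    exact ⟨solvesJSKP_of_isWave hd' (gen_odd hc)
      (fun n _ => (isCurrents_iff.1 hH.currents n).1) hW', _, isEnhanced_neg_eta hd' hc,
      coordChange_of_del hd' hc hW'.del_eq⟩

theorem existsUnique_dressing (hd : d.Admissible) (hk : IsConstant kappa) :
    ∃! d' : Dressing I, d'.Admissible ∧
      ∃ Phi, IsFirstWave d Phi ∧ IsFirstWave d' (Phi * kappa) := by
  obtain ⟨k1, k2, -⟩ := isConstant_iff.1 hk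
  obtain ⟨d', hd', h⟩ := exists_dressing ((firstSymbol_even hd).mul_even k1)
    (isNeg_mul_sub_one (firstSymbol_isNeg hd) k2)
  refine ⟨d', ⟨hd', (exists_firstWave_iff hd hd').2 h⟩, ?_⟩
  rintro d'' ⟨hd'', h'⟩
  exact firstSymbol_injective hd'' hd' (((exists_firstWave_iff hd hd'').1 h').trans h.symm)

end
end SuperKP

/-! ### The theorem assembled -/

open SuperKP in
theorem mainTheorem1 {I : Type*} [LinearOrder I] :
    -- from HSKP to JSKP
    (∀ (c : Components I) (H : ℕ → SuperFn I), SolvesHSKP c H →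
      (∀ j n, 0 < j → 0 < n →
        dt n (enhanced H j) = (-1) ^ (j * n) * dt j (enhanced H n)) ∧
      (∃ q, IsPotential H q) ∧
      ∀ q, IsPotential H q →
        dx q = zCoef (-1) c.psi ∧
        (∃ Phi Psi : SuperFn I, ∃ d : Dressing I,
          HasParity 0 Phi ∧ IsUnit Phi ∧ (∀ n, 0 < n → dt n Phi = H n * Phi) ∧
          del Phi = c.gen * Phi ∧
          Psi = Phi * fexp (-(phi * q)) ∧ IsUnit Psi ∧
          (∀ n, 0 < n → dt n Psi = enhanced H n * Psi) ∧
          del Psi = (c.gen - q) * Psi ∧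
          d.Admissible ∧ IsDressed d.op Psi) ∧
        ∀ (Psi : SuperFn I) (d : Dressing I), d.Admissible → IsDressed d.op Psi →
          (∀ n, 0 < n → dt n Psi = enhanced H n * Psi) → del Psi = (c.gen - q) * Psi →
          (∀ n, 0 < n → ∃ (N : ℕ) (Gam : ℕ → SuperFn I), (∀ l, IsField (Gam l)) ∧
            enhanced H n = ∑ l ∈ Finset.range N, Gam l * iterate (c.gen - q) l ∧
            dt n Psi = ∑ l ∈ Finset.range N, Gam l * del^[l] Psi) ∧
          PsiDO.SolvesJSKP d.op ∧ CoordChange d c (-q)) ∧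
    -- the wave function of a dressing operator, and from JSKP to HSKP
    (∀ d : Dressing I, d.Admissible →
      (∃! p : Components I × SuperFn I, IsEnhanced p.1 p.2 ∧ CoordChange d p.1 p.2) ∧
      ∀ (c : Components I) (nu0 : SuperFn I), IsEnhanced c nu0 → CoordChange d c nu0 →
        dx nu0 + zCoef (-1) c.psi = 0 ∧
        ∃ Psi : SuperFn I, IsDressed d.op Psi ∧ HasParity 0 Psi ∧ IsUnit Psi ∧
          del Psi = (c.gen + nu0) * Psi ∧
          (PsiDO.SolvesJSKP d.op → ∃ H, SolvesHSKP c H ∧ IsPotential H (-nu0) ∧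
            ∀ n, 0 < n → dt n Psi = enhanced H n * Psi)) ∧
    -- the isomorphism: the solutions of HSKP are the solutions of JSKP modulo constants
    (∀ c : Components I, (∃ H, SolvesHSKP c H) ↔
      ∃ d : Dressing I, d.Admissible ∧ PsiDO.SolvesJSKP d.op ∧ Corresponds d c) ∧
    (∀ (d : Dressing I) (c : Components I), d.Admissible → PsiDO.SolvesJSKP d.op →
      Corresponds d c →
      (∀ d' : Dressing I, d'.Admissible →
        ((PsiDO.SolvesJSKP d'.op ∧ Corresponds d' c) ↔
          ∃ kappa Phi, IsConstant kappa ∧ IsFirstWave d Phi ∧ IsFirstWave d' (Phi * kappa))) ∧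
      ∀ kappa, IsConstant kappa → ∃! d' : Dressing I, d'.Admissible ∧
        ∃ Phi, IsFirstWave d Phi ∧ IsFirstWave d' (Phi * kappa)) := by
  exact ⟨fun c H h => ⟨fun j n hj hn => h.dt_enhanced hj hn,
      (by
        obtain ⟨g, h1, h2, h3⟩ := h.exists_isWave
        exact ⟨_, h3.isPotential h.admissible h.currents h1 h2⟩),
      fun q hq => ⟨h.dx_potential hq, h.exists_dressing hq,
        fun Psi d hd hP ht hdel => h.dressing_properties hq hd hP ht hdel⟩⟩,
    fun d hd => ⟨existsUnique_coordChange hd, fun c nu0 he hcc =>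
      ⟨dx_nu0_add hd he hcc, solution_of_coordChange hd he hcc⟩⟩,
    exists_solvesHSKP_iff,
    fun d c hd hJ hC => ⟨fun d' hd' => corresponds_iff_constant hd hJ hC hd',
      fun kappa hk => existsUnique_dressing hd hk⟩⟩
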